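/- Setting. Let $R$ be an algebraically closed field of characteristic $0$, and $A$ a small, $\mathbb{Z}$-graded, strictly unital $A_\infty$-category over $R$ which is proper (each $H^*(\hom_A(X,Y))$ has finite total dimension). Let $\mathcal{S}=\mathrm{Spec}(\mathcal{R})$ be a smooth connected affine curve over $R$, with Kähler differentials $\Omega^1_{\mathcal R}$, and let $\mathcal{A}=\mathcal{R}\otimes_R A$ be the constant family of $A_\infty$-categories. For $B=\mathcal R$ or $B=R$, a family over $B$ of (right, strictly unital) $A_\infty$-modules with finite cohomology consists of graded projective $B$-modules $\mathcal M(X)$, $X\in \mathrm{Ob}\,A$, with structure maps $\mu^d_{\mathcal M}:\mathcal M(X_{d-1})\otimes\hom_A(X_{d-2},X_{d-1})\otimes\cdots\otimes\hom_A(X_0,X_1)\to\mathcal M(X_0)[2-d]$ which are $B$-linear in the first entry and satisfy the $A_\infty$-module equations and strict unitality, such that each $H^*(\mathcal M(X),\mu^1_{\mathcal M})$ is bounded and finitely generated over $B$ in each degree. With strictly unital $A_\infty$-module homomorphisms over $B$, these form a dg category, denoted $\mathcal A^{mod}$ for $B=\mathcal R$ and $A^{mod}$ for $B=R$; two objects are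 quasi-isomorphic if they are isomorphic in its degree $0$ cohomology category. Such an object is perfect if it is quasi-isomorphic to a direct summand of the Yoneda image of a (family of) twisted complexes $(\bigoplus_i \mathcal F^i\otimes X^i[-\sigma^i],\delta)$, the sum being finite, the $\mathcal F^i$ finitely generated projective $B$-modules, and $\delta$ a strictly filtration-decreasing solution of the Maurer-Cartan equation. The fibre of $\mathcal M$ at a point $s\in\mathcal S(R)$ is $\mathcal M_s=R\otimes_{\mathcal R}\mathcal M$. A deformation field is a class $[\gamma]\in HH^1(\mathcal A,\Omega^1_{\mathcal R}\otimes\mathcal A)$ (reduced Hochschild cohomology). A pre-connection $\nabla$ on a family $\mathcal M$ over $\mathcal R$ consists of degree-preserving maps $\nabla^1:\mathcal M(X_0)\to\Omega^1_{\mathcal R}\otimes\mathcal M(X_0)$ such that $m\mapsto(-1)^{|m|}\nabla^1(m)$ is a connection, together with $\mathcal R$-linear maps $\nabla^d$, $d\ge 2$, of the same form as the higher components of a strictly unital degree $0$ homomorphism $\mathcal M\to\Omega^1_{\mathcal R}\otimes\mathcal M$. The family $\mathcal M$ follows $[\gamma]$ if $$[\mu^1_{\mathcal A^{mod}}(\nabla)]=[\gamma^{mod,0}]\in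 H^1(\hom_{\mathcal A^{mod}}(\mathcal M,\Omega^1_{\mathcal R}\otimes\mathcal M)),\qquad (\gamma^{mod,0})^d(m,a_{d-1},\dots,a_1)=-\sum_{i,j}\mu_{\mathcal M}^{d-j+1}(m,\dots,\gamma^j(a_{i+j},\dots,a_{i+1}),a_i,\dots,a_1)$$ (the left hand side does not depend on the choice of $\nabla$). Proposition 1.21. Let $M$ be a perfect $A$-module such that the ring $H^0(\hom_{A^{mod}}(M,M))$ is commutative and its ideal of nilpotent elements has codimension $1$ over $R$. Fix a deformation field $[\gamma]$ and points $s,s'\in\mathcal S(R)$. If $\mathcal M_1$ and $\mathcal M_2$ are perfect families of modules over $\mathcal S$ which follow $[\gamma]$, and whose fibres $(\mathcal M_1)_s$ and $(\mathcal M_2)_s$ are both quasi-isomorphic to $M$, then the fibres $(\mathcal M_1)_{s'}$ and $(\mathcal M_2)_{s'}$ are quasi-isomorphic. -/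

import Mathlib

open scoped TensorProduct

universe u

noncomputable section

namespace AInf

/-! ### Composable chains of homogeneous morphisms -/

/-- Given a graded quiver `H`, a chain from `X` to `Y` is a composable sequence
`(a_d, …, a_1)`, `d ≥ 0`, of homogeneous elements `a_i ∈ H(X_{i-1}, X_i)` with `X_0 = X` and
`X_d = Y`. The constructor `cons` adds a new leftmost entry. -/
inductive Chain {Ob : Type u} (H : Ob → Ob → ℤ → Type u) : Ob → Ob → Type u
  | nil (X : Ob) : Chain H X X
  | cons {X Y Z : Ob} {n : ℤ} (a : H Y Z n) (p : Chain H X Y) : Chain H X Z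

namespace Chain

variable {Ob : Type u} {H : Ob → Ob → ℤ → Type u}

/-- The number `d` of entries. -/
def length {X Y : Ob} : Chain H X Y → ℕ
  | nil _ => 0
  | cons _ p => p.length + 1

/-- The total reduced degree `(|a_d| - 1) + ⋯ + (|a_1| - 1)`. -/
def rdeg {X Y : Ob} : Chain H X Y → ℤ
  | nil _ => 0
  | cons (n := n) _ p => (n - 1) + p.rdeg

/-- Concatenation: the entries of the first argument stand to the left. -/
def append {X Y Z : Ob} : Chain H Y Z → Chain H X Y → Chain H X Z
  | nil _, r => r
  | cons a q, r => cons a (q.append r)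

/-- A decomposition of a chain from `X` to `Y` into a left and a right part. -/
structure Split (H : Ob → Ob → ℤ → Type u) (X Y : Ob) where
  mid : Ob
  left : Chain H mid Y
  right : Chain H X mid

/-- All the `d + 1` decompositions of a chain of length `d`. -/
def splits {X Y : Ob} : Chain H X Y → List (Split H X Y)
  | nil X => [⟨X, nil X, nil X⟩]
  | cons a p => ⟨_, nil _, cons a p⟩ :: p.splits.map fun S => ⟨S.mid, cons a S.left, S.right⟩

/-- A function of chains, with values in `B`-modules, which is `R`-multilinear in the entries. -/
structure IsMultilinear (R B : Type u) [CommRing R] [CommRing B] [Algebra R B]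
    [∀ X Y n, AddCommGroup (H X Y n)] [∀ X Y n, Module R (H X Y n)]
    {V : Ob → Ob → Type u} [∀ X Y, AddCommGroup (V X Y)] [∀ X Y, Module B (V X Y)]
    (φ : ∀ X Y, Chain H X Y → V X Y) : Prop where
  map_add : ∀ {W X Y Z : Ob} {n : ℤ} (q : Chain H Y Z) (a a' : H X Y n) (r : Chain H W X),
    φ W Z (q.append (cons (a + a') r)) = φ W Z (q.append (cons a r)) + φ W Z (q.append (cons a' r))
  map_smul : ∀ {W X Y Z : Ob} {n : ℤ} (q : Chain H Y Z) (c : R) (a : H X Y n) (r : Chain H W X),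
    φ W Z (q.append (cons (c • a) r)) = algebraMap R B c • φ W Z (q.append (cons a r))

end Chain

open Chain

/-! ### Cohomology of a pair of composable maps -/

/-- The cohomology `ker g / im f` in the middle of `U → V → W` (for `g ∘ f = 0`). -/
abbrev Coh {B U V W : Type u} [CommRing B] [AddCommGroup U] [Module B U] [AddCommGroup V]
    [Module B V] [AddCommGroup W] [Module B W] (f : U →ₗ[B] V) (g : V →ₗ[B] W) : Type u :=
  LinearMap.ker g ⧸ (LinearMap.range f).comap (LinearMap.ker g).subtype

/-- A graded module with a degree one endomorphism has bounded cohomology which is finitely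
generated in every degree. -/
def FiniteCohomology {B : Type u} [CommRing B] {V : ℤ → Type u} [∀ n, AddCommGroup (V n)]
    [∀ n, Module B (V n)] (d : ∀ k e : ℤ, V k →ₗ[B] V e) : Prop :=
  (∀ k, Module.Finite B (Coh (d (k - 1) k) (d k (k + 1)))) ∧
    ∃ N : ℤ, ∀ k, N < |k| → Subsingleton (Coh (d (k - 1) k) (d k (k + 1)))

/-! ### `A_∞`-categories -/

/-- The data of a strictly unital `ℤ`-graded `A_∞`-category over `R`, together with
multilinearity. The value `μ p e` is the component of degree `e` of `μ^d(a_d, …, a_1)`. -/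
structure CatData (R : Type u) [Field R] where
  Ob : Type u
  Hom : Ob → Ob → ℤ → Type u
  [grp : ∀ X Y n, AddCommGroup (Hom X Y n)]
  [mod : ∀ X Y n, Module R (Hom X Y n)]
  one : ∀ X, Hom X X 0
  μ : ∀ X Y, Chain Hom X Y → ∀ e, Hom X Y e
  μ_multilinear : ∀ e, IsMultilinear R R (fun X Y p => μ X Y p e)

attribute [instance] CatData.grp CatData.mod

/-- Chains of morphisms of `A`. -/
abbrev CatData.Ch {R : Type u} [Field R] (A : CatData R) (X Y : A.Ob) : Type u := Chain A.Hom X Y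

/-- The product `μ(q, -, r)` as a linear map of one of its arguments. -/
def CatData.μAt {R : Type u} [Field R] (A : CatData R) {W X Y Z : A.Ob} (q : A.Ch Y Z)
    (r : A.Ch W X) (n e : ℤ) : A.Hom X Y n →ₗ[R] A.Hom W Z e where
  toFun a := A.μ W Z (q.append (cons a r)) e
  map_add' a a' := (A.μ_multilinear e).map_add q a a' r
  map_smul' c a := (A.μ_multilinear e).map_smul q c a r

/-- A strictly unital, proper, `ℤ`-graded `A_∞`-category over a field. -/
structure Category (R : Type u) [Field R] extends CatData R where
  /-- there is no curvature -/
  μ_nil : ∀ X e, μ X X (nil X) e = 0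
  /-- `μ^d` has degree `2 - d` -/
  μ_deg : ∀ X Y (p : Chain Hom X Y) e, e ≠ p.rdeg + 2 → μ X Y p e = 0
  /-- `∑ (-1)^{‖a_1‖ + ⋯ + ‖a_i‖} μ(a_d, …, μ(a_{i+j}, …, a_{i+1}), a_i, …, a_1) = 0` -/
  μ_rel : ∀ X Y (p : Chain Hom X Y) e,
    (p.splits.map fun S => (S.right.splits.map fun T =>
      T.right.rdeg.negOnePow •
        μ X Y (S.left.append (cons (μ _ _ T.left (T.left.rdeg + 2)) T.right)) e).sum).sum = 0
  one_left : ∀ X Y n (a : Hom X Y n), n.negOnePow • μ X Y (cons (one Y) (cons a (nil X))) n = a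
  one_right : ∀ X Y n (a : Hom X Y n), μ X Y (cons a (cons (one X) (nil X))) n = a
  one_vanish : ∀ W X Z (q : Chain Hom X Z) (r : Chain Hom W X), q.length + r.length ≠ 1 →
    ∀ e, μ W Z (q.append (cons (one X) r)) e = 0
  proper : ∀ X Y, FiniteCohomology (fun k e => toCatData.μAt (nil Y) (nil X) k e)

/-! ### Modules, and families of modules -/

section Modules

variable {R : Type u} [Field R]

/-- The data underlying a family over `B` of right `A_∞`-modules: graded `B`-modules `M(X)`, and
structure maps `μ^{d}(m, a_{d-1}, …, a_1)`, which are `B`-linear in `m ∈ M(X_{d-1})` and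
`R`-multilinear in the morphisms. The map `μ p k e` sends `m` of degree `k` to the component of
degree `e`. -/
structure ModData (A : CatData R) (B : Type u) [CommRing B] [Algebra R B] where
  M : A.Ob → ℤ → Type u
  [grp : ∀ X n, AddCommGroup (M X n)]
  [mod : ∀ X n, Module B (M X n)]
  μ : ∀ X Y, A.Ch X Y → ∀ k e, M Y k →ₗ[B] M X e
  μ_multilinear : ∀ k e, IsMultilinear R B (fun X Y p => μ X Y p k e)

attribute [instance] ModData.grp ModData.mod

variable {A : CatData R} {B : Type u} [CommRing B] [Algebra R B]

/-- `M` is a family over `B` of strictly unital `A_∞`-modules with finite cohomology. For `B = R`,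
these are the strictly unital `A_∞`-modules with finite cohomology themselves. -/
structure ModData.IsModule (M : ModData A B) : Prop where
  projective : ∀ X n, Module.Projective B (M.M X n)
  deg : ∀ X Y (p : A.Ch X Y) k e, e ≠ k + p.rdeg + 1 → M.μ X Y p k e = 0
  rel : ∀ X Y (p : A.Ch X Y) k e (m : M.M Y k),
    (p.splits.map fun S => S.right.rdeg.negOnePow •
        M.μ _ _ S.right _ e (M.μ _ _ S.left k (k + S.left.rdeg + 1) m)).sum +
    (p.splits.map fun S => (S.right.splits.map fun T => T.right.rdeg.negOnePow •
        M.μ X Y (S.left.append (cons (A.μ _ _ T.left (T.left.rdeg + 2)) T.right)) k e m).sum).sum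
      = 0
  unit : ∀ X k (m : M.M X k), M.μ X X (cons (A.one X) (nil X)) k k m = m
  unit_vanish : ∀ W X Z (q : A.Ch X Z) (r : A.Ch W X), q.length + r.length ≠ 0 →
    ∀ k e, M.μ W Z (q.append (cons (A.one X) r)) k e = 0
  finite : ∀ X, FiniteCohomology (fun k e => M.μ X X (nil X) k e)

/-- Sequences of additive maps `t^d(m, a_{d-1}, …, a_1)`, with no further condition. The morphism
complexes and the pre-connections below are cut out inside. -/
abbrev Raw (M N : ModData A B) : Type u :=
  ∀ X Y : A.Ob, A.Ch X Y → ∀ k e : ℤ, M.M Y k →+ N.M X e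

/-- The space `hom^g(M, N)` of morphisms of degree `g`: sequences of maps `t^d` of degree `g + 1 - d`,
`B`-linear in `m` and `R`-multilinear in the `a_i`, and vanishing if some `a_i` is a unit. -/
def PreHom (M N : ModData A B) (g : ℤ) : Submodule B (Raw M N) where
  carrier := {t |
    (∀ X Y (p : A.Ch X Y) k e, e ≠ k + p.rdeg + g → t X Y p k e = 0) ∧
    (∀ X Y (p : A.Ch X Y) k e (f : B) (m : M.M Y k), t X Y p k e (f • m) = f • t X Y p k e m) ∧
    IsMultilinear R B t ∧
    (∀ W X Z (q : A.Ch X Z) (r : A.Ch W X), t W Z (q.append (cons (A.one X) r)) = 0)}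
  zero_mem' := by
    refine ⟨?_, ?_, ⟨?_, ?_⟩, ?_⟩ <;> intros <;> simp
  add_mem' := by
    rintro s t ⟨h1, h2, h3, h4⟩ ⟨k1, k2, k3, k4⟩
    refine ⟨?_, ?_, ⟨?_, ?_⟩, ?_⟩
    · intro X Y p k e h
      simp [h1 X Y p k e h, k1 X Y p k e h]
    · intro X Y p k e f m
      simp [h2, k2]
    · intro W X Y Z n q a a' r
      simp only [Pi.add_apply, h3.map_add, k3.map_add]
      abel
    · intro W X Y Z n q c a r
      simp only [Pi.add_apply, h3.map_smul, k3.map_smul, smul_add]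
    · intro W X Z q r
      simp [h4, k4]
  smul_mem' := by
    rintro b t ⟨k1, k2, k3, k4⟩
    refine ⟨?_, ?_, ⟨?_, ?_⟩, ?_⟩
    · intro X Y p k e h
      simp [k1 X Y p k e h]
    · intro X Y p k e f m
      simp [k2, smul_smul, mul_comm]
    · intro W X Y Z n q a a' r
      simp only [Pi.smul_apply, k3.map_add, smul_add]
    · intro W X Y Z n q c a r
      simp only [Pi.smul_apply, k3.map_smul]
      rw [smul_comm]
    · intro W X Z q r
      simp [k4]

/-- The value at `(m, a_{d-1}, …, a_1)`, `p = (a_{d-1}, …, a_1)`, of the differential `μ^1 t` of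
a morphism `t` of degree `g`; every term carries the sign given by the sum of `|m|` and of
the reduced degrees of the `a_i` which stand in or to the left of the innermost bracket. -/
def diffFun (M N : ModData A B) (g : ℤ) (t : Raw M N) (X Y : A.Ob) (p : A.Ch X Y) (k e : ℤ)
    (m : M.M Y k) : N.M X e :=
  (p.splits.map fun S => (k + S.left.rdeg).negOnePow •
      N.μ _ _ S.right _ e (t _ _ S.left k (k + S.left.rdeg + g) m)).sum +
  (p.splits.map fun S => (k + S.left.rdeg).negOnePow •
      t _ _ S.right _ e (M.μ _ _ S.left k (k + S.left.rdeg + 1) m)).sum +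
  (p.splits.map fun S => (S.right.splits.map fun T =>
      (k + S.left.rdeg + T.left.rdeg).negOnePow •
        t X Y (S.left.append (cons (A.μ _ _ T.left (T.left.rdeg + 2)) T.right)) k e m).sum).sum

theorem diffFun_add_arg (M N : ModData A B) (g : ℤ) (t : Raw M N) (X Y : A.Ob) (p : A.Ch X Y)
    (k e : ℤ) (m m' : M.M Y k) :
    diffFun M N g t X Y p k e (m + m')
      = diffFun M N g t X Y p k e m + diffFun M N g t X Y p k e m' := by
  simp only [diffFun, map_add, smul_add, List.sum_map_add]
  abel

theorem diffFun_add (M N : ModData A B) (g : ℤ) (s t : Raw M N) (X Y : A.Ob) (p : A.Ch X Y)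
    (k e : ℤ) (m : M.M Y k) :
    diffFun M N g (s + t) X Y p k e m
      = diffFun M N g s X Y p k e m + diffFun M N g t X Y p k e m := by
  simp only [diffFun, Pi.add_apply, AddMonoidHom.add_apply, map_add, smul_add, List.sum_map_add]
  abel

theorem diffFun_smul (M N : ModData A B) (g : ℤ) (f : B) (t : Raw M N) (X Y : A.Ob)
    (p : A.Ch X Y) (k e : ℤ) (m : M.M Y k) :
    diffFun M N g (f • t) X Y p k e m = f • diffFun M N g t X Y p k e m := by
  simp only [diffFun, Pi.smul_apply, AddMonoidHom.smul_apply, map_smul, smul_add, List.smul_sum,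
    List.map_map, Function.comp_def, smul_comm f]

/-- The differential `μ^1`, on sequences of maps of degree `g`. -/
def diff (M N : ModData A B) (g : ℤ) : Raw M N →ₗ[B] Raw M N where
  toFun t X Y p k e :=
    { toFun := diffFun M N g t X Y p k e
      map_zero' := by
        have h := diffFun_add_arg M N g t X Y p k e 0 0
        rw [add_zero] at h
        exact left_eq_add.mp h
      map_add' := diffFun_add_arg M N g t X Y p k e }
  map_add' s t := by
    funext X Y p k e
    ext m
    exact diffFun_add M N g s t X Y p k e m
  map_smul' f t := by
    funext X Y p k e
    ext m
    exact diffFun_smul M N g f t X Y p k e m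

/-- Degree `g` cocycles in `hom(M, N)`. -/
def Cocycles (M N : ModData A B) (g : ℤ) : Submodule B (Raw M N) :=
  PreHom M N g ⊓ LinearMap.ker (diff M N g)

/-- Degree `g` coboundaries in `hom(M, N)`. -/
def Coboundaries (M N : ModData A B) (g : ℤ) : Submodule B (Raw M N) :=
  (PreHom M N (g - 1)).map (diff M N (g - 1))

/-- The product `μ^2(t₂, t₁)` of a morphism `t₂` with a degree zero morphism `t₁`. -/
def comp {L M N : ModData A B} (t₂ : Raw M N) (t₁ : Raw L M) : Raw L N :=
  fun _ _ p k e => (p.splits.map fun S => (k + S.left.rdeg).negOnePow •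
    (t₂ _ _ S.right (k + S.left.rdeg) e).comp (t₁ _ _ S.left k (k + S.left.rdeg))).sum

/-- The first order part of the identity endomorphism: `m ↦ (-1)^{|m|} m`. -/
def oneAt (M : ModData A B) (X : A.Ob) (k e : ℤ) : M.M X k →+ M.M X e :=
  if h : k = e then k.negOnePow • (h ▸ AddMonoidHom.id (M.M X k)) else 0

/-- The identity endomorphism of `M`, which has no higher order terms. -/
def idHom (M : ModData A B) : Raw M M
  | X, _, nil _ => fun k e => oneAt M X k e
  | _, _, cons _ _ => fun _ _ => 0

/-- Equality of classes in `H^0(hom(M, N))`. -/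
def Cohomologous {M N : ModData A B} (s t : Raw M N) : Prop := s - t ∈ Coboundaries M N 0

/-- `M` and `N` are quasi-isomorphic: isomorphic in the degree zero cohomology category. -/
def QuasiIso (M N : ModData A B) : Prop :=
  ∃ f ∈ Cocycles M N 0, ∃ g ∈ Cocycles N M 0,
    Cohomologous (comp g f) (idHom M) ∧ Cohomologous (comp f g) (idHom N)

/-- `M` is a direct summand of `N` in the degree zero cohomology category, that is, it splits an
idempotent endomorphism of `N` there. -/
def IsSummand (M N : ModData A B) : Prop :=
  ∃ f ∈ Cocycles M N 0, ∃ g ∈ Cocycles N M 0, Cohomologous (comp g f) (idHom M)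

/-- Powers of a degree zero endomorphism. -/
def power {M : ModData A B} (x : Raw M M) : ℕ → Raw M M
  | 0 => idHom M
  | n + 1 => comp x (power x n)

/-- The class of `x` in `H^0(hom(M, M))` is nilpotent. -/
def IsNilp {M : ModData A B} (x : Raw M M) : Prop := ∃ n, Cohomologous (power x n) 0

/-- The ring `H^0(hom(M, M))` is commutative, and the nilpotent elements form a subspace (ideal) of
codimension one. In terms of cocycles, which surject to `H^0(hom(M, M))`. -/
structure CommLocal (M : ModData A R) : Prop where
  comm : ∀ x ∈ Cocycles M M 0, ∀ y ∈ Cocycles M M 0, Cohomologous (comp x y) (comp y x)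
  codim_one : ∃ N : Submodule R (Cocycles M M 0),
    (∀ x : Cocycles M M 0, x ∈ N ↔ IsNilp x.1) ∧ Module.finrank R (Cocycles M M 0 ⧸ N) = 1

/-! ### Fibres of a family -/

/-- The field `R`, as an algebra over `B` through the point `s` of the base. -/
def AtPoint (_s : B →ₐ[R] R) : Type u := R

instance (s : B →ₐ[R] R) : CommRing (AtPoint s) := inferInstanceAs (CommRing R)

instance (s : B →ₐ[R] R) : Algebra B (AtPoint s) := s.toRingHom.toAlgebra

instance (s : B →ₐ[R] R) (V : Type u) [AddCommGroup V] [Module B V] :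
    Module R (AtPoint s ⊗[B] V) :=
  inferInstanceAs (Module (AtPoint s) (AtPoint s ⊗[B] V))

/-- The map `R ⊗_B V → R ⊗_B W` induced by `f`. -/
def fibreMap (s : B →ₐ[R] R) {V W : Type u} [AddCommGroup V] [Module B V] [AddCommGroup W]
    [Module B W] (f : V →ₗ[B] W) : AtPoint s ⊗[B] V →ₗ[R] AtPoint s ⊗[B] W where
  toFun x := LinearMap.lTensor (AtPoint s) f x
  map_add' x y := map_add _ x y
  map_smul' c x := (LinearMap.baseChange (AtPoint s) f).map_smul (show AtPoint s from c) x

theorem fibreMap_add (s : B →ₐ[R] R) {V W : Type u} [AddCommGroup V] [Module B V]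
    [AddCommGroup W] [Module B W] (f g : V →ₗ[B] W) :
    fibreMap s (f + g) = fibreMap s f + fibreMap s g := by
  apply LinearMap.ext
  intro x
  exact LinearMap.congr_fun (LinearMap.lTensor_add (AtPoint s) f g) x

theorem fibreMap_smul (s : B →ₐ[R] R) {V W : Type u} [AddCommGroup V] [Module B V]
    [AddCommGroup W] [Module B W] (c : R) (f : V →ₗ[B] W) :
    fibreMap s (algebraMap R B c • f) = c • fibreMap s f := by
  apply LinearMap.ext
  intro x
  refine (LinearMap.congr_fun (LinearMap.lTensor_smul (AtPoint s) (algebraMap R B c) f) x).trans ?_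
  change algebraMap R B c • (LinearMap.lTensor (AtPoint s) f x) = _
  rw [← algebraMap_smul (AtPoint s) (algebraMap R B c)]
  have hc : (algebraMap B (AtPoint s)) (algebraMap R B c) = (show AtPoint s from c) := s.commutes c
  rw [hc]
  rfl

/-- The restriction of a family of modules to the fibre at `s`: `M_s(X) = R ⊗_B M(X)`. -/
def ModData.fibre (s : B →ₐ[R] R) (M : ModData A B) : ModData A R where
  M X n := AtPoint s ⊗[B] M.M X n
  μ X Y p k e := fibreMap s (M.μ X Y p k e)
  μ_multilinear k e := by
    constructor
    · intro W X Y Z n q a a' r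
      rw [show M.μ W Z (q.append (cons (a + a') r)) k e = _ from
        (M.μ_multilinear k e).map_add q a a' r, fibreMap_add]
    · intro W X Y Z n q c a r
      rw [show M.μ W Z (q.append (cons (c • a) r)) k e = _ from
        (M.μ_multilinear k e).map_smul q c a r, fibreMap_smul, Algebra.algebraMap_self,
        RingHom.id_apply]

/-! ### Families of twisted complexes and perfect families -/

/-- A family over `B` of twisted complexes: a formal sum `⨁_i F_i ⊗ Y_i[-σ_i]`, where the `F_i`
are finitely generated projective `B`-modules, with the components of a differential.
The component from `i` to `j` is an element of
`Hom_B(F_i, F_j) ⊗_R hom_A(Y_i, Y_j)[σ_i - σ_j]` of degree one, here written as a `B`-linear map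
from `F_i` to `F_j ⊗_R hom_A(Y_i, Y_j)` (these are the same, since `F_i` is finitely generated
projective). It strictly decreases the filtration by the index (one can always split
the `F_i` and reorder so that the given filtration is of this kind). -/
structure TwData (A : CatData R) (B : Type u) [CommRing B] [Algebra R B] where
  N : ℕ
  F : Fin N → Type u
  [grp : ∀ i, AddCommGroup (F i)]
  [modB : ∀ i, Module B (F i)]
  [modR : ∀ i, Module R (F i)]
  [tower : ∀ i, IsScalarTower R B (F i)]
  fin : ∀ i, Module.Finite B (F i)
  proj : ∀ i, Module.Projective B (F i)
  Y : Fin N → A.Ob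
  σ : Fin N → ℤ
  δ : ∀ i j, F i →ₗ[B] F j ⊗[R] A.Hom (Y i) (Y j) (1 + σ i - σ j)
  δ_strict : ∀ i j, ¬ i < j → δ i j = 0

attribute [instance] TwData.grp TwData.modB TwData.modR TwData.tower

namespace TwData

/-- The degree `n` part of `hom(X, ⨁_i F_i ⊗ Y_i[-σ_i]) = ⨁_i F_i ⊗_R hom_A(X, Y_i)[-σ_i]`. -/
abbrev Tot (Y : TwData A B) (X : A.Ob) (n : ℤ) : Type u :=
  ∀ i : Fin Y.N, Y.F i ⊗[R] A.Hom X (Y.Y i) (n - Y.σ i)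

/-- Auxiliary: operations `f ⊗ (a_d, …, a_1) ↦ S(f ⊗ a_d, …, a_1)`, where `f ∈ F_i` and where
`a_d` has target `Y_i`, with values in `hom(X, ⨁_i F_i ⊗ Y_i[-σ_i])`. -/
structure Op (Y : TwData A B) where
  op : ∀ (i : Fin Y.N) (X : A.Ob), A.Ch X (Y.Y i) → ∀ e : ℤ, Y.F i →ₗ[B] Y.Tot X e
  op_add : ∀ (i : Fin Y.N) {W X Z : A.Ob} {n : ℤ} (q : A.Ch Z (Y.Y i)) (a a' : A.Hom X Z n)
    (r : A.Ch W X) (e : ℤ), op i W (q.append (cons (a + a') r)) e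
      = op i W (q.append (cons a r)) e + op i W (q.append (cons a' r)) e
  op_smul : ∀ (i : Fin Y.N) {W X Z : A.Ob} {n : ℤ} (q : A.Ch Z (Y.Y i)) (c : R)
    (a : A.Hom X Z n) (r : A.Ch W X) (e : ℤ), op i W (q.append (cons (c • a) r)) e
      = algebraMap R B c • op i W (q.append (cons a r)) e

/-- Extension of an operation to tensors in its leftmost argument. -/
def Op.ext {Y : TwData A B} (S : Y.Op) (i : Fin Y.N) {W X : A.Ob} (p : A.Ch W X) (n e : ℤ) :
    Y.F i ⊗[R] A.Hom X (Y.Y i) n →ₗ[B] Y.Tot W e :=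
  TensorProduct.AlgebraTensorModule.lift
    { toFun := fun f =>
        { toFun := fun a => S.op i W (cons a p) e f
          map_add' := fun a a' => by
            rw [show S.op i W (cons (a + a') p) e = _ from S.op_add i (nil _) a a' p e]; rfl
          map_smul' := fun c a => by
            rw [show S.op i W (cons (c • a) p) e = _ from S.op_smul i (nil _) c a p e]
            exact algebraMap_smul B c _ }
      map_add' := fun f f' => by ext a; simp
      map_smul' := fun b f => by ext a; simp }

theorem Op.ext_tmul {Y : TwData A B} (S : Y.Op) (i : Fin Y.N) {W X : A.Ob} (p : A.Ch W X)
    (n e : ℤ) (f : Y.F i) (a : A.Hom X (Y.Y i) n) :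
    S.ext i p n e (f ⊗ₜ a) = S.op i W (cons a p) e f := rfl

theorem Op.ext_add {Y : TwData A B} (S : Y.Op) (i : Fin Y.N) {V W X Z : A.Ob} {l : ℤ}
    (q : A.Ch Z X) (a a' : A.Hom W Z l) (r : A.Ch V W) (n e : ℤ) :
    S.ext i (q.append (cons (a + a') r)) n e
      = S.ext i (q.append (cons a r)) n e + S.ext i (q.append (cons a' r)) n e := by
  apply LinearMap.ext
  intro y
  induction y using TensorProduct.induction_on with
  | zero => simp
  | tmul f b =>
    rw [LinearMap.add_apply, ext_tmul, ext_tmul, ext_tmul,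
      show S.op i V (cons b (q.append (cons (a + a') r))) e = _ from
        S.op_add i (cons b q) a a' r e]
    rfl
  | add x y hx hy => rw [map_add, hx, hy, map_add]

theorem Op.ext_smul {Y : TwData A B} (S : Y.Op) (i : Fin Y.N) {V W X Z : A.Ob} {l : ℤ}
    (q : A.Ch Z X) (c : R) (a : A.Hom W Z l) (r : A.Ch V W) (n e : ℤ) :
    S.ext i (q.append (cons (c • a) r)) n e
      = algebraMap R B c • S.ext i (q.append (cons a r)) n e := by
  apply LinearMap.ext
  intro y
  induction y using TensorProduct.induction_on with
  | zero => simp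
  | tmul f b =>
    rw [LinearMap.smul_apply, ext_tmul, ext_tmul,
      show S.op i V (cons b (q.append (cons (c • a) r))) e = _ from
        S.op_smul i (cons b q) c a r e]
    rfl
  | add x y hx hy => rw [map_add, hx, hy, map_add]

/-- `f ⊗ (a_d, …, a_1) ↦ f ⊗ μ(a_d, …, a_1)`. -/
def base (Y : TwData A B) : Y.Op where
  op i X p e := LinearMap.single B (fun j : Fin Y.N => Y.F j ⊗[R] A.Hom X (Y.Y j) (e - Y.σ j)) i ∘ₗ
    (TensorProduct.AlgebraTensorModule.mk R B (Y.F i) _).flip (A.μ X (Y.Y i) p (e - Y.σ i))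
  op_add i W X Z n q a a' r e := by
    rw [show A.μ W (Y.Y i) (q.append (cons (a + a') r)) (e - Y.σ i) = _ from
      (A.μ_multilinear (e - Y.σ i)).map_add q a a' r, map_add, LinearMap.comp_add]
  op_smul i W X Z n q c a r e := by
    rw [show A.μ W (Y.Y i) (q.append (cons (c • a) r)) (e - Y.σ i) = _ from
      (A.μ_multilinear (e - Y.σ i)).map_smul q c a r, Algebra.algebraMap_self, RingHom.id_apply,
      map_smul]
    apply LinearMap.ext
    intro f
    simp only [LinearMap.comp_apply, LinearMap.smul_apply, algebraMap_smul]
    exact LinearMap.map_smul_of_tower _ c _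

/-- `f ⊗ (a_d, …, a_1) ↦ S(δ(f), a_d, …, a_1)`. -/
def step (Y : TwData A B) (S : Y.Op) : Y.Op where
  op i X p e := ∑ j, S.ext j p _ e ∘ₗ Y.δ i j
  op_add i W X Z n q a a' r e := by
    simp only [Op.ext_add, LinearMap.add_comp, Finset.sum_add_distrib]
  op_smul i W X Z n q c a r e := by
    simp only [Op.ext_smul, LinearMap.smul_comp, Finset.smul_sum]

/-- `f ⊗ (a_d, …, a_1) ↦ μ(δ, …, δ, f ⊗ a_d, …, a_1)` with `r` insertions of `δ`. -/
def insertions (Y : TwData A B) : ℕ → Y.Op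
  | 0 => Y.base
  | r + 1 => Y.step (Y.insertions r)

/-- The Maurer-Cartan equation `∑_r μ^r(δ, …, δ) = 0`, evaluated on elements `f ∈ F_i`. More than
`N - 1` insertions contribute zero, since `δ` is strictly triangular. -/
def MaurerCartan (Y : TwData A B) : Prop :=
  ∀ (i : Fin Y.N) (e : ℤ) (f : Y.F i),
    ∑ r ∈ Finset.range Y.N, (Y.insertions r).op i (Y.Y i) (nil (Y.Y i)) e f = 0

/-- The Yoneda image of a twisted complex `Y`: the module `X ↦ hom(X, Y)`, with structure maps
`μ(y, a_{d-1}, …, a_1) = ∑_r μ(δ, …, δ, y, a_{d-1}, …, a_1)`. -/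
def yon (Y : TwData A B) : ModData A B where
  M X n := Y.Tot X n
  μ X W p k e := ∑ r ∈ Finset.range Y.N, ∑ i : Fin Y.N,
    (Y.insertions r).ext i p (k - Y.σ i) e ∘ₗ LinearMap.proj i
  μ_multilinear k e := by
    constructor
    · intro V W Z X n q a a' r
      simp only [Op.ext_add, LinearMap.add_comp, Finset.sum_add_distrib]
    · intro V W Z X n q c a r
      simp only [Op.ext_smul, LinearMap.smul_comp, Finset.smul_sum]

end TwData

/-- Perfect families of modules: those quasi-isomorphic to a direct summand of (the Yoneda image of)
a family of twisted complexes. For `B = R` these are the perfect modules. -/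
structure ModData.IsPerfect (M : ModData A B) : Prop where
  isModule : M.IsModule
  summand : ∃ Y : TwData A B, Y.MaurerCartan ∧ IsSummand M Y.yon

/-! ### Deformation fields -/

open KaehlerDifferential in
/-- A cocycle in the reduced Hochschild complex `CC^1(𝒜, Ω¹ ⊗ 𝒜)`, where `𝒜` is the constant family
over `B` with fibre `A`, and `Ω¹` is the module of Kähler differentials of `B` over `R`. Its
class in `HH^1` is a deformation field. -/
structure DefField (A : CatData R) (B : Type u) [CommRing B] [Algebra R B] where
  γ : ∀ X Y, A.Ch X Y → ∀ e, Ω[B⁄R] ⊗[R] A.Hom X Y e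
  multilinear : ∀ e, IsMultilinear R B (fun X Y p => γ X Y p e)
  deg : ∀ X Y (p : A.Ch X Y) e, e ≠ p.rdeg + 1 → γ X Y p e = 0
  reduced : ∀ W X Z (q : A.Ch X Z) (r : A.Ch W X) e, γ W Z (q.append (cons (A.one X) r)) e = 0
  cocycle : ∀ X Y (p : A.Ch X Y) e,
    (p.splits.map fun S => (S.right.splits.map fun T =>
      LinearMap.lTensor Ω[B⁄R] (A.μAt S.left T.right (T.left.rdeg + 1) e)
        (γ _ _ T.left (T.left.rdeg + 1))).sum).sum -
    (p.splits.map fun S => (S.right.splits.map fun T => T.right.rdeg.negOnePow •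
      γ X Y (S.left.append (cons (A.μ _ _ T.left (T.left.rdeg + 2)) T.right)) e).sum).sum = 0

open KaehlerDifferential in
/-- The family of modules `Ω¹ ⊗ M`. -/
def ModData.omega (M : ModData A B) : ModData A B where
  M X n := Ω[B⁄R] ⊗[B] M.M X n
  μ X Y p k e := LinearMap.lTensor Ω[B⁄R] (M.μ X Y p k e)
  μ_multilinear k e := by
    constructor
    · intro W X Y Z n q a a' r
      rw [show M.μ W Z (q.append (cons (a + a') r)) k e = _ from
        (M.μ_multilinear k e).map_add q a a' r, LinearMap.lTensor_add]
    · intro W X Y Z n q c a r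
      rw [show M.μ W Z (q.append (cons (c • a) r)) k e = _ from
        (M.μ_multilinear k e).map_smul q c a r, LinearMap.lTensor_smul]

open KaehlerDifferential in
/-- The element `w ⊗ m` of `Ω¹ ⊗ M`. -/
def ModData.omegaTmul (M : ModData A B) {X : A.Ob} {k : ℤ} (w : Ω[B⁄R]) (m : M.M X k) :
    M.omega.M X k :=
  w ⊗ₜ[B] m

open KaehlerDifferential in
/-- A pre-connection on a family of modules: the maps `m ↦ (-1)^{|m|} ∇^1(m)` are connections, and
the higher order terms are as for a degree zero morphism from `M` to `Ω¹ ⊗ M`. -/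
structure IsPreconnection (M : ModData A B) (D : Raw M M.omega) : Prop where
  deg : ∀ X Y (p : A.Ch X Y) k e, e ≠ k + p.rdeg → D X Y p k e = 0
  leibniz : ∀ X k (f : B) (m : M.M X k),
    D X X (nil X) k k (f • m) =
      f • D X X (nil X) k k m +
        k.negOnePow • M.omegaTmul (KaehlerDifferential.D R B f) m
  linear : ∀ X Y (p : A.Ch X Y), p.length ≠ 0 → ∀ k e (f : B) (m : M.M Y k),
    D X Y p k e (f • m) = f • D X Y p k e m
  multilinear : IsMultilinear R B D
  unit : ∀ W X Z (q : A.Ch X Z) (r : A.Ch W X), D W Z (q.append (cons (A.one X) r)) = 0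

open KaehlerDifferential in
/-- The map `m ↦ ω ⊗ μ_M(m, q, a, r)`. -/
def insertPure (M : ModData A B) {W X Y Z : A.Ob} (q : A.Ch Y Z) (r : A.Ch W X) (n k e : ℤ)
    (w : Ω[B⁄R]) (a : A.Hom X Y n) : M.M Z k →+ Ω[B⁄R] ⊗[B] M.M W e :=
  (TensorProduct.mk B Ω[B⁄R] (M.M W e) w).toAddMonoidHom.comp
    (M.μ W Z (q.append (cons a r)) k e).toAddMonoidHom

open KaehlerDifferential in
/-- The map `m ↦ μ_M(m, q, γ, r)` for `γ ∈ Ω¹ ⊗ hom_A(X, Y)`, with values in `Ω¹ ⊗ M`; it sends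
`γ = ω ⊗ a` to `m ↦ ω ⊗ μ_M(m, q, a, r)`. -/
def insertOmega (M : ModData A B) {W X Y Z : A.Ob} (q : A.Ch Y Z) (r : A.Ch W X) (n k e : ℤ) :
    Ω[B⁄R] ⊗[R] A.Hom X Y n →+ (M.M Z k →+ Ω[B⁄R] ⊗[B] M.M W e) :=
  TensorProduct.liftAddHom
    (AddMonoidHom.mk' (fun w => AddMonoidHom.mk' (fun a => insertPure M q r n k e w a)
        (fun a a' => by
          ext m
          change w ⊗ₜ[B] (M.μ W Z (q.append (cons (a + a') r)) k e m) = _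
          rw [show M.μ W Z (q.append (cons (a + a') r)) k e = _ from
            (M.μ_multilinear k e).map_add q a a' r, LinearMap.add_apply, TensorProduct.tmul_add]
          rfl))
      (fun w w' => by
        ext a m
        exact TensorProduct.add_tmul w w' _))
    (fun c w a => by
      ext m
      change (c • w) ⊗ₜ[B] (M.μ W Z (q.append (cons a r)) k e m)
        = w ⊗ₜ[B] (M.μ W Z (q.append (cons (c • a) r)) k e m)
      rw [show M.μ W Z (q.append (cons (c • a) r)) k e = _ from
        (M.μ_multilinear k e).map_smul q c a r, LinearMap.smul_apply, ← TensorProduct.smul_tmul,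
        algebraMap_smul])

/-- The constant term of the Hochschild cochain on families of modules which is induced by `γ`:
`γ^{mod,0}(m, a_{d-1}, …, a_1) = - ∑ μ_M(m, …, γ(a_{i+j}, …, a_{i+1}), a_i, …, a_1)`. -/
def DefField.onModule (G : DefField A B) (M : ModData A B) : Raw M M.omega :=
  fun _ _ p k e => - (p.splits.map fun S => (S.right.splits.map fun T =>
    insertOmega M S.left T.right (T.left.rdeg + 1) k e
      (G.γ _ _ T.left (T.left.rdeg + 1))).sum).sum

/-- The family `M` follows the deformation field `[γ]`: the deformation class `[μ^1(∇)]`, for a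
pre-connection `∇`, agrees with the class of `γ^{mod,0}` in `H^1(hom(M, Ω¹ ⊗ M))`. -/
def DefField.IsFollowedBy (G : DefField A B) (M : ModData A B) : Prop :=
  ∃ D : Raw M M.omega, IsPreconnection M D ∧
    diff M M.omega 0 D - G.onModule M ∈ Coboundaries M M.omega 1

end Modules

end AInf

end

/-!
A family of modules which follows `[γ]` carries, along every vector field `ξ` on the curve, a
connection: contracting a pre-connection with `ξ`, and correcting it by the cochain which makes
the deformation classes agree, gives an `IsConn` (`DefField.IsFollowedBy.exists_isConn`). For two
such families the commutator with the connections commutes with the differential of `hom(M, N)`,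
since both are deformed by the same `γ`, and so it induces connections on all the cohomology
modules `HB M N g`, which are derivations for composition (`HB.deriv`, `HB.deriv_hcomp`). All of
this takes place in a category `HMod` linear over the ring `B` of functions on the curve. To avoid
signs, morphisms are rewritten as maps on total spaces (`toB`), where composition is the unsigned
`star` and the differential is `bd`.

For perfect families these cohomology modules are finitely generated over `B`
(`ModData.IsPerfect.finite_HB`): along the filtration of a twisted complex, the Yoneda lemma
(`TwData.exists_vanishes_sub_bd`) bounds them by the cohomology of the target. In characteristic
zero, a nonzero ideal of `B` stable under a derivation is not contained in a maximal ideal at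
which the derivation is nonzero (`IsParam.not_le_of_stable`), and at every point there is a vector
field which does not vanish (`exists_isParam`). Applied to annihilators, this shows that finitely
generated modules with connection are torsion free (`IsParam.exists_kills_torsion`). In particular
there is no torsion in degree `1`, so that morphisms and their compositions on a fibre are
obtained from those of the families by base change (`redH_surjective`,
`mem_ker_smul_of_redH_eq_zero`).

It remains to compare two objects `X`, `Y` of a linear category with connections, given that they
are isomorphic at `s` and have commutative local endomorphism rings there
(`exists_inverse_at_point`).

* The compositions `X → Y → X` span a submodule of `End X` stable under the connection, which is
  everything at `s`, hence also at `s'`. So at `s'` the identity of `X` is a sum of maps which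
  factor through `Y` (`exists_smul_id_mem_span`).
* At `s`, the elements of `End X` are scalars plus nilpotents, so the normalized trace of the
  regular representation is multiplicative. The failure of multiplicativity generates a
  differential ideal, contained in `ker s`, so it vanishes everywhere
  (`QuasiBasis.defect_eq_zero`). At `s'`, the normalized trace of an idempotent is then `0` or
  `1`, and since this is its rank divided by the dimension, there are only trivial idempotents
  (`QuasiBasis.idempotent_trivial`). The dimension of the fibres of `End X` is constant, so these
  are nonzero.
* By Fitting's lemma, sums of non-units at `s'` are non-units, and therefore one of the
  compositions `X → Y → X` is invertible there. It splits `X` off from `Y`, and as `Y` has only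
  trivial idempotents, `X` and `Y` are isomorphic at `s'`.
-/

noncomputable section

namespace AInf
namespace Chain

/-! ### Sums over decompositions of a chain -/

section Splits

variable {Ob : Type u} {H : Ob → Ob → ℤ → Type u} {V W : Type*} [AddCommGroup V] [AddCommGroup W]

/-- The sum of `f` over all decompositions of the chain `p` into a left and a right part. -/
def sp {X Y : Ob} (p : Chain H X Y) (f : Split H X Y → V) : V := (p.splits.map f).sum

@[simp] theorem nil_append {X Y : Ob} (r : Chain H X Y) : (nil Y).append r = r := rfl

@[simp] theorem cons_append {X Y Z Z' : Ob} {n : ℤ} (a : H Z Z' n) (q : Chain H Y Z)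
    (r : Chain H X Y) : (cons a q).append r = cons a (q.append r) := rfl

@[simp] theorem append_nil {X Y : Ob} (p : Chain H X Y) : p.append (nil X) = p := by
  induction p with
  | nil => rfl
  | cons a p ih => simp [ih]

theorem append_assoc {X Y Z Z' : Ob} (p : Chain H Z Z') (q : Chain H Y Z) (r : Chain H X Y) :
    (p.append q).append r = p.append (q.append r) := by
  induction p with
  | nil => rfl
  | cons a p ih => simp [ih]

@[simp] theorem rdeg_nil (X : Ob) : (nil X : Chain H X X).rdeg = 0 := rfl

@[simp] theorem rdeg_cons {X Y Z : Ob} {n : ℤ} (a : H Y Z n) (p : Chain H X Y) :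
    (cons a p).rdeg = (n - 1) + p.rdeg := rfl

@[simp] theorem rdeg_append {X Y Z : Ob} (p : Chain H Y Z) (q : Chain H X Y) :
    (p.append q).rdeg = p.rdeg + q.rdeg := by
  induction p with
  | nil => simp
  | cons a p ih => simp [ih, add_assoc]

@[simp] theorem length_nil (X : Ob) : (nil X : Chain H X X).length = 0 := rfl

@[simp] theorem length_cons {X Y Z : Ob} {n : ℤ} (a : H Y Z n) (p : Chain H X Y) :
    (cons a p).length = p.length + 1 := rfl

@[simp] theorem length_append {X Y Z : Ob} (p : Chain H Y Z) (q : Chain H X Y) :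
    (p.append q).length = p.length + q.length := by
  induction p with
  | nil => simp
  | cons a p ih => simp [ih]; omega

theorem append_of_mem_splits {X Y : Ob} {p : Chain H X Y} {S : Split H X Y} (h : S ∈ p.splits) :
    S.left.append S.right = p := by
  induction p with
  | nil => simp only [splits, List.mem_singleton] at h; subst h; rfl
  | cons a p ih =>
    simp only [splits, List.mem_cons, List.mem_map] at h
    rcases h with rfl | ⟨T, hT, rfl⟩
    · rfl
    · simp [ih hT]

@[simp] theorem sp_nil {X : Ob} (f : Split H X X → V) : sp (nil X) f = f ⟨X, nil X, nil X⟩ := by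
  simp [sp, splits]

theorem sp_cons {X Y Z : Ob} {n : ℤ} (a : H Y Z n) (p : Chain H X Y) (f : Split H X Z → V) :
    sp (cons a p) f = f ⟨Z, nil Z, cons a p⟩ +
      sp p (fun S => f ⟨S.mid, cons a S.left, S.right⟩) := by
  simp [sp, splits, Function.comp_def]

theorem sp_congr {X Y : Ob} {p : Chain H X Y} {f g : Split H X Y → V}
    (h : ∀ S : Split H X Y, S.left.append S.right = p → f S = g S) : sp p f = sp p g := by
  unfold sp
  rw [List.map_congr_left]
  intro S hS
  exact h S (append_of_mem_splits hS)

theorem sp_add {X Y : Ob} (p : Chain H X Y) (f g : Split H X Y → V) :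
    sp p (fun S => f S + g S) = sp p f + sp p g := by
  simp [sp, List.sum_map_add]

theorem map_sp {X Y : Ob} (h : V →+ W) (p : Chain H X Y) (f : Split H X Y → V) :
    h (sp p f) = sp p (fun S => h (f S)) := by
  simp [sp, map_list_sum, Function.comp_def]

theorem sp_neg {X Y : Ob} (p : Chain H X Y) (f : Split H X Y → V) :
    sp p (fun S => - f S) = - sp p f :=
  (map_sp (negAddMonoidHom) p f).symm

@[simp] theorem sp_zero {X Y : Ob} (p : Chain H X Y) : sp p (fun _ => (0 : V)) = 0 := by
  simp [sp]

theorem sp_smul {X Y : Ob} {S : Type*} [Monoid S] [DistribMulAction S V] (c : S) (p : Chain H X Y)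
    (f : Split H X Y → V) : sp p (fun S => c • f S) = c • sp p f :=
  (map_sp (DistribSMul.toAddMonoidHom V c) p f).symm

theorem sp_apply {X Y : Ob} (p : Chain H X Y) (f : Split H X Y → (V →+ W)) (v : V) :
    sp p f v = sp p (fun S => f S v) :=
  map_sp (AddMonoidHom.eval v) p f

theorem sp_comm {X Y X' Y' : Ob} (p : Chain H X Y) (q : Chain H X' Y')
    (f : Split H X Y → Split H X' Y' → V) :
    sp p (fun S => sp q (fun T => f S T)) = sp q (fun T => sp p (fun S => f S T)) := by
  induction p with
  | nil => simp
  | cons a p ih => simp only [sp_cons, sp_add, ih]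

theorem sp_sum {ι : Type*} {X Y : Ob} (p : Chain H X Y) (s : Finset ι) (f : ι → Split H X Y → V) :
    sp p (fun S => ∑ i ∈ s, f i S) = ∑ i ∈ s, sp p (f i) := by
  classical
  induction s using Finset.induction_on with
  | empty => simp
  | insert i s hi ih => simp only [Finset.sum_insert hi, sp_add, ih]

/-- Decomposing a chain into three parts: the two ways of doing this in two steps. -/
theorem sp_assoc {X Y : Ob} (p : Chain H X Y)
    (F : ∀ Z Z' : Ob, Chain H Z Y → Chain H Z' Z → Chain H X Z' → V) :
    sp p (fun S => sp S.right (fun T => F S.mid T.mid S.left T.left T.right)) =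
      sp p (fun S => sp S.left (fun T => F T.mid S.mid T.left T.right S.right)) := by
  induction p with
  | nil => simp
  | cons a p ih =>
    simp only [sp_cons, sp_nil, sp_add]
    rw [ih (fun Z Z' l m r => F Z Z' (cons a l) m r)]
    abel

/-- A decomposition of a concatenation, with a marked entry, decomposes the part to the left or
the part to the right of that entry. -/
theorem sp_append_cons {W X Y Z : Ob} {n : ℤ} (q : Chain H Y Z) (b : H X Y n) (r : Chain H W X)
    (f : Split H W Z → V) :
    sp (q.append (cons b r)) f =
      sp q (fun S => f ⟨S.mid, S.left, S.right.append (cons b r)⟩) +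
      sp r (fun S => f ⟨S.mid, q.append (cons b S.left), S.right⟩) := by
  induction q with
  | nil => simp [sp_cons]
  | cons a q ih =>
    simp only [cons_append, sp_cons]
    rw [ih]
    abel

/-- The sum over all decompositions of a chain into three parts. -/
def sp3 {X Y : Ob} (p : Chain H X Y)
    (F : ∀ {Z Z' : Ob}, Chain H Z Y → Chain H Z' Z → Chain H X Z' → V) : V :=
  sp p (fun S => sp S.right (fun T => F S.left T.left T.right))

theorem sp3_congr {X Y : Ob} {p : Chain H X Y}
    {F G : ∀ {Z Z' : Ob}, Chain H Z Y → Chain H Z' Z → Chain H X Z' → V}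
    (h : ∀ {Z Z' : Ob} (l : Chain H Z Y) (m : Chain H Z' Z) (r : Chain H X Z'),
      l.append (m.append r) = p → F l m r = G l m r) : sp3 p F = sp3 p G := by
  unfold sp3
  refine sp_congr fun S hS => sp_congr fun T hT => h _ _ _ ?_
  rw [hT, hS]

theorem sp3_add {X Y : Ob} (p : Chain H X Y)
    (F G : ∀ {Z Z' : Ob}, Chain H Z Y → Chain H Z' Z → Chain H X Z' → V) :
    sp3 p (fun l m r => F l m r + G l m r) = sp3 p F + sp3 p G := by
  simp only [sp3, sp_add]

theorem map_sp3 {X Y : Ob} (h : V →+ W) (p : Chain H X Y)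
    (F : ∀ {Z Z' : Ob}, Chain H Z Y → Chain H Z' Z → Chain H X Z' → V) :
    h (sp3 p F) = sp3 p (fun l m r => h (F l m r)) := by
  simp only [sp3, map_sp]

theorem sp3_cons {X Y Z : Ob} {n : ℤ} (a : H Y Z n) (p : Chain H X Y)
    (F : ∀ {Z₁ Z₂ : Ob}, Chain H Z₁ Z → Chain H Z₂ Z₁ → Chain H X Z₂ → V) :
    sp3 (cons a p) F = sp (cons a p) (fun T => F (nil Z) T.left T.right) +
      sp3 p (fun l m r => F (cons a l) m r) := by
  simp only [sp3, sp_cons _ _ fun S : Split H X Z => sp S.right fun T => F S.left T.left T.right]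

theorem sp3_append_cons {W X Y Z : Ob} {n : ℤ} (q : Chain H Y Z) (b : H X Y n) (r : Chain H W X)
    (F : ∀ {Z₁ Z₂ : Ob}, Chain H Z₁ Z → Chain H Z₂ Z₁ → Chain H W Z₂ → V) :
    sp3 (q.append (cons b r)) F =
      sp3 q (fun l m l' => F l m (l'.append (cons b r))) +
      sp q (fun S => sp r (fun T => F S.left (S.right.append (cons b T.left)) T.right)) +
      sp3 r (fun l m l' => F (q.append (cons b l)) m l') := by
  simp only [sp3, sp_append_cons, sp_add]

/-- Decomposing a chain into five parts, by first fixing the middle or the fourth one. -/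
theorem sp3_sp3_left {X Y : Ob} (p : Chain H X Y)
    (F : ∀ {Z₁ Z₂ Z₃ Z₄ : Ob}, Chain H Z₁ Y → Chain H Z₂ Z₁ → Chain H Z₃ Z₂ → Chain H Z₄ Z₃ →
      Chain H X Z₄ → V) :
    sp3 p (fun l m r => sp3 l (fun l₁ l₂ l₃ => F l₁ l₂ l₃ m r)) =
      sp3 p (fun l m r => sp3 r (fun r₁ r₂ r₃ => F l m r₁ r₂ r₃)) := by
  unfold sp3
  refine (sp_congr fun S _ => sp_comm _ _ _).trans ?_
  refine (sp_assoc p (fun _ _ l m r => sp r fun T => sp m fun V =>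
    F l V.left V.right T.left T.right)).symm.trans ?_
  refine sp_congr fun S _ => ?_
  refine (sp_congr fun U _ => sp_comm _ _ _).trans ?_
  exact (sp_assoc S.right (fun _ _ l m r => sp r fun T => F S.left l m T.left T.right)).symm

/-- Decomposing a chain into five parts, by fixing the three middle ones together. -/
theorem sp3_sp_sp {X Y : Ob} (p : Chain H X Y)
    (F : ∀ {Z₁ Z₂ Z₃ Z₄ : Ob}, Chain H Z₁ Y → Chain H Z₂ Z₁ → Chain H Z₃ Z₂ → Chain H Z₄ Z₃ →
      Chain H X Z₄ → V) :
    sp3 p (fun l m r => sp l (fun S => sp r (fun T => F S.left S.right m T.left T.right))) =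
      sp3 p (fun l m r => sp3 m (fun m₁ m₂ m₃ => F l m₁ m₂ m₃ r)) := by
  unfold sp3
  refine (sp_congr fun S _ => sp_comm _ _ _).trans ?_
  refine (sp_assoc p (fun _ _ l m r => sp r fun T => sp T.right fun V =>
    F l m T.left V.left V.right)).symm.trans ?_
  refine sp_congr fun S _ => ?_
  refine Eq.trans ?_ (sp_assoc S.right (fun _ _ l m r => sp m fun V =>
    F S.left l V.left V.right r))
  refine sp_congr fun T _ => ?_
  exact sp_assoc T.right (fun _ _ l m r => F S.left T.left l m r)

end Splits
end Chain
end AInf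

namespace AInf
open Chain

/-! ### Inserting the operations of an `A_∞`-category into functions of chains -/

section Insertion

theorem sign_congr {V : Type*} [AddCommGroup V] {m n : ℤ} (h : Even (m - n)) (v : V) :
    m.negOnePow • v = n.negOnePow • v := by
  rw [(Int.negOnePow_eq_iff m n).mpr h]

theorem sign_smul_smul {V : Type*} [AddCommGroup V] (m n : ℤ) (v : V) :
    m.negOnePow • n.negOnePow • v = (m + n).negOnePow • v := by
  rw [Int.negOnePow_add, mul_smul]

theorem sign_neg {V : Type*} [AddCommGroup V] {m n : ℤ} (h : Odd (m - n)) (v : V) :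
    m.negOnePow • v = - (n.negOnePow • v) := by
  rw [show m = (m - n) + n by ring, Int.negOnePow_add, Int.negOnePow_odd _ h, mul_smul]
  simp [Units.smul_def]

variable {Ob : Type u} {H : Ob → Ob → ℤ → Type u} [∀ X Y n, AddCommGroup (H X Y n)]

/-- A function of chains with fixed end points which is additive in every entry. -/
def IsAdditive {X Y : Ob} {V : Type*} [AddCommGroup V] (φ : Chain H X Y → V) : Prop :=
  ∀ {W Z : Ob} {n : ℤ} (q : Chain H Z Y) (a a' : H W Z n) (r : Chain H X W),
    φ (q.append (cons (a + a') r)) = φ (q.append (cons a r)) + φ (q.append (cons a' r))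

/-- The value of an additive function of chains, as a function of one entry. -/
def IsAdditive.at {X Y : Ob} {V : Type*} [AddCommGroup V] {φ : Chain H X Y → V}
    (h : IsAdditive φ) {W Z : Ob} (n : ℤ) (q : Chain H Z Y) (r : Chain H X W) : H W Z n →+ V :=
  AddMonoidHom.mk' (fun a => φ (q.append (cons a r))) fun a a' => h q a a' r

theorem IsAdditive.map_zero {X Y : Ob} {V : Type*} [AddCommGroup V] {φ : Chain H X Y → V}
    (h : IsAdditive φ) {W Z : Ob} (n : ℤ) (q : Chain H Z Y) (r : Chain H X W) :
    φ (q.append (cons (0 : H W Z n) r)) = 0 :=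
  (h.at n q r).map_zero

variable {R : Type u} [Field R] (A : Category R)

/-- Insertion of the `A_∞`-operations into all parts of a chain. -/
def aI {V : Type*} [AddCommGroup V] {X Y : A.Ob} (φ : A.Ch X Y → V) : A.Ch X Y → V := fun p =>
  sp3 p fun l m r => r.rdeg.negOnePow • φ (l.append (cons (A.μ _ _ m (m.rdeg + 2)) r))

variable {A}

theorem sp3_mu {X Y : A.Ob} (p : A.Ch X Y) (e : ℤ) :
    sp3 p (fun l m r => r.rdeg.negOnePow •
      A.μ X Y (l.append (cons (A.μ _ _ m (m.rdeg + 2)) r)) e) = 0 :=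
  A.μ_rel X Y p e

theorem rdeg_insert {W X Y Z : A.Ob} (l : A.Ch Y Z) (m : A.Ch X Y) (r : A.Ch W X) :
    (l.append (cons (A.μ _ _ m (m.rdeg + 2)) r)).rdeg = (l.append (m.append r)).rdeg + 1 := by
  simp; ring

theorem aI_comp {V W : Type*} [AddCommGroup V] [AddCommGroup W] {X Y : A.Ob} (h : V →+ W)
    (φ : A.Ch X Y → V) : aI A (fun p => h (φ p)) = fun p => h (aI A φ p) := by
  funext p
  unfold aI
  rw [map_sp3]
  simp only [Units.smul_def, map_zsmul]

theorem aI_add {V : Type*} [AddCommGroup V] {X Y : A.Ob} (φ ψ : A.Ch X Y → V) :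
    aI A (fun p => φ p + ψ p) = fun p => aI A φ p + aI A ψ p := by
  funext p
  unfold aI
  simp only [smul_add]
  exact sp3_add _ _ _

theorem aI_sign {V : Type*} [AddCommGroup V] {X Y : A.Ob} (φ : A.Ch X Y → V) (p : A.Ch X Y) :
    aI A (fun p => p.rdeg.negOnePow • φ p) p = - (p.rdeg.negOnePow • aI A φ p) := by
  unfold aI sp3
  simp only [← sp_smul, ← sp_neg, sign_smul_smul]
  refine sp_congr fun S hS => sp_congr fun T hT => sign_neg ?_ _
  rw [rdeg_insert, hT, hS]
  grind

theorem aI_apply_insert {V : Type*} [AddCommGroup V] {W X Y Z : A.Ob} {n : ℤ}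
    (φ : A.Ch W Z → V) (q : A.Ch Y Z) (b : A.Hom X Y n) (r : A.Ch W X) :
    aI A φ (q.append (cons b r)) =
      sp3 q (fun l m l' => (l'.append (cons b r)).rdeg.negOnePow •
        φ ((l.append (cons (A.μ _ _ m (m.rdeg + 2)) l')).append (cons b r))) +
      sp q (fun S => sp r (fun T => T.right.rdeg.negOnePow • φ (S.left.append
        (cons (A.μ _ _ (S.right.append (cons b T.left))
          ((S.right.append (cons b T.left)).rdeg + 2)) T.right)))) +
      sp3 r (fun l m l' => l'.rdeg.negOnePow •
        φ (q.append (cons b (l.append (cons (A.μ _ _ m (m.rdeg + 2)) l'))))) := by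
  unfold aI
  rw [sp3_append_cons]
  simp only [append_assoc, cons_append]

theorem IsAdditive.sp3_mu {V : Type*} [AddCommGroup V] {W X Y Z : A.Ob} {φ : A.Ch W Z → V}
    (hφ : IsAdditive φ) (l : A.Ch Y Z) (m : A.Ch X Y) (r : A.Ch W X) :
    sp3 m (fun m₁ m₂ m₃ => m₃.rdeg.negOnePow • φ (l.append (cons (A.μ _ _
      (m₁.append (cons (A.μ _ _ m₂ (m₂.rdeg + 2)) m₃))
        ((m₁.append (cons (A.μ _ _ m₂ (m₂.rdeg + 2)) m₃)).rdeg + 2)) r))) = 0 := by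
  have h := congrArg (hφ.at (m.rdeg + 1 + 2) l r) (AInf.sp3_mu m (m.rdeg + 1 + 2))
  rw [map_sp3, _root_.map_zero] at h
  rw [← h]
  refine sp3_congr fun m₁ m₂ m₃ hm => ?_
  rw [rdeg_insert, hm, Units.smul_def, Units.smul_def, map_zsmul]
  rfl

/-- Inserting the `A_∞`-operations twice gives zero. -/
theorem aI_aI {V : Type*} [AddCommGroup V] {X Y : A.Ob} {φ : A.Ch X Y → V} (hφ : IsAdditive φ)
    (p : A.Ch X Y) : aI A (aI A φ) p = 0 := by
  have h : aI A (aI A φ) p = sp3 p (fun l m r => sp3 l (fun l₁ l₂ l₃ =>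
        (r.rdeg + (l₃.append (cons (A.μ _ _ m (m.rdeg + 2)) r)).rdeg).negOnePow •
        φ ((l₁.append (cons (A.μ _ _ l₂ (l₂.rdeg + 2)) l₃)).append
          (cons (A.μ _ _ m (m.rdeg + 2)) r)))) +
      sp3 p (fun l m r => sp l (fun S => sp r (fun T =>
        (r.rdeg + T.right.rdeg).negOnePow • φ (S.left.append
        (cons (A.μ _ _ (S.right.append (cons (A.μ _ _ m (m.rdeg + 2)) T.left))
          ((S.right.append (cons (A.μ _ _ m (m.rdeg + 2)) T.left)).rdeg + 2)) T.right))))) +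
      sp3 p (fun l m r => sp3 r (fun r₁ r₂ r₃ => (r.rdeg + r₃.rdeg).negOnePow •
        φ (l.append (cons (A.μ _ _ m (m.rdeg + 2))
          (r₁.append (cons (A.μ _ _ r₂ (r₂.rdeg + 2)) r₃)))))) := by
    rw [← sp3_add, ← sp3_add]
    refine sp3_congr fun l m r _ => ?_
    rw [aI_apply_insert]
    simp only [smul_add, sp3, ← sp_smul, sign_smul_smul]
  have h₁ : sp3 p (fun l m r => sp3 l (fun l₁ l₂ l₃ =>
        (r.rdeg + (l₃.append (cons (A.μ _ _ m (m.rdeg + 2)) r)).rdeg).negOnePow •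
        φ ((l₁.append (cons (A.μ _ _ l₂ (l₂.rdeg + 2)) l₃)).append
          (cons (A.μ _ _ m (m.rdeg + 2)) r)))) =
      - sp3 p (fun l m r => sp3 r (fun r₁ r₂ r₃ => (r.rdeg + r₃.rdeg).negOnePow •
        φ (l.append (cons (A.μ _ _ m (m.rdeg + 2))
          (r₁.append (cons (A.μ _ _ r₂ (r₂.rdeg + 2)) r₃)))))) := by
    rw [sp3_sp3_left p (fun l₁ l₂ l₃ m r =>
        (r.rdeg + (l₃.append (cons (A.μ _ _ m (m.rdeg + 2)) r)).rdeg).negOnePow •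
        φ ((l₁.append (cons (A.μ _ _ l₂ (l₂.rdeg + 2)) l₃)).append
          (cons (A.μ _ _ m (m.rdeg + 2)) r)))]
    simp only [sp3, ← sp_neg]
    refine sp_congr fun S _ => sp_congr fun T _ => sp_congr fun U hU => sp_congr fun U' hU' => ?_
    rw [append_assoc, cons_append]
    refine sign_neg ?_ _
    rw [← hU, ← hU']
    simp only [rdeg_append, rdeg_cons]
    grind
  have h₂ : sp3 p (fun l m r => sp l (fun S => sp r (fun T =>
        (r.rdeg + T.right.rdeg).negOnePow • φ (S.left.append
        (cons (A.μ _ _ (S.right.append (cons (A.μ _ _ m (m.rdeg + 2)) T.left))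
          ((S.right.append (cons (A.μ _ _ m (m.rdeg + 2)) T.left)).rdeg + 2)) T.right))))) = 0 := by
    have := sp3_sp_sp p (fun l m₁ m₂ m₃ r => m₃.rdeg.negOnePow • φ (l.append (cons (A.μ _ _
      (m₁.append (cons (A.μ _ _ m₂ (m₂.rdeg + 2)) m₃))
        ((m₁.append (cons (A.μ _ _ m₂ (m₂.rdeg + 2)) m₃)).rdeg + 2)) r)))
    rw [sp3_congr fun l m r _ => hφ.sp3_mu l m r] at this
    simp only [sp3, sp_zero] at this ⊢
    rw [← this]
    refine sp_congr fun S _ => sp_congr fun T _ => sp_congr fun U hU => sp_congr fun U' hU' => ?_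
    refine sign_congr ?_ _
    rw [← hU', rdeg_append]
    grind
  rw [h, h₁, h₂]
  abel

/-! ### Inserting a Hochschild cocycle, contracted with a vector field -/

variable {B : Type u} [CommRing B] [Algebra R B]

/-- A function of chains with values in a `B`-module, with fixed end points, which is
`R`-multilinear in the entries. -/
structure IsMul (B : Type u) [CommRing B] [Algebra R B] {X Y : A.Ob} {V : Type*} [AddCommGroup V]
    [Module B V] (φ : A.Ch X Y → V) : Prop where
  add : IsAdditive φ
  smul : ∀ {W Z : A.Ob} {n : ℤ} (q : A.Ch Z Y) (c : R) (a : A.Hom W Z n) (r : A.Ch X W),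
    φ (q.append (cons (c • a) r)) = algebraMap R B c • φ (q.append (cons a r))

variable {V : Type*} [AddCommGroup V] [Module B V]

/-- The map `ω ⊗ a ↦ ξ(ω) φ(q, a, r)`. -/
def IsMul.ins {X Y : A.Ob} {φ : A.Ch X Y → V} (hφ : IsMul B φ) (ξ : Ω[B⁄R] →ₗ[B] B) {W Z : A.Ob}
    (n : ℤ) (q : A.Ch Z Y) (r : A.Ch X W) : Ω[B⁄R] ⊗[R] A.Hom W Z n →+ V :=
  TensorProduct.liftAddHom
    (AddMonoidHom.mk' (fun w => AddMonoidHom.mk' (fun a => ξ w • φ (q.append (cons a r)))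
        (fun a a' => by rw [hφ.add, smul_add]))
      (fun w w' => by ext a; simp [add_smul]))
    (fun c w a => by
      simp only [AddMonoidHom.mk'_apply, hφ.smul, ← mul_smul, mul_comm _ (algebraMap R B c)]
      rw [← algebraMap_smul B c w, map_smul, smul_eq_mul])

@[simp] theorem IsMul.ins_tmul {X Y : A.Ob} {φ : A.Ch X Y → V} (hφ : IsMul B φ)
    (ξ : Ω[B⁄R] →ₗ[B] B) {W Z : A.Ob} (n : ℤ) (q : A.Ch Z Y) (r : A.Ch X W) (w : Ω[B⁄R])
    (a : A.Hom W Z n) : hφ.ins ξ n q r (w ⊗ₜ a) = ξ w • φ (q.append (cons a r)) := rfl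

/-- Insertion of a Hochschild cocycle `γ`, contracted with `ξ`, into all parts of a chain. -/
def gI (G : DefField A.toCatData B) (ξ : Ω[B⁄R] →ₗ[B] B) {X Y : A.Ob} {φ : A.Ch X Y → V}
    (hφ : IsMul B φ) : A.Ch X Y → V := fun p =>
  sp3 p fun l m r => hφ.ins ξ (m.rdeg + 1) l r (G.γ _ _ m (m.rdeg + 1))

/-- An additive map from an `R`-module to a `B`-module which is `R`-linear. -/
structure IsRLin (R B : Type u) [CommRing R] [CommRing B] [Algebra R B] {U V : Type*}
    [AddCommGroup U] [Module R U] [AddCommGroup V] [Module B V] (f : U → V) : Prop where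
  add : ∀ a a', f (a + a') = f a + f a'
  smul : ∀ (c : R) a, f (c • a) = algebraMap R B c • f a

namespace IsRLin

variable {U V : Type*} [AddCommGroup U] [Module R U] [AddCommGroup V] [Module B V]

theorem congr {f g : U → V} (hg : IsRLin R B g) (h : ∀ a, f a = g a) : IsRLin R B f :=
  (funext h : f = g) ▸ hg

theorem zero : IsRLin R B (fun _ : U => (0 : V)) := ⟨by simp, by simp⟩

theorem add' {f g : U → V} (hf : IsRLin R B f) (hg : IsRLin R B g) :
    IsRLin R B (fun a => f a + g a) :=
  ⟨fun a a' => by rw [hf.add, hg.add]; abel, fun c a => by rw [hf.smul, hg.smul, smul_add]⟩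

theorem comp_add {W : Type*} [AddCommGroup W] [Module B W] {f : U → V} (hf : IsRLin R B f)
    (h : V →+ W) (hh : ∀ (c : R) v, h (algebraMap R B c • v) = algebraMap R B c • h v) :
    IsRLin R B (fun a => h (f a)) :=
  ⟨fun a a' => by rw [hf.add, map_add], fun c a => by rw [hf.smul, hh]⟩

theorem neg {f : U → V} (hf : IsRLin R B f) : IsRLin R B (fun a => - f a) :=
  hf.comp_add negAddMonoidHom (by simp)

theorem sub {f g : U → V} (hf : IsRLin R B f) (hg : IsRLin R B g) :
    IsRLin R B (fun a => f a - g a) := by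
  simpa only [sub_eq_add_neg] using hf.add' hg.neg

theorem sign {f : U → V} (hf : IsRLin R B f) (n : ℤ) : IsRLin R B (fun a => n.negOnePow • f a) :=
  hf.comp_add (DistribSMul.toAddMonoidHom V n.negOnePow) (fun c v => by
    exact smul_comm _ _ _)

theorem bsmul {f : U → V} (hf : IsRLin R B f) (b : B) : IsRLin R B (fun a => b • f a) :=
  hf.comp_add (DistribSMul.toAddMonoidHom V b) (fun _ _ => smul_comm _ _ _)

theorem sp {Ob : Type u} {H : Ob → Ob → ℤ → Type u} {X Y : Ob} (p : Chain H X Y)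
    {f : Split H X Y → U → V} (hf : ∀ S, IsRLin R B (f S)) :
    IsRLin R B (fun a => Chain.sp p (fun S => f S a)) := by
  constructor
  · intro a a'
    rw [← Chain.sp_add]
    exact sp_congr fun S _ => (hf S).add a a'
  · intro c a
    rw [← Chain.sp_smul]
    exact sp_congr fun S _ => (hf S).smul c a

end IsRLin

theorem isMul_iff {X Y : A.Ob} {φ : A.Ch X Y → V} :
    IsMul B φ ↔ ∀ {W Z : A.Ob} (n : ℤ) (q : A.Ch Z Y) (r : A.Ch X W),
      IsRLin R B (fun a : A.Hom W Z n => φ (q.append (cons a r))) :=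
  ⟨fun h _ _ _ q r => ⟨fun a a' => h.add q a a' r, fun c a => h.smul q c a r⟩,
    fun h => ⟨fun q a a' r => (h _ q r).add a a', fun q c a r => (h _ q r).smul c a⟩⟩

theorem IsMul.lin {X Y : A.Ob} {φ : A.Ch X Y → V} (hφ : IsMul B φ) {W Z : A.Ob} (n : ℤ)
    (q : A.Ch Z Y) (r : A.Ch X W) : IsRLin R B (fun a : A.Hom W Z n => φ (q.append (cons a r))) :=
  isMul_iff.mp hφ n q r

theorem mu_lin {W X Y Z : A.Ob} (q : A.Ch Y Z) (r : A.Ch W X) (n e : ℤ) :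
    IsRLin R R (fun a : A.Hom X Y n => A.μ W Z (q.append (cons a r)) e) :=
  ⟨fun a a' => (A.μ_multilinear e).map_add q a a' r,
    fun c a => (A.μ_multilinear e).map_smul q c a r⟩

theorem IsRLin.comp {U U' : Type*} [AddCommGroup U] [Module R U] [AddCommGroup U'] [Module R U']
    {f : U → V} {g : U' → U} (hf : IsRLin R B f) (hg : IsRLin R R g) :
    IsRLin R B (fun a => f (g a)) :=
  ⟨fun a a' => by rw [hg.add, hf.add], fun c a => by rw [hg.smul]; exact hf.smul c _⟩

theorem isMul_aI {X Y : A.Ob} {φ : A.Ch X Y → V} (hφ : IsMul B φ) : IsMul B (aI A φ) := by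
  rw [isMul_iff]
  intro W Z n q r
  simp only [aI_apply_insert]
  refine ((IsRLin.sp _ fun S => IsRLin.sp _ fun T => ?_).add'
    (IsRLin.sp _ fun S => IsRLin.sp _ fun T => ?_)).add'
    (IsRLin.sp _ fun S => IsRLin.sp _ fun T => ?_)
  · simp only [rdeg_append, rdeg_cons]
    exact (hφ.lin n _ r).sign _
  · refine (((hφ.lin (S.right.rdeg + (n - 1 + T.left.rdeg) + 2) S.left T.right).comp
      (mu_lin S.right T.left n _)).sign T.right.rdeg).congr fun a => ?_
    rw [rdeg_append, rdeg_cons]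
  · exact (hφ.lin n q _).sign _

theorem gI_apply_insert (G : DefField A.toCatData B) (ξ : Ω[B⁄R] →ₗ[B] B) {W X Y Z : A.Ob} {n : ℤ}
    {φ : A.Ch W Z → V} (hφ : IsMul B φ) (q : A.Ch Y Z) (b : A.Hom X Y n) (r : A.Ch W X) :
    gI G ξ hφ (q.append (cons b r)) =
      sp3 q (fun l m l' => hφ.ins ξ (m.rdeg + 1) l (l'.append (cons b r))
        (G.γ _ _ m (m.rdeg + 1))) +
      sp q (fun S => sp r (fun T => hφ.ins ξ ((S.right.append (cons b T.left)).rdeg + 1) S.left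
        T.right (G.γ _ _ (S.right.append (cons b T.left))
          ((S.right.append (cons b T.left)).rdeg + 1)))) +
      sp3 r (fun l m l' => hφ.ins ξ (m.rdeg + 1) (q.append (cons b l)) l'
        (G.γ _ _ m (m.rdeg + 1))) := by
  unfold gI
  rw [sp3_append_cons]

theorem IsMul.ins_lin_of {X Y : A.Ob} {φ : A.Ch X Y → V} (hφ : IsMul B φ) (ξ : Ω[B⁄R] →ₗ[B] B)
    {W Z : A.Ob} {U : Type*} [AddCommGroup U] [Module R U] (n : ℤ) (q : U → A.Ch Z Y)
    (r : U → A.Ch X W)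
    (h : ∀ a : A.Hom W Z n, IsRLin R B (fun x => φ ((q x).append (cons a (r x)))))
    (w : Ω[B⁄R] ⊗[R] A.Hom W Z n) : IsRLin R B (fun x => hφ.ins ξ n (q x) (r x) w) := by
  induction w using TensorProduct.induction_on with
  | zero => simpa using IsRLin.zero
  | tmul w a => exact (h a).bsmul _
  | add x y hx hy => simpa only [map_add] using hx.add' hy

theorem IsMul.ins_smul {X Y : A.Ob} {φ : A.Ch X Y → V} (hφ : IsMul B φ) (ξ : Ω[B⁄R] →ₗ[B] B)
    {W Z : A.Ob} (n : ℤ) (q : A.Ch Z Y) (r : A.Ch X W) (b : B) (w : Ω[B⁄R] ⊗[R] A.Hom W Z n) :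
    hφ.ins ξ n q r (b • w) = b • hφ.ins ξ n q r w := by
  induction w using TensorProduct.induction_on with
  | zero => simp
  | tmul w a => rw [TensorProduct.smul_tmul', ins_tmul, ins_tmul, map_smul, smul_eq_mul, mul_smul]
  | add x y hx hy => rw [smul_add, map_add, hx, hy, map_add, smul_add]

theorem isMul_gI (G : DefField A.toCatData B) (ξ : Ω[B⁄R] →ₗ[B] B) {X Y : A.Ob}
    {φ : A.Ch X Y → V} (hφ : IsMul B φ) : IsMul B (gI G ξ hφ) := by
  rw [isMul_iff]
  intro W Z n q r
  simp only [gI_apply_insert]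
  refine ((IsRLin.sp _ fun S => IsRLin.sp _ fun T => ?_).add'
    (IsRLin.sp _ fun S => IsRLin.sp _ fun T => ?_)).add'
    (IsRLin.sp _ fun S => IsRLin.sp _ fun T => ?_)
  · refine hφ.ins_lin_of ξ _ _ _ (fun a => ?_) _
    simpa only [append_assoc, cons_append] using hφ.lin n (S.left.append (cons a T.right)) r
  · have h : IsRLin R B fun a : A.Hom W Z n =>
        hφ.ins ξ (S.right.rdeg + (n - 1 + T.left.rdeg) + 1) S.left T.right
        (G.γ _ _ (S.right.append (cons a T.left)) (S.right.rdeg + (n - 1 + T.left.rdeg) + 1)) :=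
      ⟨fun a a' => by
          rw [(G.multilinear (S.right.rdeg + (n - 1 + T.left.rdeg) + 1)).map_add, map_add],
        fun c a => by
          rw [(G.multilinear (S.right.rdeg + (n - 1 + T.left.rdeg) + 1)).map_smul, hφ.ins_smul]⟩
    refine h.congr fun a => ?_
    rw [rdeg_append, rdeg_cons]
  · refine hφ.ins_lin_of ξ _ _ _ (fun a => ?_) _
    simpa only [append_assoc, cons_append] using hφ.lin n q (S.left.append (cons a T.right))

/-- The Hochschild cocycle condition, inserted into a function of chains. -/
theorem IsMul.sp3_gamma (G : DefField A.toCatData B) (ξ : Ω[B⁄R] →ₗ[B] B) {W X Y Z : A.Ob}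
    {φ : A.Ch W Z → V} (hφ : IsMul B φ) (l : A.Ch Y Z) (m : A.Ch X Y) (r : A.Ch W X) :
    sp3 m (fun m₁ m₂ m₃ => hφ.ins ξ (m.rdeg + 2) l r
        (LinearMap.lTensor Ω[B⁄R] (A.μAt m₁ m₃ (m₂.rdeg + 1) (m.rdeg + 2))
          (G.γ _ _ m₂ (m₂.rdeg + 1)))) =
      sp3 m (fun m₁ m₂ m₃ => m₃.rdeg.negOnePow • hφ.ins ξ (m.rdeg + 2) l r
        (G.γ _ _ (m₁.append (cons (A.μ _ _ m₂ (m₂.rdeg + 2)) m₃)) (m.rdeg + 2))) := by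
  have h := congrArg (hφ.ins ξ (m.rdeg + 2) l r) (G.cocycle _ _ m (m.rdeg + 2))
  rw [map_sub, _root_.map_zero, sub_eq_zero] at h
  refine Eq.trans ?_ (h.trans ?_)
  · rw [← map_sp3]
    rfl
  · refine (map_sp3 (hφ.ins ξ (m.rdeg + 2) l r) m (fun m₁ m₂ m₃ => m₃.rdeg.negOnePow •
        (G.γ _ _ (m₁.append (cons (A.μ _ _ m₂ (m₂.rdeg + 2)) m₃)) (m.rdeg + 2)))).trans ?_
    simp only [Units.smul_def, map_zsmul]

theorem ins_aI {W X Y Z : A.Ob} {n : ℤ} {φ : A.Ch W Z → V} (hφ : IsMul B φ)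
    (ξ : Ω[B⁄R] →ₗ[B] B) (q : A.Ch Y Z) (r : A.Ch W X) (w : Ω[B⁄R] ⊗[R] A.Hom X Y n) :
    (isMul_aI hφ).ins ξ n q r w =
      sp3 q (fun l m l' => (l'.rdeg + (n - 1 + r.rdeg)).negOnePow •
        hφ.ins ξ n (l.append (cons (A.μ _ _ m (m.rdeg + 2)) l')) r w) +
      sp q (fun S => sp r (fun T => T.right.rdeg.negOnePow •
        hφ.ins ξ (S.right.rdeg + (n - 1 + T.left.rdeg) + 2) S.left T.right
          (LinearMap.lTensor Ω[B⁄R] (A.μAt S.right T.left n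
            (S.right.rdeg + (n - 1 + T.left.rdeg) + 2)) w))) +
      sp3 r (fun l m l' => l'.rdeg.negOnePow •
        hφ.ins ξ n q (l.append (cons (A.μ _ _ m (m.rdeg + 2)) l')) w) := by
  induction w using TensorProduct.induction_on with
  | zero => simp [sp3]
  | tmul w a =>
    rw [IsMul.ins_tmul, aI_apply_insert]
    simp only [smul_add, sp3, ← sp_smul, IsMul.ins_tmul, LinearMap.lTensor_tmul, rdeg_append,
      rdeg_cons, smul_comm (ξ w), CatData.μAt, LinearMap.coe_mk, AddHom.coe_mk]
    congr 2
    refine sp_congr fun S _ => sp_congr fun T _ => ?_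
    rw [rdeg_append, rdeg_cons]
  | add x y hx hy =>
    simp only [map_add, hx, hy, smul_add, sp3, sp_add]
    abel

/-- Insertion of a Hochschild cocycle commutes with insertion of the `A_∞`-operations. -/
theorem gI_aI (G : DefField A.toCatData B) (ξ : Ω[B⁄R] →ₗ[B] B) {X Y : A.Ob}
    {φ : A.Ch X Y → V} (hφ : IsMul B φ) (p : A.Ch X Y) :
    gI G ξ (isMul_aI hφ) p = aI A (gI G ξ hφ) p := by
  have h : aI A (gI G ξ hφ) p =
      sp3 p (fun l m r => sp3 l (fun l₁ l₂ l₃ => r.rdeg.negOnePow •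
        hφ.ins ξ (l₂.rdeg + 1) l₁ (l₃.append (cons (A.μ _ _ m (m.rdeg + 2)) r))
          (G.γ _ _ l₂ (l₂.rdeg + 1)))) +
      sp3 p (fun l m r => sp l (fun S => sp r (fun T => r.rdeg.negOnePow •
        hφ.ins ξ ((S.right.append (cons (A.μ _ _ m (m.rdeg + 2)) T.left)).rdeg + 1) S.left T.right
          (G.γ _ _ (S.right.append (cons (A.μ _ _ m (m.rdeg + 2)) T.left))
            ((S.right.append (cons (A.μ _ _ m (m.rdeg + 2)) T.left)).rdeg + 1))))) +
      sp3 p (fun l m r => sp3 r (fun r₁ r₂ r₃ => r.rdeg.negOnePow •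
        hφ.ins ξ (r₂.rdeg + 1) (l.append (cons (A.μ _ _ m (m.rdeg + 2)) r₁)) r₃
          (G.γ _ _ r₂ (r₂.rdeg + 1)))) := by
    rw [← sp3_add, ← sp3_add]
    refine sp3_congr fun l m r _ => ?_
    rw [gI_apply_insert]
    simp only [smul_add, sp3, ← sp_smul]
  have h' : gI G ξ (isMul_aI hφ) p =
      sp3 p (fun l m r => sp3 l (fun l₁ l₂ l₃ => (l₃.rdeg + (m.rdeg + 1 - 1 + r.rdeg)).negOnePow •
        hφ.ins ξ (m.rdeg + 1) (l₁.append (cons (A.μ _ _ l₂ (l₂.rdeg + 2)) l₃)) r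
          (G.γ _ _ m (m.rdeg + 1)))) +
      sp3 p (fun l m r => sp l (fun S => sp r (fun T => T.right.rdeg.negOnePow •
        hφ.ins ξ (S.right.rdeg + (m.rdeg + 1 - 1 + T.left.rdeg) + 2) S.left T.right
          (LinearMap.lTensor Ω[B⁄R] (A.μAt S.right T.left (m.rdeg + 1)
            (S.right.rdeg + (m.rdeg + 1 - 1 + T.left.rdeg) + 2)) (G.γ _ _ m (m.rdeg + 1)))))) +
      sp3 p (fun l m r => sp3 r (fun r₁ r₂ r₃ => r₃.rdeg.negOnePow •
        hφ.ins ξ (m.rdeg + 1) l (r₁.append (cons (A.μ _ _ r₂ (r₂.rdeg + 2)) r₃))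
          (G.γ _ _ m (m.rdeg + 1)))) := by
    rw [← sp3_add, ← sp3_add]
    refine sp3_congr fun l m r _ => ?_
    rw [ins_aI]
  have e₁ := sp3_sp3_left p (fun l₁ l₂ l₃ m r => r.rdeg.negOnePow •
        hφ.ins ξ (l₂.rdeg + 1) l₁ (l₃.append (cons (A.μ _ _ m (m.rdeg + 2)) r))
          (G.γ _ _ l₂ (l₂.rdeg + 1)))
  have e₂ := sp3_sp3_left p (fun l₁ l₂ l₃ m r => (l₃.rdeg + (m.rdeg + 1 - 1 + r.rdeg)).negOnePow •
        hφ.ins ξ (m.rdeg + 1) (l₁.append (cons (A.μ _ _ l₂ (l₂.rdeg + 2)) l₃)) r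
          (G.γ _ _ m (m.rdeg + 1)))
  have e₃ := sp3_sp_sp p (fun l m₁ m₂ m₃ r =>
    (r.rdeg + m₃.rdeg).negOnePow •
        hφ.ins ξ ((m₁.append (cons (A.μ _ _ m₂ (m₂.rdeg + 2)) m₃)).rdeg + 1) l r
          (G.γ _ _ (m₁.append (cons (A.μ _ _ m₂ (m₂.rdeg + 2)) m₃))
            ((m₁.append (cons (A.μ _ _ m₂ (m₂.rdeg + 2)) m₃)).rdeg + 1)))
  have e₄ := sp3_sp_sp p (fun l m₁ m₂ m₃ r => r.rdeg.negOnePow •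
        hφ.ins ξ (m₁.rdeg + (m₂.rdeg + 1 - 1 + m₃.rdeg) + 2) l r
          (LinearMap.lTensor Ω[B⁄R] (A.μAt m₁ m₃ (m₂.rdeg + 1)
            (m₁.rdeg + (m₂.rdeg + 1 - 1 + m₃.rdeg) + 2)) (G.γ _ _ m₂ (m₂.rdeg + 1))))
  have e₅ : sp3 p (fun l m r => sp3 m (fun m₁ m₂ m₃ => r.rdeg.negOnePow •
        hφ.ins ξ (m₁.rdeg + (m₂.rdeg + 1 - 1 + m₃.rdeg) + 2) l r
          (LinearMap.lTensor Ω[B⁄R] (A.μAt m₁ m₃ (m₂.rdeg + 1)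
            (m₁.rdeg + (m₂.rdeg + 1 - 1 + m₃.rdeg) + 2)) (G.γ _ _ m₂ (m₂.rdeg + 1))))) =
      sp3 p (fun l m r => sp3 m (fun m₁ m₂ m₃ => (r.rdeg + m₃.rdeg).negOnePow •
        hφ.ins ξ ((m₁.append (cons (A.μ _ _ m₂ (m₂.rdeg + 2)) m₃)).rdeg + 1) l r
          (G.γ _ _ (m₁.append (cons (A.μ _ _ m₂ (m₂.rdeg + 2)) m₃))
            ((m₁.append (cons (A.μ _ _ m₂ (m₂.rdeg + 2)) m₃)).rdeg + 1)))) := by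
    refine sp3_congr fun l m r _ => ?_
    have := congrArg (fun v => r.rdeg.negOnePow • v) (hφ.sp3_gamma G ξ l m r)
    simp only [sp3, ← sp_smul, sign_smul_smul] at this ⊢
    refine Eq.trans ?_ (this.trans ?_)
    · refine sp_congr fun S hS => sp_congr fun T hT => ?_
      rw [show S.left.rdeg + (T.left.rdeg + 1 - 1 + T.right.rdeg) + 2 = m.rdeg + 2 by
        rw [← hS, ← hT]; simp]
    · refine sp_congr fun S hS => sp_congr fun T hT => ?_
      rw [show (S.left.append (cons (A.μ _ _ T.left (T.left.rdeg + 2)) T.right)).rdeg + 1 =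
        m.rdeg + 2 by rw [← hS, ← hT]; simp; ring]
  rw [h, h', e₁, e₂]
  have e₆ : sp3 p (fun l m r => sp l (fun S => sp r (fun T => T.right.rdeg.negOnePow •
        hφ.ins ξ (S.right.rdeg + (m.rdeg + 1 - 1 + T.left.rdeg) + 2) S.left T.right
          (LinearMap.lTensor Ω[B⁄R] (A.μAt S.right T.left (m.rdeg + 1)
            (S.right.rdeg + (m.rdeg + 1 - 1 + T.left.rdeg) + 2)) (G.γ _ _ m (m.rdeg + 1)))))) =
      sp3 p (fun l m r => sp l (fun S => sp r (fun T => r.rdeg.negOnePow •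
        hφ.ins ξ ((S.right.append (cons (A.μ _ _ m (m.rdeg + 2)) T.left)).rdeg + 1) S.left T.right
          (G.γ _ _ (S.right.append (cons (A.μ _ _ m (m.rdeg + 2)) T.left))
            ((S.right.append (cons (A.μ _ _ m (m.rdeg + 2)) T.left)).rdeg + 1))))) := by
    refine (e₄.trans (e₅.trans e₃.symm)).trans ?_
    simp only [sp3]
    refine sp_congr fun S _ => sp_congr fun T _ => sp_congr fun U hU => sp_congr fun U' hU' => ?_
    refine sign_congr ?_ _
    rw [← hU', rdeg_append]
    grind
  rw [e₆]
  have e₇ : sp3 p (fun l m r => sp3 r (fun r₁ r₂ r₃ =>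
        (r₁.rdeg + (r₂.rdeg + 1 - 1 + r₃.rdeg)).negOnePow •
        hφ.ins ξ (r₂.rdeg + 1) (l.append (cons (A.μ _ _ m (m.rdeg + 2)) r₁)) r₃
          (G.γ _ _ r₂ (r₂.rdeg + 1)))) =
      sp3 p (fun l m r => sp3 r (fun r₁ r₂ r₃ => r.rdeg.negOnePow •
        hφ.ins ξ (r₂.rdeg + 1) (l.append (cons (A.μ _ _ m (m.rdeg + 2)) r₁)) r₃
          (G.γ _ _ r₂ (r₂.rdeg + 1)))) := by
    refine sp3_congr fun l m r _ => sp3_congr fun r₁ r₂ r₃ hr => sign_congr ?_ _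
    rw [← hr, rdeg_append, rdeg_append]
    grind
  rw [e₇]
  abel

end Insertion
end AInf

namespace AInf
open Chain

/-! ### The bar formalism for morphisms of modules -/

section Bar

variable {R : Type u} [Field R] {A : Category R} {B : Type u} [CommRing B] [Algebra R B]

/-- The total space `⨁_k M(Y)^k`. -/
abbrev ModData.T (M : ModData A.toCatData B) (Y : A.Ob) : Type u :=
  DirectSum ℤ (fun k => M.M Y k)

/-- The inclusion of the degree `k` part into the total space. -/
abbrev ModData.of (M : ModData A.toCatData B) {Y : A.Ob} (k : ℤ) : M.M Y k →+ M.T Y :=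
  DirectSum.of (fun k => M.M Y k) k

/-- Sequences of additive maps between total spaces, indexed by chains of morphisms. -/
abbrev BHom (M N : ModData A.toCatData B) : Type u := ∀ X Y : A.Ob, A.Ch X Y → (M.T Y →+ N.T X)

variable {K L M N : ModData A.toCatData B}

/-- Composition: `(v ⋆ u)(m, a_{d-1}, …, a_1) = ∑ v(u(m, a_{d-1}, …), …, a_1)`, without signs. -/
def star (v : BHom M N) (u : BHom L M) : BHom L N := fun X Y p =>
  sp p fun S => (v X S.mid S.right).comp (u S.mid Y S.left)

/-- The unit for `star`. -/
def bone (M : ModData A.toCatData B) : BHom M M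
  | _, _, nil _ => AddMonoidHom.id _
  | _, _, cons _ _ => 0

/-- Multiplication with the sign given by the reduced degrees of the morphisms. -/
def eps (u : BHom M N) : BHom M N := fun X Y p => p.rdeg.negOnePow • u X Y p

/-- The map `m ↦ (-1)^{|m|} m`. -/
def sgn (M : ModData A.toCatData B) (Y : A.Ob) : M.T Y →+ M.T Y :=
  DirectSum.toAddMonoid fun k => k.negOnePow • M.of k

/-- Multiplication with the sign given by the total degree of all the arguments. -/
def tau (u : BHom M N) : BHom M N := fun X Y p => p.rdeg.negOnePow • (u X Y p).comp (sgn M Y)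

/-- Insertion of the `A_∞`-operations of `A`. -/
def IB (u : BHom M N) : BHom M N := fun X Y p => aI A (u X Y) p

/-- The structure maps of a module, on total spaces. -/
def bmu (M : ModData A.toCatData B) : BHom M M := fun X Y p =>
  DirectSum.toAddMonoid fun k => (M.of (k + p.rdeg + 1)).comp
    (M.μ X Y p k (k + p.rdeg + 1)).toAddMonoidHom

/-- The graded commutator with the structure maps, without the overall sign. -/
def bL (u : BHom M N) : BHom M N := star (bmu N) u - star (eps u) (bmu M) - IB u

/-- The differential of morphisms. -/
def bd (u : BHom M N) : BHom M N := tau (bL u)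

theorem sp3_apply {V W : Type*} [AddCommGroup V] [AddCommGroup W] {X Y : A.Ob} (p : A.Ch X Y)
    (F : ∀ {Z Z' : A.Ob}, A.Ch Z Y → A.Ch Z' Z → A.Ch X Z' → (V →+ W)) (v : V) :
    sp3 p F v = sp3 p (fun l m r => F l m r v) := by
  simp only [sp3, sp_apply]

theorem bhom_ext {u v : BHom M N} (h : ∀ X Y p k m, u X Y p (M.of k m) = v X Y p (M.of k m)) :
    u = v := by
  funext X Y p
  refine DirectSum.addHom_ext fun k m => h X Y p k m

theorem star_add (v : BHom M N) (u u' : BHom L M) : star v (u + u') = star v u + star v u' := by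
  funext X Y p
  simp only [star, Pi.add_apply, AddMonoidHom.comp_add, sp_add]

theorem add_star (v v' : BHom M N) (u : BHom L M) : star (v + v') u = star v u + star v' u := by
  funext X Y p
  simp only [star, Pi.add_apply, AddMonoidHom.add_comp, sp_add]

/-- Composition from the right as an additive map. -/
def starHom : BHom M N →+ BHom L M →+ BHom L N :=
  AddMonoidHom.mk' (fun v => AddMonoidHom.mk' (star v) (star_add v))
    (fun v v' => by ext1 u; exact add_star v v' u)

theorem star_neg (v : BHom M N) (u : BHom L M) : star v (-u) = - star v u := (starHom v).map_neg u

theorem neg_star (v : BHom M N) (u : BHom L M) : star (-v) u = - star v u :=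
  (starHom.flip u).map_neg v

theorem star_sub (v : BHom M N) (u u' : BHom L M) : star v (u - u') = star v u - star v u' :=
  (starHom v).map_sub u u'

theorem sub_star (v v' : BHom M N) (u : BHom L M) : star (v - v') u = star v u - star v' u :=
  (starHom.flip u).map_sub v v'

theorem star_zero (v : BHom M N) : star v (0 : BHom L M) = 0 := (starHom v).map_zero

theorem zero_star (u : BHom L M) : star (0 : BHom M N) u = 0 := (starHom.flip u).map_zero

theorem smul_star (b : B) (v : BHom M N) (u : BHom L M) : star (b • v) u = b • star v u := by
  funext X Y p
  simp only [star, Pi.smul_apply, ← sp_smul]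
  rfl

theorem star_assoc (w : BHom M N) (v : BHom L M) (u : BHom K L) :
    star (star w v) u = star w (star v u) := by
  funext X Y p
  refine AddMonoidHom.ext fun x => ?_
  simp only [star, sp_apply, AddMonoidHom.comp_apply, map_sp]
  exact sp_assoc p (fun Z Z' l m r => w X Z' r (v Z' Z m (u Z Y l x)))

theorem bone_star (u : BHom M N) : star (bone N) u = u := by
  funext X Y p
  have h : ∀ (D : Type u) [AddCommGroup D] {X Y : A.Ob} (p : A.Ch X Y)
      (f : ∀ Z, A.Ch Z Y → (D →+ N.T Z)),
      (sp p fun S => (bone N X S.mid S.right).comp (f S.mid S.left)) = f X p := by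
    intro D _ X Y p
    induction p with
    | nil => intro f; simp [bone]
    | cons a p ih =>
      intro f
      rw [sp_cons, ih fun Z q => f Z (cons a q)]
      simp [bone]
  exact h _ p (fun Z q => u Z Y q)

theorem star_bone (u : BHom M N) : star u (bone M) = u := by
  funext X Y p
  cases p with
  | nil => simp [star, bone]
  | cons a p => simp [star, sp_cons, bone]

theorem eps_star (v : BHom M N) (u : BHom L M) : eps (star v u) = star (eps v) (eps u) := by
  funext X Y p
  refine AddMonoidHom.ext fun x => ?_
  simp only [eps, star, ← sp_smul]
  rw [sp_apply, sp_apply]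
  refine sp_congr fun S hS => ?_
  rw [← hS, rdeg_append, add_comm, Int.negOnePow_add, mul_smul]
  simp [Units.smul_def]

theorem tau_star (v : BHom M N) (u : BHom L M) : tau (star v u) = star (eps v) (tau u) := by
  funext X Y p
  refine AddMonoidHom.ext fun x => ?_
  simp only [eps, tau, star, AddMonoidHom.smul_apply, AddMonoidHom.comp_apply]
  rw [sp_apply, sp_apply, ← sp_smul]
  refine sp_congr fun S hS => ?_
  rw [← hS, rdeg_append, add_comm, Int.negOnePow_add, mul_smul]
  simp [Units.smul_def]

theorem eps_eps (u : BHom M N) : eps (eps u) = u := by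
  funext X Y p
  simp only [eps, smul_smul, ← Int.negOnePow_add, Int.negOnePow_even _ ⟨_, rfl⟩, one_smul]

@[simp] theorem sgn_of (Y : A.Ob) (k : ℤ) (m : M.M Y k) :
    sgn M Y (M.of k m) = k.negOnePow • M.of k m := by
  simp [sgn, ModData.of]

theorem sgn_sgn (Y : A.Ob) (x : M.T Y) : sgn M Y (sgn M Y x) = x := by
  have h : (sgn M Y).comp (sgn M Y) = AddMonoidHom.id _ := by
    refine DirectSum.addHom_ext fun k m => ?_
    rw [AddMonoidHom.comp_apply]
    change sgn M Y (sgn M Y (M.of k m)) = M.of k m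
    rw [sgn_of, Units.smul_def, map_zsmul, sgn_of, ← Units.smul_def, sign_smul_smul,
      Int.negOnePow_even _ ⟨_, rfl⟩, one_smul]
  exact DFunLike.congr_fun h x

theorem tau_tau (u : BHom M N) : tau (tau u) = u := by
  funext X Y p
  refine AddMonoidHom.ext fun x => ?_
  simp only [tau, AddMonoidHom.smul_apply, AddMonoidHom.comp_apply, sgn_sgn, sign_smul_smul,
    Int.negOnePow_even _ ⟨_, rfl⟩, one_smul]

theorem eps_tau (u : BHom M N) : eps (tau u) = tau (eps u) := by
  funext X Y p
  refine AddMonoidHom.ext fun x => ?_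
  simp only [tau, eps, AddMonoidHom.smul_apply, AddMonoidHom.comp_apply]

theorem tau_add (u v : BHom M N) : tau (u + v) = tau u + tau v := by
  funext X Y p
  simp only [tau, Pi.add_apply, AddMonoidHom.add_comp, smul_add]

/-- `tau` as an additive map. -/
def tauHom : BHom M N →+ BHom M N := AddMonoidHom.mk' tau tau_add

theorem tau_sub (u v : BHom M N) : tau (u - v) = tau u - tau v := tauHom.map_sub u v

theorem tau_zero : tau (0 : BHom M N) = 0 := tauHom.map_zero

theorem tau_smul (b : B) (u : BHom M N) : tau (b • u) = b • tau u := by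
  funext X Y p
  refine AddMonoidHom.ext fun x => ?_
  simp [tau, Units.smul_def, smul_comm b]

theorem eps_add (u v : BHom M N) : eps (u + v) = eps u + eps v := by
  funext X Y p
  simp only [eps, Pi.add_apply, smul_add]

/-- `eps` as an additive map. -/
def epsHom : BHom M N →+ BHom M N := AddMonoidHom.mk' eps eps_add

theorem eps_sub (u v : BHom M N) : eps (u - v) = eps u - eps v := epsHom.map_sub u v

theorem eps_neg (u : BHom M N) : eps (-u) = - eps u := epsHom.map_neg u

theorem IB_add (u v : BHom M N) : IB (u + v) = IB u + IB v := by
  funext X Y p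
  exact congrFun (aI_add (u X Y) (v X Y)) p

/-- `IB` as an additive map. -/
def IBHom : BHom M N →+ BHom M N := AddMonoidHom.mk' IB IB_add

theorem IB_sub (u v : BHom M N) : IB (u - v) = IB u - IB v := IBHom.map_sub u v

theorem IB_eps (u : BHom M N) : IB (eps u) = - eps (IB u) := by
  funext X Y p
  exact aI_sign (u X Y) p

theorem IB_tau (u : BHom M N) : IB (tau u) = - tau (IB u) := by
  funext X Y p
  refine (aI_sign (fun p => (u X Y p).comp (sgn M Y)) p).trans ?_
  have h := congrFun (aI_comp (AddMonoidHom.compHom' (P := N.T X) (sgn M Y)) (u X Y)) p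
  exact congrArg (fun z => -(p.rdeg.negOnePow • z)) h

theorem IB_IB {u : BHom M N} (hu : ∀ X Y, IsAdditive (u X Y)) : IB (IB u) = 0 := by
  funext X Y p
  exact aI_aI (hu X Y) p

/-- Insertion of the `A_∞`-operations is an odd derivation for composition. -/
theorem IB_star (v : BHom M N) (u : BHom L M) :
    IB (star v u) = star (IB v) u + star (eps v) (IB u) := by
  funext X Y p
  refine AddMonoidHom.ext fun x => ?_
  have h : IB (star v u) X Y p x =
      sp3 p (fun l m r => sp l fun S => r.rdeg.negOnePow •
        v X S.mid (S.right.append (cons (A.μ _ _ m (m.rdeg + 2)) r)) (u S.mid Y S.left x)) +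
      sp3 p (fun l m r => sp r fun S => r.rdeg.negOnePow •
        v X S.mid S.right (u S.mid Y (l.append (cons (A.μ _ _ m (m.rdeg + 2)) S.left)) x)) := by
    rw [← sp3_add]
    refine (sp3_apply p _ x).trans (sp3_congr fun l m r _ => ?_)
    simp only [star, sp_append_cons, smul_add, ← sp_smul]
    rw [AddMonoidHom.add_apply, sp_apply, sp_apply]
    rfl
  rw [h]
  refine congr_arg₂ (· + ·) ?_ ?_
  · simp only [sp3]
    refine (sp_congr fun S _ => sp_comm _ _ _).trans ?_
    refine (sp_assoc p (fun Z Z' l m r => sp r fun T => T.right.rdeg.negOnePow •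
      v X Z (m.append (cons (A.μ _ _ T.left (T.left.rdeg + 2)) T.right)) (u Z Y l x))).symm.trans
        ?_
    rw [star, sp_apply]
    refine sp_congr fun S _ => ?_
    rw [AddMonoidHom.comp_apply, IB, aI, sp3_apply]
    rfl
  · simp only [sp3]
    have e₁ : ∀ S : Split A.Hom X Y, (sp S.right fun T => sp T.right fun U =>
        T.right.rdeg.negOnePow • v X U.mid U.right
          (u U.mid Y (S.left.append (cons (A.μ _ _ T.left (T.left.rdeg + 2)) U.left)) x)) =
        sp S.right fun T => sp T.left fun U => (U.right.append T.right).rdeg.negOnePow •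
          v X T.mid T.right
          (u T.mid Y (S.left.append (cons (A.μ _ _ U.left (U.left.rdeg + 2)) U.right)) x) := by
      intro S
      rw [← sp_assoc S.right (fun Z Z' l m r => (m.append r).rdeg.negOnePow •
        v X Z' r (u Z' Y (S.left.append (cons (A.μ _ _ l (l.rdeg + 2)) m)) x))]
      refine sp_congr fun T _ => sp_congr fun U hU => ?_
      rw [hU]
    refine (sp_congr fun S _ => e₁ S).trans ?_
    refine (sp_assoc p (fun Z Z' l m r => sp m fun U => (U.right.append r).rdeg.negOnePow •
      v X Z' r (u Z' Y (l.append (cons (A.μ _ _ U.left (U.left.rdeg + 2)) U.right)) x))).trans ?_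
    rw [star, sp_apply]
    refine sp_congr fun S _ => ?_
    simp only [AddMonoidHom.comp_apply, IB, aI]
    rw [sp3_apply, map_sp3]
    simp only [sp3]
    refine sp_congr fun T _ => sp_congr fun U _ => ?_
    simp only [eps, AddMonoidHom.smul_apply, rdeg_append, Int.negOnePow_add, mul_smul,
      Units.smul_def, map_zsmul]

/-! ### Homogeneous morphisms and the differential -/

/-- The maps in the sequence are homogeneous of total degree `g`. -/
def IsDeg (g : ℤ) (u : BHom M N) : Prop :=
  ∀ X Y (p : A.Ch X Y) k (m : M.M Y k) e, e ≠ k + p.rdeg + g → (u X Y p (M.of k m)) e = 0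

theorem eq_of_degree {X : A.Ob} {x : M.T X} {d : ℤ} (h : ∀ e, e ≠ d → x e = 0) :
    x = M.of d (x d) := by
  refine DFinsupp.ext fun e => ?_
  by_cases he : e = d
  · subst he
    exact (DirectSum.of_eq_same e _).symm
  · rw [h e he]
    exact (DirectSum.of_eq_of_ne d e _ he).symm

theorem IsDeg.eq_of {g : ℤ} {u : BHom M N} (hu : IsDeg g u) {X Y : A.Ob} (p : A.Ch X Y) {k : ℤ}
    (m : M.M Y k) : u X Y p (M.of k m) =
      N.of (k + p.rdeg + g) ((u X Y p (M.of k m)) (k + p.rdeg + g)) :=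
  eq_of_degree (hu X Y p k m)

theorem of_apply_ne {X : A.Ob} {d e : ℤ} (m : M.M X d) (h : e ≠ d) : (M.of d m) e = 0 :=
  DirectSum.of_eq_of_ne d e m h

theorem isDeg_bmu (M : ModData A.toCatData B) : IsDeg 1 (bmu M) := by
  intro X Y p k m e he
  simp only [bmu, ModData.of, DirectSum.toAddMonoid_of]
  exact of_apply_ne _ he

theorem isDeg_bone (M : ModData A.toCatData B) : IsDeg 0 (bone M) := by
  intro X Y p k m e he
  cases p with
  | nil => exact of_apply_ne _ (by simpa using he)
  | cons a p => rfl

theorem IsDeg.star {g h : ℤ} {v : BHom M N} {u : BHom L M} (hv : IsDeg g v) (hu : IsDeg h u) :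
    IsDeg (g + h) (star v u) := by
  intro X Y p k m e he
  rw [AInf.star, sp_apply]
  refine (map_sp (DFinsupp.evalAddMonoidHom (β := fun e => N.M X e) e) p _).trans ?_
  rw [← sp_zero p]
  refine sp_congr fun S hS => ?_
  rw [AddMonoidHom.comp_apply, hu.eq_of]
  refine hv _ _ _ _ _ _ fun h => he ?_
  rw [h, ← hS, rdeg_append]
  ring

theorem IsDeg.congr {g h : ℤ} {u : BHom M N} (hu : IsDeg g u) (e : g = h) : IsDeg h u := e ▸ hu

theorem IsDeg.add {g : ℤ} {u v : BHom M N} (hu : IsDeg g u) (hv : IsDeg g v) :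
    IsDeg g (u + v) := by
  intro X Y p k m e he
  refine (congrArg₂ (· + ·) (hu X Y p k m e he) (hv X Y p k m e he)).trans (add_zero _)

theorem IsDeg.neg {g : ℤ} {u : BHom M N} (hu : IsDeg g u) : IsDeg g (-u) := by
  intro X Y p k m e he
  exact (congrArg (- ·) (hu X Y p k m e he)).trans neg_zero

theorem IsDeg.sub {g : ℤ} {u v : BHom M N} (hu : IsDeg g u) (hv : IsDeg g v) :
    IsDeg g (u - v) := sub_eq_add_neg u v ▸ hu.add hv.neg

theorem IsDeg.eps {g : ℤ} {u : BHom M N} (hu : IsDeg g u) : IsDeg g (eps u) := by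
  intro X Y p k m e he
  have := hu X Y p k m e he
  exact (congrArg (p.rdeg.negOnePow • ·) this).trans (smul_zero _)

theorem IsDeg.tau {g : ℤ} {u : BHom M N} (hu : IsDeg g u) : IsDeg g (tau u) := by
  intro X Y p k m e he
  have := hu X Y p k m e he
  simp only [AInf.tau, AddMonoidHom.smul_apply, AddMonoidHom.comp_apply, sgn_of, Units.smul_def,
    map_zsmul]
  refine (congrArg (fun x => ((p.rdeg.negOnePow : ℤˣ) : ℤ) • ((k.negOnePow : ℤˣ) : ℤ) • x)
    this).trans ?_
  simp

theorem isDeg_IB {g : ℤ} {u : BHom M N} (hu : IsDeg g u) : IsDeg (g + 1) (IB u) := by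
  intro X Y p k m e he
  rw [IB, aI, sp3_apply]
  refine (map_sp3 (DFinsupp.evalAddMonoidHom (β := fun e => N.M X e) e) p _).trans ?_
  rw [sp3, ← sp_zero p]
  refine sp_congr fun S hS => ?_
  rw [← sp_zero S.right]
  refine sp_congr fun T hT => ?_
  refine (congrArg (T.right.rdeg.negOnePow • ·) (hu X Y _ k m e fun h => he ?_)).trans (smul_zero _)
  rw [h, rdeg_insert, hT, hS]
  ring

theorem IsDeg.bL {g : ℤ} {u : BHom M N} (hu : IsDeg g u) : IsDeg (g + 1) (bL u) :=
  ((((isDeg_bmu N).star hu).congr (add_comm _ _)).sub (hu.eps.star (isDeg_bmu M))).sub (isDeg_IB hu)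

theorem IsDeg.bd {g : ℤ} {u : BHom M N} (hu : IsDeg g u) : IsDeg (g + 1) (bd u) := hu.bL.tau

theorem sgn_comp {g : ℤ} {u : BHom M N} (hu : IsDeg g u) {X Y : A.Ob} (p : A.Ch X Y) (x : M.T Y) :
    sgn N X (u X Y p x) = (p.rdeg + g).negOnePow • u X Y p (sgn M Y x) := by
  have h : (sgn N X).comp (u X Y p) = (p.rdeg + g).negOnePow • (u X Y p).comp (sgn M Y) := by
    refine DirectSum.addHom_ext fun k m => ?_
    change sgn N X (u X Y p (M.of k m)) = (p.rdeg + g).negOnePow • u X Y p (sgn M Y (M.of k m))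
    rw [sgn_of, Units.smul_def k.negOnePow, map_zsmul, ← Units.smul_def, sign_smul_smul, hu.eq_of,
      sgn_of]
    exact sign_congr (by grind) _
  exact DFunLike.congr_fun h x

theorem tau_star' {g : ℤ} (v : BHom M N) {u : BHom L M} (hu : IsDeg g u) :
    tau (star v u) = g.negOnePow • star (tau v) u := by
  funext X Y p
  refine AddMonoidHom.ext fun x => ?_
  simp only [tau, star, AddMonoidHom.smul_apply, AddMonoidHom.comp_apply, Pi.smul_apply]
  rw [sp_apply, sp_apply, ← sp_smul, ← sp_smul]
  refine sp_congr fun S hS => ?_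
  simp only [AddMonoidHom.smul_apply, AddMonoidHom.comp_apply, sgn_comp hu, Units.smul_def,
    map_zsmul]
  simp only [← Units.smul_def, sign_smul_smul]
  refine sign_congr ?_ _
  rw [← hS, rdeg_append]
  grind

theorem bL_star (v : BHom M N) (u : BHom L M) :
    bL (star v u) = star (bL v) u + star (eps v) (bL u) := by
  simp only [bL, IB_star, eps_star, sub_star, star_sub, star_assoc]
  abel

/-- The Leibniz rule for composition. -/
theorem bd_star {g : ℤ} (v : BHom M N) {u : BHom L M} (hu : IsDeg g u) :
    bd (star v u) = g.negOnePow • star (bd v) u + star v (bd u) := by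
  simp only [bd, bL_star, tau_add, tau_star' _ hu, tau_star (eps v), eps_eps]

/-- The `A_∞`-module equations. -/
def IsRel (M : ModData A.toCatData B) : Prop := star (eps (bmu M)) (bmu M) + IB (bmu M) = 0

theorem bL_tau (u : BHom M N) :
    bL (tau u) = tau (star (eps (bmu N)) u + star (eps u) (bmu M) + IB u) := by
  have h := tau_star' (eps u) (isDeg_bmu M)
  rw [bL, IB_tau, eps_tau, tau_add, tau_add, tau_star, eps_eps, h]
  simp
  abel

/-- The differential squares to zero. -/
theorem bd_bd (hM : IsRel M) (hN : IsRel N) {u : BHom M N} (hu : ∀ X Y, IsAdditive (u X Y)) :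
    bd (bd u) = 0 := by
  rw [bd, bd, bL_tau, tau_tau]
  have h₁ : IB (bmu M) = - star (eps (bmu M)) (bmu M) := eq_neg_of_add_eq_zero_right hM
  have h₂ : IB (bmu N) = - star (eps (bmu N)) (bmu N) := eq_neg_of_add_eq_zero_right hN
  simp only [bL, star_sub, eps_sub, sub_star, IB_sub, eps_star, IB_star, eps_eps, IB_eps, IB_IB hu,
    h₁, h₂, star_neg, neg_star, star_assoc]
  abel

end Bar
end AInf

namespace AInf
open Chain

section Bar

variable {R : Type u} [Field R] {A : Category R} {B : Type u} [CommRing B] [Algebra R B]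
variable {K L M N : ModData A.toCatData B}

/-! ### Morphism complexes in the bar formalism -/

/-- The sequence consists of `B`-linear maps. -/
def IsBLin (u : BHom M N) : Prop := ∀ X Y (p : A.Ch X Y) (f : B) (x : M.T Y),
  u X Y p (f • x) = f • u X Y p x

/-- The sequence is `R`-multilinear in the morphisms. -/
def IsMulti (u : BHom M N) : Prop := ∀ X Y, IsMul B (u X Y)

/-- The maps vanish if one of the morphisms is a unit. -/
def IsRed (u : BHom M N) : Prop :=
  ∀ W X Z (q : A.Ch X Z) (r : A.Ch W X), u W Z (q.append (cons (A.one X) r)) = 0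

/-- Morphisms of degree `g` in the bar formalism. -/
structure IsHom (g : ℤ) (u : BHom M N) : Prop where
  deg : IsDeg g u
  lin : IsBLin u
  mul : IsMulti u
  red : IsRed u

/-- The strict unitality of a module, in the bar formalism, together with the module equations. -/
structure IsUMod (M : ModData A.toCatData B) : Prop where
  rel : IsRel M
  unit : ∀ X, bmu M X X (cons (A.one X) (nil X)) = AddMonoidHom.id _
  unit_vanish : ∀ W X Z (q : A.Ch X Z) (r : A.Ch W X), q.length + r.length ≠ 0 →
    bmu M W Z (q.append (cons (A.one X) r)) = 0

theorem of_congr {X : A.Ob} {d d' : ℤ} (h : d = d') (f : ∀ e, M.M X e) :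
    M.of d (f d) = M.of d' (f d') := by rw [h]

theorem of_smul {X : A.Ob} (k : ℤ) (b : B) (m : M.M X k) : M.of k (b • m) = b • M.of k m :=
  DirectSum.of_smul B k b m

theorem blin_of {u : BHom M N} (h : ∀ X Y (p : A.Ch X Y) (f : B) k (m : M.M Y k),
    u X Y p (M.of k (f • m)) = f • u X Y p (M.of k m)) : IsBLin u := by
  intro X Y p f x
  induction x using DirectSum.induction_on with
  | zero => simp
  | of k m => rw [← h]; exact congrArg _ (of_smul k f m).symm
  | add x y hx hy => rw [smul_add, map_add, hx, hy, map_add, smul_add]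

theorem bmu_of (X Y : A.Ob) (p : A.Ch X Y) (k : ℤ) (m : M.M Y k) :
    bmu M X Y p (M.of k m) = M.of (k + p.rdeg + 1) (M.μ X Y p k (k + p.rdeg + 1) m) := by
  simp [bmu, ModData.of]

theorem isBLin_bmu (M : ModData A.toCatData B) : IsBLin (bmu M) :=
  blin_of fun X Y p f k m => by rw [bmu_of, bmu_of, map_smul, of_smul]

theorem isMulti_of {u : BHom M N}
    (h : ∀ {W X Y Z : A.Ob} (n : ℤ) (q : A.Ch Y Z) (r : A.Ch W X) k (m : M.M Z k),
      IsRLin R B (fun a : A.Hom X Y n => u W Z (q.append (cons a r)) (M.of k m))) :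
    IsMulti u := fun _ _ => isMul_iff.mpr fun n q r =>
  ⟨fun a a' => DirectSum.addHom_ext fun k m => (h n q r k m).add a a',
    fun c a => DirectSum.addHom_ext fun k m => (h n q r k m).smul c a⟩

theorem isMulti_bmu (M : ModData A.toCatData B) : IsMulti (bmu M) :=
  isMulti_of fun {W X Y Z} n q r k m => by
    have h : IsRLin R B fun a : A.Hom X Y n => M.of (k + (q.rdeg + (n - 1 + r.rdeg)) + 1)
        (M.μ W Z (q.append (cons a r)) k (k + (q.rdeg + (n - 1 + r.rdeg)) + 1) m) := by
      constructor
      · intro a a'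
        have := (M.μ_multilinear k (k + (q.rdeg + (n - 1 + r.rdeg)) + 1)).map_add q a a' r
        rw [this, LinearMap.add_apply, map_add]
      · intro c a
        have := (M.μ_multilinear k (k + (q.rdeg + (n - 1 + r.rdeg)) + 1)).map_smul q c a r
        rw [this, LinearMap.smul_apply, of_smul]
    refine h.congr fun a => ?_
    rw [bmu_of, rdeg_append, rdeg_cons]

theorem IsMulti.at {u : BHom M N} (hu : IsMulti u) {W X Y Z : A.Ob} (n : ℤ) (q : A.Ch Y Z)
    (r : A.Ch W X) (x : M.T Z) :
    IsRLin R B (fun a : A.Hom X Y n => u W Z (q.append (cons a r)) x) :=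
  ((hu W Z).lin n q r).comp_add (AddMonoidHom.eval x) fun _ _ => rfl

theorem isMulti_of' {u : BHom M N}
    (h : ∀ {W X Y Z : A.Ob} (n : ℤ) (q : A.Ch Y Z) (r : A.Ch W X) (x : M.T Z),
      IsRLin R B (fun a : A.Hom X Y n => u W Z (q.append (cons a r)) x)) :
    IsMulti u := fun _ _ => isMul_iff.mpr fun n q r =>
  ⟨fun a a' => AddMonoidHom.ext fun x => (h n q r x).add a a',
    fun c a => AddMonoidHom.ext fun x => (h n q r x).smul c a⟩

theorem IsMulti.star_of {v : BHom M N} {u : BHom L M} (hv : IsMulti v)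
    (hl : ∀ X Y (p : A.Ch X Y) (c : R) x,
      v X Y p (algebraMap R B c • x) = algebraMap R B c • v X Y p x)
    (hu : IsMulti u) : IsMulti (star v u) := isMulti_of' fun {W X Y Z} n q r x => by
  have h : IsRLin R B fun a : A.Hom X Y n =>
      sp q (fun S => v W S.mid (S.right.append (cons a r)) (u S.mid Z S.left x)) +
      sp r (fun S => v W S.mid S.right (u S.mid Z (q.append (cons a S.left)) x)) :=
    (IsRLin.sp _ fun S => hv.at n _ _ _).add'
      (IsRLin.sp _ fun S => (hu.at n _ _ x).comp_add _ fun c y => hl _ _ _ _ _)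
  refine h.congr fun a => ?_
  rw [AInf.star, sp_append_cons, AddMonoidHom.add_apply, sp_apply, sp_apply]
  rfl

theorem IsMulti.star {v : BHom M N} {u : BHom L M} (hv : IsMulti v) (hl : IsBLin v)
    (hu : IsMulti u) : IsMulti (star v u) := hv.star_of (fun X Y p _ x => hl X Y p _ x) hu

theorem IsMulti.eps {u : BHom M N} (hu : IsMulti u) : IsMulti (eps u) :=
  isMulti_of' fun {W X Y Z} n q r x => by
    refine ((hu.at n q r x).sign (q.rdeg + (n - 1 + r.rdeg))).congr fun a => ?_
    simp [AInf.eps]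

theorem IsMulti.tau {u : BHom M N} (hu : IsMulti u) : IsMulti (tau u) :=
  isMulti_of' fun {W X Y Z} n q r x => by
    refine ((hu.at n q r (sgn M Z x)).sign (q.rdeg + (n - 1 + r.rdeg))).congr fun a => ?_
    simp [AInf.tau]

theorem IsMulti.add {u v : BHom M N} (hu : IsMulti u) (hv : IsMulti v) : IsMulti (u + v) :=
  isMulti_of' fun n q r x => (hu.at n q r x).add' (hv.at n q r x)

theorem IsMulti.neg {u : BHom M N} (hu : IsMulti u) : IsMulti (-u) :=
  isMulti_of' fun n q r x => (hu.at n q r x).neg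

theorem IsMulti.sub {u v : BHom M N} (hu : IsMulti u) (hv : IsMulti v) : IsMulti (u - v) :=
  isMulti_of' fun n q r x => (hu.at n q r x).sub (hv.at n q r x)

theorem IsMulti.smul {u : BHom M N} (hu : IsMulti u) (b : B) : IsMulti (b • u) :=
  isMulti_of' fun n q r x => (hu.at n q r x).bsmul b

theorem IsMulti.IB {u : BHom M N} (hu : IsMulti u) : IsMulti (IB u) := fun X Y => isMul_aI (hu X Y)

theorem IsMulti.bL {u : BHom M N} (hu : IsMulti u) (hl : IsBLin u) : IsMulti (bL u) :=
  (((isMulti_bmu N).star (isBLin_bmu N) hu).sub (hu.eps.star (fun X Y p f x => by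
    simp [AInf.eps, hl X Y p f x, Units.smul_def, smul_comm f]) (isMulti_bmu M))).sub hu.IB

theorem IsBLin.add {u v : BHom M N} (hu : IsBLin u) (hv : IsBLin v) : IsBLin (u + v) := by
  intro X Y p f x
  simp only [Pi.add_apply, AddMonoidHom.add_apply, hu X Y p f x, hv X Y p f x, smul_add]

theorem IsBLin.neg {u : BHom M N} (hu : IsBLin u) : IsBLin (-u) := by
  intro X Y p f x
  simp only [Pi.neg_apply, AddMonoidHom.neg_apply, hu X Y p f x, smul_neg]

theorem IsBLin.sub {u v : BHom M N} (hu : IsBLin u) (hv : IsBLin v) : IsBLin (u - v) :=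
  sub_eq_add_neg u v ▸ hu.add hv.neg

theorem IsBLin.smul {u : BHom M N} (hu : IsBLin u) (b : B) : IsBLin (b • u) := by
  intro X Y p f x
  simp only [Pi.smul_apply, AddMonoidHom.smul_apply, hu X Y p f x, smul_comm b]

theorem IsBLin.star {v : BHom M N} {u : BHom L M} (hv : IsBLin v) (hu : IsBLin u) :
    IsBLin (star v u) := by
  intro X Y p f x
  simp only [AInf.star, sp_apply, AddMonoidHom.comp_apply, hu _ _ _ f, hv _ _ _ f, sp_smul]

theorem IsBLin.eps {u : BHom M N} (hu : IsBLin u) : IsBLin (eps u) := by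
  intro X Y p f x
  simp [AInf.eps, hu X Y p f x, Units.smul_def, smul_comm f]

theorem sgn_smul (Y : A.Ob) (f : B) (x : M.T Y) : sgn M Y (f • x) = f • sgn M Y x := by
  induction x using DirectSum.induction_on with
  | zero => simp
  | of k m =>
    have h : f • DirectSum.of (fun k => M.M Y k) k m = M.of k (f • m) := (of_smul k f m).symm
    rw [h, sgn_of, of_smul]
    refine Eq.trans ?_ (congrArg (f • ·) (sgn_of Y k m).symm)
    simp [Units.smul_def, smul_comm f]
  | add x y hx hy => rw [smul_add, map_add, hx, hy, map_add, smul_add]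

theorem IsBLin.tau {u : BHom M N} (hu : IsBLin u) : IsBLin (tau u) := by
  intro X Y p f x
  simp [AInf.tau, sgn_smul, hu X Y p f _, Units.smul_def, smul_comm f]

theorem IsBLin.IB {u : BHom M N} (hu : IsBLin u) : IsBLin (IB u) := by
  intro X Y p f x
  rw [AInf.IB, aI, sp3_apply, sp3_apply, sp3, sp3, ← sp_smul]
  refine sp_congr fun S _ => ?_
  rw [← sp_smul]
  refine sp_congr fun T _ => ?_
  simp [hu X Y _ f, Units.smul_def, smul_comm f]

theorem IsBLin.bL {u : BHom M N} (hu : IsBLin u) : IsBLin (bL u) :=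
  (((isBLin_bmu N).star hu).sub (hu.eps.star (isBLin_bmu M))).sub hu.IB

theorem isRed_tau {u : BHom M N} (hu : IsRed u) : IsRed (tau u) := by
  intro W X Z q r
  simp [AInf.tau, hu W X Z q r]

theorem IsRed.star {v : BHom M N} {u : BHom L M} (hv : IsRed v) (hu : IsRed u) :
    IsRed (star v u) := by
  intro W X Z q r
  simp [AInf.star, sp_append_cons, hv _ _ _ _ _, hu _ _ _ _ _]

theorem nil_or_snoc {X Y : A.Ob} (q : A.Ch X Y) : (∃ h : Y = X, q = h ▸ nil Y) ∨
    ∃ (Z : A.Ob) (n : ℤ) (a : A.Hom X Z n) (q' : A.Ch Z Y), q = q'.append (cons a (nil X)) := by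
  induction q with
  | nil => exact Or.inl ⟨rfl, rfl⟩
  | cons a p ih =>
    right
    rcases ih with ⟨h, h'⟩ | ⟨Z, n, b, q', rfl⟩
    · subst h
      subst h'
      exact ⟨_, _, a, nil _, rfl⟩
    · exact ⟨Z, n, b, cons a q', rfl⟩

theorem mu_unit_eq_zero {W X Z : A.Ob} (q : A.Ch X Z) (r : A.Ch W X) (h : q.length + r.length ≠ 1)
    (e : ℤ) : A.μ W Z (q.append (cons (A.one X) r)) e = 0 := A.one_vanish W X Z q r h e

theorem length_eq_zero {X Y : A.Ob} {p : A.Ch X Y} (h : p.length = 0) :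
    ∃ h : Y = X, p = h ▸ nil Y := by
  cases p with
  | nil => exact ⟨rfl, rfl⟩
  | cons a p => simp at h

/-- Sums over splittings only involving the first decomposition. -/
theorem sp_first {V : Type*} [AddCommGroup V] {X Y : A.Ob} (p : A.Ch X Y)
    (f : Split A.Hom X Y → V) (h : ∀ S, S.left.length ≠ 0 → f S = 0) :
    sp p f = f ⟨Y, nil Y, p⟩ := by
  cases p with
  | nil => simp
  | cons a p =>
    rw [sp_cons, sp_congr (g := fun _ => 0) fun S _ => h _ (by simp), sp_zero, add_zero]

theorem sp_last {V : Type*} [AddCommGroup V] {X Y : A.Ob} (p : A.Ch X Y)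
    (f : Split A.Hom X Y → V) (h : ∀ S, S.right.length ≠ 0 → f S = 0) :
    sp p f = f ⟨X, p, nil X⟩ := by
  rcases nil_or_snoc p with ⟨rfl, rfl⟩ | ⟨Z, n, a, q, rfl⟩
  · simp
  · rw [sp_append_cons, sp_congr (g := fun _ => 0) fun S _ => h _ (by simp), sp_zero, zero_add]
    simp

theorem insert_unit_left {V : Type*} [AddCommGroup V] {W X Y Z : A.Ob} {φ : A.Ch W Z → V}
    (hφ : IsAdditive φ) (q : A.Ch Y Z) {n d : ℤ} (a : A.Hom X Y n) (r : A.Ch W X) (hd : d = n) :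
    φ (q.append (cons (A.μ X Y (cons (A.one Y) (cons a (nil X))) d) r)) =
      n.negOnePow • φ (q.append (cons a r)) := by
  subst hd
  have h := congrArg (hφ.at d q r) (A.one_left X Y d a)
  rw [Units.smul_def, map_zsmul] at h
  have h' := congrArg (d.negOnePow • ·) h
  simp only [← Units.smul_def, sign_smul_smul, Int.negOnePow_even _ ⟨_, rfl⟩, one_smul] at h'
  exact h'

theorem insert_unit_right {V : Type*} [AddCommGroup V] {W X Y Z : A.Ob} {φ : A.Ch W Z → V}
    (q : A.Ch Y Z) {n d : ℤ} (a : A.Hom X Y n) (r : A.Ch W X) (hd : d = n) :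
    φ (q.append (cons (A.μ X Y (cons a (cons (A.one X) (nil X))) d) r)) =
      φ (q.append (cons a r)) := by
  subst hd
  rw [A.one_right]

theorem insert_unit_zero {V : Type*} [AddCommGroup V] {W X Y Y' Z : A.Ob} {φ : A.Ch W Z → V}
    (hφ : IsAdditive φ) (q : A.Ch Y' Z) (q' : A.Ch X Y') (r' : A.Ch Y X) (r : A.Ch W Y) (d : ℤ)
    (h : q'.length + r'.length ≠ 1) :
    φ (q.append (cons (A.μ Y Y' (q'.append (cons (A.one X) r')) d) r)) = 0 := by
  rw [mu_unit_eq_zero q' r' h]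
  exact hφ.map_zero d q r

/-- The insertions of the `A_∞`-operations which involve a given unit and no entry to its left. -/
theorem sp_insert_unit {V : Type*} [AddCommGroup V] {W X Z : A.Ob} {φ : A.Ch W Z → V}
    (hφ : IsAdditive φ) (q : A.Ch X Z) (r : A.Ch W X) :
    sp r (fun T => T.right.rdeg.negOnePow • φ (q.append (cons (A.μ _ _ (cons (A.one X) T.left)
      ((cons (A.one X) T.left).rdeg + 2)) T.right))) =
    - (if r.length = 0 then 0 else r.rdeg.negOnePow • φ (q.append r)) := by
  cases r with
  | nil =>
    simpa using insert_unit_zero hφ q (nil _) (nil _) (nil _) ((-1) + 2) (by simp)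
  | cons a r =>
    have h₀ := insert_unit_zero hφ q (nil _) (nil _) (cons a r)
      ((cons (A.one X) (nil _)).rdeg + 2) (by simp)
    rw [nil_append] at h₀
    rw [sp_cons, h₀, smul_zero, zero_add, sp_first]
    · rw [insert_unit_left hφ _ a _ (by simp; ring)]
      simp only [length_cons, Nat.add_eq_zero_iff, one_ne_zero, and_false, if_false,
        sign_smul_smul, rdeg_cons]
      exact sign_neg (by grind) _
    · intro S hS
      have h₁ := insert_unit_zero hφ q (nil _) (cons a S.left) S.right
        ((cons (A.one X) (cons a S.left)).rdeg + 2) (by simpa using hS)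
      rw [nil_append] at h₁
      rw [h₁, smul_zero]

theorem IsRed.IB {u : BHom M N} (hu : IsRed u) (ha : IsMulti u) {W X Z : A.Ob} (q : A.Ch X Z)
    (r : A.Ch W X) :
    IB u W Z (q.append (cons (A.one X) r)) =
      (if q.length = 0 then 0 else r.rdeg.negOnePow • u W Z (q.append r)) -
      (if r.length = 0 then 0 else r.rdeg.negOnePow • u W Z (q.append r)) := by
  have hφ : IsAdditive (u W Z) := (ha W Z).add
  rw [AInf.IB, aI_apply_insert]
  have e₁ : sp3 q (fun l m l' => (l'.append (cons (A.one X) r)).rdeg.negOnePow •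
      u W Z ((l.append (cons (A.μ _ _ m (m.rdeg + 2)) l')).append (cons (A.one X) r))) = 0 := by
    simp [sp3, hu _ _ _ _ _]
  have e₂ : sp3 r (fun l m l' => l'.rdeg.negOnePow •
      u W Z (q.append (cons (A.one X) (l.append (cons (A.μ _ _ m (m.rdeg + 2)) l'))))) = 0 := by
    simp [sp3, hu _ _ _ _ _]
  rw [e₁, e₂, zero_add, add_zero, sub_eq_add_neg, ← sp_insert_unit hφ q r]
  rcases nil_or_snoc q with ⟨rfl, rfl⟩ | ⟨Y, n, b, q, rfl⟩
  · simp
  · rw [sp_append_cons, sp_nil]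
    refine congrArg₂ (· + ·) ?_ ?_
    · rw [sp_last]
      · rw [sp_first]
        · rw [if_neg (by simp), append_assoc q (cons b (nil X)) r, cons_append, nil_append]
          have hd : (cons b (cons (A.one X) (nil X))).rdeg + 2 = n := by
            simp only [rdeg_cons, rdeg_nil]; ring
          exact congrArg (r.rdeg.negOnePow • ·) (insert_unit_right (φ := u W Z) q b r hd)
        · intro S hS
          exact (congrArg _ (insert_unit_zero hφ q (cons b (nil _)) S.left S.right _
            (by simpa using hS))).trans (smul_zero _)
      · intro S hS
        refine (sp_congr fun T _ => ?_).trans (sp_zero r)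
        exact (congrArg _ (insert_unit_zero hφ S.left (S.right.append (cons b (nil _))) T.left
          T.right _ (by simp; omega))).trans (smul_zero _)
    · simp

theorem rdeg_eq_zero {X Y : A.Ob} {p : A.Ch X Y} (h : p.length = 0) : p.rdeg = 0 := by
  cases p with
  | nil => rfl
  | cons a p => simp at h

theorem IsRed.bL {u : BHom M N} (hu : IsRed u) (ha : IsMulti u) (hM : IsUMod M) (hN : IsUMod N) :
    IsRed (bL u) := by
  intro W X Z q r
  have h₁ : AInf.star (bmu N) u W Z (q.append (cons (A.one X) r)) =
      if r.length = 0 then u W Z (q.append r) else 0 := by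
    rw [AInf.star, sp_append_cons, sp_congr (p := r) (g := fun _ => 0) fun S _ => by
      rw [hu _ _ _ _ _, AddMonoidHom.comp_zero], sp_zero, add_zero]
    split_ifs with hr
    · obtain ⟨rfl, rfl⟩ := length_eq_zero hr
      rw [sp_last]
      · rw [append_nil]
        exact AddMonoidHom.ext fun x => DFunLike.congr_fun (hN.unit _) _
      · intro S hS
        rw [hN.unit_vanish _ _ _ _ _ (by simpa using hS), AddMonoidHom.zero_comp]
    · refine (sp_congr fun S _ => ?_).trans (sp_zero q)
      rw [hN.unit_vanish _ _ _ _ _ (by omega), AddMonoidHom.zero_comp]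
  have h₂ : AInf.star (AInf.eps u) (bmu M) W Z (q.append (cons (A.one X) r)) =
      if q.length = 0 then r.rdeg.negOnePow • u W Z (q.append r) else 0 := by
    rw [AInf.star, sp_append_cons, sp_congr (p := q) (g := fun _ => 0) fun S _ => by
      rw [AInf.eps, hu _ _ _ _ _, smul_zero, AddMonoidHom.zero_comp], sp_zero, zero_add]
    split_ifs with hq
    · obtain ⟨rfl, rfl⟩ := length_eq_zero hq
      rw [sp_first]
      · refine AddMonoidHom.ext fun x => ?_
        exact congrArg (AInf.eps u W _ r) (DFunLike.congr_fun (hM.unit _) x)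
      · intro S hS
        rw [hM.unit_vanish _ _ _ _ _ (by simpa using hS), AddMonoidHom.comp_zero]
    · refine (sp_congr fun S _ => ?_).trans (sp_zero r)
      rw [hM.unit_vanish _ _ _ _ _ (by omega), AddMonoidHom.comp_zero]
  simp only [AInf.bL, Pi.sub_apply, h₁, h₂, hu.IB ha]
  split_ifs with h h' h'
  · simp [rdeg_eq_zero h]
  · simp [rdeg_eq_zero h]
  · simp
  · simp

theorem IsHom.bd {g : ℤ} {u : BHom M N} (hu : IsHom g u) (hM : IsUMod M) (hN : IsUMod N) :
    IsHom (g + 1) (bd u) where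
  deg := hu.deg.bd
  lin := hu.lin.bL.tau
  mul := (hu.mul.bL hu.lin).tau
  red := isRed_tau (hu.red.bL hu.mul hM hN)

theorem IsHom.star {g h : ℤ} {v : BHom M N} {u : BHom L M} (hv : IsHom g v) (hu : IsHom h u) :
    IsHom (g + h) (star v u) where
  deg := hv.deg.star hu.deg
  lin := hv.lin.star hu.lin
  mul := hv.mul.star hv.lin hu.mul
  red := hv.red.star hu.red

theorem isHom_bone (M : ModData A.toCatData B) : IsHom 0 (bone M) where
  deg := isDeg_bone M
  lin := by
    intro X Y p f x
    cases p with
    | nil => rfl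
    | cons a p => simp [bone]
  mul := isMulti_of' fun n q r x => by
    cases q with
    | nil => simpa [bone] using IsRLin.zero
    | cons a q => simpa [bone] using IsRLin.zero
  red := by
    intro W X Z q r
    cases q with
    | nil => rfl
    | cons a q => rfl

theorem IsHom.add {g : ℤ} {u v : BHom M N} (hu : IsHom g u) (hv : IsHom g v) :
    IsHom g (u + v) where
  deg := hu.deg.add hv.deg
  lin := hu.lin.add hv.lin
  mul := hu.mul.add hv.mul
  red := fun W X Z q r => by simp [hu.red W X Z q r, hv.red W X Z q r]

theorem IsHom.smul {g : ℤ} {u : BHom M N} (hu : IsHom g u) (b : B) : IsHom g (b • u) where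
  deg := fun X Y p k m e he =>
    (congrArg (b • ·) (hu.deg X Y p k m e he)).trans (smul_zero _)
  lin := hu.lin.smul b
  mul := hu.mul.smul b
  red := fun W X Z q r => by simp [hu.red W X Z q r]

theorem isHom_zero (g : ℤ) : IsHom g (0 : BHom M N) where
  deg := fun X Y p k m e he => rfl
  lin := fun X Y p f x => by simp
  mul := isMulti_of' fun n q r x => IsRLin.zero
  red := fun W X Z q r => rfl

/-- The morphisms of degree `g`, as a submodule. -/
def HomB (M N : ModData A.toCatData B) (g : ℤ) : Submodule B (BHom M N) where
  carrier := {u | IsHom g u}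
  add_mem' := IsHom.add
  zero_mem' := isHom_zero g
  smul_mem' := fun b _ hu => hu.smul b

theorem bmu_star_smul (b : B) (u : BHom L M) : star (bmu M) (b • u) = b • star (bmu M) u := by
  funext X Y p
  refine AddMonoidHom.ext fun x => ?_
  simp only [star, sp_apply, Pi.smul_apply, AddMonoidHom.smul_apply, AddMonoidHom.comp_apply,
    isBLin_bmu M _ _ _ b, sp_smul]

theorem bL_smul (b : B) (u : BHom M N) : bL (b • u) = b • bL u := by
  have h₁ : eps (b • u) = b • eps u := by
    funext X Y p
    simp [eps, Units.smul_def, smul_comm b]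
  have h₂ : IB (b • u) = b • IB u := by
    funext X Y p
    exact congrFun (aI_comp (DistribSMul.toAddMonoidHom _ b) (u X Y)) p
  rw [bL, bL, bmu_star_smul, h₁, smul_star, h₂, smul_sub, smul_sub]

theorem bL_add (u v : BHom M N) : bL (u + v) = bL u + bL v := by
  simp only [bL, star_add, eps_add, add_star, IB_add]
  abel

/-- The differential as a linear map. -/
def bdₗ (M N : ModData A.toCatData B) : BHom M N →ₗ[B] BHom M N where
  toFun := bd
  map_add' u v := by rw [bd, bL_add, tau_add]; rfl
  map_smul' b u := by rw [bd, bL_smul, tau_smul]; rfl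

theorem bd_sub (u v : BHom M N) : bd (u - v) = bd u - bd v := (bdₗ M N).map_sub u v

theorem bd_smul (b : B) (u : BHom M N) : bd (b • u) = b • bd u := (bdₗ M N).map_smul b u

/-! ### Comparison with the definitions in terms of components -/

/-- The sequence of maps on total spaces determined by a sequence of maps of degree `g`. The sign
turns compositions into compositions without signs. -/
def toB (g : ℤ) (t : Raw M N) : BHom M N := fun X Y p => DirectSum.toAddMonoid fun k =>
  (k + p.rdeg).negOnePow • (N.of (k + p.rdeg + g)).comp (t X Y p k (k + p.rdeg + g))

/-- The components of a sequence of maps on total spaces. -/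
def ofB (u : BHom M N) : Raw M N := fun X Y p k e => (k + p.rdeg).negOnePow •
  (DFinsupp.evalAddMonoidHom (β := fun e => N.M X e) e).comp ((u X Y p).comp (M.of k))

theorem toB_of (g : ℤ) (t : Raw M N) {X Y : A.Ob} (p : A.Ch X Y) (k : ℤ) (m : M.M Y k) :
    toB g t X Y p (M.of k m) =
      (k + p.rdeg).negOnePow • N.of (k + p.rdeg + g) (t X Y p k (k + p.rdeg + g) m) := by
  simp [toB, ModData.of]

theorem ofB_apply (u : BHom M N) {X Y : A.Ob} (p : A.Ch X Y) (k e : ℤ) (m : M.M Y k) :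
    ofB u X Y p k e m = (k + p.rdeg).negOnePow • (u X Y p (M.of k m)) e := rfl

theorem of_eval (X : A.Ob) (d : ℤ) (m : M.M X d) : (M.of d m) d = m :=
  DirectSum.of_eq_same d m

theorem smul_eval {X : A.Ob} (n : ℤ) (x : M.T X) (e : ℤ) :
    (n.negOnePow • x) e = n.negOnePow • x e :=
  map_zsmul (DFinsupp.evalAddMonoidHom (β := fun e => M.M X e) e) _ x

theorem toB_ofB {g : ℤ} {u : BHom M N} (hu : IsDeg g u) : toB g (ofB u) = u := by
  refine bhom_ext fun X Y p k m => ?_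
  rw [toB_of, ofB_apply, hu.eq_of, of_eval, Units.smul_def _ ((u X Y p _) _), map_zsmul,
    ← Units.smul_def, sign_smul_smul, Int.negOnePow_even _ ⟨_, rfl⟩, one_smul]

theorem ofB_toB {g : ℤ} {t : Raw M N}
    (ht : ∀ X Y (p : A.Ch X Y) k e, e ≠ k + p.rdeg + g → t X Y p k e = 0) :
    ofB (toB g t) = t := by
  funext X Y p k e
  refine AddMonoidHom.ext fun m => ?_
  rw [ofB_apply, toB_of, smul_eval, sign_smul_smul, Int.negOnePow_even _ ⟨_, rfl⟩, one_smul]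
  by_cases he : e = k + p.rdeg + g
  · subst he
    exact of_eval _ _ _
  · rw [ht X Y p k e he]
    exact of_apply_ne _ he

theorem isDeg_toB (g : ℤ) (t : Raw M N) : IsDeg g (toB g t) := by
  intro X Y p k m e he
  rw [toB_of, smul_eval, of_apply_ne _ he, smul_zero]

theorem isMulti_toB (g : ℤ) {t : Raw M N} (ht : IsMultilinear R B t) : IsMulti (toB g t) :=
  isMulti_of fun {W X Y Z} n q r k m => by
    have h : IsRLin R B fun a : A.Hom X Y n => N.of (k + (q.rdeg + (n - 1 + r.rdeg)) + g)
        (t W Z (q.append (cons a r)) k (k + (q.rdeg + (n - 1 + r.rdeg)) + g) m) := by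
      constructor
      · intro a a'
        have := ht.map_add q a a' r
        rw [this, ← map_add]
        rfl
      · intro c a
        have := ht.map_smul q c a r
        rw [this, ← of_smul]
        rfl
    refine (h.sign (k + (q.rdeg + (n - 1 + r.rdeg)))).congr fun a => ?_
    rw [toB_of, rdeg_append, rdeg_cons]

theorem isRed_toB (g : ℤ) {t : Raw M N} (ht : ∀ W X Z (q : A.Ch X Z) (r : A.Ch W X),
    t W Z (q.append (cons (A.one X) r)) = 0) : IsRed (toB g t) :=
  fun W X Z q r => DirectSum.addHom_ext fun k m => by
    refine (toB_of g t _ k m).trans ?_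
    have h : t W Z (q.append (cons (A.one X) r)) = 0 := ht W X Z q r
    rw [h]
    simp

theorem isHom_toB {g : ℤ} {t : Raw M N} (ht : t ∈ PreHom M N g) : IsHom g (toB g t) where
  deg := isDeg_toB g t
  lin := blin_of fun X Y p f k m => by
    rw [toB_of, toB_of, ht.2.1, of_smul, Units.smul_def, smul_comm, ← Units.smul_def]
  mul := isMulti_toB g ht.2.2.1
  red := isRed_toB g ht.2.2.2

theorem ofB_mem {g : ℤ} {u : BHom M N} (hu : IsHom g u) : ofB u ∈ PreHom M N g := by
  refine ⟨?_, ?_, ⟨?_, ?_⟩, ?_⟩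
  · intro X Y p k e he
    refine AddMonoidHom.ext fun m => ?_
    rw [ofB_apply, hu.deg X Y p k m e he, smul_zero]
    rfl
  · intro X Y p k e f m
    rw [ofB_apply, ofB_apply, of_smul, hu.lin, Units.smul_def, Units.smul_def, smul_comm f]
    rfl
  · intro W X Y Z n q a a' r
    funext k e
    refine AddMonoidHom.ext fun m => ?_
    change ofB u _ _ _ k e m = ofB u _ _ _ k e m + ofB u _ _ _ k e m
    simp only [ofB_apply, rdeg_append, rdeg_cons]
    rw [(hu.mul.at n q r _).add, ← smul_add]
    rfl
  · intro W X Y Z n q c a r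
    funext k e
    refine AddMonoidHom.ext fun m => ?_
    change ofB u _ _ _ k e m = algebraMap R B c • ofB u _ _ _ k e m
    simp only [ofB_apply, rdeg_append, rdeg_cons]
    rw [(hu.mul.at n q r _).smul, Units.smul_def, Units.smul_def, smul_comm (algebraMap R B c)]
    rfl
  · intro W X Z q r
    funext k e
    refine AddMonoidHom.ext fun m => ?_
    rw [ofB_apply, hu.red]
    exact smul_zero _

theorem toB_add (g : ℤ) (s t : Raw M N) : toB g (s + t) = toB g s + toB g t := by
  refine bhom_ext fun X Y p k m => ?_
  simp only [Pi.add_apply, AddMonoidHom.add_apply, toB_of, map_add, smul_add]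

theorem toB_smul (g : ℤ) (b : B) (t : Raw M N) : toB g (b • t) = b • toB g t := by
  refine bhom_ext fun X Y p k m => ?_
  simp only [Pi.smul_apply, AddMonoidHom.smul_apply, toB_of]
  rw [of_smul, Units.smul_def, Units.smul_def, smul_comm b]

theorem toB_sub (g : ℤ) (s t : Raw M N) : toB g (s - t) = toB g s - toB g t :=
  (AddMonoidHom.mk' (toB g) (toB_add g)).map_sub s t

theorem toB_zero (g : ℤ) : toB g (0 : Raw M N) = 0 :=
  (AddMonoidHom.mk' (toB (M := M) (N := N) g) (toB_add g)).map_zero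

theorem toB_diff (g : ℤ) (t : Raw M N) : toB (g + 1) (diff M N g t) = bd (toB g t) := by
  refine bhom_ext fun X Y p k m => ?_
  rw [toB_of]
  change (k + p.rdeg).negOnePow • N.of _ (diffFun M N g t X Y p k (k + p.rdeg + (g + 1)) m) = _
  have h : tau (bL (toB g t)) X Y p (M.of k m) =
      (k + p.rdeg).negOnePow • bL (toB g t) X Y p (M.of k m) := by
    rw [tau, AddMonoidHom.smul_apply, AddMonoidHom.comp_apply, sgn_of, Units.smul_def k.negOnePow,
      map_zsmul, ← Units.smul_def, sign_smul_smul, add_comm]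
  rw [bd, h]
  congr 1
  have e₁ : star (bmu N) (toB g t) X Y p (M.of k m) = sp p fun S => (k + S.left.rdeg).negOnePow •
      N.of (k + p.rdeg + (g + 1)) (N.μ _ _ S.right _ (k + p.rdeg + (g + 1))
        (t _ _ S.left k (k + S.left.rdeg + g) m)) := by
    rw [star, sp_apply]
    refine sp_congr fun S hS => ?_
    rw [AddMonoidHom.comp_apply, toB_of, Units.smul_def, map_zsmul, ← Units.smul_def, bmu_of]
    congr 1
    refine of_congr ?_ fun e => N.μ _ _ S.right _ e (t _ _ S.left k (k + S.left.rdeg + g) m)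
    rw [← hS, rdeg_append]
    ring
  have e₂ : star (eps (toB g t)) (bmu M) X Y p (M.of k m) =
      - sp p fun S => (k + S.left.rdeg).negOnePow • N.of (k + p.rdeg + (g + 1))
        (t _ _ S.right _ (k + p.rdeg + (g + 1)) (M.μ _ _ S.left k (k + S.left.rdeg + 1) m)) := by
    rw [star, sp_apply, ← sp_neg]
    refine sp_congr fun S hS => ?_
    rw [AddMonoidHom.comp_apply, bmu_of, eps, AddMonoidHom.smul_apply, toB_of, sign_smul_smul,
      of_congr (d' := k + p.rdeg + (g + 1)) ?_
        fun e => t _ _ S.right _ e (M.μ _ _ S.left k (k + S.left.rdeg + 1) m)]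
    · exact sign_neg (by grind) _
    · rw [← hS, rdeg_append]
      ring
  have e₃ : IB (toB g t) X Y p (M.of k m) =
      - sp3 p fun l m' r => (k + l.rdeg + m'.rdeg).negOnePow • N.of (k + p.rdeg + (g + 1))
        (t X Y (l.append (cons (A.μ _ _ m' (m'.rdeg + 2)) r)) k (k + p.rdeg + (g + 1)) m) := by
    rw [IB, aI, sp3_apply, sp3, sp3, ← sp_neg]
    refine sp_congr fun S hS => ?_
    rw [← sp_neg]
    refine sp_congr fun T hT => ?_
    rw [AddMonoidHom.smul_apply, toB_of, sign_smul_smul,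
      of_congr (d' := k + p.rdeg + (g + 1)) ?_
        fun e => t X Y (S.left.append (cons (A.μ _ _ T.left (T.left.rdeg + 2)) T.right)) k e m]
    · refine sign_neg ?_ _
      simp only [rdeg_append, rdeg_cons]
      grind
    · rw [rdeg_insert, hT, hS]
      ring
  simp only [bL, Pi.sub_apply, AddMonoidHom.sub_apply, e₁, e₂, e₃, sub_neg_eq_add]
  rw [diffFun, map_add, map_add]
  refine congrArg₂ (· + ·) (congrArg₂ (· + ·) ?_ ?_) ?_
  · refine (map_sp (N.of _) p _).trans (sp_congr fun S _ => ?_)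
    simp only [Units.smul_def, map_zsmul]
  · refine (map_sp (N.of _) p _).trans (sp_congr fun S _ => ?_)
    simp only [Units.smul_def, map_zsmul]
  · refine (map_sp (N.of _) p _).trans (sp_congr fun S _ => ?_)
    refine (map_sp (N.of _) S.right _).trans (sp_congr fun T _ => ?_)
    simp only [Units.smul_def, map_zsmul]

theorem toB_comp (g : ℤ) (t₂ : Raw M N) (t₁ : Raw L M) :
    toB g (comp t₂ t₁) = star (toB g t₂) (toB 0 t₁) := by
  refine bhom_ext fun X Y p k m => ?_
  rw [toB_of, star, sp_apply, comp]
  have h : (sp p fun S => (k + S.left.rdeg).negOnePow •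
      (t₂ _ _ S.right (k + S.left.rdeg) (k + p.rdeg + g)).comp
        (t₁ _ _ S.left k (k + S.left.rdeg))) m = sp p fun S => (k + S.left.rdeg).negOnePow •
      (t₂ _ _ S.right (k + S.left.rdeg) (k + p.rdeg + g)
        (t₁ _ _ S.left k (k + S.left.rdeg) m)) := sp_apply p _ m
  refine (congrArg (fun x => (k + p.rdeg).negOnePow • N.of (k + p.rdeg + g) x) h).trans ?_
  rw [map_sp, ← sp_smul]
  refine sp_congr fun S hS => ?_
  have e₁ : toB 0 t₁ S.mid Y S.left (L.of k m) = (k + S.left.rdeg).negOnePow •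
      M.of (k + S.left.rdeg) (t₁ _ _ S.left k (k + S.left.rdeg) m) := by
    rw [toB_of]
    exact congrArg _ (of_congr (add_zero _) fun e => t₁ _ _ S.left k e m)
  have e₂ : N.of (k + S.left.rdeg + S.right.rdeg + g) (t₂ _ _ S.right (k + S.left.rdeg)
      (k + S.left.rdeg + S.right.rdeg + g) (t₁ _ _ S.left k (k + S.left.rdeg) m)) =
      N.of (k + p.rdeg + g) (t₂ _ _ S.right (k + S.left.rdeg)
      (k + p.rdeg + g) (t₁ _ _ S.left k (k + S.left.rdeg) m)) := by
    refine of_congr ?_ fun e => t₂ _ _ S.right (k + S.left.rdeg) e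
      (t₁ _ _ S.left k (k + S.left.rdeg) m)
    rw [← hS, rdeg_append]
    ring
  rw [AddMonoidHom.comp_apply, e₁, Units.smul_def, Units.smul_def, Units.smul_def, map_zsmul,
    map_zsmul, toB_of, e₂, ← Units.smul_def, ← Units.smul_def, ← Units.smul_def, sign_smul_smul,
    sign_smul_smul]
  refine sign_congr ?_ _
  rw [← hS, rdeg_append]
  grind

theorem toB_idHom (M : ModData A.toCatData B) : toB 0 (idHom M) = bone M := by
  refine bhom_ext fun X Y p k m => ?_
  rw [toB_of]
  cases p with
  | nil =>
    rw [rdeg_nil, of_congr (d' := k) (by simp) fun e => idHom M _ _ (nil _) k e m]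
    have h : idHom M X X (nil X) k k m = k.negOnePow • m := by
      simp [idHom, oneAt]
    rw [h, Units.smul_def, Units.smul_def, map_zsmul, ← Units.smul_def, ← Units.smul_def,
      sign_smul_smul, Int.negOnePow_even _ (by simp), one_smul]
    rfl
  | cons a p =>
    have h : idHom M _ _ (cons a p) k (k + (cons a p).rdeg + 0) m = 0 := rfl
    rw [h, map_zero, smul_zero]
    rfl

end Bar
end AInf

namespace AInf
open Chain

section Bar

variable {R : Type u} [Field R] {A : Category R} {B : Type u} [CommRing B] [Algebra R B]
variable {K L M N : ModData A.toCatData B}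

/-! ### Connections, and the derivations they induce -/

section Insertion

variable (G : DefField A.toCatData B) (ξ : Ω[B⁄R] →ₗ[B] B)

theorem IsMul.map_ins {V V' : Type*} [AddCommGroup V] [Module B V] [AddCommGroup V'] [Module B V']
    {X Y : A.Ob} {φ : A.Ch X Y → V} {ψ : A.Ch X Y → V'} (hφ : IsMul B φ) (hψ : IsMul B ψ)
    (h : V →+ V') (hB : ∀ (b : B) v, h (b • v) = b • h v) {W Z : A.Ob} (n : ℤ) (q : A.Ch Z Y)
    (r : A.Ch X W) (H : ∀ a : A.Hom W Z n, ψ (q.append (cons a r)) = h (φ (q.append (cons a r))))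
    (w : Ω[B⁄R] ⊗[R] A.Hom W Z n) : hψ.ins ξ n q r w = h (hφ.ins ξ n q r w) := by
  induction w using TensorProduct.induction_on with
  | zero => simp
  | tmul w a => rw [ins_tmul, ins_tmul, H, hB]
  | add x y hx hy => simp only [map_add, hx, hy]

/-- Insertion of `γ` commutes with linear maps which only depend on the total degree. -/
theorem map_gI {V V' : Type*} [AddCommGroup V] [Module B V] [AddCommGroup V'] [Module B V']
    {X Y : A.Ob} {φ : A.Ch X Y → V} {ψ : A.Ch X Y → V'} (hφ : IsMul B φ) (hψ : IsMul B ψ)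
    (h : V →+ V') (hB : ∀ (b : B) v, h (b • v) = b • h v) (p : A.Ch X Y)
    (H : ∀ q : A.Ch X Y, q.rdeg = p.rdeg → ψ q = h (φ q)) : gI G ξ hψ p = h (gI G ξ hφ p) := by
  rw [gI, gI, map_sp3]
  refine sp3_congr fun l m r hp => hφ.map_ins ξ hψ h hB _ l r (fun a => H _ ?_) _
  rw [← hp]
  simp

theorem IsMul.ins_eq_zero {V : Type*} [AddCommGroup V] [Module B V]
    {X Y : A.Ob} {φ : A.Ch X Y → V} (hφ : IsMul B φ) {W Z : A.Ob} (n : ℤ) (q : A.Ch Z Y)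
    (r : A.Ch X W) (H : ∀ a : A.Hom W Z n, φ (q.append (cons a r)) = 0)
    (w : Ω[B⁄R] ⊗[R] A.Hom W Z n) : hφ.ins ξ n q r w = 0 := by
  induction w using TensorProduct.induction_on with
  | zero => simp
  | tmul w a => rw [ins_tmul, H, smul_zero]
  | add x y hx hy => rw [map_add, hx, hy, add_zero]

/-- Insertion of the Hochschild cocycle `γ`, contracted with `ξ`. -/
def GB {u : BHom M N} (hu : IsMulti u) : BHom M N := fun X Y p => gI G ξ (hu X Y) p

theorem GB_congr {u v : BHom M N} (hu : IsMulti u) (hv : IsMulti v) (h : u = v) :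
    GB G ξ hu = GB G ξ hv := by
  subst h
  rfl

theorem GB_apply {u : BHom M N} (hu : IsMulti u) {X Y : A.Ob} (p : A.Ch X Y) (x : M.T Y) :
    GB G ξ hu X Y p x =
      sp3 p fun l m r => (hu X Y).ins ξ (m.rdeg + 1) l r (G.γ _ _ m (m.rdeg + 1)) x := by
  rw [GB, gI, sp3_apply]

theorem GB_eps {u : BHom M N} (hu : IsMulti u) : GB G ξ hu.eps = eps (GB G ξ hu) := by
  funext X Y p
  refine map_gI G ξ (hu X Y) _ (DistribSMul.toAddMonoidHom _ p.rdeg.negOnePow)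
    (fun b v => ?_) p fun q hq => ?_
  · simp only [DistribSMul.toAddMonoidHom_apply, Units.smul_def, smul_comm b]
  · simp only [eps, hq]
    rfl

theorem GB_tau {u : BHom M N} (hu : IsMulti u) : GB G ξ hu.tau = tau (GB G ξ hu) := by
  funext X Y p
  refine map_gI G ξ (hu X Y) (hu.tau X Y) ((DistribSMul.toAddMonoidHom _ p.rdeg.negOnePow).comp
    (AddMonoidHom.compHom' (sgn M Y))) (fun b v => ?_) p fun q hq => ?_
  · refine AddMonoidHom.ext fun x => ?_
    simp only [AddMonoidHom.comp_apply, DistribSMul.toAddMonoidHom_apply, Units.smul_def,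
      AddMonoidHom.smul_apply, AddMonoidHom.compHom'_apply_apply, smul_comm b]
  · simp only [tau, hq]
    rfl

theorem GB_smul {u : BHom M N} (hu : IsMulti u) (b : B) :
    GB G ξ (hu.smul b) = b • GB G ξ hu := by
  funext X Y p
  exact map_gI G ξ (hu X Y) (hu.smul b X Y) (DistribSMul.toAddMonoidHom _ b)
    (fun c v => smul_comm _ _ _) p fun q hq => rfl

theorem IsBLin.GB {u : BHom M N} (hu : IsMulti u) (hl : IsBLin u) : IsBLin (GB G ξ hu) := by
  intro X Y p f x
  have h := map_gI G ξ (hu X Y) (hu.smul f X Y)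
    (AddMonoidHom.compHom' (DistribSMul.toAddMonoidHom (M.T Y) f)) (fun b v => rfl) p
    fun q _ => AddMonoidHom.ext fun x => (hl X Y q f x).symm
  have h' := congrFun (congrFun (congrFun (GB_smul G ξ hu f) X) Y) p
  exact (DFunLike.congr_fun h x).symm.trans (DFunLike.congr_fun h' x)

theorem GB_add {u v : BHom M N} (hu : IsMulti u) (hv : IsMulti v) :
    GB G ξ (hu.add hv) = GB G ξ hu + GB G ξ hv := by
  funext X Y p
  rw [GB, gI]
  refine Eq.trans (sp3_congr fun l m r _ => ?_) (sp3_add p _ _)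
  have h : ∀ (n : ℤ) (w : Ω[B⁄R] ⊗[R] A.Hom _ _ n), (hu.add hv X Y).ins ξ n l r w =
      (hu X Y).ins ξ n l r w + (hv X Y).ins ξ n l r w := by
    intro n w
    induction w using TensorProduct.induction_on with
    | zero => simp
    | tmul w a => simp only [IsMul.ins_tmul]; exact smul_add _ _ _
    | add x y hx hy => simp only [map_add, hx, hy]; abel
  exact h _ _

theorem GB_neg {u : BHom M N} (hu : IsMulti u) : GB G ξ hu.neg = - GB G ξ hu := by
  funext X Y p
  exact map_gI G ξ (hu X Y) (hu.neg X Y) negAddMonoidHom (fun c v => (smul_neg _ _).symm) p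
    fun q hq => rfl

theorem GB_sub {u v : BHom M N} (hu : IsMulti u) (hv : IsMulti v) :
    GB G ξ (hu.sub hv) = GB G ξ hu - GB G ξ hv := by
  rw [GB_congr G ξ (hu.sub hv) (hu.add hv.neg) (sub_eq_add_neg u v), GB_add G ξ hu hv.neg,
    GB_neg G ξ hv, sub_eq_add_neg]

theorem GB_IB {u : BHom M N} (hu : IsMulti u) : GB G ξ hu.IB = IB (GB G ξ hu) := by
  funext X Y p
  exact gI_aI G ξ (hu X Y) p

theorem ins_star {v : BHom M N} {u : BHom L M} (hv : IsMulti v) (hl : IsBLin v) (hu : IsMulti u)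
    {W X Y Z : A.Ob} (n : ℤ) (q : A.Ch Y Z) (r : A.Ch W X) (w : Ω[B⁄R] ⊗[R] A.Hom X Y n)
    (x : L.T Z) : (hv.star hl hu W Z).ins ξ n q r w x =
      sp q (fun S => (hv W S.mid).ins ξ n S.right r w (u S.mid Z S.left x)) +
      sp r (fun S => v W S.mid S.right ((hu S.mid Z).ins ξ n q S.left w x)) := by
  induction w using TensorProduct.induction_on with
  | zero => simp
  | tmul w a =>
    simp only [IsMul.ins_tmul, AddMonoidHom.smul_apply, hl _ _ _ _ _]
    rw [star, sp_append_cons, AddMonoidHom.add_apply, sp_apply, sp_apply, smul_add, sp_smul,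
      sp_smul]
    rfl
  | add w w' h h' =>
    simp only [map_add, AddMonoidHom.add_apply, h, h', sp_add]
    abel

/-- Insertion of `γ` is a derivation for composition. -/
theorem GB_star {v : BHom M N} {u : BHom L M} (hv : IsMulti v) (hl : IsBLin v) (hu : IsMulti u) :
    GB G ξ (hv.star hl hu) = star (GB G ξ hv) u + star v (GB G ξ hu) := by
  funext X Y p
  refine AddMonoidHom.ext fun x => ?_
  rw [GB_apply, sp3_congr fun l m r _ => ins_star ξ hv hl hu _ l r _ x]
  refine (sp3_add p _ _).trans ?_
  refine congr_arg₂ (· + ·) ?_ ?_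
  · simp only [sp3]
    refine (sp_congr fun S _ => sp_comm _ _ _).trans ?_
    refine (sp_assoc p (fun Z Z' l m r => sp r fun T => (hv X Z).ins ξ (T.left.rdeg + 1) m T.right
        (G.γ _ _ T.left (T.left.rdeg + 1)) (u Z Y l x))).symm.trans ?_
    rw [star, sp_apply]
    refine sp_congr fun S _ => ?_
    rw [AddMonoidHom.comp_apply, GB_apply]
    rfl
  · simp only [sp3]
    refine (sp_congr fun S _ => sp_assoc S.right (fun Z Z' l m r => v X Z' r
      ((hu Z' Y).ins ξ (l.rdeg + 1) S.left m (G.γ _ _ l (l.rdeg + 1)) x))).trans ?_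
    refine (sp_assoc p (fun Z Z' l m r => sp m fun U => v X Z' r
      ((hu Z' Y).ins ξ (U.left.rdeg + 1) l U.right (G.γ _ _ U.left (U.left.rdeg + 1)) x))).trans ?_
    rw [star, sp_apply]
    refine sp_congr fun S _ => ?_
    rw [AddMonoidHom.comp_apply, GB_apply, map_sp3]
    rfl

theorem isMulti_GB {u : BHom M N} (hu : IsMulti u) : IsMulti (GB G ξ hu) :=
  fun X Y => isMul_gI G ξ (hu X Y)

theorem IsDeg.GB {g : ℤ} {u : BHom M N} (hd : IsDeg g u) (hu : IsMulti u) :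
    IsDeg g (GB G ξ hu) := by
  intro X Y p k x e he
  rw [GB_apply]
  refine (map_sp3 (DFinsupp.evalAddMonoidHom (β := fun e => N.M X e) e) p _).trans ?_
  refine (sp3_congr (G := fun _ _ _ => 0) fun l m r hp => ?_).trans (by simp [sp3])
  have h : ∀ w : Ω[B⁄R] ⊗[R] A.Hom _ _ (m.rdeg + 1),
      ((hu X Y).ins ξ (m.rdeg + 1) l r w (M.of k x)) e = 0 := by
    intro w
    induction w using TensorProduct.induction_on with
    | zero => simp
    | tmul w a =>
      refine (congrArg (ξ w • ·) (hd X Y (l.append (cons a r)) k x e ?_)).trans (smul_zero _)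
      rw [← hp] at he
      simpa using he
    | add w w' h h' =>
      rw [map_add]
      exact (congrArg₂ (· + ·) h h').trans (add_zero _)
  exact h _

theorem IsRed.GB {u : BHom M N} (hr : IsRed u) (hu : IsMulti u) : IsRed (GB G ξ hu) := by
  intro W X Z q r
  rw [AInf.GB, gI_apply_insert]
  have e₁ : sp3 q (fun l m l' => (hu W Z).ins ξ (m.rdeg + 1) l (l'.append (cons (A.one X) r))
      (G.γ _ _ m (m.rdeg + 1))) = 0 := by
    refine (sp3_congr (G := fun _ _ _ => 0) fun l m r' _ => ?_).trans (by simp [sp3])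
    refine (hu W Z).ins_eq_zero ξ _ _ _ (fun a => ?_) _
    have := hr W X Z (l.append (cons a r')) r
    rwa [append_assoc] at this
  have e₂ : sp3 r (fun l m l' => (hu W Z).ins ξ (m.rdeg + 1) (q.append (cons (A.one X) l)) l'
      (G.γ _ _ m (m.rdeg + 1))) = 0 := by
    refine (sp3_congr (G := fun _ _ _ => 0) fun l m r' _ => ?_).trans (by simp [sp3])
    refine (hu W Z).ins_eq_zero ξ _ _ _ (fun a => ?_) _
    have := hr W X Z q (l.append (cons a r'))
    rwa [append_assoc]
  rw [e₁, e₂, zero_add, add_zero]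
  refine (sp_congr fun S _ => ?_).trans (sp_zero q)
  refine (sp_congr fun T _ => ?_).trans (sp_zero r)
  have h := G.reduced T.mid X S.mid S.right T.left
    ((S.right.append (cons (A.one X) T.left)).rdeg + 1)
  refine (congrArg ((hu W Z).ins ξ _ S.left T.right) ?_).trans (map_zero _)
  exact h

theorem IsHom.GB {g : ℤ} {u : BHom M N} (hu : IsHom g u) : IsHom g (GB G ξ hu.mul) where
  deg := hu.deg.GB G ξ hu.mul
  lin := hu.lin.GB G ξ hu.mul
  mul := isMulti_GB G ξ hu.mul
  red := hu.red.GB G ξ hu.mul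

/-- A pre-connection along the derivation `ξ ∘ d`, in the bar formalism, whose deformation class
is the contraction of the one of `γ` on the cochain level. -/
structure IsConn (n : BHom M M) : Prop where
  deg : IsDeg 0 n
  leibniz : ∀ X Y (p : A.Ch X Y) (f : B) (x : M.T Y), n X Y p (f • x) =
    f • n X Y p x + ξ (KaehlerDifferential.D R B f) • bone M X Y p x
  mul : IsMulti n
  red : IsRed n
  bd_eq : bd n = - tau (GB G ξ (isMulti_bmu M))

variable {G ξ}

theorem IsConn.smul {n : BHom M M} (hn : IsConn G ξ n) {X Y : A.Ob} (p : A.Ch X Y) (c : R)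
    (x : M.T Y) : n X Y p (algebraMap R B c • x) = algebraMap R B c • n X Y p x := by
  simp [hn.leibniz]

theorem IsConn.star_smul {n : BHom M M} (hn : IsConn G ξ n) (f : B) (u : BHom L M) :
    star n (f • u) = f • star n u + ξ (KaehlerDifferential.D R B f) • u := by
  have h : star n (f • u) = f • star n u + ξ (KaehlerDifferential.D R B f) • star (bone M) u := by
    funext X Y p
    refine AddMonoidHom.ext fun x => ?_
    simp only [star, sp_apply, Pi.smul_apply, AddMonoidHom.smul_apply, AddMonoidHom.comp_apply,
      hn.leibniz, sp_add, sp_smul, Pi.add_apply, AddMonoidHom.add_apply]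
  rw [h, bone_star]

/-- The derivative of a morphism with respect to connections. -/
def nabD (m : BHom M M) (n : BHom N N) {u : BHom M N} (hu : IsMulti u) (G : DefField A.toCatData B)
    (ξ : Ω[B⁄R] →ₗ[B] B) : BHom M N := star n u - star u m - GB G ξ hu

variable {l : BHom L L} {m : BHom M M} {n : BHom N N}

theorem IsHom.nabD (hm : IsConn G ξ m) (hn : IsConn G ξ n) {g : ℤ} {u : BHom M N}
    (hu : IsHom g u) : IsHom g (nabD m n hu.mul G ξ) where
  deg := (((hn.deg.star hu.deg).congr (zero_add g)).sub
    ((hu.deg.star hm.deg).congr (add_zero g))).sub (hu.GB G ξ).deg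
  lin := by
    intro X Y p f x
    have h₁ : AInf.star n u X Y p (f • x) = f • AInf.star n u X Y p x +
        ξ (KaehlerDifferential.D R B f) • AInf.star (bone N) u X Y p x := by
      simp only [AInf.star, sp_apply, AddMonoidHom.comp_apply, hn.leibniz, sp_add, sp_smul,
        hu.lin _ _ _ _ _]
    have h₂ : AInf.star u m X Y p (f • x) = f • AInf.star u m X Y p x +
        ξ (KaehlerDifferential.D R B f) • AInf.star u (bone M) X Y p x := by
      simp only [AInf.star, sp_apply, AddMonoidHom.comp_apply, hm.leibniz, sp_add, sp_smul,
        hu.lin _ _ _ _ _, map_add]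
    rw [bone_star] at h₁
    rw [star_bone] at h₂
    simp only [AInf.nabD, Pi.sub_apply, AddMonoidHom.sub_apply, h₁, h₂, (hu.GB G ξ).lin _ _ _ _ _]
    simp only [smul_sub]
    abel
  mul := ((hn.mul.star_of (fun X Y p => hn.smul p) hu.mul).sub (hu.mul.star hu.lin hm.mul)).sub
    (isMulti_GB G ξ hu.mul)
  red := by
    have h₁ := hn.red.star hu.red
    have h₂ := hu.red.star hm.red
    have h₃ := (hu.GB G ξ).red
    intro W X Z q r
    simp only [AInf.nabD, Pi.sub_apply, h₁ _ _ _ _ _, h₂ _ _ _ _ _, h₃ _ _ _ _ _, sub_zero]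

theorem nabD_congr {u v : BHom M N} (hu : IsMulti u) (hv : IsMulti v) (h : u = v) :
    nabD m n hu G ξ = nabD m n hv G ξ := by
  subst h
  rfl

theorem nabD_add {u v : BHom M N} (hu : IsMulti u) (hv : IsMulti v) :
    nabD m n (hu.add hv) G ξ = nabD m n hu G ξ + nabD m n hv G ξ := by
  simp only [nabD, star_add, add_star, GB_add G ξ hu hv]
  abel

theorem IsConn.nabD_smul (hn : IsConn G ξ n) {u : BHom M N} (hu : IsMulti u) (f : B) :
    nabD m n (hu.smul f) G ξ =
      f • nabD m n hu G ξ + ξ (KaehlerDifferential.D R B f) • u := by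
  simp only [nabD, hn.star_smul, smul_star, GB_smul G ξ hu, smul_sub]
  abel

/-- Differentiation is a derivation for composition. -/
theorem nabD_star {v : BHom M N} {u : BHom L M} (hv : IsMulti v) (hl : IsBLin v)
    (hu : IsMulti u) : nabD l n (hv.star hl hu) G ξ =
      star (nabD m n hv G ξ) u + star v (nabD l m hu G ξ) := by
  simp only [nabD, GB_star G ξ hv hl hu, sub_star, star_sub, star_assoc]
  abel

/-- Differentiation commutes with the differential. -/
theorem bd_nabD (hm : IsConn G ξ m) (hn : IsConn G ξ n) {g : ℤ} {u : BHom M N} (hu : IsHom g u) :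
    bd (nabD m n hu.mul G ξ) = nabD m n (hu.mul.bL hu.lin).tau G ξ := by
  have h₁ : IsMulti (star (bmu N) u) := (isMulti_bmu N).star (isBLin_bmu N) hu.mul
  have h₂ : IsMulti (star (eps u) (bmu M)) := hu.mul.eps.star hu.lin.eps (isMulti_bmu M)
  have e : GB G ξ (hu.mul.bL hu.lin) = bL (GB G ξ hu.mul) + star (GB G ξ (isMulti_bmu N)) u -
      star (eps u) (GB G ξ (isMulti_bmu M)) := by
    refine (GB_congr G ξ (hu.mul.bL hu.lin) ((h₁.sub h₂).sub hu.mul.IB) rfl).trans ?_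
    rw [GB_sub G ξ (h₁.sub h₂) hu.mul.IB,
      GB_sub G ξ h₁ h₂, GB_star G ξ (isMulti_bmu N) (isBLin_bmu N) hu.mul,
      GB_star G ξ hu.mul.eps hu.lin.eps (isMulti_bmu M), GB_IB G ξ hu.mul, GB_eps G ξ hu.mul, bL]
    abel
  have e' : GB G ξ (hu.mul.bL hu.lin).tau = bd (GB G ξ hu.mul) +
      g.negOnePow • star (tau (GB G ξ (isMulti_bmu N))) u -
      star u (tau (GB G ξ (isMulti_bmu M))) := by
    rw [GB_tau G ξ (hu.mul.bL hu.lin), e, tau_sub, tau_add, tau_star' _ hu.deg, tau_star, eps_eps]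
    rfl
  rw [nabD, nabD, e', bd_sub, bd_sub, bd_star _ hu.deg, bd_star _ hm.deg, hm.bd_eq, hn.bd_eq,
    neg_star, star_neg, Int.negOnePow_zero, one_smul, smul_neg]
  change _ = star n (bd u) - star (bd u) m - _
  abel

end Insertion

end Bar
end AInf

namespace AInf
open Chain

section Bar

variable {R : Type u} [Field R] {A : Category R} {B : Type u} [CommRing B] [Algebra R B]
variable {K L M N : ModData A.toCatData B}

/-! ### Modules and pre-connections in the bar formalism -/

theorem ModData.IsModule.isUMod (hM : M.IsModule) : IsUMod M where
  rel := by
    refine bhom_ext fun X Y p k m => ?_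
    change star (eps (bmu M)) (bmu M) X Y p (M.of k m) + IB (bmu M) X Y p (M.of k m) = 0
    have h := congrArg (M.of (k + p.rdeg + 2)) (hM.rel X Y p k (k + p.rdeg + 2) m)
    rw [map_zero, map_add] at h
    rw [← h]
    refine congrArg₂ (· + ·) ?_ ?_
    · rw [star, sp_apply]
      refine Eq.trans (sp_congr fun S hS => ?_) (map_sp (M.of (k + p.rdeg + 2)) p _).symm
      rw [AddMonoidHom.comp_apply, bmu_of, eps, AddMonoidHom.smul_apply, bmu_of, Units.smul_def,
        Units.smul_def, map_zsmul]
      refine congrArg _ (of_congr ?_ fun e => M.μ _ _ S.right _ e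
        (M.μ _ _ S.left k (k + S.left.rdeg + 1) m))
      rw [← hS, rdeg_append]
      ring
    · rw [IB, aI, sp3_apply]
      refine Eq.trans (sp_congr fun S hS => ?_) (map_sp (M.of (k + p.rdeg + 2)) p _).symm
      refine Eq.trans (sp_congr fun T hT => ?_) (map_sp (M.of (k + p.rdeg + 2)) S.right _).symm
      change T.right.rdeg.negOnePow • bmu M X Y _ (M.of k m) = _
      rw [bmu_of, Units.smul_def, Units.smul_def, map_zsmul]
      refine congrArg _ (of_congr ?_ fun e => M.μ X Y (S.left.append
        (cons (A.μ _ _ T.left (T.left.rdeg + 2)) T.right)) k e m)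
      rw [rdeg_insert, hT, hS]
      ring
  unit X := DirectSum.addHom_ext fun k m => by
    refine (bmu_of X X (cons (A.one X) (nil X)) k m).trans ?_
    have hd : k + (cons (A.one X) (nil X)).rdeg + 1 = k := by
      simp only [rdeg_cons, rdeg_nil]
      ring
    rw [of_congr hd fun e => M.μ X X (cons (A.one X) (nil X)) k e m, hM.unit]
    rfl
  unit_vanish W X Z q r h := DirectSum.addHom_ext fun k m => by
    refine (bmu_of W Z _ k m).trans ?_
    rw [hM.unit_vanish W X Z q r h, LinearMap.zero_apply, map_zero, AddMonoidHom.zero_apply]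

section Contraction

variable (ξ : Ω[B⁄R] →ₗ[B] B)

/-- Contraction `ω ⊗ m ↦ ξ(ω) m`. -/
def contr (M : ModData A.toCatData B) (X : A.Ob) (k : ℤ) : M.omega.M X k →ₗ[B] M.M X k :=
  TensorProduct.lift (LinearMap.lsmul B (M.M X k) ∘ₗ ξ)

theorem contr_tmul {X : A.Ob} {k : ℤ} (w : Ω[B⁄R]) (m : M.M X k) :
    contr ξ M X k (M.omegaTmul w m) = ξ w • m :=
  TensorProduct.lift.tmul _ _

theorem contr_mu {X Y : A.Ob} (p : A.Ch X Y) (k e : ℤ) (x : M.omega.M Y k) :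
    contr ξ M X e (M.omega.μ X Y p k e x) = M.μ X Y p k e (contr ξ M Y k x) := by
  have h : (contr ξ M X e).comp (M.omega.μ X Y p k e) = (M.μ X Y p k e).comp (contr ξ M Y k) := by
    refine TensorProduct.ext' fun w m => ?_
    refine (contr_tmul ξ w (M.μ X Y p k e m)).trans ?_
    refine Eq.trans ?_ (congrArg (M.μ X Y p k e) (contr_tmul ξ w m)).symm
    exact (map_smul _ _ _).symm
  exact LinearMap.congr_fun h x

theorem contr_sign {X : A.Ob} {k : ℤ} (n : ℤ) (x : M.omega.M X k) :
    contr ξ M X k (n.negOnePow • x) = n.negOnePow • contr ξ M X k x := by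
  rw [Units.smul_def, Units.smul_def, map_zsmul]

/-- Contraction of a sequence of maps with values in `Ω¹ ⊗ M`. -/
def contract (t : Raw M M.omega) : Raw M M := fun X Y p k e =>
  (contr ξ M X e).toAddMonoidHom.comp (t X Y p k e)

theorem contract_apply (t : Raw M M.omega) {X Y : A.Ob} (p : A.Ch X Y) (k e : ℤ) (m : M.M Y k) :
    contract ξ t X Y p k e m = contr ξ M X e (t X Y p k e m) := rfl

theorem diff_contract (g : ℤ) (t : Raw M M.omega) :
    diff M M g (contract ξ t) = contract ξ (diff M M.omega g t) := by
  funext X Y p k e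
  refine AddMonoidHom.ext fun m => ?_
  rw [contract_apply]
  change diffFun M M g _ X Y p k e m = contr ξ M X e (diffFun M M.omega g t X Y p k e m)
  rw [diffFun, diffFun, map_add, map_add]
  refine congrArg₂ (· + ·) (congrArg₂ (· + ·) ?_ ?_) ?_
  · refine Eq.trans (sp_congr fun S _ => ?_) (map_sp (contr ξ M X e).toAddMonoidHom p _).symm
    refine Eq.trans ?_ (map_zsmul (contr ξ M X e).toAddMonoidHom _ _).symm
    exact congrArg _ (contr_mu ξ _ _ _ _).symm
  · refine Eq.trans (sp_congr fun S _ => ?_) (map_sp (contr ξ M X e).toAddMonoidHom p _).symm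
    exact (map_zsmul (contr ξ M X e).toAddMonoidHom _ _).symm
  · refine Eq.trans (sp_congr fun S _ => ?_) (map_sp (contr ξ M X e).toAddMonoidHom p _).symm
    refine Eq.trans (sp_congr fun T _ => ?_)
      (map_sp (contr ξ M X e).toAddMonoidHom S.right _).symm
    exact (map_zsmul (contr ξ M X e).toAddMonoidHom _ _).symm

theorem contr_insertOmega {W X Y Z : A.Ob} (q : A.Ch Y Z) (r : A.Ch W X) (n k e : ℤ)
    (w : Ω[B⁄R] ⊗[R] A.Hom X Y n) (m : M.M Z k) (he : e = k + (q.rdeg + (n - 1 + r.rdeg)) + 1) :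
    M.of e (contr ξ M W e (insertOmega M q r n k e w m)) =
      (isMulti_bmu M W Z).ins ξ n q r w (M.of k m) := by
  have h : (M.of e).comp ((contr ξ M W e).toAddMonoidHom.comp
      ((AddMonoidHom.eval m).comp (insertOmega M q r n k e))) w =
        (isMulti_bmu M W Z).ins ξ n q r w (M.of k m) := by
    induction w using TensorProduct.induction_on with
    | zero => rw [map_zero, map_zero, AddMonoidHom.zero_apply]
    | tmul w a =>
      have h : contr ξ M W e (insertOmega M q r n k e (w ⊗ₜ a) m) =
          ξ w • M.μ W Z (q.append (cons a r)) k e m := contr_tmul ξ w _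
      refine (congrArg (M.of e) h).trans ?_
      rw [of_smul, IsMul.ins_tmul, AddMonoidHom.smul_apply, bmu_of]
      refine congrArg _ (of_congr ?_ fun e => M.μ W Z (q.append (cons a r)) k e m)
      simpa using he
    | add x y hx hy => rw [map_add, map_add, hx, hy, AddMonoidHom.add_apply]
  exact h

theorem toB_contract_onModule (G : DefField A.toCatData B) :
    toB 1 (contract ξ (G.onModule M)) = - tau (GB G ξ (isMulti_bmu M)) := by
  refine bhom_ext fun X Y p k m => ?_
  have h₁ : M.of (k + p.rdeg + 1) (contract ξ (G.onModule M) X Y p k (k + p.rdeg + 1) m) =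
      - GB G ξ (isMulti_bmu M) X Y p (M.of k m) := by
    rw [GB_apply]
    refine (map_neg ((M.of _).comp (contr ξ M X _).toAddMonoidHom) _).trans (congrArg _ ?_)
    refine (congrArg _ (sp_apply p _ m)).trans ((map_sp _ p _).trans (sp_congr fun S hS => ?_))
    refine (congrArg _ (sp_apply S.right _ m)).trans
      ((map_sp _ S.right _).trans (sp_congr fun T hT => ?_))
    refine contr_insertOmega ξ S.left T.right _ k _ _ m ?_
    rw [← hS, ← hT]
    simp
  rw [toB_of, h₁]
  change _ = - (p.rdeg.negOnePow • (GB G ξ (isMulti_bmu M) X Y p).comp (sgn M Y)) (M.of k m)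
  rw [AddMonoidHom.smul_apply, AddMonoidHom.comp_apply, sgn_of, Units.smul_def k.negOnePow,
    map_zsmul, ← Units.smul_def, sign_smul_smul, add_comm k, smul_neg]

/-- A family which follows a deformation field carries a connection along every derivation,
whose deformation class is given by that field on the cochain level. -/
theorem DefField.IsFollowedBy.exists_isConn {G : DefField A.toCatData B} (h : G.IsFollowedBy M) :
    ∃ n : BHom M M, IsConn G ξ n := by
  obtain ⟨D, hD, β, hβ, hβD⟩ := h
  rw [show (1 : ℤ) - 1 = 0 from rfl] at hβ hβD
  have hval : ∀ X Y (p : A.Ch X Y) k e m, contract ξ (D - β) X Y p k e m =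
      contr ξ M X e (D X Y p k e m - β X Y p k e m) := fun _ _ _ _ _ _ => rfl
  refine ⟨toB 0 (contract ξ (D - β)), isDeg_toB 0 _, ?_, isMulti_toB 0 ⟨?_, ?_⟩,
    isRed_toB 0 ?_, ?_⟩
  · intro X Y p f x
    induction x using DirectSum.induction_on with
    | zero => simp
    | of k m =>
      have e₁ : f • M.of k m = M.of k (f • m) := (of_smul k f m).symm
      have e₂ : toB 0 (contract ξ (D - β)) X Y p (M.of k (f • m)) =
          f • toB 0 (contract ξ (D - β)) X Y p (M.of k m) +
            ξ (KaehlerDifferential.D R B f) • bone M X Y p (M.of k m) := by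
        cases p with
        | nil =>
          rw [toB_of, toB_of, of_congr (show k + (nil X).rdeg + 0 = k by simp)
            fun e => contract ξ (D - β) X X (nil X) k e (f • m),
            of_congr (show k + (nil X).rdeg + 0 = k by simp)
            fun e => contract ξ (D - β) X X (nil X) k e m, hval, hval, hD.leibniz, hβ.2.1]
          have e₃ : f • D X X (nil X) k k m +
              k.negOnePow • M.omegaTmul (KaehlerDifferential.D R B f) m - f • β X X (nil X) k k m =
              f • (D X X (nil X) k k m - β X X (nil X) k k m) +
                k.negOnePow • M.omegaTmul (KaehlerDifferential.D R B f) m := by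
            rw [smul_sub]
            abel
          rw [e₃, map_add, map_add, map_smul, of_smul, smul_add, Units.smul_def, Units.smul_def,
            smul_comm f]
          congr 1
          have e₄ : contr ξ M X k (k.negOnePow • M.omegaTmul (KaehlerDifferential.D R B f) m) =
              k.negOnePow • ξ (KaehlerDifferential.D R B f) • m :=
            (contr_sign ξ k _).trans (congrArg (k.negOnePow • ·) (contr_tmul ξ _ m))
          rw [e₄, Units.smul_def, map_zsmul, of_smul, ← Units.smul_def, ← Units.smul_def,
            sign_smul_smul, Int.negOnePow_even _ (by simp), one_smul]
          rfl
        | cons a p =>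
          rw [toB_of, toB_of, hval, hval, hD.linear _ _ _ (by simp), hβ.2.1, ← smul_sub, map_smul,
            of_smul, Units.smul_def, smul_comm f]
          exact (add_zero _).symm.trans (congrArg _ (smul_zero _).symm)
      exact (congrArg _ e₁).trans e₂
    | add x y hx hy =>
      rw [smul_add, map_add, hx, hy, map_add, map_add, smul_add, smul_add]
      abel
  · intro W X Y Z n q a a' r
    funext k e
    refine AddMonoidHom.ext fun m => ?_
    change contract ξ (D - β) _ _ _ k e m =
      contract ξ (D - β) _ _ _ k e m + contract ξ (D - β) _ _ _ k e m
    rw [hval, hval, hval, hD.multilinear.map_add, hβ.2.2.1.map_add, ← map_add]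
    congr 1
    exact add_sub_add_comm _ _ _ _
  · intro W X Y Z n q c a r
    funext k e
    refine AddMonoidHom.ext fun m => ?_
    change contract ξ (D - β) _ _ _ k e m = algebraMap R B c • contract ξ (D - β) _ _ _ k e m
    rw [hval, hval, hD.multilinear.map_smul, hβ.2.2.1.map_smul, ← map_smul]
    congr 1
    exact (smul_sub _ _ _).symm
  · intro W X Z q r
    funext k e
    refine AddMonoidHom.ext fun m => ?_
    rw [hval, hD.unit, hβ.2.2.2]
    exact (congrArg _ (sub_self _)).trans (map_zero _)
  · rw [← toB_diff, diff_contract, map_sub, hβD, ← toB_contract_onModule]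
    congr 2
    exact sub_sub_cancel _ _

end Contraction

end Bar
end AInf

namespace AInf
open Chain

/-! ### The cohomology category -/

variable {R : Type u} [Field R] {A : Category R} {B : Type u} [CommRing B] [Algebra R B]
variable {K L M N : ModData A.toCatData B}

theorem IsBLin.star_smul {v : BHom M N} (hv : IsBLin v) (b : B) (u : BHom L M) :
    AInf.star v (b • u) = b • AInf.star v u := by
  funext X Y p
  refine AddMonoidHom.ext fun x => ?_
  simp only [AInf.star, sp_apply, Pi.smul_apply, AddMonoidHom.smul_apply, AddMonoidHom.comp_apply,
    hv _ _ _ b, sp_smul]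

theorem bd_bone (M : ModData A.toCatData B) : bd (bone M) = 0 := by
  have h₁ : eps (bone M) = bone M := by
    funext X Y p
    cases p with
    | nil => simp [eps]
    | cons a p => simp [eps, bone]
  have h₂ : IB (bone M) = 0 := by
    funext X Y p
    refine (sp_congr fun S _ => (sp_congr (g := fun _ => 0) fun T _ => ?_).trans
      (sp_zero _)).trans (sp_zero p)
    have h : ∀ {X Y Z Z' : A.Ob} {n : ℤ} (q : A.Ch Z Y) (a : A.Hom Z' Z n) (r : A.Ch X Z'),
        bone M X Y (q.append (cons a r)) = 0 := by
      intro X Y Z Z' n q a r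
      cases q <;> rfl
    exact (congrArg (T.right.rdeg.negOnePow • ·) (h _ _ _)).trans (smul_zero _)
  rw [bd, bL, star_bone, h₁, bone_star, h₂, sub_self, sub_zero, tau_zero]

/-- The cocycles of degree `g` in the bar formalism. -/
def ZB (M N : ModData A.toCatData B) (g : ℤ) : Submodule B (BHom M N) :=
  HomB M N g ⊓ LinearMap.ker (bdₗ M N)

/-- The coboundaries of degree `g` in the bar formalism. -/
def BB (M N : ModData A.toCatData B) (g : ℤ) : Submodule B (BHom M N) :=
  (HomB M N (g - 1)).map (bdₗ M N)

/-- The cohomology `H^g(hom(M, N))`. -/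
abbrev HB (M N : ModData A.toCatData B) (g : ℤ) : Type u :=
  ZB M N g ⧸ (BB M N g).submoduleOf (ZB M N g)

theorem mem_ZB {g : ℤ} {u : BHom M N} : u ∈ ZB M N g ↔ IsHom g u ∧ bd u = 0 := Iff.rfl

theorem mem_BB {g : ℤ} {u : BHom M N} : u ∈ BB M N g ↔ ∃ w, IsHom (g - 1) w ∧ bd w = u := Iff.rfl

/-- The class of a cocycle. -/
abbrev cls (g : ℤ) (u : ZB M N g) : HB M N g := Submodule.Quotient.mk u

theorem cls_eq_iff {g : ℤ} {u v : ZB M N g} : cls g u = cls g v ↔ u.1 - v.1 ∈ BB M N g :=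
  Submodule.Quotient.eq _

theorem star_mem_ZB {g : ℤ} {v : BHom M N} {u : BHom L M} (hv : v ∈ ZB M N g)
    (hu : u ∈ ZB L M 0) : star v u ∈ ZB L N g := by
  refine mem_ZB.mpr ⟨?_, ?_⟩
  · have := hv.1.star hu.1
    rwa [add_zero] at this
  · rw [bd_star v hu.1.deg, (mem_ZB.mp hv).2, (mem_ZB.mp hu).2]
    simp [zero_star, star_zero]

theorem star_mem_BB {g : ℤ} {v : BHom M N} {u : BHom L M} (hv : v ∈ ZB M N g)
    (hu : u ∈ BB L M 0) : star v u ∈ BB L N g := by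
  obtain ⟨w, hw, rfl⟩ := mem_BB.mp hu
  refine mem_BB.mpr ⟨star v w, ?_, ?_⟩
  · have := hv.1.star hw
    rwa [zero_sub, ← sub_eq_add_neg] at this
  · rw [bd_star v hw.deg, (mem_ZB.mp hv).2]
    simp [zero_star]

theorem star_mem_BB' {g : ℤ} {v : BHom M N} {u : BHom L M} (hv : v ∈ BB M N g)
    (hu : u ∈ ZB L M 0) : star v u ∈ BB L N g := by
  obtain ⟨w, hw, rfl⟩ := mem_BB.mp hv
  refine mem_BB.mpr ⟨star w u, ?_, ?_⟩
  · have := hw.star hu.1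
    rwa [add_zero] at this
  · rw [bd_star w hu.1.deg, (mem_ZB.mp hu).2]
    simp [star_zero]

/-- Composition of cocycles. -/
def starZ (L M N : ModData A.toCatData B) (g : ℤ) : ZB M N g →ₗ[B] ZB L M 0 →ₗ[B] ZB L N g :=
  LinearMap.mk₂ B (fun v u => ⟨star v.1 u.1, star_mem_ZB v.2 u.2⟩)
    (fun v v' u => Subtype.ext (add_star v.1 v'.1 u.1))
    (fun b v u => Subtype.ext (smul_star b v.1 u.1))
    (fun v u u' => Subtype.ext (star_add v.1 u.1 u'.1))
    (fun b v u => Subtype.ext (IsBLin.star_smul v.2.1.lin b u.1))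

/-- Composition in cohomology. -/
def hcomp (L M N : ModData A.toCatData B) (g : ℤ) : HB M N g →ₗ[B] HB L M 0 →ₗ[B] HB L N g :=
  Submodule.liftQ _
    { toFun := fun v => Submodule.mapQ _ _ (starZ L M N g v) fun _ hu => star_mem_BB v.2 hu
      map_add' := fun v v' => by
        ext u
        change cls g (starZ L M N g (v + v') u) = _
        rw [map_add]
        rfl
      map_smul' := fun b v => by
        ext u
        change cls g (starZ L M N g (b • v) u) = _
        rw [map_smul]
        rfl }
    (fun v hv => by
      rw [LinearMap.mem_ker]
      ext u
      exact (Submodule.Quotient.mk_eq_zero _).mpr (star_mem_BB' hv u.2))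

theorem bone_mem_ZB (M : ModData A.toCatData B) : bone M ∈ ZB M M 0 :=
  mem_ZB.mpr ⟨isHom_bone M, bd_bone M⟩

/-- The degree zero cohomology category of families of modules. -/
def HMod (A : Category R) (B : Type u) [CommRing B] [Algebra R B] : Type (u + 1) :=
  ModData A.toCatData B

/-- A family of modules as an object of the cohomology category. -/
def HMod.of (M : ModData A.toCatData B) : HMod A B := M

instance : CategoryTheory.Category.{u} (HMod A B) where
  Hom M N := HB (A := A) (B := B) M N 0
  id M := cls 0 ⟨bone M, bone_mem_ZB M⟩
  comp u v := hcomp _ _ _ 0 v u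
  id_comp u := by
    obtain ⟨u, rfl⟩ := Submodule.Quotient.mk_surjective _ u
    exact congrArg (cls 0) (Subtype.ext (star_bone u.1))
  comp_id u := by
    obtain ⟨u, rfl⟩ := Submodule.Quotient.mk_surjective _ u
    exact congrArg (cls 0) (Subtype.ext (bone_star u.1))
  assoc u v w := by
    obtain ⟨u, rfl⟩ := Submodule.Quotient.mk_surjective _ u
    obtain ⟨v, rfl⟩ := Submodule.Quotient.mk_surjective _ v
    obtain ⟨w, rfl⟩ := Submodule.Quotient.mk_surjective _ w
    exact congrArg (cls 0) (Subtype.ext (star_assoc w.1 v.1 u.1).symm)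

instance : CategoryTheory.Preadditive (HMod A B) where
  homGroup M N := inferInstanceAs (AddCommGroup (HB (A := A) (B := B) M N 0))
  add_comp L M N u u' v := (hcomp L M N 0 v).map_add u u'
  comp_add L M N u v v' := (hcomp L M N 0).map_add₂ v v' u

instance : CategoryTheory.Linear B (HMod A B) where
  homModule M N := inferInstanceAs (Module B (HB (A := A) (B := B) M N 0))
  smul_comp L M N b u v := (hcomp L M N 0 v).map_smul b u
  comp_smul L M N u b v := (hcomp L M N 0).map_smul₂ b v u

/-! ### Derivations of cohomology -/

section Derivation

variable {G : DefField A.toCatData B} {ξ : Ω[B⁄R] →ₗ[B] B} {l : BHom L L} {m : BHom M M}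
  {n : BHom N N}

theorem nabD_zero (h : IsMulti (0 : BHom M N)) : nabD m n h G ξ = 0 := by
  have h' := nabD_add (m := m) (n := n) (G := G) (ξ := ξ) h h
  rw [nabD_congr (h.add h) h (add_zero 0)] at h'
  exact left_eq_add.mp h'

theorem nabD_mem_ZB (hm : IsConn G ξ m) (hn : IsConn G ξ n) {g : ℤ} {u : BHom M N}
    (hu : u ∈ ZB M N g) : nabD m n hu.1.mul G ξ ∈ ZB M N g := by
  refine mem_ZB.mpr ⟨IsHom.nabD hm hn hu.1, ?_⟩
  have h0 : IsMulti (0 : BHom M N) := (isHom_zero 0).mul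
  exact (bd_nabD hm hn hu.1).trans ((nabD_congr _ h0 (mem_ZB.mp hu).2).trans (nabD_zero h0))

theorem nabD_mem_BB (hm : IsConn G ξ m) (hn : IsConn G ξ n) {g : ℤ} {u : BHom M N}
    (hu : u ∈ BB M N g) (hu' : IsMulti u) : nabD m n hu' G ξ ∈ BB M N g := by
  obtain ⟨w, hw, rfl⟩ := mem_BB.mp hu
  exact mem_BB.mpr ⟨_, IsHom.nabD hm hn hw, bd_nabD hm hn hw⟩

/-- The derivation of cohomology induced by connections on both modules. -/
def HB.deriv (hm : IsConn G ξ m) (hn : IsConn G ξ n) (g : ℤ) : HB M N g →+ HB M N g :=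
  QuotientAddGroup.lift ((BB M N g).submoduleOf (ZB M N g)).toAddSubgroup
    (AddMonoidHom.mk' (fun u : ZB M N g => cls g ⟨nabD m n u.2.1.mul G ξ, nabD_mem_ZB hm hn u.2⟩)
      fun u v => congrArg (cls g) (Subtype.ext (nabD_add u.2.1.mul v.2.1.mul)))
    fun u hu => (Submodule.Quotient.mk_eq_zero _).mpr (nabD_mem_BB hm hn hu u.2.1.mul)

theorem HB.deriv_smul (hm : IsConn G ξ m) (hn : IsConn G ξ n) (g : ℤ) (f : B) (x : HB M N g) :
    HB.deriv hm hn g (f • x) =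
      f • HB.deriv hm hn g x + ξ (KaehlerDifferential.D R B f) • x := by
  obtain ⟨u, rfl⟩ := Submodule.Quotient.mk_surjective _ x
  exact congrArg (cls g) (Subtype.ext (hn.nabD_smul u.2.1.mul f))

theorem HB.deriv_hcomp (hl : IsConn G ξ l) (hm : IsConn G ξ m) (hn : IsConn G ξ n) (g : ℤ)
    (y : HB M N g) (x : HB L M 0) : HB.deriv hl hn g (hcomp L M N g y x) =
      hcomp L M N g (HB.deriv hm hn g y) x + hcomp L M N g y (HB.deriv hl hm 0 x) := by
  obtain ⟨u, rfl⟩ := Submodule.Quotient.mk_surjective _ x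
  obtain ⟨v, rfl⟩ := Submodule.Quotient.mk_surjective _ y
  exact congrArg (cls g) (Subtype.ext (nabD_star v.2.1.mul v.2.1.lin u.2.1.mul))

end Derivation

/-! ### Quasi-isomorphisms -/

/-- The components outside the expected degree vanish. -/
def HasDeg (g : ℤ) (t : Raw M N) : Prop :=
  ∀ X Y (p : A.Ch X Y) k e, e ≠ k + p.rdeg + g → t X Y p k e = 0

/-- The structure maps of the family have the expected degrees. -/
def ModData.HasDeg (M : ModData A.toCatData B) : Prop :=
  ∀ X Y (p : A.Ch X Y) k e, e ≠ k + p.rdeg + 1 → M.μ X Y p k e = 0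

theorem toB_injective {g : ℤ} {t t' : Raw M N} (ht : HasDeg g t) (ht' : HasDeg g t')
    (h : toB g t = toB g t') : t = t' := by
  rw [← ofB_toB ht, ← ofB_toB ht', h]

theorem HasDeg.sub {g : ℤ} {t t' : Raw M N} (ht : HasDeg g t) (ht' : HasDeg g t') :
    HasDeg g (t - t') := fun X Y p k e he => by
  rw [Pi.sub_apply, Pi.sub_apply, Pi.sub_apply, Pi.sub_apply, Pi.sub_apply, ht X Y p k e he,
    ht' X Y p k e he, sub_zero]

theorem hasDeg_idHom (M : ModData A.toCatData B) : HasDeg 0 (idHom M) := by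
  intro X Y p k e he
  cases p with
  | nil => exact dif_neg fun h => he (by simp [h])
  | cons a p => rfl

theorem HasDeg.comp {t₂ : Raw M N} {t₁ : Raw L M} (h₂ : HasDeg 0 t₂) : HasDeg 0 (comp t₂ t₁) := by
  intro X Y p k e he
  refine (sp_congr (g := fun _ => 0) fun S hS => ?_).trans (sp_zero p)
  have : e ≠ k + S.left.rdeg + S.right.rdeg + 0 := by
    rw [← hS, rdeg_append] at he
    omega
  rw [h₂ _ _ _ _ _ this, AddMonoidHom.zero_comp, smul_zero]

theorem HasDeg.diff {g : ℤ} {t : Raw M N} (ht : HasDeg g t) (hN : N.HasDeg) :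
    HasDeg (g + 1) (diff M N g t) := by
  intro X Y p k e he
  refine AddMonoidHom.ext fun m => ?_
  have h₁ : (sp p fun S => (k + S.left.rdeg).negOnePow •
      N.μ _ _ S.right _ e (t _ _ S.left k (k + S.left.rdeg + g) m)) = 0 := by
    refine (sp_congr (g := fun _ => 0) fun S hS => ?_).trans (sp_zero p)
    rw [hN _ _ _ _ _ (by rw [← hS, rdeg_append] at he; omega), LinearMap.zero_apply, smul_zero]
  have h₂ : (sp p fun S => (k + S.left.rdeg).negOnePow •
      t _ _ S.right _ e (M.μ _ _ S.left k (k + S.left.rdeg + 1) m)) = 0 := by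
    refine (sp_congr (g := fun _ => 0) fun S hS => ?_).trans (sp_zero p)
    rw [ht _ _ _ _ _ (by rw [← hS, rdeg_append] at he; omega), AddMonoidHom.zero_apply, smul_zero]
  have h₃ : (sp p fun S => sp S.right fun T => (k + S.left.rdeg + T.left.rdeg).negOnePow •
      t X Y (S.left.append (cons (A.μ _ _ T.left (T.left.rdeg + 2)) T.right)) k e m) = 0 := by
    refine (sp_congr (g := fun _ => 0) fun S hS => (sp_congr (g := fun _ => 0)
      fun T hT => ?_).trans (sp_zero _)).trans (sp_zero p)
    rw [ht _ _ _ _ _ (by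
      rw [← hS, rdeg_append, ← hT, rdeg_append] at he
      rw [rdeg_append, rdeg_cons]
      omega), AddMonoidHom.zero_apply, smul_zero]
  exact (congrArg₂ (· + ·) (congrArg₂ (· + ·) h₁ h₂) h₃).trans (by rw [add_zero, add_zero])

theorem toB_mem_ZB {g : ℤ} {t : Raw M N} (ht : t ∈ Cocycles M N g) : toB g t ∈ ZB M N g := by
  refine mem_ZB.mpr ⟨isHom_toB ht.1, ?_⟩
  rw [← toB_diff, LinearMap.mem_ker.mp ht.2, toB_zero]

theorem toB_mem_BB {g : ℤ} {t : Raw M N} (ht : t ∈ Coboundaries M N g) : toB g t ∈ BB M N g := by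
  obtain ⟨w, hw, rfl⟩ := ht
  refine mem_BB.mpr ⟨_, isHom_toB hw, ?_⟩
  rw [← toB_diff, sub_add_cancel]

theorem ofB_mem_Cocycles (hN : N.HasDeg) {g : ℤ} {u : BHom M N} (hu : u ∈ ZB M N g) :
    ofB u ∈ Cocycles M N g := by
  have h := ofB_mem hu.1
  have hd : HasDeg g (ofB u) := h.1
  refine ⟨h, LinearMap.mem_ker.mpr (toB_injective (hd.diff hN) (fun _ _ _ _ _ _ => rfl) ?_)⟩
  rw [toB_diff, toB_ofB hu.1.deg, (mem_ZB.mp hu).2, toB_zero]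

theorem mem_Coboundaries (hN : N.HasDeg) {g : ℤ} {t : Raw M N} (ht : HasDeg g t)
    (h : toB g t ∈ BB M N g) : t ∈ Coboundaries M N g := by
  obtain ⟨w, hw, hw'⟩ := mem_BB.mp h
  have hd : HasDeg (g - 1) (ofB w) := (ofB_mem hw).1
  refine ⟨ofB w, ofB_mem hw, toB_injective (g := g) ?_ ht ?_⟩
  · have := hd.diff hN
    rwa [sub_add_cancel] at this
  · have := toB_diff (g - 1) (ofB w)
    rw [toB_ofB hw.deg, sub_add_cancel] at this
    rw [this, hw']

/-- The class of a cocycle, as a morphism in the cohomology category. -/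
def hcls {t : Raw M N} (ht : t ∈ Cocycles M N 0) : HB M N 0 := cls 0 ⟨toB 0 t, toB_mem_ZB ht⟩

theorem hcls_surjective (hN : N.HasDeg) (x : HB M N 0) :
    ∃ (t : Raw M N) (ht : t ∈ Cocycles M N 0), hcls ht = x := by
  obtain ⟨u, rfl⟩ := Submodule.Quotient.mk_surjective _ x
  exact ⟨ofB u.1, ofB_mem_Cocycles hN u.2, congrArg (cls 0) (Subtype.ext (toB_ofB u.2.1.deg))⟩

theorem cohomologous_iff (hN : N.HasDeg) {t t' : Raw M N} (ht : HasDeg 0 t) (ht' : HasDeg 0 t') :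
    Cohomologous t t' ↔ toB 0 t - toB 0 t' ∈ BB M N 0 := by
  rw [← toB_sub]
  exact ⟨toB_mem_BB, mem_Coboundaries hN (ht.sub ht')⟩

theorem toB_cohomologous {t t' : Raw M N} (h : Cohomologous t t') :
    toB 0 t - toB 0 t' ∈ BB M N 0 := by
  rw [← toB_sub]
  exact toB_mem_BB h

theorem quasiIso_iff (hM : M.HasDeg) (hN : N.HasDeg) : QuasiIso M N ↔
    ∃ (f : HB M N 0) (g : HB N M 0), hcomp M N M 0 g f = cls 0 ⟨bone M, bone_mem_ZB M⟩ ∧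
      hcomp N M N 0 f g = cls 0 ⟨bone N, bone_mem_ZB N⟩ := by
  constructor
  · rintro ⟨f, hf, g, hg, h₁, h₂⟩
    refine ⟨hcls hf, hcls hg, cls_eq_iff.mpr ?_, cls_eq_iff.mpr ?_⟩
    · have := toB_cohomologous h₁
      rwa [toB_comp, toB_idHom] at this
    · have := toB_cohomologous h₂
      rwa [toB_comp, toB_idHom] at this
  · rintro ⟨f, g, h₁, h₂⟩
    obtain ⟨f, hf, rfl⟩ := hcls_surjective hN f
    obtain ⟨g, hg, rfl⟩ := hcls_surjective hM g
    refine ⟨f, hf, g, hg, (cohomologous_iff hM (HasDeg.comp hg.1.1) (hasDeg_idHom M)).mpr ?_,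
      (cohomologous_iff hN (HasDeg.comp hf.1.1) (hasDeg_idHom N)).mpr ?_⟩
    · rw [toB_comp, toB_idHom]
      exact cls_eq_iff.mp h₁
    · rw [toB_comp, toB_idHom]
      exact cls_eq_iff.mp h₂

open CategoryTheory in
theorem quasiIso_iff_nonempty_iso (hM : M.HasDeg) (hN : N.HasDeg) :
    QuasiIso M N ↔ Nonempty ((HMod.of M) ≅ (HMod.of N)) := by
  rw [quasiIso_iff hM hN]
  exact ⟨fun ⟨f, g, h₁, h₂⟩ => ⟨⟨f, g, h₁, h₂⟩⟩,
    fun ⟨e⟩ => ⟨e.hom, e.inv, e.hom_inv_id, e.inv_hom_id⟩⟩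

/-! ### Commutative local endomorphism rings -/

section Local

open CategoryTheory

/-- The endomorphism ring in the cohomology category. -/
abbrev HEnd (M : ModData A.toCatData B) : Type u := End (HMod.of M)

/-- The class of a cocycle in the endomorphism ring. -/
def ecls {x : BHom M M} (hx : x ∈ ZB M M 0) : HEnd M := cls 0 ⟨x, hx⟩

theorem ecls_eq_iff {x y : BHom M M} (hx : x ∈ ZB M M 0) (hy : y ∈ ZB M M 0) :
    ecls hx = ecls hy ↔ x - y ∈ BB M M 0 := cls_eq_iff

theorem ecls_congr {x y : BHom M M} (hx : x ∈ ZB M M 0) (hy : y ∈ ZB M M 0) (h : x = y) :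
    ecls hx = ecls hy := by
  subst h
  rfl

theorem ecls_mul {x y : BHom M M} (hx : x ∈ ZB M M 0) (hy : y ∈ ZB M M 0) :
    ecls hx * ecls hy = ecls (star_mem_ZB hx hy) := rfl

theorem ecls_bone : ecls (bone_mem_ZB M) = 1 := rfl

theorem ecls_sub_smul {x y : BHom M M} (hx : x ∈ ZB M M 0) (hy : y ∈ ZB M M 0) (a : B) :
    ecls hx - a • ecls hy = ecls ((ZB M M 0).sub_mem hx ((ZB M M 0).smul_mem a hy)) := rfl

theorem ecls_surjective (x : HEnd M) : ∃ (u : BHom M M) (hu : u ∈ ZB M M 0), ecls hu = x := by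
  obtain ⟨u, rfl⟩ := Submodule.Quotient.mk_surjective _ x
  exact ⟨u.1, u.2, rfl⟩

theorem ecls_toB_surjective (hM : M.HasDeg) (x : HEnd M) :
    ∃ (t : Raw M M) (ht : t ∈ Cocycles M M 0), ecls (toB_mem_ZB ht) = x := by
  obtain ⟨u, hu, rfl⟩ := ecls_surjective x
  exact ⟨ofB u, ofB_mem_Cocycles hM hu, ecls_congr _ _ (toB_ofB hu.1.deg)⟩

theorem ecls_power {x : Raw M M} (hx : x ∈ Cocycles M M 0) (n : ℕ) :
    ∃ h : toB 0 (power x n) ∈ ZB M M 0, ecls h = ecls (toB_mem_ZB hx) ^ n := by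
  induction n with
  | zero =>
    have e : toB 0 (power x 0) = bone M := toB_idHom M
    exact ⟨e ▸ bone_mem_ZB M, (ecls_congr _ (bone_mem_ZB M) e).trans (by rw [ecls_bone, pow_zero])⟩
  | succ n ih =>
    obtain ⟨h, h'⟩ := ih
    have e : toB 0 (power x (n + 1)) = star (toB 0 x) (toB 0 (power x n)) := toB_comp 0 x _
    have h1 := star_mem_ZB (toB_mem_ZB hx) h
    exact ⟨e ▸ h1, (ecls_congr _ h1 e).trans (by rw [← ecls_mul _ h, h', pow_succ'])⟩

theorem isNilp_iff (hM : M.HasDeg) {x : Raw M M} (hx : x ∈ Cocycles M M 0) :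
    IsNilp x ↔ IsNilpotent (ecls (toB_mem_ZB hx)) := by
  have hd : ∀ n, HasDeg 0 (power x n) := by
    intro n
    cases n with
    | zero => exact hasDeg_idHom M
    | succ n => exact HasDeg.comp hx.1.1
  refine exists_congr fun n => ?_
  obtain ⟨h, h'⟩ := ecls_power hx n
  rw [cohomologous_iff hM (hd n) (t' := 0) (fun _ _ _ _ _ _ => rfl), ← h', toB_zero]
  exact (ecls_eq_iff h (ZB M M 0).zero_mem).symm

theorem CommLocal.commute {M : ModData A.toCatData R} (h : CommLocal M) (hM : M.HasDeg)
    (x y : HEnd M) : x * y = y * x := by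
  obtain ⟨x, hx, rfl⟩ := ecls_toB_surjective hM x
  obtain ⟨y, hy, rfl⟩ := ecls_toB_surjective hM y
  have := toB_cohomologous (h.comm x hx y hy)
  rw [toB_comp, toB_comp] at this
  rw [ecls_mul, ecls_mul, ecls_eq_iff]
  exact this

theorem idHom_mem_Cocycles (hM : M.HasDeg) : idHom M ∈ Cocycles M M 0 := by
  have h := ofB_mem_Cocycles hM (bone_mem_ZB M)
  rwa [← toB_idHom, ofB_toB (hasDeg_idHom M)] at h

theorem ecls_idHom (hM : M.HasDeg) : ecls (toB_mem_ZB (idHom_mem_Cocycles hM)) = 1 :=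
  ecls_congr _ (bone_mem_ZB M) (toB_idHom M)

theorem CommLocal.one_ne_zero {M : ModData A.toCatData R} (h : CommLocal M) (hM : M.HasDeg) :
    (1 : HEnd M) ≠ 0 := by
  intro h0
  obtain ⟨N, hN, hN'⟩ := h.codim_one
  have : N = ⊤ := by
    refine eq_top_iff.mpr fun x _ => (hN x).mpr ((isNilp_iff hM x.2).mpr ⟨1, ?_⟩)
    rw [pow_one, ← one_mul (ecls _), h0, zero_mul]
  subst this
  rw [Module.finrank_zero_of_subsingleton] at hN'
  exact zero_ne_one hN'

theorem CommLocal.exists_isNilpotent {M : ModData A.toCatData R} (h : CommLocal M)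
    (hM : M.HasDeg) (x : HEnd M) : ∃ a : R, IsNilpotent (x - algebraMap R (HEnd M) a) := by
  obtain ⟨x, hx, rfl⟩ := ecls_toB_surjective hM x
  obtain ⟨N, hN, hN'⟩ := h.codim_one
  let e : Cocycles M M 0 := ⟨idHom M, idHom_mem_Cocycles hM⟩
  have he : N.mkQ e ≠ 0 := by
    intro h0
    have h1 := (isNilp_iff hM e.2).mp ((hN e).mp ((Submodule.Quotient.mk_eq_zero N).mp h0))
    rw [ecls_idHom hM] at h1
    have : Nontrivial (HEnd M) := nontrivial_of_ne _ _ (h.one_ne_zero hM)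
    exact not_isNilpotent_one h1
  obtain ⟨a, ha⟩ := (finrank_eq_one_iff_of_nonzero' _ he).mp hN' (N.mkQ ⟨x, hx⟩)
  refine ⟨a, ?_⟩
  rw [← map_smul, ← sub_eq_zero, ← map_sub, Submodule.mkQ_apply, Submodule.Quotient.mk_eq_zero,
    ← N.neg_mem_iff, neg_sub] at ha
  have h1 := (isNilp_iff hM (Subtype.property _)).mp ((hN _).mp ha)
  rw [Algebra.algebraMap_eq_smul_one, ← ecls_idHom hM, ecls_sub_smul]
  have e' : toB 0 (x - a • idHom M) = toB 0 x - a • toB 0 (idHom M) := by rw [toB_sub, toB_smul]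
  rwa [ecls_congr _ _ e'] at h1

end Local

end AInf

namespace AInf

/-! ### Points on a smooth curve -/

section Param

variable {B : Type u} [CommRing B]

/-- The function `t` generates the maximal ideal `𝔪` after inverting `b ∉ 𝔪`. Recording the
denominator `b` avoids passing to the local ring. -/
structure IsParam (𝔪 : Ideal B) (t b : B) : Prop where
  mem : t ∈ 𝔪
  notMem : b ∉ 𝔪
  dvd : ∀ x ∈ 𝔪, t ∣ b * x

variable {𝔪 : Ideal B}

theorem IsParam.pow_dvd {t b : B} (h : IsParam 𝔪 t b) {k : ℕ} {x : B} (hx : x ∈ 𝔪 ^ k) :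
    t ^ k ∣ b ^ k * x := by
  induction k generalizing x with
  | zero => simp
  | succ k ih =>
    rw [pow_succ'] at hx
    refine Submodule.mul_induction_on hx (fun m hm n hn => ?_) fun x y hx hy => ?_
    · obtain ⟨c, hc⟩ := h.dvd m hm
      obtain ⟨d, hd⟩ := ih hn
      exact ⟨c * d, by linear_combination b ^ k * n * hc + t * c * hd⟩
    · rw [mul_add]
      exact dvd_add hx hy

variable [h𝔪 : 𝔪.IsMaximal]

theorem mem_pow_of_mul_mem {a x : B} (ha : a ∉ 𝔪) {k : ℕ} (h : a * x ∈ 𝔪 ^ k) : x ∈ 𝔪 ^ k := by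
  induction k with
  | zero => simp
  | succ k ih =>
    obtain ⟨r, m, hm, hr⟩ := Ideal.IsMaximal.exists_inv h𝔪 ha
    have hx := ih (Ideal.pow_le_pow_right (Nat.le_succ k) h)
    have e : x = r * (a * x) + m * x := by linear_combination (-x) * hr
    rw [e]
    exact add_mem (Ideal.mul_mem_left _ _ h) (pow_succ' 𝔪 k ▸ Ideal.mul_mem_mul hm hx)

theorem exists_order [IsNoetherianRing B] [IsDomain B] {x : B} (hx : x ≠ 0) :
    ∃ k, x ∈ 𝔪 ^ k ∧ x ∉ 𝔪 ^ (k + 1) := by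
  classical
  have h : ∃ k, x ∉ 𝔪 ^ k := by
    by_contra! h
    refine hx ?_
    rw [← Ideal.mem_bot, ← Ideal.iInf_pow_eq_bot_of_isDomain 𝔪 h𝔪.ne_top, Ideal.mem_iInf]
    exact h
  obtain ⟨k, hk⟩ : ∃ k, Nat.find h = k + 1 := Nat.exists_eq_succ_of_ne_zero fun h0 => by
    have := Nat.find_spec h
    rw [h0] at this
    simp at this
  exact ⟨k, not_not.mp (Nat.find_min h (by omega)), hk ▸ Nat.find_spec h⟩

theorem IsParam.exists_eq [IsNoetherianRing B] [IsDomain B] {t b : B} (h : IsParam 𝔪 t b) {x : B}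
    (hx : x ≠ 0) : ∃ k, ∃ u ∉ 𝔪, b ^ k * x = t ^ k * u := by
  obtain ⟨k, h₁, h₂⟩ := exists_order (𝔪 := 𝔪) hx
  obtain ⟨u, hu⟩ := h.pow_dvd h₁
  refine ⟨k, u, fun hm => h₂ ?_, hu⟩
  refine mem_pow_of_mul_mem (a := b ^ k) (fun hb => h.notMem (h𝔪.isPrime.mem_of_pow_mem k hb)) ?_
  rw [hu, pow_succ]
  exact Ideal.mul_mem_mul (Ideal.pow_mem_pow h.mem k) hm

/-- In characteristic zero, nonzero differential ideals are not contained in a maximal ideal at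
which the derivation does not vanish: the order of vanishing of the elements could be lowered. -/
theorem IsParam.not_le_of_stable {R : Type u} [Field R] [CharZero R] [Algebra R B]
    [IsNoetherianRing B] [IsDomain B]
    {t b : B} (h : IsParam 𝔪 t b) (d : Derivation R B B) (ht : d t ∉ 𝔪) {I : Ideal B}
    (hI : I ≠ ⊥) (hd : ∀ x ∈ I, d x ∈ I) : ¬ I ≤ 𝔪 := by
  intro hle
  obtain ⟨x, hx, hx0⟩ := Submodule.exists_mem_ne_zero_of_ne_bot hI
  have key : ∀ k, ∀ u ∉ 𝔪, t ^ k * u ∉ I := by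
    intro k
    induction k with
    | zero =>
      intro u hu hI
      exact hu (hle (by simpa using hI))
    | succ k ih =>
      intro u hu hmem
      -- `d (t ^ (k + 1) u) = t ^ k ((k + 1) d t u + t d u)`, and the bracket is not in `𝔪`.
      refine ih ((k + 1 : ℕ) * d t * u + t * d u) (fun hm => ?_) ?_
      · have h₁ : ((k + 1 : ℕ) : B) * d t * u ∈ 𝔪 := by
          have := 𝔪.sub_mem hm (𝔪.mul_mem_right (d u) h.mem)
          rwa [add_sub_cancel_right] at this
        have h₂ : ((k + 1 : ℕ) : B) ∉ 𝔪 := by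
          intro hk
          refine h𝔪.ne_top (Ideal.eq_top_of_isUnit_mem _ hk ?_)
          have : ((k + 1 : ℕ) : B) = algebraMap R B ((k + 1 : ℕ) : R) := by simp
          rw [this]
          exact (IsUnit.mk0 _ (Nat.cast_ne_zero.mpr (Nat.succ_ne_zero k))).map _
        rcases h𝔪.isPrime.mem_or_mem h₁ with h | h
        · rcases h𝔪.isPrime.mem_or_mem h with h | h
          · exact h₂ h
          · exact ht h
        · exact hu h
      · have := hd _ hmem
        rw [d.leibniz, d.leibniz_pow, smul_eq_mul, smul_eq_mul] at this
        convert this using 1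
        simp only [Nat.add_sub_cancel, nsmul_eq_mul, smul_eq_mul]
        ring
  obtain ⟨k, u, hu, e⟩ := h.exists_eq hx0
  exact key k u hu (e ▸ I.mul_mem_left _ hx)

end Param

section Curve

variable {R : Type u} [Field R] {B : Type u} [CommRing B] [Algebra R B]

instance ker_isMaximal (s : B →ₐ[R] R) : (RingHom.ker s).IsMaximal :=
  RingHom.ker_isMaximal_of_surjective s fun c => ⟨algebraMap R B c, by simp⟩

theorem sub_mem_ker (s : B →ₐ[R] R) (f : B) : f - algebraMap R B (s f) ∈ RingHom.ker s := by
  simp [RingHom.mem_ker]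

/-- Derivations with prescribed first order behaviour at a point. -/
theorem exists_derivation [Module.Projective B Ω[B⁄R]] (s : B →ₐ[R] R) {N : Ideal B}
    (hN : RingHom.ker s ^ 2 ≤ N) {x : B} (hx : x ∈ RingHom.ker s) (hxN : x ∉ N) :
    ∃ ξ : Ω[B⁄R] →ₗ[B] B, ξ (KaehlerDifferential.D R B x) ∉ RingHom.ker s ∧
      ∀ y ∈ N, y ∈ RingHom.ker s → ξ (KaehlerDifferential.D R B y) ∈ RingHom.ker s := by
  obtain ⟨μ, hμx, hμ⟩ := Submodule.exists_dual_map_eq_bot_of_notMem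
    (p := N.restrictScalars R) (x := x) hxN inferInstance
  have hμN : ∀ y ∈ N, μ y = 0 := fun y hy => by
    have : μ y ∈ (N.restrictScalars R).map μ := ⟨y, hy, rfl⟩
    rwa [hμ, Submodule.mem_bot] at this
  -- A functional on `ker s` which vanishes on its square defines a derivation into the residue
  -- field, which lifts to a vector field as `Ω` is projective.
  let δ : Derivation R B (B ⧸ RingHom.ker s) := Derivation.mk'
    { toFun := fun f => Ideal.Quotient.mk _ (algebraMap R B (μ (f - algebraMap R B (s f))))
      map_add' := fun f g => by
        rw [← map_add, ← map_add, ← map_add]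
        congr 3
        simp only [map_add]
        ring
      map_smul' := fun c f => by
        have : c • f - algebraMap R B (s (c • f)) = c • (f - algebraMap R B (s f)) := by
          simp only [Algebra.smul_def, map_mul, s.commutes, Algebra.algebraMap_self,
            RingHom.id_apply]
          ring
        rw [this, map_smul, smul_eq_mul, map_mul, map_mul]
        simp [Algebra.smul_def] } (by
      intro f g
      have hs : ∀ f : B, (Ideal.Quotient.mk (RingHom.ker s)) f =
          Ideal.Quotient.mk _ (algebraMap R B (s f)) :=
        fun f => Ideal.Quotient.eq.mpr (sub_mem_ker s f)
      have e : f * g - algebraMap R B (s (f * g)) =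
          (f - algebraMap R B (s f)) * (g - algebraMap R B (s g)) +
          (s f • (g - algebraMap R B (s g)) + s g • (f - algebraMap R B (s f))) := by
        simp only [map_mul, Algebra.smul_def]
        ring
      have h0 : (f - algebraMap R B (s f)) * (g - algebraMap R B (s g)) ∈ N :=
        hN (sq (RingHom.ker s) ▸ Ideal.mul_mem_mul (sub_mem_ker s f) (sub_mem_ker s g))
      have e' : μ (f * g - algebraMap R B (s (f * g))) =
          s f * μ (g - algebraMap R B (s g)) + s g * μ (f - algebraMap R B (s f)) := by
        rw [e, map_add, hμN _ h0, zero_add, map_add, map_smul, map_smul, smul_eq_mul, smul_eq_mul]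
      simp only [LinearMap.coe_mk, AddHom.coe_mk]
      rw [e']
      simp only [map_add, map_mul, Algebra.smul_def,
        Ideal.Quotient.algebraMap_eq, hs f, hs g])
  obtain ⟨ξ, hξ⟩ := Module.projective_lifting_property (RingHom.ker s).mkQ
    δ.liftKaehlerDifferential (Submodule.mkQ_surjective _)
  have hval : ∀ y ∈ RingHom.ker s, (Ideal.Quotient.mk (RingHom.ker s))
      (ξ (KaehlerDifferential.D R B y)) = Ideal.Quotient.mk _ (algebraMap R B (μ y)) := by
    intro y hy
    have h := LinearMap.congr_fun hξ (KaehlerDifferential.D R B y)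
    rw [Derivation.liftKaehlerDifferential_comp_D] at h
    refine h.trans ?_
    change Ideal.Quotient.mk _ (algebraMap R B (μ (y - algebraMap R B (s y)))) = _
    rw [RingHom.mem_ker] at hy
    rw [hy, map_zero, sub_zero]
  refine ⟨ξ, fun h => hμx ?_, fun y hy hy' => ?_⟩
  · have h' := hval x hx
    rw [Ideal.Quotient.eq_zero_iff_mem.mpr h, eq_comm, Ideal.Quotient.eq_zero_iff_mem] at h'
    simpa [RingHom.mem_ker] using h'
  · have h' := hval y hy'
    rw [hμN y hy, map_zero, map_zero] at h'
    exact Ideal.Quotient.eq_zero_iff_mem.mp h'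

/-- A derivation which kills a subring over which everything is algebraic vanishes. -/
theorem derivation_eq_zero [CharZero R] [IsDomain B] {S : Type*} [CommRing S] [Algebra S B]
    (hinj : Function.Injective (algebraMap S B)) (hint : Algebra.IsIntegral S B)
    (d : Derivation R B B) (hd : ∀ c : S, d (algebraMap S B c) = 0) (y : B) : d y = 0 := by
  classical
  have : IsDomain S := hinj.isDomain _
  have : CharZero B := charZero_of_injective_algebraMap (algebraMap R B).injective
  have : CharZero S := ⟨fun m n h => by
    have := congrArg (algebraMap S B) h
    simpa using this⟩
  let d' : Derivation S B B := Derivation.mk'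
    { toFun := d
      map_add' := map_add d
      map_smul' := fun c x => by
        rw [Algebra.smul_def, d.leibniz, hd, smul_zero, add_zero, smul_eq_mul, Algebra.smul_def]
        rfl } d.leibniz
  obtain ⟨p, hp, hpy⟩ := hint.isIntegral y
  have hex : ∃ n, ∃ p : Polynomial S, p ≠ 0 ∧ Polynomial.aeval y p = 0 ∧ p.natDegree = n :=
    ⟨_, p, hp.ne_zero, hpy, rfl⟩
  -- For a polynomial relation `q(y) = 0` of minimal degree, `q'(y) d y = 0` and `q'(y) ≠ 0`.
  obtain ⟨q, hq, hqy, hqn⟩ := Nat.find_spec hex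
  have hdeg : q.natDegree ≠ 0 := by
    intro h0
    rw [Polynomial.eq_C_of_natDegree_eq_zero h0, Polynomial.aeval_C] at hqy
    have := (map_eq_zero_iff _ hinj).mp hqy
    refine hq ?_
    rw [Polynomial.eq_C_of_natDegree_eq_zero h0, this, Polynomial.C_0]
  have hder : Polynomial.derivative q ≠ 0 := fun h0 =>
    hdeg (Polynomial.derivative_eq_zero.mp h0)
  have hne : Polynomial.aeval y (Polynomial.derivative q) ≠ 0 := fun h0 =>
    Nat.find_min hex (m := (Polynomial.derivative q).natDegree)
      (hqn ▸ Polynomial.natDegree_derivative_lt hdeg) ⟨_, hder, h0, rfl⟩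
  have h := d'.map_aeval q y
  rw [hqy, map_zero, smul_eq_mul] at h
  exact (mul_eq_zero.mp h.symm).resolve_left hne

/-- Derivations on a curve are determined by their value on one function, namely the coordinate of
a Noether normalization. -/
theorem exists_determining [CharZero R] [IsDomain B] [Algebra.FiniteType R B]
    (hB : ringKrullDim B = 1) : ∃ x : B, ∀ d : Derivation R B B, d x = 0 → ∀ y, d y = 0 := by
  obtain ⟨n, g, hinj, hint⟩ := exists_integral_inj_algHom_of_fg R B
  let _ : Algebra (MvPolynomial (Fin n) R) B := g.toRingHom.toAlgebra
  have hint' : Algebra.IsIntegral (MvPolynomial (Fin n) R) B := ⟨hint⟩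
  have hn : n ≤ 1 := by
    have hle : ringKrullDim (MvPolynomial (Fin n) R) ≤ ringKrullDim B := by
      refine iSup_le fun l => ?_
      obtain ⟨P, hP⟩ : ∃ P : Ideal B, P.IsPrime ∧ P.LiesOver l.head.asIdeal := by
        obtain ⟨P, _, hP, hP'⟩ := Ideal.exists_ideal_over_prime_of_isIntegral
          (S := B) l.head.asIdeal (⊥ : Ideal B) (by
            have : Ideal.comap (algebraMap (MvPolynomial (Fin n) R) B) ⊥ = ⊥ :=
              (RingHom.injective_iff_ker_eq_bot _).mp hinj
            rw [this]
            exact bot_le)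
        exact ⟨P, hP, ⟨hP'.symm⟩⟩
      have := hP.1
      have := hP.2
      obtain ⟨L, hL, -⟩ := Ideal.exists_ltSeries_of_hasGoingUp l P
      exact le_iSup_of_le L (by rw [hL])
    rw [MvPolynomial.ringKrullDim_of_isNoetherianRing, hB, ringKrullDim_eq_zero_of_field,
      zero_add, Nat.card_eq_fintype_card, Fintype.card_fin] at hle
    exact_mod_cast hle
  have hgen : ∀ d : Derivation R B B, (∀ i, d (g (MvPolynomial.X i)) = 0) → ∀ y, d y = 0 := by
    intro d hd
    refine derivation_eq_zero hinj hint' d fun c => ?_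
    change d (g c) = 0
    induction c using MvPolynomial.induction_on with
    | C a => rw [← MvPolynomial.algebraMap_eq, g.commutes, d.map_algebraMap]
    | add p q hp hq => rw [map_add, map_add, hp, hq, add_zero]
    | mul_X p i hp => rw [map_mul, d.leibniz, hp, hd, smul_zero, smul_zero, add_zero]
  interval_cases n
  · exact ⟨0, fun d _ => hgen d fun i => i.elim0⟩
  · exact ⟨g (MvPolynomial.X 0), fun d h => hgen d fun i => by rwa [Subsingleton.elim i 0]⟩

/-- At each point of a smooth curve there is a local parameter, with nonzero derivative along a
suitable vector field. -/
theorem exists_isParam [CharZero R] [IsDomain B] [Algebra.Smooth R B]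
    (hB : ringKrullDim B = 1) (s : B →ₐ[R] R) :
    ∃ (t b : B) (ξ : Ω[B⁄R] →ₗ[B] B), IsParam (RingHom.ker s) t b ∧
      ξ (KaehlerDifferential.D R B t) ∉ RingHom.ker s := by
  have hnoeth : IsNoetherianRing B := Algebra.FiniteType.isNoetherianRing R B
  set 𝔪 := RingHom.ker s with hm
  -- If `𝔪 = 𝔪 ^ 2`, then `𝔪 = 0` by Nakayama's lemma, and `B` is a field.
  have h₁ : ∃ t ∈ 𝔪, t ∉ 𝔪 ^ 2 := by
    by_contra! h
    obtain ⟨r, hr, h0⟩ := Submodule.exists_sub_one_mem_and_smul_eq_zero_of_fg_of_le_smul 𝔪 𝔪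
      (IsNoetherian.noetherian 𝔪) (by rw [smul_eq_mul, ← sq]; exact h)
    have hr0 : r ≠ 0 := by
      rintro rfl
      refine (ker_isMaximal s).ne_top (Ideal.eq_top_of_isUnit_mem _ hr ?_)
      simp
    have hbot : 𝔪 = ⊥ := by
      rw [eq_bot_iff]
      exact fun n hn => (mul_eq_zero.mp (h0 n hn)).resolve_left hr0
    have hf : IsField B := by
      rw [Ring.isField_iff_maximal_bot]
      exact hbot ▸ ker_isMaximal s
    let _ := hf.toField
    rw [ringKrullDim_eq_zero_of_field] at hB
    exact zero_ne_one hB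
  obtain ⟨t, ht, ht2⟩ := h₁
  obtain ⟨ξ, hξ, hξN⟩ := exists_derivation s (N := 𝔪 ^ 2) le_rfl ht ht2
  obtain ⟨x, hx⟩ := exists_determining (R := R) hB
  -- A function `y ∈ 𝔪` independent of `t` modulo `𝔪 ^ 2` would give a second vector field `η`,
  -- linearly independent of `ξ`. But all derivations are proportional to each other.
  have h₂ : 𝔪 ≤ Ideal.span {t} ⊔ 𝔪 ^ 2 := by
    intro y hy
    by_contra hyN
    obtain ⟨η, hη, hηN⟩ := exists_derivation s (N := Ideal.span {t} ⊔ 𝔪 ^ 2) le_sup_right hy hyN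
    have hηt := hηN t (Ideal.mem_sup_left (Ideal.mem_span_singleton_self t)) ht
    let dξ : Derivation R B B := ξ.compDer (KaehlerDifferential.D R B)
    let dη : Derivation R B B := η.compDer (KaehlerDifferential.D R B)
    have hrel : ∀ z, dη x * dξ z = dξ x * dη z := fun z => by
      have := hx (dη x • dξ - dξ x • dη) (by
        simp only [Derivation.sub_apply, Derivation.smul_apply, smul_eq_mul]
        ring) z
      simp only [Derivation.sub_apply, Derivation.smul_apply, smul_eq_mul] at this
      exact sub_eq_zero.mp this
    have hdet : dξ t * dη y - dξ y * dη t ∉ 𝔪 := fun hmem => by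
      have h3 : dξ t * dη y ∈ 𝔪 := by
        have := 𝔪.add_mem hmem (𝔪.mul_mem_left (dξ y) hηt)
        simpa [dη] using this
      rcases (ker_isMaximal s).isPrime.mem_or_mem h3 with h | h
      · exact hξ h
      · exact hη h
    have hdet0 : dξ t * dη y - dξ y * dη t ≠ 0 := fun h => hdet (h ▸ 𝔪.zero_mem)
    have hξx : dξ x = 0 := by
      by_contra h0
      refine hdet0 ((mul_eq_zero.mp (?_ : dξ x * _ = 0)).resolve_left h0)
      linear_combination (dξ y) * (hrel t) - (dξ t) * (hrel y)
    exact hξ (by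
      have := hx dξ hξx t
      change dξ t ∈ 𝔪
      rw [this]
      exact 𝔪.zero_mem)
  obtain ⟨b, hb, hbm⟩ := Submodule.exists_sub_one_mem_and_smul_le_of_fg_of_le_sup (I := 𝔪)
    (N := Ideal.span {t}) (N' := 𝔪) (P := 𝔪) (IsNoetherian.noetherian 𝔪) le_rfl
    (by rw [smul_eq_mul, ← sq]; exact h₂)
  refine ⟨t, b, ξ, ⟨ht, fun h => ?_, fun y hy => ?_⟩, hξ⟩
  · refine (ker_isMaximal s).ne_top ((Ideal.eq_top_iff_one _).mpr ?_)
    have := 𝔪.sub_mem h hb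
    rwa [sub_sub_cancel] at this
  · exact Ideal.mem_span_singleton.mp (hbm (Submodule.smul_mem_pointwise_smul y b 𝔪 hy))

end Curve
end AInf

namespace AInf

/-! ### Modules with a connection over a curve -/

section Conn

variable {B : Type u} [CommRing B] {𝔪 : Ideal B}

/-- The additive endomorphism `D` is a connection along the derivation `d`. -/
def IsLeibniz {R : Type u} [CommRing R] [Algebra R B] (d : Derivation R B B) {E : Type u}
    [AddCommGroup E] [Module B E] (D : E →+ E) : Prop :=
  ∀ (f : B) (x : E), D (f • x) = f • D x + d f • x

variable {R : Type u} [Field R] [CharZero R] [Algebra R B] [IsDomain B] [IsNoetherianRing B]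
  {E : Type u} [AddCommGroup E] [Module B E] [Module.Finite B E]

/-- The torsion of a finitely generated module with connection is not supported at a point at which
the vector field does not vanish. -/
theorem IsParam.exists_kills_torsion [𝔪.IsMaximal] {t b : B} (h : IsParam 𝔪 t b)
    {d : Derivation R B B} (ht : d t ∉ 𝔪) {D : E →+ E} (hD : IsLeibniz d D) :
    ∃ c ∉ 𝔪, ∀ (a : B) (x : E), a ≠ 0 → a • x = 0 → c • x = 0 := by
  let I : Ideal B := (Submodule.torsion B E).annihilator
  have hI : I ≠ ⊥ := by
    intro h0
    have h1 := Submodule.annihilator_top_inter_nonZeroDivisors (R := B)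
      (M := Submodule.torsion B E) (Submodule.torsion_isTorsion)
    obtain ⟨r, hr, hr'⟩ := h1
    have : r ∈ I := Submodule.mem_annihilator.mpr fun x hx => by
      have := Submodule.mem_annihilator.mp hr ⟨x, hx⟩ trivial
      exact congrArg Subtype.val this
    rw [h0, Submodule.mem_bot] at this
    exact nonZeroDivisors.ne_zero hr' this
  have hst : ∀ x ∈ I, d x ∈ I := by
    intro f hf
    rw [Submodule.mem_annihilator] at hf ⊢
    intro x hx
    have hDx : D x ∈ Submodule.torsion B E := by
      obtain ⟨a, ha⟩ := hx
      refine ⟨a * a, ?_⟩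
      have h1 := hD a x
      change (a : B) • x = 0 at ha
      rw [ha, map_zero] at h1
      change ((a : B) * a) • D x = 0
      have h2 := congrArg ((a : B) • ·) h1
      simp only [smul_zero, smul_add, smul_comm (a : B) (d a), ha, add_zero] at h2
      rw [mul_smul]
      exact h2.symm
    have h1 := hD f x
    rw [hf x hx, hf _ hDx, map_zero, zero_add] at h1
    exact h1.symm
  obtain ⟨c, hc, hc'⟩ := Set.not_subset.mp (h.not_le_of_stable d ht hI hst)
  exact ⟨c, hc', fun a x ha hx => Submodule.mem_annihilator.mp hc x
    ⟨⟨a, mem_nonZeroDivisors_of_ne_zero ha⟩, hx⟩⟩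

/-- A submodule which is stable under a connection, and which is everything at one point, is
everything at any other point at which the vector field does not vanish. -/
theorem IsParam.exists_smul_mem [𝔪.IsMaximal] {t b : B} (h : IsParam 𝔪 t b)
    {d : Derivation R B B} (ht : d t ∉ 𝔪) {D : E →+ E} (hD : IsLeibniz d D) {J : Submodule B E}
    (hJ : ∀ x ∈ J, D x ∈ J) {𝔫 : Ideal B} (h𝔫 : 𝔫 ≠ ⊤) (hn : ⊤ ≤ J ⊔ 𝔫 • (⊤ : Submodule B E)) :
    ∃ c ∉ 𝔪, ∀ x : E, c • x ∈ J := by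
  obtain ⟨r, hr, hrJ⟩ := Submodule.exists_sub_one_mem_and_smul_le_of_fg_of_le_sup
    (I := 𝔫) (N := J) (N' := ⊤) (P := ⊤) Module.Finite.fg_top le_rfl hn
  let I : Ideal B := J.colon Set.univ
  have hmem : ∀ c, c ∈ I ↔ ∀ x, c • x ∈ J := fun c => by
    simp [I, Submodule.mem_colon]
  have hrI : r ∈ I := (hmem r).mpr fun x =>
    hrJ (Submodule.smul_mem_pointwise_smul x r ⊤ trivial)
  have hI : I ≠ ⊥ := by
    intro h0
    rw [h0, Submodule.mem_bot] at hrI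
    rw [hrI, zero_sub, neg_mem_iff] at hr
    exact h𝔫 ((Ideal.eq_top_iff_one _).mpr hr)
  have hst : ∀ x ∈ I, d x ∈ I := by
    intro f hf
    rw [hmem] at hf ⊢
    intro x
    have h1 := hD f x
    have h2 : d f • x = D (f • x) - f • D x := by rw [h1]; abel
    rw [h2]
    exact J.sub_mem (hJ _ (hf x)) (hf _)
  obtain ⟨c, hc, hc'⟩ := Set.not_subset.mp (h.not_le_of_stable d ht hI hst)
  exact ⟨c, hc', (hmem c).mp hc⟩

end Conn

section QuasiBasis

variable {B : Type u} [CommRing B] (𝔪 : Ideal B) (E : Type u) [AddCommGroup E] [Module B E]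

/-- A basis of a module after inverting a function `c` which does not vanish at a point: `ι` and `κ`
are inverse to each other up to multiplication with `c`. -/
structure QuasiBasis where
  n : ℕ
  ι : (Fin n → B) →ₗ[B] E
  κ : E →ₗ[B] (Fin n → B)
  c : B
  hc : c ∉ 𝔪
  ικ : ∀ x, ι (κ x) = c • x
  κι : ∀ v, κ (ι v) = c • v

variable {𝔪 E}

theorem QuasiBasis.c_ne (e : QuasiBasis 𝔪 E) : e.c ≠ 0 := fun h => e.hc (h ▸ 𝔪.zero_mem)

/-- A finitely generated module without torsion at a point is free near that point. -/
theorem IsParam.nonempty_quasiBasis [𝔪.IsMaximal] [IsDomain B] [IsNoetherianRing B]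
    [Module.Finite B E] {t b : B} (h : IsParam 𝔪 t b) {a : B} (ha : a ∉ 𝔪)
    (hE : ∀ (f : B) (x : E), f ≠ 0 → f • x = 0 → a • x = 0) : Nonempty (QuasiBasis 𝔪 E) := by
  classical
  let P : Submodule B E := 𝔪 • ⊤
  let _ := Ideal.Quotient.field 𝔪
  have hfin : Module.Finite (B ⧸ 𝔪) (E ⧸ P) := Module.Finite.of_restrictScalars_finite B _ _
  let β := Module.finBasis (B ⧸ 𝔪) (E ⧸ P)
  set n := Module.finrank (B ⧸ 𝔪) (E ⧸ P)
  choose e he using fun i => Submodule.Quotient.mk_surjective P (β i)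
  let ι : (Fin n → B) →ₗ[B] E := Fintype.linearCombination B e
  have hι : ∀ v, ι v = ∑ i, v i • e i := fun v => Fintype.linearCombination_apply B e v
  have hmod : ∀ v, ι v ∈ P → ∀ i, v i ∈ 𝔪 := by
    intro v hv i
    have h1 : ∑ i, (Ideal.Quotient.mk 𝔪 (v i)) • β i = 0 := by
      rw [← (Submodule.Quotient.mk_eq_zero P).mpr hv, hι, ← Submodule.mkQ_apply, map_sum]
      refine Finset.sum_congr rfl fun j _ => ?_
      rw [← he]
      rfl
    exact Ideal.Quotient.eq_zero_iff_mem.mp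
      (Fintype.linearIndependent_iff.mp β.linearIndependent _ h1 i)
  -- The coefficients of a relation can be divided by their greatest common power of `t`, since
  -- there is no torsion. But the `e i` are linearly independent at the point.
  have hinj : Function.Injective ι := by
    rw [injective_iff_map_eq_zero]
    intro v hv
    by_contra hv0
    have hex : ∃ k, ∃ i, v i ∉ 𝔪 ^ (k + 1) := by
      obtain ⟨i, hi⟩ := Function.ne_iff.mp hv0
      obtain ⟨k, -, hk⟩ := exists_order (𝔪 := 𝔪) hi
      exact ⟨k, i, hk⟩
    have hall : ∀ i, v i ∈ 𝔪 ^ Nat.find hex := by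
      intro i
      rcases Nat.eq_zero_or_pos (Nat.find hex) with h0 | h0
      · simp [h0]
      · have := Nat.find_min hex (m := Nat.find hex - 1) (by omega)
        push Not at this
        simpa only [Nat.sub_add_cancel h0] using this i
    obtain ⟨i, hi⟩ := Nat.find_spec hex
    generalize Nat.find hex = k at hall hi
    choose u hu using fun i => h.pow_dvd (hall i)
    have hui : u i ∉ 𝔪 := by
      intro hm
      refine hi (mem_pow_of_mul_mem (a := b ^ k)
        (fun hb => h.notMem (Ideal.IsPrime.mem_of_pow_mem inferInstance k hb)) ?_)
      rw [hu, pow_succ]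
      exact Ideal.mul_mem_mul (Ideal.pow_mem_pow h.mem k) hm
    have ht0 : t ^ k ≠ 0 := by
      rcases Nat.eq_zero_or_pos k with h0 | h0
      · simp [h0]
      · intro h0'
        have hb0 : b ^ k ≠ 0 := pow_ne_zero _ fun hb => h.notMem (hb ▸ 𝔪.zero_mem)
        refine hv0 (funext fun j => ?_)
        have := hu j
        rw [h0', zero_mul] at this
        exact (mul_eq_zero.mp this).resolve_left hb0
    have h1 : t ^ k • ι u = 0 := by
      rw [← map_smul, show t ^ k • u = b ^ k • v from funext fun j => (hu j).symm, map_smul, hv,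
        smul_zero]
    have h2 := hE _ _ ht0 h1
    rw [← map_smul] at h2
    have h3 := hmod (a • u) (h2 ▸ P.zero_mem) i
    exact (Ideal.IsPrime.mem_or_mem inferInstance h3).elim ha hui
  have hspan : (⊤ : Submodule B E) ≤ LinearMap.range ι ⊔ P := by
    intro x _
    have h1 := β.sum_repr (Submodule.Quotient.mk x)
    choose v hv using fun i => Ideal.Quotient.mk_surjective (β.repr (Submodule.Quotient.mk x) i)
    have h2 : x - ι v ∈ P := by
      rw [← Submodule.Quotient.mk_eq_zero, Submodule.Quotient.mk_sub, sub_eq_zero, ← h1, hι]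
      refine Eq.trans ?_ (map_sum P.mkQ _ _).symm
      refine Finset.sum_congr rfl fun j _ => ?_
      rw [← hv, ← he]
      rfl
    rw [show x = ι v + (x - ι v) by abel]
    exact Submodule.add_mem_sup ⟨v, rfl⟩ h2
  obtain ⟨c, hc, hcr⟩ := Submodule.exists_sub_one_mem_and_smul_le_of_fg_of_le_sup
    (I := 𝔪) (N := LinearMap.range ι) (N' := ⊤) (P := ⊤) Module.Finite.fg_top le_rfl hspan
  have hcm : c ∉ 𝔪 := fun hm => Ideal.IsPrime.ne_top' ((Ideal.eq_top_iff_one 𝔪).mpr (by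
    have := 𝔪.sub_mem hm hc
    rwa [sub_sub_cancel] at this))
  let eq := LinearEquiv.ofInjective ι hinj
  have hmem : ∀ x : E, c • x ∈ LinearMap.range ι := fun x =>
    hcr (Submodule.smul_mem_pointwise_smul x c ⊤ trivial)
  let κ : E →ₗ[B] (Fin n → B) := eq.symm.toLinearMap ∘ₗ
    LinearMap.codRestrict (LinearMap.range ι) (c • LinearMap.id) hmem
  have hικ : ∀ x, ι (κ x) = c • x := fun x =>
    congrArg Subtype.val (eq.apply_symm_apply ⟨c • x, hmem x⟩)
  exact ⟨⟨n, ι, κ, c, hcm, hικ, fun v => hinj (by rw [hικ, map_smul])⟩⟩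

namespace QuasiBasis

/-- The trace, multiplied with the denominator `c`. -/
def tr (e : QuasiBasis 𝔪 E) (φ : E →ₗ[B] E) : B :=
  LinearMap.trace B (Fin e.n → B) (e.κ ∘ₗ φ ∘ₗ e.ι)

theorem tr_add (e : QuasiBasis 𝔪 E) (φ ψ : E →ₗ[B] E) : e.tr (φ + ψ) = e.tr φ + e.tr ψ := by
  simp [tr, LinearMap.add_comp, LinearMap.comp_add]

theorem tr_smul (e : QuasiBasis 𝔪 E) (a : B) (φ : E →ₗ[B] E) : e.tr (a • φ) = a * e.tr φ := by
  simp [tr, LinearMap.smul_comp, LinearMap.comp_smul]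

theorem tr_id [Nontrivial B] (e : QuasiBasis 𝔪 E) : e.tr LinearMap.id = e.c * e.n := by
  have h : e.κ ∘ₗ LinearMap.id ∘ₗ e.ι = e.c • LinearMap.id := LinearMap.ext e.κι
  rw [tr, h, map_smul, LinearMap.trace_id, smul_eq_mul, Module.finrank_fin_fun]

theorem tr_apply (e : QuasiBasis 𝔪 E) (φ : E →ₗ[B] E) :
    e.tr φ = ∑ j, e.κ (φ (e.ι (Pi.single j 1))) j := by
  rw [tr, LinearMap.trace_eq_matrix_trace B (Pi.basisFun B (Fin e.n)), Matrix.trace]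
  refine Finset.sum_congr rfl fun j _ => ?_
  rw [Matrix.diag_apply, LinearMap.toMatrix_apply, Pi.basisFun_apply, Pi.basisFun_repr]
  rfl

/-- The trace is independent of the choice of basis, up to the denominators. -/
theorem tr_eq [IsDomain B] {𝔫 : Ideal B} (e : QuasiBasis 𝔪 E) (e' : QuasiBasis 𝔫 E)
    (φ : E →ₗ[B] E) : e.c * e'.tr φ = e'.c * e.tr φ := by
  have h₁ : e.c • (e'.κ ∘ₗ φ ∘ₗ e'.ι) = (e'.κ ∘ₗ φ ∘ₗ e.ι) ∘ₗ (e.κ ∘ₗ e'.ι) :=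
    LinearMap.ext fun v => by simp [e.ικ]
  have h₂ : e'.c • (e.κ ∘ₗ φ ∘ₗ e.ι) = (e.κ ∘ₗ e'.ι) ∘ₗ (e'.κ ∘ₗ φ ∘ₗ e.ι) :=
    LinearMap.ext fun v => by simp [e'.ικ]
  rw [tr, tr, ← smul_eq_mul, ← smul_eq_mul, ← map_smul, ← map_smul, h₁, h₂,
    LinearMap.trace_comp_comm']

theorem n_eq [IsDomain B] [CharZero B] {𝔫 : Ideal B} (e : QuasiBasis 𝔪 E) (e' : QuasiBasis 𝔫 E) :
    e.n = e'.n := by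
  have h := tr_eq e e' LinearMap.id
  rw [tr_id, tr_id, mul_left_comm] at h
  exact_mod_cast (mul_left_cancel₀ e.c_ne (mul_left_cancel₀ e'.c_ne h)).symm

theorem c_mul_trace (e : QuasiBasis 𝔪 E) {k : Type u} [Field k] [Algebra B k]
    [Module.Finite k (k ⊗[B] E)] (φ : E →ₗ[B] E) :
    algebraMap B k e.c * LinearMap.trace k (k ⊗[B] E) (φ.baseChange k) =
      algebraMap B k (e.tr φ) := by
  have h₁ : (e.c • φ) = e.ι ∘ₗ (e.κ ∘ₗ φ) := LinearMap.ext fun x => by simp [e.ικ]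
  rw [tr, ← LinearMap.trace_baseChange, ← smul_eq_mul, algebraMap_smul,
    ← LinearMap.comp_assoc, LinearMap.baseChange_comp, LinearMap.trace_comp_comm',
    ← LinearMap.baseChange_comp, ← h₁, LinearMap.baseChange_smul]
  exact (LinearMap.map_smul_of_tower (LinearMap.trace k (k ⊗[B] E)) e.c _).symm

theorem finrank_eq [Nontrivial B] (e : QuasiBasis 𝔪 E) {k : Type u} [Field k] [CharZero k]
    [Algebra B k] [Module.Finite k (k ⊗[B] E)] (hk : algebraMap B k e.c ≠ 0) :
    Module.finrank k (k ⊗[B] E) = e.n := by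
  have h := e.c_mul_trace (k := k) LinearMap.id
  rw [LinearMap.baseChange_id, LinearMap.trace_id, tr_id, map_mul, map_natCast] at h
  exact_mod_cast mul_left_cancel₀ hk h

/-- If `ψ = [D, φ]` for a connection `D`, the trace of `ψ` is the derivative of the trace of `φ`. In
terms of `tr = c • trace`, the formula contains a correction by the derivative of `c`. -/
theorem c_mul_tr_deriv (e : QuasiBasis 𝔪 E) {R : Type u} [CommRing R] [Algebra R B]
    {d : Derivation R B B} {D : E →+ E} (hD : IsLeibniz d D) (φ ψ : E →ₗ[B] E)
    (hψ : ∀ x, D (φ x) = ψ x + φ (D x)) :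
    e.c * e.tr ψ = e.c * d (e.tr φ) - d e.c * e.tr φ := by
  classical
  have hsum : ∀ v : Fin e.n → B, e.ι v = ∑ i, v i • e.ι (Pi.single i 1) := fun v => by
    conv_lhs => rw [pi_eq_sum_univ' v]
    rw [map_sum]
    refine Finset.sum_congr rfl fun i _ => ?_
    rw [← map_smul]
  have hκ : ∀ y : E, ∀ l, d e.c * e.κ y l + e.c * e.κ (D y) l =
      e.c * d (e.κ y l) + ∑ i, e.κ y i * e.κ (D (e.ι (Pi.single i 1))) l := by
    intro y l
    have h1 := hD e.c y
    rw [← e.ικ, hsum (e.κ y), map_sum] at h1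
    simp only [hD _ _, Finset.sum_add_distrib, ← hsum (fun i => d (e.κ y i))] at h1
    have h2 := congrFun (congrArg e.κ h1) l
    simp only [map_add, map_sum, map_smul, e.κι, Pi.add_apply, Finset.sum_apply, Pi.smul_apply,
      smul_eq_mul] at h2
    linear_combination -h2
  have h3 : ∀ j, e.c * e.κ (φ (D (e.ι (Pi.single j 1)))) j =
      ∑ i, e.κ (D (e.ι (Pi.single j 1))) i * e.κ (φ (e.ι (Pi.single i 1))) j := by
    intro j
    have h4 : e.c • D (e.ι (Pi.single j 1)) =
        ∑ i, e.κ (D (e.ι (Pi.single j 1))) i • e.ι (Pi.single i 1) := by rw [← hsum, e.ικ]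
    have h5 := congrFun (congrArg (fun z => e.κ (φ z)) h4) j
    simpa only [map_smul, map_sum, Finset.sum_apply, Pi.smul_apply, smul_eq_mul] using h5
  have h6 : ∀ j, e.κ (ψ (e.ι (Pi.single j 1))) j = e.κ (D (φ (e.ι (Pi.single j 1)))) j -
      e.κ (φ (D (e.ι (Pi.single j 1)))) j := fun j => by rw [hψ, map_add, Pi.add_apply]; ring
  rw [tr_apply, tr_apply, map_sum, Finset.mul_sum, Finset.mul_sum, Finset.mul_sum,
    ← Finset.sum_sub_distrib]
  have h7 : ∑ j, (e.c * e.κ (ψ (e.ι (Pi.single j 1))) j -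
      (e.c * d (e.κ (φ (e.ι (Pi.single j 1))) j) - d e.c * e.κ (φ (e.ι (Pi.single j 1))) j)) =
      (∑ j, ∑ i, e.κ (φ (e.ι (Pi.single j 1))) i * e.κ (D (e.ι (Pi.single i 1))) j) -
      ∑ j, ∑ i, e.κ (D (e.ι (Pi.single j 1))) i * e.κ (φ (e.ι (Pi.single i 1))) j := by
    rw [← Finset.sum_sub_distrib]
    refine Finset.sum_congr rfl fun j _ => ?_
    rw [h6, ← h3]
    linear_combination hκ (φ (e.ι (Pi.single j 1))) j
  rw [Finset.sum_comm, ← Finset.sum_sub_distrib] at h7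
  rw [← sub_eq_zero, ← Finset.sum_sub_distrib, h7]
  refine Finset.sum_eq_zero fun j _ => ?_
  rw [sub_eq_zero]
  exact Finset.sum_congr rfl fun i _ => mul_comm _ _

end QuasiBasis
end QuasiBasis
end AInf

namespace AInf

/-! ### Algebras with a connection over a curve: transport of locality -/

section Residue

variable {B : Type u} [CommRing B] (k : Type u) [Field k] [Algebra B k] (E : Type u) [Ring E]
  [Algebra B E]

/-- Restriction of an algebra to the fibre at a point with residue field `k`. -/
abbrev res (B : Type u) [CommRing B] (k : Type u) [Field k] [Algebra B k] (E : Type u) [Ring E]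
    [Algebra B E] : E →ₐ[B] k ⊗[B] E :=
  Algebra.TensorProduct.includeRight

variable {k E}

theorem one_tmul_eq_zero {S : Type u} [CommRing S] [Algebra B S]
    (hS : Function.Surjective (algebraMap B S)) {V : Type u} [AddCommGroup V] [Module B V] {x : V} :
    (1 : S) ⊗ₜ[B] x = 0 ↔ x ∈ RingHom.ker (algebraMap B S) • (⊤ : Submodule B V) := by
  let e : (B ⧸ RingHom.ker (algebraMap B S)) ≃ₐ[B] S :=
    Ideal.quotientKerAlgEquivOfSurjective (f := Algebra.ofId B S) hS
  let e' := TensorProduct.congr e.toLinearEquiv (LinearEquiv.refl B V)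
  have h : (1 : S) ⊗ₜ[B] x = e' (1 ⊗ₜ x) := by simp [e']
  rw [h, e'.map_eq_zero_iff, ← (TensorProduct.quotTensorEquivQuotSMul V _).map_eq_zero_iff,
    TensorProduct.quotTensorEquivQuotSMul_mk_one_tmul, Submodule.Quotient.mk_eq_zero]

theorem res_eq_zero (hk : Function.Surjective (algebraMap B k)) {x : E} :
    res B k E x = 0 ↔ x ∈ RingHom.ker (algebraMap B k) • (⊤ : Submodule B E) :=
  one_tmul_eq_zero hk

theorem res_surjective (hk : Function.Surjective (algebraMap B k)) :
    Function.Surjective (res B k E) := by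
  intro y
  induction y using TensorProduct.induction_on with
  | zero => exact ⟨0, map_zero _⟩
  | tmul a x =>
    obtain ⟨b, rfl⟩ := hk a
    refine ⟨b • x, ?_⟩
    rw [Algebra.TensorProduct.includeRight_apply, TensorProduct.tmul_smul, TensorProduct.smul_tmul',
      Algebra.smul_def, mul_one]
  | add x y hx hy =>
    obtain ⟨x, rfl⟩ := hx
    obtain ⟨y, rfl⟩ := hy
    exact ⟨x + y, map_add _ _ _⟩

theorem mulLeft_baseChange (x : E) :
    (LinearMap.mulLeft B x).baseChange k = LinearMap.mulLeft k (res B k E x) := by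
  refine TensorProduct.AlgebraTensorModule.ext fun a y => ?_
  simp

end Residue

section Trace

variable {B : Type u} [CommRing B] {𝔪 : Ideal B} {E : Type u} [Ring E] [Algebra B E]

namespace QuasiBasis

/-- The obstruction for the normalized trace `x ↦ trace(x) / n` of the left regular representation
to be multiplicative, freed of denominators. -/
def defect (e : QuasiBasis 𝔪 E) (x y : E) : B :=
  e.n * e.c * e.tr (LinearMap.mulLeft B (x * y)) -
    e.tr (LinearMap.mulLeft B x) * e.tr (LinearMap.mulLeft B y)

theorem tr_mulLeft_add (e : QuasiBasis 𝔪 E) (x y : E) : e.tr (LinearMap.mulLeft B (x + y)) =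
    e.tr (LinearMap.mulLeft B x) + e.tr (LinearMap.mulLeft B y) := by
  rw [← tr_add]
  congr 1
  ext z
  simp [add_mul]

theorem tr_mulLeft_algebraMap [Nontrivial B] (e : QuasiBasis 𝔪 E) (a : B) :
    e.tr (LinearMap.mulLeft B (algebraMap B E a)) = a * (e.c * e.n) := by
  rw [← tr_id, ← tr_smul]
  congr 1
  ext z
  simp [Algebra.smul_def]

theorem defect_eq_zero_of [IsDomain B] [CharZero B] {𝔫 : Ideal B} (e : QuasiBasis 𝔫 E)
    (e' : QuasiBasis 𝔪 E) {x y : E} (h : e.defect x y = 0) : e'.defect x y = 0 := by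
  have h₁ := tr_eq e e' (LinearMap.mulLeft B x)
  have h₂ := tr_eq e e' (LinearMap.mulLeft B y)
  have h₃ := tr_eq e e' (LinearMap.mulLeft B (x * y))
  refine (mul_eq_zero.mp (?_ : e.c ^ 2 * e'.defect x y = 0)).resolve_left (pow_ne_zero 2 e.c_ne)
  rw [defect] at h ⊢
  rw [← n_eq e e']
  linear_combination (e.n * e'.c * e.c) * h₃ - e.c * e'.tr (LinearMap.mulLeft B y) * h₁ -
    e'.c * e.tr (LinearMap.mulLeft B x) * h₂ + e'.c ^ 2 * h

variable {k : Type u} [Field k] [Algebra B k] [Module.Finite B E]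

theorem tr_mem_of_nilpotent (hk : ∀ f, algebraMap B k f = 0 ↔ f ∈ 𝔪)
    (e : QuasiBasis 𝔪 E) {x : E} (hx : IsNilpotent (res B k E x)) :
    e.tr (LinearMap.mulLeft B x) ∈ 𝔪 := by
  have h := e.c_mul_trace (k := k) (LinearMap.mulLeft B x)
  have hnil : IsNilpotent (LinearMap.mulLeft (k) (res B k E x)) := by
    obtain ⟨n, hn⟩ := hx
    exact ⟨n, by rw [LinearMap.pow_mulLeft, hn, LinearMap.mulLeft_zero_eq_zero]⟩
  rw [mulLeft_baseChange, (LinearMap.isNilpotent_trace_of_isNilpotent hnil).eq_zero, mul_zero] at h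
  exact (hk _).mp h.symm

/-- At a point where the algebra is commutative and local, with residue field the base field, the
normalized trace is multiplicative. -/
theorem defect_mem [Nontrivial B] (hk : ∀ f, algebraMap B k f = 0 ↔ f ∈ 𝔪)
    (e : QuasiBasis 𝔪 E)
    (hc : ∀ x y : E, res B k E x * res B k E y = res B k E y * res B k E x)
    (hl : ∀ x : E, ∃ a : B, IsNilpotent (res B k E (x - algebraMap B E a))) (x y : E) :
    e.defect x y ∈ 𝔪 := by
  obtain ⟨a, ha⟩ := hl x
  obtain ⟨b, hb⟩ := hl y
  generalize hu : x - algebraMap B E a = u at ha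
  generalize hv : y - algebraMap B E b = v at hb
  obtain rfl : x = algebraMap B E a + u := by rw [← hu]; abel
  obtain rfl : y = algebraMap B E b + v := by rw [← hv]; abel
  have hw : IsNilpotent (res B k E (a • v + b • u + u * v)) := by
    rw [map_add, map_add, map_smul, map_smul, map_mul]
    have huv : Commute (res B k E u) (res B k E v) := hc u v
    refine Commute.isNilpotent_add ?_ (Commute.isNilpotent_add ?_ (hb.smul a) (ha.smul b))
      (huv.isNilpotent_mul_right ha)
    · exact (((huv.symm.mul_right (Commute.refl _)).smul_left a)).add_left
        (((Commute.refl _).mul_right huv).smul_left b)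
    · exact (huv.symm.smul_left a).smul_right b
  have e₁ : (algebraMap B E a + u) * (algebraMap B E b + v) =
      algebraMap B E (a * b) + (a • v + b • u + u * v) := by
    rw [map_mul, Algebra.smul_def, Algebra.smul_def, Algebra.commutes b u]
    noncomm_ring
  have h₁ := e.tr_mem_of_nilpotent hk ha
  have h₂ := e.tr_mem_of_nilpotent hk hb
  have h₃ := e.tr_mem_of_nilpotent hk hw
  rw [defect, e₁, tr_mulLeft_add, tr_mulLeft_add e _ u, tr_mulLeft_add e _ v,
    tr_mulLeft_algebraMap, tr_mulLeft_algebraMap, tr_mulLeft_algebraMap]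
  generalize e.tr (LinearMap.mulLeft B u) = U at *
  generalize e.tr (LinearMap.mulLeft B v) = V at *
  generalize e.tr (LinearMap.mulLeft B (a • v + b • u + u * v)) = W at *
  have e₂ : (e.n * e.c * (a * b * (e.c * e.n) + W) - (a * (e.c * e.n) + U) * (b * (e.c * e.n) + V))
      = (e.n * e.c) * W - ((a * (e.c * e.n)) * V + (b * (e.c * e.n) + V) * U) := by ring
  rw [e₂]
  exact 𝔪.sub_mem (𝔪.mul_mem_left _ h₃) (𝔪.add_mem (𝔪.mul_mem_left _ h₂) (𝔪.mul_mem_left _ h₁))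

/-- Multiplicativity of the normalized trace spreads out from one point, since the ideal generated
by all defects is differential. -/
theorem defect_eq_zero {R : Type u} [Field R] [CharZero R] [Algebra R B] [IsDomain B]
    [IsNoetherianRing B] [𝔪.IsMaximal]
    (hk : ∀ f, algebraMap B k f = 0 ↔ f ∈ 𝔪) (e : QuasiBasis 𝔪 E) {t b : B} (h : IsParam 𝔪 t b)
    {d : Derivation R B B} (ht : d t ∉ 𝔪) {D : E →+ E} (hD : IsLeibniz d D)
    (hD' : ∀ x y, D (x * y) = D x * y + x * D y)
    (hc : ∀ x y : E, res B k E x * res B k E y = res B k E y * res B k E x)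
    (hl : ∀ x : E, ∃ a : B, IsNilpotent (res B k E (x - algebraMap B E a))) (x y : E) :
    e.defect x y = 0 := by
  let I : Ideal B := Ideal.span (Set.range fun p : E × E => e.defect p.1 p.2)
  have hmem : ∀ x y, e.defect x y ∈ I := fun x y => Ideal.subset_span ⟨(x, y), rfl⟩
  have hT : ∀ x, e.c * e.tr (LinearMap.mulLeft B (D x)) =
      e.c * d (e.tr (LinearMap.mulLeft B x)) - d e.c * e.tr (LinearMap.mulLeft B x) := fun x =>
    e.c_mul_tr_deriv hD _ _ fun z => hD' x z
  have hI : I = ⊥ := by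
    by_contra h0
    -- The ideal is stable under `c d` rather than `d`, because of the denominators in `tr`.
    refine h.not_le_of_stable (e.c • d) (fun hm => ?_) h0 (fun f hf => ?_)
      (Ideal.span_le.mpr ?_)
    · exact (Ideal.IsPrime.mem_or_mem inferInstance hm).elim e.hc ht
    · refine Submodule.span_induction (p := fun f _ => (e.c • d) f ∈ I) ?_ ?_ ?_ ?_ hf
      · rintro _ ⟨⟨x, y⟩, rfl⟩
        have key : (e.c • d) (e.defect x y) = 2 * d e.c * e.defect x y +
            e.c * (e.defect (D x) y + e.defect x (D y)) := by
          have h₁ := hT x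
          have h₂ := hT y
          have h₃ := hT (x * y)
          rw [hD', tr_mulLeft_add] at h₃
          simp only [defect, Derivation.smul_apply, smul_eq_mul, map_sub, Derivation.leibniz,
            Derivation.map_natCast]
          linear_combination (-(e.n * e.c)) * h₃ + e.tr (LinearMap.mulLeft B y) * h₁ +
            e.tr (LinearMap.mulLeft B x) * h₂
        change (e.c • d) (e.defect x y) ∈ I
        rw [key]
        exact I.add_mem (I.mul_mem_left _ (hmem x y))
          (I.mul_mem_left _ (I.add_mem (hmem _ _) (hmem _ _)))
      · rw [map_zero]
        exact I.zero_mem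
      · intro f g _ _ hf hg
        rw [map_add]
        exact I.add_mem hf hg
      · intro a f hf hf'
        rw [smul_eq_mul, Derivation.leibniz]
        exact I.add_mem (I.mul_mem_left _ hf') (I.mul_mem_right _ hf)
    · rintro _ ⟨⟨x, y⟩, rfl⟩
      exact e.defect_mem hk hc hl x y
  have := hmem x y
  rwa [hI, Submodule.mem_bot] at this

/-- If the normalized trace is multiplicative, there are no nontrivial idempotents: the trace of an
idempotent is then `0` or the full dimension, and in characteristic zero it is also its rank. -/
theorem idempotent_trivial [Nontrivial B] [CharZero k]
    (hk : ∀ f, algebraMap B k f = 0 ↔ f ∈ 𝔪)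
    (hs : Function.Surjective (algebraMap B k)) (e : QuasiBasis 𝔪 E)
    (h : ∀ x y, e.defect x y = 0) {x : k ⊗[B] E} (hx : IsIdempotentElem x) : x = 0 ∨ x = 1 := by
  have hc : algebraMap B k e.c ≠ 0 := fun h0 => e.hc ((hk _).mp h0)
  obtain ⟨y, rfl⟩ := res_surjective hs x
  have key : ∀ z : k ⊗[B] E, IsIdempotentElem z →
      LinearMap.trace k (k ⊗[B] E) (LinearMap.mulLeft k z) = 0 → z = 0 := by
    intro z hz h0
    have hz' : IsIdempotentElem (LinearMap.mulLeft k z) := by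
      refine LinearMap.ext fun w => ?_
      simp only [Module.End.mul_apply, LinearMap.mulLeft_apply, ← mul_assoc, hz.eq]
    have := LinearMap.congr_fun ((LinearMap.IsIdempotentElem.trace_eq_zero_iff hz').mp h0) 1
    simpa using this
  have h₁ := e.c_mul_trace (k := k) (LinearMap.mulLeft B y)
  have h₂ := e.c_mul_trace (k := k) (LinearMap.mulLeft B (y * y))
  have h₃ := congrArg (algebraMap B k) (h y y)
  rw [mulLeft_baseChange] at h₁ h₂
  rw [map_mul, hx.eq] at h₂
  rw [defect, map_sub, map_mul, map_mul, map_mul, map_natCast, map_zero, ← h₁, ← h₂] at h₃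
  set τ := LinearMap.trace k (k ⊗[B] E) (LinearMap.mulLeft k (res B k E y)) with hτ
  have h₄ : τ * (e.n - τ) = 0 := by
    refine mul_left_cancel₀ (pow_ne_zero 2 hc) ?_
    linear_combination h₃
  rcases mul_eq_zero.mp h₄ with h0 | h0
  · exact Or.inl (key _ hx h0)
  · refine Or.inr (sub_eq_zero.mp (key _ hx.one_sub ?_)).symm
    have h5 : LinearMap.mulLeft k (1 - res B k E y) =
        LinearMap.id - LinearMap.mulLeft k (res B k E y) := by
      ext; simp [sub_mul]
    rw [h5, map_sub, LinearMap.trace_id, e.finrank_eq hc]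
    exact h0

end QuasiBasis

end Trace

/-! ### Sums of non-units -/

section Artin

variable (k : Type u) [Field k] {A : Type u} [Ring A] [Algebra k A]

/-- Fitting's lemma: a finite dimensional algebra without nontrivial idempotents is local. -/
theorem isUnit_or_isNilpotent [Module.Finite k A]
    (h : ∀ x : A, IsIdempotentElem x → x = 0 ∨ x = 1) (x : A) :
    IsUnit x ∨ IsNilpotent x := by
  obtain ⟨n, hn⟩ := (LinearMap.eventually_isCompl_ker_pow_range_pow
    (LinearMap.mulLeft k x)).exists_forall_of_atTop
  have hc := hn (n + 1) (Nat.le_succ n)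
  rw [LinearMap.pow_mulLeft] at hc
  set y := x ^ (n + 1) with hy
  obtain ⟨a, ha, b, hb, hab⟩ := Submodule.mem_sup.mp
    (show (1 : A) ∈ LinearMap.ker _ ⊔ LinearMap.range _ by rw [hc.sup_eq_top]; trivial)
  obtain ⟨c, hc'⟩ := hb
  rw [LinearMap.mem_ker, LinearMap.mulLeft_apply] at ha
  rw [LinearMap.mulLeft_apply] at hc'
  have hba : b * a ∈ LinearMap.ker (LinearMap.mulLeft k y) ⊓
      LinearMap.range (LinearMap.mulLeft k y) := by
    refine ⟨?_, ⟨c * a, ?_⟩⟩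
    · have e : b * a = a - a * a := by
        rw [show b = 1 - a by rw [← hab]; abel]; noncomm_ring
      rw [SetLike.mem_coe, LinearMap.mem_ker, LinearMap.mulLeft_apply, e, mul_sub, ← mul_assoc, ha,
        zero_mul, sub_zero]
    · rw [LinearMap.mulLeft_apply, ← mul_assoc, hc']
  rw [hc.inf_eq_bot, Submodule.mem_bot] at hba
  have hid : IsIdempotentElem a := by
    have : (a + b) * a = a * a + b * a := add_mul _ _ _
    rw [hab, hba, one_mul, add_zero] at this
    exact this.symm
  rcases h a hid with rfl | rfl
  · left
    rw [zero_add] at hab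
    have h1 : x * (x ^ n * c) = 1 := by rw [← mul_assoc, ← pow_succ', ← hy, hc', hab]
    have := IsNoetherianRing.of_finite k A
    exact IsUnit.of_mul_eq_one _ h1
  · exact Or.inr ⟨n + 1, by rw [← hy]; simpa using ha⟩

theorem exists_isUnit_of_sum [Module.Finite k A] [Nontrivial A]
    (h : ∀ x : A, IsIdempotentElem x → x = 0 ∨ x = 1) {ι : Type*}
    (s : Finset ι) (f : ι → A) (hs : IsUnit (∑ i ∈ s, f i)) : ∃ i ∈ s, IsUnit (f i) := by
  classical
  induction s using Finset.induction_on with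
  | empty =>
    rw [Finset.sum_empty] at hs
    exact absurd hs not_isUnit_zero
  | insert i s hi ih =>
    by_cases hu : IsUnit (f i)
    · exact ⟨i, Finset.mem_insert_self i s, hu⟩
    · rw [Finset.sum_insert hi] at hs
      obtain ⟨u, hu'⟩ := hs
      have h1 : ↑u⁻¹ * f i + ↑u⁻¹ * ∑ j ∈ s, f j = 1 := by
        rw [← mul_add, ← hu', Units.inv_mul]
      have h2 : IsNilpotent (↑u⁻¹ * f i) := (isUnit_or_isNilpotent k h _).resolve_left
        fun h0 => hu ((Units.isUnit_units_mul u⁻¹ _).mp h0)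
      have h3 : IsUnit (↑u⁻¹ * ∑ j ∈ s, f j) := by
        rw [← eq_sub_iff_add_eq'] at h1
        rw [h1]
        exact h2.isUnit_one_sub
      obtain ⟨j, hj, hj'⟩ := ih ((Units.isUnit_units_mul u⁻¹ _).mp h3)
      exact ⟨j, Finset.mem_insert_of_mem hj, hj'⟩

end Artin
end AInf

namespace AInf

/-! ### Transport of isomorphisms in a linear category with connection -/

open CategoryTheory

section LinearCategory

theorem res_eq_one {B : Type u} [CommRing B] {k : Type u} [Field k] [Algebra B k] {E : Type u}
    [Ring E] [Algebra B E] (hs : Function.Surjective (algebraMap B k)) {x : E} :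
    res B k E x = 1 ↔ x - 1 ∈ RingHom.ker (algebraMap B k) • (⊤ : Submodule B E) := by
  rw [← res_eq_zero hs, map_sub, map_one, sub_eq_zero]

theorem isIdempotentElem_res {B : Type u} [CommRing B] {k : Type u} [Field k] [Algebra B k]
    {E : Type u} [Ring E] [Algebra B E] (hs : Function.Surjective (algebraMap B k)) {x : E}
    (hx : x * x - x ∈ RingHom.ker (algebraMap B k) • (⊤ : Submodule B E)) :
    IsIdempotentElem (res B k E x) := by
  rw [IsIdempotentElem, ← map_mul, ← sub_eq_zero, ← map_sub]
  exact (res_eq_zero hs).mpr hx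

variable {B : Type u} [CommRing B] {C : Type*} [CategoryTheory.Category.{u} C] [Preadditive C]
  [Linear B C]

theorem comp_mem_smul_top_left (𝔪 : Ideal B) {X Y Z : C} {x : X ⟶ Y}
    (hx : x ∈ 𝔪 • (⊤ : Submodule B (X ⟶ Y))) (y : Y ⟶ Z) :
    x ≫ y ∈ 𝔪 • (⊤ : Submodule B (X ⟶ Z)) := by
  have h := Submodule.mem_map_of_mem (f := Linear.rightComp B X y) hx
  rw [Submodule.map_smul''] at h
  exact Submodule.smul_mono le_rfl le_top h

theorem comp_mem_smul_top_right (𝔪 : Ideal B) {X Y Z : C} (x : X ⟶ Y) {y : Y ⟶ Z}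
    (hy : y ∈ 𝔪 • (⊤ : Submodule B (Y ⟶ Z))) :
    x ≫ y ∈ 𝔪 • (⊤ : Submodule B (X ⟶ Z)) := by
  have h := Submodule.mem_map_of_mem (f := Linear.leftComp B Z x) hy
  rw [Submodule.map_smul''] at h
  exact Submodule.smul_mono le_rfl le_top h

section Span

variable {R : Type u} [Field R] [CharZero R] [Algebra R B] [IsDomain B] [Algebra.Smooth R B]

/-- If two objects become isomorphic at one point of the curve, the identity of the first one is
a sum of maps factoring through the second one, near any other point. The maps which factor like
this form a submodule stable under the connection. -/
theorem exists_smul_id_mem_span {X Y : C} [Module.Finite B (X ⟶ X)] {𝔪 𝔫 : Ideal B}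
    [𝔪.IsMaximal] {t b : B} (h : IsParam 𝔪 t b) {d : Derivation R B B} (ht : d t ∉ 𝔪)
    {DX : (X ⟶ X) →+ (X ⟶ X)} (hD : IsLeibniz d DX) (D₁ : (X ⟶ Y) → (X ⟶ Y))
    (D₂ : (Y ⟶ X) → (Y ⟶ X)) (hD' : ∀ f g, DX (f ≫ g) = D₁ f ≫ g + f ≫ D₂ g) (h𝔫 : 𝔫 ≠ ⊤)
    (f₀ : X ⟶ Y) (g₀ : Y ⟶ X) (h₀ : f₀ ≫ g₀ - 𝟙 X ∈ 𝔫 • (⊤ : Submodule B (X ⟶ X))) :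
    ∃ c ∉ 𝔪, c • 𝟙 X ∈ Submodule.span B (Set.range fun p : (X ⟶ Y) × (Y ⟶ X) => p.1 ≫ p.2) := by
  have hnoeth : IsNoetherianRing B := Algebra.FiniteType.isNoetherianRing R B
  set J := Submodule.span B (Set.range fun p : (X ⟶ Y) × (Y ⟶ X) => p.1 ≫ p.2) with hJ
  have hmem : ∀ f g, f ≫ g ∈ J := fun f g => Submodule.subset_span ⟨(f, g), rfl⟩
  have h₁ : ∀ x ∈ J, DX x ∈ J := by
    intro x hx
    refine Submodule.span_induction (p := fun x _ => DX x ∈ J) ?_ ?_ ?_ ?_ hx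
    · rintro _ ⟨⟨f, g⟩, rfl⟩
      rw [hD']
      exact J.add_mem (hmem _ _) (hmem _ _)
    · rw [map_zero]
      exact J.zero_mem
    · intro x y _ _ hx hy
      rw [map_add]
      exact J.add_mem hx hy
    · intro a x hx hx'
      rw [hD]
      exact J.add_mem (J.smul_mem _ hx') (J.smul_mem _ hx)
  have h₂ : ⊤ ≤ J ⊔ 𝔫 • (⊤ : Submodule B (X ⟶ X)) := by
    intro x _
    have e : x = f₀ ≫ g₀ ≫ x - (f₀ ≫ g₀ - 𝟙 X) ≫ x := by simp
    rw [e]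
    exact Submodule.sub_mem _ (Submodule.mem_sup_left (hmem _ _))
      (Submodule.mem_sup_right (comp_mem_smul_top_left 𝔫 h₀ x))
  obtain ⟨c, hc, hc'⟩ := h.exists_smul_mem ht hD h₁ h𝔫 h₂
  exact ⟨c, hc, hc' _⟩

end Span

/-- A split monomorphism at a point, into an object with only trivial idempotents, is
an isomorphism. -/
theorem comp_sub_id_mem {X Y : C} (k : Type u) [Field k] [Algebra B k]
    (hs : Function.Surjective (algebraMap B k)) {f : X ⟶ Y} {g : Y ⟶ X}
    (h₁ : f ≫ g - 𝟙 X ∈ RingHom.ker (algebraMap B k) • (⊤ : Submodule B (X ⟶ X)))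
    [Nontrivial (k ⊗[B] End X)]
    (hY : ∀ x : k ⊗[B] End Y, IsIdempotentElem x → x = 0 ∨ x = 1) :
    g ≫ f - 𝟙 Y ∈ RingHom.ker (algebraMap B k) • (⊤ : Submodule B (Y ⟶ Y)) := by
  let u : End X := f ≫ g
  let w : End Y := g ≫ f
  have hu : res B k (End X) u = 1 := (res_eq_one hs).mpr h₁
  have hid : IsIdempotentElem (res B k (End Y) w) := by
    refine isIdempotentElem_res hs ?_
    have e : (g ≫ f) ≫ (g ≫ f) - g ≫ f = g ≫ (f ≫ g - 𝟙 X) ≫ f := by simp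
    change (g ≫ f) ≫ (g ≫ f) - g ≫ f ∈ _
    rw [e]
    exact comp_mem_smul_top_right _ _ (comp_mem_smul_top_left _ h₁ _)
  -- If `gf` vanishes at the point, so does `fgfg`, which is the identity there.
  rcases hY _ hid with h0 | h0
  · have h2 : g ≫ f ∈ RingHom.ker (algebraMap B k) • (⊤ : Submodule B (Y ⟶ Y)) :=
      (res_eq_zero hs).mp h0
    have h3 : u * u ∈ RingHom.ker (algebraMap B k) • (⊤ : Submodule B (End X)) := by
      have e : (f ≫ g) ≫ (f ≫ g) = f ≫ (g ≫ f) ≫ g := by simp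
      change (f ≫ g) ≫ (f ≫ g) ∈ RingHom.ker (algebraMap B k) • (⊤ : Submodule B (X ⟶ X))
      rw [e]
      have h3 := comp_mem_smul_top_right _ f (comp_mem_smul_top_left _ h2 g)
      exact h3
    have h4 := (res_eq_zero hs).mpr h3
    rw [map_mul, hu, one_mul] at h4
    exact absurd h4 one_ne_zero
  · have h2 := (res_eq_one hs).mp h0
    exact h2

/-- If two objects with only trivial idempotents at a point are such that the identity of the first
factors, up to sums, through the second, then they are isomorphic at that point. -/
theorem exists_inverse_of_smul_id_mem_span {X Y : C} [Module.Finite B (End X)]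
    (k : Type u) [Field k] [Algebra B k] (hs : Function.Surjective (algebraMap B k))
    {c : B} (hc : algebraMap B k c ≠ 0)
    (hc' : c • 𝟙 X ∈ Submodule.span B (Set.range fun p : (X ⟶ Y) × (Y ⟶ X) => p.1 ≫ p.2))
    [Nontrivial (k ⊗[B] End X)]
    (hX : ∀ x : k ⊗[B] End X, IsIdempotentElem x → x = 0 ∨ x = 1)
    (hY : ∀ x : k ⊗[B] End Y, IsIdempotentElem x → x = 0 ∨ x = 1) :
    ∃ (f : X ⟶ Y) (g : Y ⟶ X),
      f ≫ g - 𝟙 X ∈ RingHom.ker (algebraMap B k) • (⊤ : Submodule B (X ⟶ X)) ∧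
      g ≫ f - 𝟙 Y ∈ RingHom.ker (algebraMap B k) • (⊤ : Submodule B (Y ⟶ Y)) := by
  set 𝔪 := RingHom.ker (algebraMap B k) with h𝔪
  have hfin : Module.Finite k (k ⊗[B] End X) := inferInstance
  obtain ⟨n, a, p, hp⟩ := Submodule.mem_span_set'.mp hc'
  choose q hq using fun i => (p i).2
  have hu : IsUnit (∑ i, res B k (End X) (a i • ((q i).1 ≫ (q i).2 : End X))) := by
    have : ∑ i, res B k (End X) (a i • ((q i).1 ≫ (q i).2 : End X)) =
        algebraMap k (k ⊗[B] End X) (algebraMap B k c) := by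
      rw [← map_sum]
      have e : ∑ i, a i • ((q i).1 ≫ (q i).2 : End X) = algebraMap B (End X) c := by
        rw [Algebra.algebraMap_eq_smul_one]
        exact (Finset.sum_congr rfl fun i _ => congrArg (a i • ·) (hq i)).trans hp
      rw [e, AlgHom.commutes, ← IsScalarTower.algebraMap_apply]
    rw [this]
    exact (isUnit_iff_ne_zero.mpr hc).map _
  -- Non-units form an ideal, so one of the summands is invertible at the point.
  obtain ⟨i, -, hi⟩ := exists_isUnit_of_sum k hX Finset.univ _ hu
  obtain ⟨w, hw⟩ := hi
  obtain ⟨v, hv⟩ := res_surjective hs (↑w⁻¹ : k ⊗[B] End X)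
  let f : X ⟶ Y := a i • (q i).1
  let g : Y ⟶ X := (q i).2 ≫ (show X ⟶ X from v)
  let u : End X := f ≫ g
  have hfg : res B k (End X) u = 1 := by
    have e : u = v * (show End X from a i • ((q i).1 ≫ (q i).2)) := by
      change (a i • (q i).1) ≫ (q i).2 ≫ _ = (a i • ((q i).1 ≫ (q i).2)) ≫ _
      rw [Linear.smul_comp, Linear.smul_comp, Category.assoc]
    rw [e, map_mul, hv]
    exact (congrArg ((↑w⁻¹ : k ⊗[B] End X) * ·) hw.symm).trans (Units.inv_mul w)
  have h₁ := (res_eq_one hs).mp hfg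
  exact ⟨f, g, h₁, comp_sub_id_mem k hs h₁ hY⟩

end LinearCategory

section Connections

variable {B : Type u} [CommRing B] {R : Type u} [Field R] [CharZero R] [Algebra R B] [IsDomain B]
  [Algebra.Smooth R B]

theorem exists_quasiBasis (hB : ringKrullDim B = 1) {E : Type u} [Ring E] [Algebra B E]
    [Module.Finite B E]
    (hE : ∀ ξ : Ω[B⁄R] →ₗ[B] B, ∃ D : E →+ E, IsLeibniz (ξ.compDer (KaehlerDifferential.D R B)) D)
    (s : B →ₐ[R] R) : Nonempty (QuasiBasis (RingHom.ker s) E) := by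
  have hnoeth : IsNoetherianRing B := Algebra.FiniteType.isNoetherianRing R B
  obtain ⟨t, b, ξ, h, ht⟩ := exists_isParam hB s
  obtain ⟨D, hD⟩ := hE ξ
  obtain ⟨c, hc, hc'⟩ := h.exists_kills_torsion ht hD
  exact h.nonempty_quasiBasis hc hc'

/-- An algebra with connection over a curve which is, at one point, commutative and local with
residue field the base field, is nontrivial and without nontrivial idempotents at every point. -/
theorem nontrivial_and_idempotent_trivial (hB : ringKrullDim B = 1) {E : Type u} [Ring E]
    [Algebra B E] [Module.Finite B E]
    (hE : ∀ ξ : Ω[B⁄R] →ₗ[B] B, ∃ D : E →+ E,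
      IsLeibniz (ξ.compDer (KaehlerDifferential.D R B)) D ∧ ∀ x y, D (x * y) = D x * y + x * D y)
    (s : B →ₐ[R] R)
    (hcomm : ∀ x y : E, x * y - y * x ∈ RingHom.ker s • (⊤ : Submodule B E))
    (hloc : ∀ x : E, ∃ a : B, ∃ n : ℕ,
      (x - algebraMap B E a) ^ n ∈ RingHom.ker s • (⊤ : Submodule B E))
    (hone : (1 : E) ∉ RingHom.ker s • (⊤ : Submodule B E))
    {k : Type u} [Field k] [CharZero k] [Algebra B k] (hk : Function.Surjective (algebraMap B k))
    (s' : B →ₐ[R] R) (hs' : RingHom.ker (algebraMap B k) = RingHom.ker s') :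
    Nontrivial (k ⊗[B] E) ∧ ∀ x : k ⊗[B] E, IsIdempotentElem x → x = 0 ∨ x = 1 := by
  have hnoeth : IsNoetherianRing B := Algebra.FiniteType.isNoetherianRing R B
  have hE' : ∀ ξ : Ω[B⁄R] →ₗ[B] B, ∃ D : E →+ E,
      IsLeibniz (ξ.compDer (KaehlerDifferential.D R B)) D := fun ξ => (hE ξ).imp fun D h => h.1
  have hchar : CharZero B := charZero_of_injective_algebraMap (algebraMap R B).injective
  obtain ⟨e⟩ := exists_quasiBasis hB hE' s
  obtain ⟨e'⟩ := exists_quasiBasis hB hE' s'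
  obtain ⟨t, b, ξ, h, ht⟩ := exists_isParam hB s
  obtain ⟨D, hD, hD'⟩ := hE ξ
  let _ : Algebra B R := s.toRingHom.toAlgebra
  have hsurj : Function.Surjective (algebraMap B R) := fun c =>
    ⟨algebraMap R B c, s.commutes c⟩
  have hmem : ∀ x : E, res B R E x = 0 ↔ x ∈ RingHom.ker s • (⊤ : Submodule B E) := fun x =>
    res_eq_zero hsurj
  have hdef : ∀ x y, e.defect x y = 0 :=
    e.defect_eq_zero (k := R) (fun f => Iff.rfl) h ht hD hD'
      (fun x y => by
        rw [← sub_eq_zero, ← map_mul, ← map_mul, ← map_sub]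
        exact (hmem _).mpr (hcomm x y))
      (fun x => by
        obtain ⟨a, n, hn⟩ := hloc x
        exact ⟨a, n, by rw [← map_pow]; exact (hmem _).mpr hn⟩)
  have hk' : ∀ f, algebraMap B k f = 0 ↔ f ∈ RingHom.ker s' := fun f => by
    rw [← hs', RingHom.mem_ker]
  refine ⟨?_, fun x hx =>
    e'.idempotent_trivial hk' hk (fun x y => e.defect_eq_zero_of e' (hdef x y)) hx⟩
  -- The fibres at both points have the same dimension.
  have hn : Nontrivial (R ⊗[B] E) :=
    nontrivial_of_ne (res B R E 1) 0 fun h0 => hone ((hmem _).mp h0)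
  have h₁ : Module.finrank R (R ⊗[B] E) = e.n := e.finrank_eq fun h0 => e.hc h0
  have h₂ : Module.finrank k (k ⊗[B] E) = e'.n := e'.finrank_eq fun h0 => e'.hc ((hk' _).mp h0)
  have h₃ : 0 < Module.finrank R (R ⊗[B] E) := Module.finrank_pos
  exact Module.nontrivial_of_finrank_pos (R := k) (by rw [h₂, ← e.n_eq e', ← h₁]; exact h₃)

/-- In a linear category with a compatible family of connections, isomorphisms at one point of the
curve between objects with commutative local endomorphism rings at that point imply the existence
of isomorphisms at any other point. -/
theorem exists_inverse_at_point {C : Type*} [CategoryTheory.Category.{u} C] [Preadditive C]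
    [Linear B C] {ι : Type*} (X : ι → C) [hfin : ∀ i j, Module.Finite B (X i ⟶ X j)]
    (hB : ringKrullDim B = 1)
    (hconn : ∀ ξ : Ω[B⁄R] →ₗ[B] B, ∃ D : ∀ i j, (X i ⟶ X j) →+ (X i ⟶ X j),
      (∀ i j, IsLeibniz (ξ.compDer (KaehlerDifferential.D R B)) (D i j)) ∧
        ∀ i j k f g, D i k (f ≫ g) = D i j f ≫ g + f ≫ D j k g)
    (s s' : B →ₐ[R] R)
    (hcomm : ∀ i (x y : X i ⟶ X i),
      x ≫ y - y ≫ x ∈ RingHom.ker s • (⊤ : Submodule B (X i ⟶ X i)))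
    (hloc : ∀ i (x : End (X i)), ∃ a : B, ∃ n : ℕ,
      (x - algebraMap B (End (X i)) a) ^ n ∈ RingHom.ker s • (⊤ : Submodule B (End (X i))))
    (hone : ∀ i, 𝟙 (X i) ∉ RingHom.ker s • (⊤ : Submodule B (X i ⟶ X i)))
    {i j : ι} (f₀ : X i ⟶ X j) (g₀ : X j ⟶ X i)
    (h₀ : f₀ ≫ g₀ - 𝟙 (X i) ∈ RingHom.ker s • (⊤ : Submodule B (X i ⟶ X i))) :
    ∃ (f : X i ⟶ X j) (g : X j ⟶ X i),
      f ≫ g - 𝟙 (X i) ∈ RingHom.ker s' • (⊤ : Submodule B (X i ⟶ X i)) ∧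
      g ≫ f - 𝟙 (X j) ∈ RingHom.ker s' • (⊤ : Submodule B (X j ⟶ X j)) := by
  obtain ⟨t, b, ξ, h, ht⟩ := exists_isParam hB s'
  obtain ⟨D, hD, hD'⟩ := hconn ξ
  obtain ⟨c, hc, hc'⟩ := exists_smul_id_mem_span h ht (hD i i) (D i j) (D j i)
    (fun f g => hD' i j i f g) (Ideal.IsMaximal.ne_top inferInstance) f₀ g₀ h₀
  let _ : Algebra B R := s'.toRingHom.toAlgebra
  have hsurj : Function.Surjective (algebraMap B R) := fun c =>
    ⟨algebraMap R B c, s'.commutes c⟩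
  have hfin' : ∀ i, Module.Finite B (End (X i)) := fun i => hfin i i
  have key := fun i => nontrivial_and_idempotent_trivial hB (E := End (X i))
    (fun ξ => by
      obtain ⟨D, hD, hD'⟩ := hconn ξ
      exact ⟨D i i, hD i i, fun x y => (hD' i i i y x).trans (add_comm _ _)⟩)
    s (fun x y => hcomm i y x) (hloc i) (hone i) hsurj s' rfl
  have := (key i).1
  exact exists_inverse_of_smul_id_mem_span R hsurj (fun h0 => hc h0) hc' (key i).2 (key j).2

end Connections
end AInf

namespace AInf
open Chain

/-! ### Restriction to a fibre -/

variable {R : Type u} [Field R] {A : Category R} {B : Type u} [CommRing B] [Algebra R B]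
variable {L M N : ModData A.toCatData B} (s : B →ₐ[R] R)

theorem algebraMap_atPoint_surjective : Function.Surjective (algebraMap B (AtPoint s)) :=
  fun c => ⟨algebraMap R B c, s.commutes c⟩

section Module

variable {V : Type u} [AddCommGroup V] [Module B V]

/-- The restriction map `V → R ⊗_B V`. -/
def toFib (V : Type u) [AddCommGroup V] [Module B V] : V →+ AtPoint s ⊗[B] V :=
  (TensorProduct.mk B (AtPoint s) V 1).toAddMonoidHom

theorem toFib_smul (f : B) (x : V) : toFib s V (f • x) = s f • toFib s V x := by
  change (1 : AtPoint s) ⊗ₜ[B] (f • x) = _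
  rw [← TensorProduct.smul_tmul, Algebra.smul_def]
  rfl

theorem toFib_surjective : Function.Surjective (toFib s V) := by
  intro y
  induction y using TensorProduct.induction_on with
  | zero => exact ⟨0, map_zero _⟩
  | tmul a x =>
    obtain ⟨b, rfl⟩ := algebraMap_atPoint_surjective s a
    refine ⟨b • x, ?_⟩
    change (1 : AtPoint s) ⊗ₜ[B] (b • x) = _
    rw [← TensorProduct.smul_tmul, Algebra.smul_def, mul_one]
  | add x y hx hy =>
    obtain ⟨x, rfl⟩ := hx
    obtain ⟨y, rfl⟩ := hy
    exact ⟨x + y, map_add _ _ _⟩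

theorem toFib_eq_zero {x : V} : toFib s V x = 0 ↔ x ∈ RingHom.ker s • (⊤ : Submodule B V) :=
  one_tmul_eq_zero (algebraMap_atPoint_surjective s)

theorem exists_section (V : Type u) [AddCommGroup V] [Module B V] :
    ∃ j : AtPoint s ⊗[B] V →+ V, (∀ x, toFib s V (j x) = x) ∧
      ∀ (c : R) x, j (c • x) = algebraMap R B c • j x := by
  let _ : Module R V := Module.compHom V (algebraMap R B)
  let π : V →ₗ[R] AtPoint s ⊗[B] V :=
    { toFun := toFib s V
      map_add' := map_add _
      map_smul' := fun c x => by
        change toFib s V (algebraMap R B c • x) = _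
        rw [toFib_smul, s.commutes]
        rfl }
  obtain ⟨j, hj⟩ := π.exists_rightInverse_of_surjective
    (LinearMap.range_eq_top.mpr (toFib_surjective s))
  exact ⟨j.toAddMonoidHom, fun x => LinearMap.congr_fun hj x, fun c x => j.map_smul c x⟩

/-- An `R`-linear section of the restriction map. -/
def fibSec (V : Type u) [AddCommGroup V] [Module B V] : AtPoint s ⊗[B] V →+ V :=
  (exists_section s V).choose

theorem toFib_fibSec (x : AtPoint s ⊗[B] V) : toFib s V (fibSec s V x) = x :=
  (exists_section s V).choose_spec.1 x

theorem fibSec_smul (c : R) (x : AtPoint s ⊗[B] V) :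
    fibSec s V (c • x) = algebraMap R B c • fibSec s V x :=
  (exists_section s V).choose_spec.2 c x

end Module

/-- Restriction to the fibre, in each degree. -/
def fibM (M : ModData A.toCatData B) (Y : A.Ob) (k : ℤ) : M.M Y k →+ (M.fibre s).M Y k :=
  toFib s (M.M Y k)

/-- The section of `fibM`. -/
def secM (M : ModData A.toCatData B) (Y : A.Ob) (k : ℤ) : (M.fibre s).M Y k →+ M.M Y k :=
  fibSec s (M.M Y k)

theorem fibM_secM (M : ModData A.toCatData B) (Y : A.Ob) (k : ℤ) (x : (M.fibre s).M Y k) :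
    fibM s M Y k (secM s M Y k x) = x := toFib_fibSec s x

theorem fibM_smul (M : ModData A.toCatData B) (Y : A.Ob) (k : ℤ) (f : B) (x : M.M Y k) :
    fibM s M Y k (f • x) = s f • fibM s M Y k x := toFib_smul s f x

theorem secM_smul (M : ModData A.toCatData B) (Y : A.Ob) (k : ℤ) (c : R) (x : (M.fibre s).M Y k) :
    secM s M Y k (c • x) = algebraMap R B c • secM s M Y k x := fibSec_smul s c x

theorem fibM_eq_zero (M : ModData A.toCatData B) (Y : A.Ob) (k : ℤ) {x : M.M Y k} :
    fibM s M Y k x = 0 ↔ x ∈ RingHom.ker s • (⊤ : Submodule B (M.M Y k)) := toFib_eq_zero s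

/-- The restriction map on total spaces. -/
def toT (M : ModData A.toCatData B) (Y : A.Ob) : M.T Y →+ (M.fibre s).T Y :=
  DirectSum.map (fibM s M Y)

/-- A section of the restriction map on total spaces. -/
def secT (M : ModData A.toCatData B) (Y : A.Ob) : (M.fibre s).T Y →+ M.T Y :=
  DirectSum.map (secM s M Y)

theorem toT_of (M : ModData A.toCatData B) (Y : A.Ob) (k : ℤ) (m : M.M Y k) :
    toT s M Y (M.of k m) = (M.fibre s).of k (fibM s M Y k m) := DirectSum.map_of _ _ _

theorem secT_of (M : ModData A.toCatData B) (Y : A.Ob) (k : ℤ) (m : (M.fibre s).M Y k) :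
    secT s M Y ((M.fibre s).of k m) = M.of k (secM s M Y k m) := DirectSum.map_of _ _ _

theorem toT_apply (M : ModData A.toCatData B) (Y : A.Ob) (k : ℤ) (x : M.T Y) :
    (toT s M Y x) k = fibM s M Y k (x k) := DirectSum.map_apply _ _ _

theorem secT_apply (M : ModData A.toCatData B) (Y : A.Ob) (k : ℤ) (x : (M.fibre s).T Y) :
    (secT s M Y x) k = secM s M Y k (x k) := DirectSum.map_apply _ _ _

theorem toT_secT (M : ModData A.toCatData B) (Y : A.Ob) (x : (M.fibre s).T Y) :
    toT s M Y (secT s M Y x) = x :=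
  DFinsupp.ext fun k => by rw [toT_apply, secT_apply, fibM_secM]

theorem toT_smul (M : ModData A.toCatData B) (Y : A.Ob) (f : B) (x : M.T Y) :
    toT s M Y (f • x) = s f • toT s M Y x :=
  DFinsupp.ext fun k => by
    rw [toT_apply, DirectSum.smul_apply, fibM_smul, DirectSum.smul_apply, toT_apply]

theorem secT_smul (M : ModData A.toCatData B) (Y : A.Ob) (c : R) (x : (M.fibre s).T Y) :
    secT s M Y (c • x) = algebraMap R B c • secT s M Y x :=
  DFinsupp.ext fun k => by
    rw [secT_apply, DirectSum.smul_apply, secM_smul, DirectSum.smul_apply, secT_apply]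

/-- A `B`-linear map commutes with restriction to the fibre, in the sense that it maps elements
which restrict to zero to elements which restrict to zero. -/
theorem IsBLin.toT_eq_zero {u : BHom M N} (hu : IsBLin u) {X Y : A.Ob} (p : A.Ch X Y) {k : ℤ}
    {m : M.M Y k} (hm : fibM s M Y k m = 0) : toT s N X (u X Y p (M.of k m)) = 0 := by
  rw [fibM_eq_zero] at hm
  refine Submodule.smul_induction_on hm (fun f hf n _ => ?_) fun x y hx hy => ?_
  · rw [of_smul, hu, toT_smul, (RingHom.mem_ker).mp hf, zero_smul]
  · rw [map_add, map_add, map_add, hx, hy, add_zero]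

/-- The restriction of a sequence of maps to the fibre. -/
def redB (u : BHom M N) : BHom (M.fibre s) (N.fibre s) := fun X Y p =>
  (toT s N X).comp ((u X Y p).comp (secT s M Y))

variable {s}

theorem redB_toT {u : BHom M N} (hu : IsBLin u) {X Y : A.Ob} (p : A.Ch X Y) (x : M.T Y) :
    redB s u X Y p (toT s M Y x) = toT s N X (u X Y p x) := by
  induction x using DirectSum.induction_on with
  | zero => simp
  | of k m =>
    have h : toT s M Y (DirectSum.of (fun k => M.M Y k) k m) = _ := toT_of s M Y k m
    rw [h]
    change toT s N X (u X Y p (secT s M Y _)) = toT s N X (u X Y p (M.of k m))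
    rw [secT_of, ← sub_eq_zero, ← map_sub, ← map_sub, ← map_sub]
    refine hu.toT_eq_zero s p ?_
    rw [map_sub, fibM_secM, sub_self]
  | add x y hx hy => rw [map_add, map_add, map_add, map_add, hx, hy]

theorem redB_eq {u : BHom M N} (hu : IsBLin u) {v : BHom (M.fibre s) (N.fibre s)}
    (h : ∀ X Y (p : A.Ch X Y) k (m : M.M Y k),
      v X Y p (toT s M Y (M.of k m)) = toT s N X (u X Y p (M.of k m))) : redB s u = v := by
  refine bhom_ext fun X Y p k y => ?_
  obtain ⟨m, rfl⟩ : ∃ m, fibM s M Y k m = y := toFib_surjective s y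
  rw [← toT_of, redB_toT hu, h]

theorem redB_add (u v : BHom M N) : redB s (u + v) = redB s u + redB s v := by
  funext X Y p
  refine AddMonoidHom.ext fun x => ?_
  exact (toT s N X).map_add _ _

theorem redB_sub (u v : BHom M N) : redB s (u - v) = redB s u - redB s v :=
  (AddMonoidHom.mk' (redB s) redB_add).map_sub u v

theorem redB_smul (f : B) (u : BHom M N) : redB s (f • u) = s f • redB s u := by
  funext X Y p
  refine AddMonoidHom.ext fun x => ?_
  exact toT_smul s N X f _

theorem redB_zero : redB s (0 : BHom M N) = 0 :=
  (AddMonoidHom.mk' (redB s) redB_add).map_zero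

theorem redB_star {v : BHom M N} (hv : IsBLin v) (u : BHom L M) :
    redB s (star v u) = star (redB s v) (redB s u) := by
  funext X Y p
  refine AddMonoidHom.ext fun x => ?_
  change toT s N X (star v u X Y p (secT s L Y x)) = _
  simp only [star, sp_apply, map_sp, AddMonoidHom.comp_apply]
  refine sp_congr fun S _ => ?_
  rw [← redB_toT hv]
  rfl

theorem redB_eps (u : BHom M N) : redB s (eps u) = eps (redB s u) := by
  funext X Y p
  refine AddMonoidHom.ext fun x => ?_
  simp [redB, eps, Units.smul_def]

theorem sgn_secT (M : ModData A.toCatData B) (Y : A.Ob) (x : (M.fibre s).T Y) :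
    sgn M Y (secT s M Y x) = secT s M Y (sgn (M.fibre s) Y x) := by
  induction x using DirectSum.induction_on with
  | zero => simp
  | of k m =>
    change sgn M Y (secT s M Y ((M.fibre s).of k m)) =
      secT s M Y (sgn (M.fibre s) Y ((M.fibre s).of k m))
    rw [secT_of, sgn_of, sgn_of, Units.smul_def, Units.smul_def, map_zsmul, secT_of]
  | add x y hx hy => rw [map_add, map_add, map_add, map_add, hx, hy]

theorem redB_tau (u : BHom M N) : redB s (tau u) = tau (redB s u) := by
  funext X Y p
  refine AddMonoidHom.ext fun x => ?_
  simp only [redB, tau, AddMonoidHom.smul_apply, AddMonoidHom.comp_apply, Units.smul_def,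
    map_zsmul, sgn_secT]

theorem redB_IB (u : BHom M N) : redB s (IB u) = IB (redB s u) := by
  funext X Y p
  exact (congrFun (aI_comp (((AddMonoidHom.compHom (toT s N X))).comp
    (AddMonoidHom.compHom' (secT s M Y))) (u X Y)) p).symm

theorem redB_bmu (M : ModData A.toCatData B) : redB s (bmu M) = bmu (M.fibre s) :=
  redB_eq (isBLin_bmu M) fun X Y p k m => by
    rw [bmu_of, toT_of, toT_of, bmu_of]
    rfl

theorem redB_bone (M : ModData A.toCatData B) : redB s (bone M) = bone (M.fibre s) := by
  refine redB_eq (isHom_bone M).lin fun X Y p k m => ?_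
  cases p with
  | nil => rfl
  | cons a p => exact (map_zero _).symm

theorem redB_bd {u : BHom M N} (hu : IsBLin u) : redB s (bd u) = bd (redB s u) := by
  rw [bd, bd, redB_tau, bL, bL, redB_sub, redB_sub, redB_star (isBLin_bmu N), redB_star hu.eps,
    redB_bmu, redB_bmu, redB_eps, redB_IB]

theorem IsHom.redB {g : ℤ} {u : BHom M N} (hu : IsHom g u) : IsHom g (redB s u) where
  deg := by
    intro X Y p k m e he
    change (toT s N X (u X Y p (secT s M Y _))) e = 0
    rw [secT_of, toT_apply, hu.deg X Y p k _ e he, map_zero]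
  lin := by
    intro X Y p c x
    change toT s N X (u X Y p (secT s M Y _)) = _
    rw [secT_smul, hu.lin, toT_smul, s.commutes]
    rfl
  mul := isMulti_of' fun {W X Y Z} n q r x => by
    have h := hu.mul.at n q r (secT s M Z x)
    constructor
    · intro a a'
      change toT s N W (u W Z _ (secT s M Z x)) = _
      rw [h.add, map_add]
      rfl
    · intro c a
      change toT s N W (u W Z _ (secT s M Z x)) = _
      rw [h.smul, toT_smul, s.commutes]
      rfl
  red := by
    intro W X Z q r
    refine AddMonoidHom.ext fun x => ?_
    change toT s N W (u W Z _ _) = 0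
    rw [hu.red, AddMonoidHom.zero_apply, map_zero]

end AInf

namespace AInf
open Chain

/-! ### Lifting from a fibre -/

variable {R : Type u} [Field R] {A : Category R} {B : Type u} [CommRing B] [Algebra R B]
variable {L M N : ModData A.toCatData B} {s : B →ₐ[R] R}

/-- Every morphism between fibres of families, the first one of which consists of projective
modules, lifts to the families. -/
theorem exists_redB_eq (hM : ∀ X k, Module.Projective B (M.M X k)) {g : ℤ}
    {v : BHom (M.fibre s) (N.fibre s)} (hv : IsHom g v) :
    ∃ u : BHom M N, IsHom g u ∧ redB s u = v := by
  choose i hi using fun X k => (Module.projective_def.mp (hM X k))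
  -- `i` splits the surjection from the free module on the elements of `M.M X k`, and `φ` lifts `v`
  -- element by element, so linearity in `m` comes from extending `φ` to the free module.
  let φ : ∀ X Y (p : A.Ch X Y) k, M.M Y k → N.T X := fun X Y p k x =>
    secT s N X (v X Y p (toT s M Y (M.of k x)))
  let u : BHom M N := fun X Y p => DirectSum.toAddMonoid fun k =>
    ((Finsupp.linearCombination B (φ X Y p k)) ∘ₗ i Y k).toAddMonoidHom
  have hu : ∀ X Y (p : A.Ch X Y) k (m : M.M Y k),
      u X Y p (M.of k m) = (i Y k m).sum fun x c => c • φ X Y p k x := fun X Y p k m => by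
    refine (DirectSum.toAddMonoid_of _ k m).trans ?_
    exact Finsupp.linearCombination_apply B _
  have hlin : IsBLin u := blin_of fun X Y p f k m => by
    have h : ∀ m, u X Y p (M.of k m) = Finsupp.linearCombination B (φ X Y p k) (i Y k m) := fun m =>
      DirectSum.toAddMonoid_of _ k m
    rw [h, h, map_smul, map_smul]
  refine ⟨u, ⟨?_, hlin, ?_, ?_⟩, redB_eq hlin fun X Y p k m => ?_⟩
  · intro X Y p k m e he
    rw [hu, Finsupp.sum]
    refine (DFinsupp.finsetSum_apply _ _ _).trans (Finset.sum_eq_zero fun x _ => ?_)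
    rw [DirectSum.smul_apply, secT_apply, toT_of, hv.deg X Y p k _ e he, map_zero, smul_zero]
  · refine isMulti_of fun {W X Y Z} n q r k m => ?_
    have h := fun x => hv.mul.at n q r (toT s M Z (M.of k x))
    constructor
    · intro a a'
      simp only [hu, φ, (h _).add, map_add, smul_add, Finsupp.sum_add]
    · intro c a
      simp only [hu, φ, (h _).smul, Finsupp.smul_sum]
      refine Finsupp.sum_congr fun x _ => ?_
      rw [Algebra.algebraMap_self, RingHom.id_apply, secT_smul, smul_comm]
  · intro W X Z q r
    refine DirectSum.addHom_ext fun k m => ?_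
    refine (hu _ _ _ k m).trans ?_
    refine Finset.sum_eq_zero fun x _ => ?_
    have h : v W Z (q.append (cons (A.one X) r)) = 0 := hv.red W X Z q r
    simp only [φ, h, AddMonoidHom.zero_apply, map_zero, smul_zero]
  · have h : m = (i Y k m).sum fun x c => c • x := by
      conv_lhs => rw [← hi Y k m]
      exact Finsupp.linearCombination_apply B _
    rw [hu, Finsupp.sum, map_sum]
    conv_lhs => rw [h, Finsupp.sum, map_sum, map_sum, map_sum]
    refine Finset.sum_congr rfl fun x _ => ?_
    rw [of_smul, toT_smul, hv.lin, toT_smul, toT_secT]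

theorem IsHom.of_smul {g : ℤ} {t : B} (ht : ∀ X k (x : N.M X k), t • x = 0 → x = 0)
    {y : BHom M N} (hy : IsHom g (t • y)) : IsHom g y := by
  have hT : ∀ X (x x' : N.T X), t • x = t • x' → x = x' := fun X x x' h => by
    rw [← sub_eq_zero, ← smul_sub] at h
    refine sub_eq_zero.mp (DFinsupp.ext fun k => ht X k _ ?_)
    rw [← DirectSum.smul_apply, h]
    rfl
  refine ⟨?_, ?_, isMulti_of' fun n q r x => ⟨?_, ?_⟩, ?_⟩
  · intro X Y p k m e he
    refine ht X e _ ?_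
    rw [← DirectSum.smul_apply]
    exact hy.deg X Y p k m e he
  · intro X Y p f x
    refine hT X _ _ ?_
    rw [smul_comm t f]
    exact hy.lin X Y p f x
  · intro a a'
    refine hT _ _ _ ?_
    rw [smul_add]
    exact (hy.mul.at n q r x).add a a'
  · intro c a
    refine hT _ _ _ ?_
    rw [smul_comm t]
    exact (hy.mul.at n q r x).smul c a
  · intro W X Z q r
    refine AddMonoidHom.ext fun x => hT _ _ _ ?_
    rw [AddMonoidHom.zero_apply, smul_zero]
    exact DFunLike.congr_fun (hy.red W X Z q r) x

theorem exists_smul_eq_of_toT_eq_zero {t b : B} (h : IsParam (RingHom.ker s) t b) {X : A.Ob}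
    {x : N.T X} (hx : toT s N X x = 0) : ∃ y, b • x = t • y := by
  classical
  have key : ∀ k (z : N.M X k), fibM s N X k z = 0 → ∃ y, b • z = t • y := by
    intro k z hz
    refine Submodule.smul_induction_on ((fibM_eq_zero s N X k).mp hz) (fun f hf n _ => ?_)
      fun z z' hz hz' => ?_
    · obtain ⟨c, hc⟩ := h.dvd f hf
      exact ⟨c • n, by rw [smul_smul, smul_smul, hc]⟩
    · obtain ⟨y, hy⟩ := hz
      obtain ⟨y', hy'⟩ := hz'
      exact ⟨y + y', by rw [smul_add, smul_add, hy, hy']⟩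
  choose y hy using fun k => key k (x k) (by rw [← toT_apply, hx]; rfl)
  refine ⟨DirectSum.mk (fun k => N.M X k) x.support fun k => y k, DFinsupp.ext fun k => ?_⟩
  rw [DirectSum.smul_apply, DirectSum.smul_apply]
  by_cases hk : k ∈ x.support
  · rw [DirectSum.mk_apply_of_mem hk, hy]
  · rw [DirectSum.mk_apply_of_notMem hk, DFinsupp.notMem_support_iff.mp hk, smul_zero, smul_zero]

/-- A morphism which vanishes on a fibre is, up to a unit near that point, divisible by the local
parameter. -/
theorem exists_smul_eq_of_redB_eq_zero {t b : B} (h : IsParam (RingHom.ker s) t b)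
    (ht : ∀ X k (x : N.M X k), t • x = 0 → x = 0) {g : ℤ} {u : BHom M N} (hu : IsHom g u)
    (h0 : redB s u = 0) : ∃ y : BHom M N, IsHom g y ∧ b • u = t • y := by
  have hT : ∀ X (x x' : N.T X), t • x = t • x' → x = x' := fun X x x' h => by
    rw [← sub_eq_zero, ← smul_sub] at h
    refine sub_eq_zero.mp (DFinsupp.ext fun k => ht X k _ ?_)
    rw [← DirectSum.smul_apply, h]
    rfl
  choose y hy using fun X Y (p : A.Ch X Y) (x : M.T Y) =>
    exists_smul_eq_of_toT_eq_zero (x := u X Y p x) h (by rw [← redB_toT hu.lin, h0]; rfl)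
  let y' : BHom M N := fun X Y p => AddMonoidHom.mk' (y X Y p) fun x x' => hT _ _ _ (by
    rw [smul_add, ← hy, ← hy, ← hy, map_add, smul_add])
  have e : b • u = t • y' := by
    funext X Y p
    exact AddMonoidHom.ext fun x => hy X Y p x
  exact ⟨y', IsHom.of_smul ht (e ▸ hu.smul b), e⟩

/-! ### Restriction in cohomology -/

theorem cls_eq_zero_iff {g : ℤ} {u : ZB M N g} : cls g u = 0 ↔ u.1 ∈ BB M N g :=
  Submodule.Quotient.mk_eq_zero _

theorem redB_mem_ZB {g : ℤ} {u : BHom M N} (hu : u ∈ ZB M N g) :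
    redB s u ∈ ZB (M.fibre s) (N.fibre s) g :=
  mem_ZB.mpr ⟨hu.1.redB, by rw [← redB_bd hu.1.lin, (mem_ZB.mp hu).2, redB_zero]⟩

theorem redB_mem_BB {g : ℤ} {u : BHom M N} (hu : u ∈ BB M N g) :
    redB s u ∈ BB (M.fibre s) (N.fibre s) g := by
  obtain ⟨w, hw, rfl⟩ := mem_BB.mp hu
  exact mem_BB.mpr ⟨_, hw.redB, (redB_bd hw.lin).symm⟩

variable (s) in
/-- Restriction of cohomology classes to a fibre. -/
def redH (M N : ModData A.toCatData B) (g : ℤ) : HB M N g →+ HB (M.fibre s) (N.fibre s) g :=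
  QuotientAddGroup.lift ((BB M N g).submoduleOf (ZB M N g)).toAddSubgroup
    (AddMonoidHom.mk' (fun u : ZB M N g => cls g ⟨redB s u.1, redB_mem_ZB u.2⟩)
      fun u v => congrArg (cls g) (Subtype.ext (redB_add u.1 v.1)))
    fun _ hu => (Submodule.Quotient.mk_eq_zero _).mpr (redB_mem_BB hu)

theorem redH_cls (g : ℤ) (u : ZB M N g) :
    redH s M N g (cls g u) = cls g ⟨redB s u.1, redB_mem_ZB u.2⟩ := rfl

theorem redH_smul (g : ℤ) (f : B) (x : HB M N g) :
    redH s M N g (f • x) = s f • redH s M N g x := by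
  obtain ⟨u, rfl⟩ := Submodule.Quotient.mk_surjective _ x
  exact congrArg (cls g) (Subtype.ext (redB_smul f u.1))

theorem redH_hcomp (g : ℤ) (y : HB M N g) (x : HB L M 0) :
    redH s L N g (hcomp L M N g y x) = hcomp _ _ _ g (redH s M N g y) (redH s L M 0 x) := by
  obtain ⟨u, rfl⟩ := Submodule.Quotient.mk_surjective _ x
  obtain ⟨v, rfl⟩ := Submodule.Quotient.mk_surjective _ y
  exact congrArg (cls g) (Subtype.ext (redB_star v.2.1.lin u.1))

theorem redH_bone (M : ModData A.toCatData B) :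
    redH s M M 0 (cls 0 ⟨bone M, bone_mem_ZB M⟩) = cls 0 ⟨bone _, bone_mem_ZB _⟩ :=
  congrArg (cls 0) (Subtype.ext (redB_bone M))

theorem redH_eq_zero_of_mem {g : ℤ} {x : HB M N g}
    (hx : x ∈ RingHom.ker s • (⊤ : Submodule B (HB M N g))) : redH s M N g x = 0 := by
  refine Submodule.smul_induction_on hx (fun f hf n _ => ?_) fun x y hx hy => ?_
  · rw [redH_smul, (RingHom.mem_ker).mp hf, zero_smul]
  · rw [map_add, hx, hy, add_zero]

theorem IsHom.bd_bd (hM : IsUMod M) (hN : IsUMod N) {g : ℤ} {u : BHom M N} (hu : IsHom g u) :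
    AInf.bd (AInf.bd u) = 0 := AInf.bd_bd hM.rel hN.rel fun X Y => (hu.mul X Y).add

theorem bhom_eq_zero_of_smul {t : B} (ht : ∀ X k (x : N.M X k), t • x = 0 → x = 0) {u : BHom M N}
    (hu : t • u = 0) : u = 0 := by
  funext X Y p
  refine AddMonoidHom.ext fun x => DFinsupp.ext fun k => ht X k _ ?_
  rw [← DirectSum.smul_apply]
  have : t • u X Y p x = 0 := DFunLike.congr_fun (congrFun (congrFun (congrFun hu X) Y) p) x
  rw [this]
  rfl

theorem exists_sub_one_mem_ker {b : B} (hb : b ∉ RingHom.ker s) :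
    ∃ c : B, c * b - 1 ∈ RingHom.ker s := by
  refine ⟨algebraMap R B (s b)⁻¹, ?_⟩
  rw [RingHom.mem_ker] at hb ⊢
  simp [hb]

/-- The restriction of classes to the fibre has kernel `ker s • H`. No assumption on torsion in the
cohomology is needed for this. -/
theorem mem_ker_smul_of_redH_eq_zero (hM : IsUMod M) (hN : IsUMod N)
    (hM' : ∀ X k, Module.Projective B (M.M X k)) {t b : B} (h : IsParam (RingHom.ker s) t b)
    (ht : ∀ X k (x : N.M X k), t • x = 0 → x = 0) {g : ℤ} {x : HB M N g}
    (hx : redH s M N g x = 0) : x ∈ RingHom.ker s • (⊤ : Submodule B (HB M N g)) := by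
  obtain ⟨u, rfl⟩ := Submodule.Quotient.mk_surjective _ x
  rw [redH_cls] at hx
  obtain ⟨w, hw, hw'⟩ := mem_BB.mp (cls_eq_zero_iff.mp hx)
  obtain ⟨w₀, hw₀, rfl⟩ := exists_redB_eq hM' hw
  have hd : IsHom g (bd w₀) := by
    have := hw₀.bd hM hN
    rwa [sub_add_cancel] at this
  have h₁ : IsHom g (u.1 - bd w₀) := (HomB M N g).sub_mem u.2.1 hd
  obtain ⟨y, hy, e⟩ := exists_smul_eq_of_redB_eq_zero h ht h₁ (by
    rw [redB_sub, redB_bd hw₀.lin, hw']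
    exact sub_self _)
  have hy' : bd y = 0 := bhom_eq_zero_of_smul ht (by
    rw [← bd_smul, ← e, bd_smul, bd_sub, (mem_ZB.mp u.2).2, hw₀.bd_bd hM hN, sub_zero, smul_zero])
  have e' : b • cls g u = t • cls g ⟨y, mem_ZB.mpr ⟨hy, hy'⟩⟩ := by
    refine cls_eq_iff.mpr (mem_BB.mpr ⟨b • w₀, hw₀.smul b, ?_⟩)
    change bd (b • w₀) = b • u.1 - t • y
    rw [← e, bd_smul, smul_sub, sub_sub_cancel]
  obtain ⟨c, hc⟩ := exists_sub_one_mem_ker h.notMem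
  have e'' : cls g u = c • t • cls g ⟨y, mem_ZB.mpr ⟨hy, hy'⟩⟩ - (c * b - 1) • cls g u := by
    rw [← e', sub_smul, mul_smul, one_smul, sub_sub_cancel]
  change cls g u ∈ _
  rw [e'']
  refine Submodule.sub_mem _ (Submodule.smul_mem _ c ?_) (Submodule.smul_mem_smul hc trivial)
  exact Submodule.smul_mem_smul h.mem trivial

/-- Cohomology classes on the fibre extend to the family, if there is no torsion in the next degree
near that point. -/
theorem redH_surjective (hM : IsUMod M) (hN : IsUMod N)
    (hM' : ∀ X k, Module.Projective B (M.M X k)) {t b : B} (h : IsParam (RingHom.ker s) t b)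
    (ht : ∀ X k (x : N.M X k), t • x = 0 → x = 0) {g : ℤ} {b' : B} (hb' : b' ∉ RingHom.ker s)
    (hb'' : ∀ z : HB M N (g + 1), t • z = 0 → b' • z = 0) :
    Function.Surjective (redH s M N g) := by
  intro x
  obtain ⟨v, rfl⟩ := Submodule.Quotient.mk_surjective _ x
  obtain ⟨u, hu, e₁⟩ := exists_redB_eq hM' v.2.1
  obtain ⟨y, hy, e⟩ := exists_smul_eq_of_redB_eq_zero h ht (hu.bd hM hN) (by
    rw [redB_bd hu.lin, e₁, (mem_ZB.mp v.2).2])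
  have hy' : bd y = 0 := bhom_eq_zero_of_smul ht (by
    rw [← bd_smul, ← e, bd_smul, hu.bd_bd hM hN, smul_zero])
  have h₁ : t • cls (g + 1) ⟨y, mem_ZB.mpr ⟨hy, hy'⟩⟩ = 0 := by
    refine (Submodule.Quotient.mk_eq_zero _).mpr (mem_BB.mpr ⟨b • u, ?_, ?_⟩)
    · rw [add_sub_cancel_right]
      exact hu.smul b
    · rw [bd_smul, e]
      rfl
  have h₂ : cls (g + 1) (b' • (⟨y, mem_ZB.mpr ⟨hy, hy'⟩⟩ : ZB M N (g + 1))) = 0 := hb'' _ h₁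
  obtain ⟨z, hz, hz'⟩ := mem_BB.mp (cls_eq_zero_iff.mp h₂)
  rw [add_sub_cancel_right] at hz
  have hz'' : bd z = b' • y := hz'
  have hw : (b' * b) • u - t • z ∈ ZB M N g := mem_ZB.mpr
    ⟨(HomB M N g).sub_mem (hu.smul _) (hz.smul _), by
      rw [bd_sub, bd_smul, bd_smul, hz'', mul_smul, e, smul_comm, sub_self]⟩
  obtain ⟨c, hc⟩ := exists_sub_one_mem_ker
    (fun h0 => ((Ideal.IsPrime.mem_or_mem inferInstance h0).elim hb' h.notMem : False))
  refine ⟨c • cls g ⟨_, hw⟩, ?_⟩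
  rw [redH_smul, redH_cls]
  refine congrArg (cls g) (Subtype.ext ?_ : s c • (⟨_, redB_mem_ZB hw⟩ : ZB _ _ g) = v)
  change s c • redB s ((b' * b) • u - t • z) = v.1
  rw [redB_sub, redB_smul, redB_smul, e₁, (RingHom.mem_ker).mp h.mem, zero_smul, sub_zero,
    smul_smul, ← map_mul]
  rw [RingHom.mem_ker, map_sub, map_one, sub_eq_zero] at hc
  rw [hc, one_smul]

end AInf

namespace AInf
open Chain

/-! ### The Yoneda module of a twisted complex -/

variable {R : Type u} [Field R] {A : Category R} {B : Type u} [CommRing B] [Algebra R B]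

namespace TwData

variable (Y : TwData A.toCatData B)

theorem exists_list_tmul {V W : Type u} [AddCommGroup V] [Module R V] [AddCommGroup W] [Module R W]
    (x : V ⊗[R] W) : ∃ l : List (V × W), (l.map fun y => y.1 ⊗ₜ[R] y.2).sum = x := by
  induction x using TensorProduct.induction_on with
  | zero => exact ⟨[], rfl⟩
  | tmul v w => exact ⟨[(v, w)], by simp⟩
  | add x y hx hy =>
    obtain ⟨l, rfl⟩ := hx
    obtain ⟨l', rfl⟩ := hy
    exact ⟨l ++ l', by simp⟩

open scoped Classical in
/-- A presentation of `δ(f)` as a sum of pure tensors. -/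
def rep (i j : Fin Y.N) (f : Y.F i) : List (Y.F j × A.Hom (Y.Y i) (Y.Y j) (1 + Y.σ i - Y.σ j)) :=
  if Y.δ i j f = 0 then [] else (exists_list_tmul (Y.δ i j f)).choose

theorem sum_rep (i j : Fin Y.N) (f : Y.F i) :
    ((Y.rep i j f).map fun y => y.1 ⊗ₜ[R] y.2).sum = Y.δ i j f := by
  unfold rep
  split_ifs with h
  · rw [h]
    rfl
  · exact (exists_list_tmul (Y.δ i j f)).choose_spec

/-- The inclusion of the degree `k` part into the total space of the Yoneda module. -/
def ofTot {X : A.Ob} (k : ℤ) : Y.Tot X k →+ Y.yon.T X := Y.yon.of k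

theorem ofTot_congr {X : A.Ob} {k k' : ℤ} (h : k = k') (x : ∀ e, Y.Tot X e) :
    Y.ofTot k (x k) = Y.ofTot k' (x k') := by rw [h]

/-- Functions on sequences `f ⊗ (a_d, …, a_1)`, with values in the Yoneda module. -/
abbrev Fam : Type u := ∀ (i : Fin Y.N) (X : A.Ob), A.Ch X (Y.Y i) → Y.F i → Y.yon.T X

/-- Insertion of `δ` in the leftmost place. -/
def ins (φ : Y.Fam) : Y.Fam := fun i X p f =>
  ∑ j, ((Y.rep i j f).map fun y => φ j X (cons y.2 p) y.1).sum

theorem ins_add (φ ψ : Y.Fam) : Y.ins (φ + ψ) = Y.ins φ + Y.ins ψ := by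
  funext i X p f
  simp only [ins, Pi.add_apply, List.sum_map_add, Finset.sum_add_distrib]

/-- `ins` as an additive map. -/
def insHom : Y.Fam →+ Y.Fam := AddMonoidHom.mk' Y.ins Y.ins_add

/-- Repeated insertion vanishes, since `δ` is strictly triangular. -/
theorem ins_iterate_eq_zero (r : ℕ) (φ : Y.Fam) (i : Fin Y.N) (h : Y.N ≤ i + r) :
    Y.ins^[r] φ i = 0 := by
  induction r generalizing i with
  | zero => exact absurd i.2 (not_lt.mpr h)
  | succ r ih =>
    funext X p f
    rw [Function.iterate_succ_apply']
    refine Finset.sum_eq_zero fun j _ => ?_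
    by_cases hij : i < j
    · rw [ih j (by omega)]
      simp
    · have : Y.rep i j f = [] := by
        exact if_pos (by rw [Y.δ_strict i j hij, LinearMap.zero_apply])
      rw [this]
      rfl

/-- The operations `f ⊗ (a_d, …, a_1) ↦ μ(δ, …, δ, f ⊗ a_d, …, a_1)` with `r` insertions of `δ`. -/
def famOp (r : ℕ) : Y.Fam := fun i X p f =>
  Y.ofTot (p.rdeg + 2 + Y.σ i) ((Y.insertions r).op i X p (p.rdeg + 2 + Y.σ i) f)

/-- The sum of the operations `famOp`. -/
def famTot : Y.Fam := ∑ r ∈ Finset.range Y.N, Y.famOp r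

theorem famTot_apply (i : Fin Y.N) (X : A.Ob) (p : A.Ch X (Y.Y i)) (f : Y.F i) :
    Y.famTot i X p f = ∑ r ∈ Finset.range Y.N, Y.famOp r i X p f := by
  simp only [famTot, Finset.sum_apply]

theorem ins_famOp (r : ℕ) : Y.ins (Y.famOp r) = Y.famOp (r + 1) := by
  funext i X p f
  have h : (Y.insertions (r + 1)).op i X p (p.rdeg + 2 + Y.σ i) f =
      ∑ j, ((Y.rep i j f).map fun y =>
        (Y.insertions r).op j X (cons y.2 p) (p.rdeg + 2 + Y.σ i) y.1).sum := by
    change (∑ j, (Y.insertions r).ext j p _ (p.rdeg + 2 + Y.σ i) ∘ₗ Y.δ i j) f = _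
    rw [LinearMap.sum_apply]
    refine Finset.sum_congr rfl fun j _ => ?_
    rw [LinearMap.comp_apply, ← Y.sum_rep, map_list_sum, List.map_map]
    rfl
  rw [ins, famOp, h, map_sum]
  refine Finset.sum_congr rfl fun j _ => ?_
  rw [map_list_sum, List.map_map]
  congr 1
  refine List.map_congr_left fun y _ => ?_
  exact Y.ofTot_congr (by rw [rdeg_cons]; ring) fun e => (Y.insertions r).op j X (cons y.2 p) e y.1

theorem famOp_eq_iterate (r : ℕ) : Y.famOp r = Y.ins^[r] (Y.famOp 0) := by
  induction r with
  | zero => rfl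
  | succ r ih => rw [Function.iterate_succ_apply', ← ih, ins_famOp]

theorem famOp_eq_zero (r : ℕ) (i : Fin Y.N) (h : Y.N ≤ i + r) : Y.famOp r i = 0 := by
  rw [famOp_eq_iterate, ins_iterate_eq_zero Y r _ i h]

theorem famTot_sub_ins : Y.famTot - Y.ins Y.famTot = Y.famOp 0 := by
  have h₁ : Y.ins Y.famTot = ∑ r ∈ Finset.range Y.N, Y.famOp (r + 1) :=
    (map_sum Y.insHom _ _).trans (Finset.sum_congr rfl fun r _ => Y.ins_famOp r)
  have h₂ : Y.famOp Y.N = 0 := funext fun i => Y.famOp_eq_zero Y.N i (by omega)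
  have h₃ := (Finset.sum_range_succ Y.famOp Y.N).symm.trans (Finset.sum_range_succ' Y.famOp Y.N)
  rw [h₁, famTot, sub_eq_iff_eq_add, add_comm, ← h₃, h₂, add_zero]

theorem bmu_single (i : Fin Y.N) {W X : A.Ob} (p : A.Ch W X) (k : ℤ) (f : Y.F i)
    (a : A.Hom X (Y.Y i) (k - Y.σ i)) :
    bmu Y.yon W X p (Y.ofTot k (Pi.single i (f ⊗ₜ a))) = Y.famTot i W (cons a p) f := by
  refine (bmu_of W X p k _).trans ?_
  rw [famTot_apply]
  change Y.ofTot _ ((∑ r ∈ Finset.range Y.N, ∑ j : Fin Y.N,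
    (Y.insertions r).ext j p (k - Y.σ j) _ ∘ₗ LinearMap.proj j) _) = _
  rw [LinearMap.sum_apply, map_sum]
  refine Finset.sum_congr rfl fun r _ => ?_
  rw [LinearMap.sum_apply, Finset.sum_eq_single i]
  · rw [LinearMap.comp_apply, LinearMap.proj_apply, Pi.single_eq_same, Op.ext_tmul]
    exact Y.ofTot_congr (by rw [rdeg_cons]; ring) fun e => (Y.insertions r).op i W (cons a p) e f
  · intro j _ hj
    rw [LinearMap.comp_apply, LinearMap.proj_apply, Pi.single_eq_of_ne hj, map_zero]
  · simp

theorem tot_ext {X : A.Ob} {k : ℤ} {G : Type*} [AddCommGroup G] {φ ψ : Y.Tot X k →+ G}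
    (h : ∀ i (f : Y.F i) (a : A.Hom X (Y.Y i) (k - Y.σ i)),
      φ (Pi.single i (f ⊗ₜ a)) = ψ (Pi.single i (f ⊗ₜ a))) : φ = ψ := by
  refine AddMonoidHom.functions_ext' _ _ _ fun i => ?_
  refine AddMonoidHom.ext fun x => ?_
  induction x using TensorProduct.induction_on with
  | zero => rw [map_zero, map_zero]
  | tmul f a => exact h i f a
  | add x y hx hy => rw [map_add, map_add, hx, hy]

/-- The terms of the module equations with `r` insertions of `δ` in the inner operation. -/
def kap (r : ℕ) : Y.Fam := fun i _ p f =>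
  sp p fun S => S.right.rdeg.negOnePow • bmu Y.yon _ _ S.right (Y.famOp r i S.mid S.left f)

/-- Insertion of the `A_∞`-operations of `A`. -/
def insMu (φ : Y.Fam) : Y.Fam := fun i X p f => aI A (fun p => φ i X p f) p

/-- The terms in `kap` where the inner operation has no further entry. -/
def kapNil (r : ℕ) : Y.Fam := fun i _ p f =>
  p.rdeg.negOnePow • bmu Y.yon _ _ p (Y.famOp r i _ (nil _) f)

theorem kap_cons (r : ℕ) (i : Fin Y.N) {W X : A.Ob} {n : ℤ} (a : A.Hom X (Y.Y i) n) (p : A.Ch W X)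
    (f : Y.F i) : Y.kap r i W (cons a p) f = Y.kapNil r i W (cons a p) f +
      sp p fun S => S.right.rdeg.negOnePow •
        bmu Y.yon _ _ S.right (Y.famOp r i S.mid (cons a S.left) f) := sp_cons _ _ _

theorem sum_list_sp {ι V : Type*} [AddCommGroup V] {W X : A.Ob} (p : A.Ch W X) (l : List ι)
    (F : ι → Split A.Hom W X → V) : (l.map fun y => sp p (F y)).sum =
      sp p fun S => (l.map fun y => F y S).sum := by
  induction l with
  | nil => exact (sp_zero p).symm
  | cons y l ih => simp only [List.map_cons, List.sum_cons, ih, sp_add]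

theorem ins_kap (r : ℕ) : Y.ins (Y.kap r) = Y.ins (Y.kapNil r) + Y.kap (r + 1) := by
  funext i X p f
  simp only [ins, kap_cons, List.sum_map_add, Finset.sum_add_distrib, Pi.add_apply, sum_list_sp]
  congr 1
  rw [← sp_sum]
  refine sp_congr fun S _ => ?_
  rw [← ins_famOp, ins, map_sum, Finset.smul_sum]
  refine Finset.sum_congr rfl fun j _ => ?_
  rw [map_list_sum, List.smul_sum, List.map_map, List.map_map]
  rfl

theorem famOp_zero_nil (i : Fin Y.N) (f : Y.F i) : Y.famOp 0 i _ (nil _) f = 0 := by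
  change Y.ofTot _ (Pi.single i (f ⊗ₜ A.μ _ _ (nil (Y.Y i)) _)) = 0
  rw [A.μ_nil, TensorProduct.tmul_zero, Pi.single_zero, map_zero]

theorem kapNil_zero : Y.kapNil 0 = 0 := by
  funext i X p f
  rw [kapNil, famOp_zero_nil, map_zero, smul_zero]
  rfl

theorem sum_kapNil (hY : Y.MaurerCartan) : ∑ r ∈ Finset.range Y.N, Y.kapNil r = 0 := by
  funext i X p f
  have h : ∑ r ∈ Finset.range Y.N, Y.famOp r i _ (nil _) f = 0 := by
    simp only [famOp]
    rw [← map_sum, hY, map_zero]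
  simp only [Finset.sum_apply, kapNil]
  rw [← Finset.smul_sum, ← map_sum, h, map_zero, smul_zero]
  rfl

theorem famTot_mu (i : Fin Y.N) {W X : A.Ob} (l : A.Ch X (Y.Y i)) (r : A.Ch W X) (f : Y.F i) :
    bmu Y.yon W X r (Y.famOp 0 i X l f) =
      Y.famTot i W (cons (A.μ _ _ l (l.rdeg + 2)) r) f := by
  have h : ∀ d d', d = d' → Y.famTot i W (cons (A.μ _ _ l d) r) f =
      Y.famTot i W (cons (A.μ _ _ l d') r) f := by
    rintro d _ rfl
    rfl
  rw [h _ (l.rdeg + 2 + Y.σ i - Y.σ i) (by ring)]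
  exact Y.bmu_single i r _ f _

theorem insMu_famTot_cons (i : Fin Y.N) {W X : A.Ob} {n : ℤ} (a : A.Hom X (Y.Y i) n) (p : A.Ch W X)
    (f : Y.F i) : Y.insMu Y.famTot i W (cons a p) f = Y.kap 0 i W (cons a p) f +
      aI A (fun p => Y.famTot i W (cons a p) f) p := by
  rw [insMu, aI, sp3_cons]
  congr 1
  refine sp_congr fun S _ => ?_
  rw [famTot_mu]
  rfl

theorem aI_list {ι V : Type*} [AddCommGroup V] {W X : A.Ob} (l : List ι)
    (F : ι → A.Ch W X → V) (p : A.Ch W X) : (l.map fun y => aI A (F y) p).sum =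
      aI A (fun p => (l.map fun y => F y p).sum) p := by
  induction l with
  | nil => exact (congrFun (aI_comp (0 : V →+ V) fun _ => 0) p).symm
  | cons y l ih =>
    simp only [List.map_cons, List.sum_cons, ih]
    exact (congrFun (aI_add (F y) fun p => (l.map fun y => F y p).sum) p).symm

theorem aI_sum {ι V : Type*} [AddCommGroup V] {W X : A.Ob} (s : Finset ι)
    (F : ι → A.Ch W X → V) (p : A.Ch W X) :
    ∑ y ∈ s, aI A (F y) p = aI A (fun p => ∑ y ∈ s, F y p) p := by
  simp only [← Finset.sum_map_toList]
  exact aI_list s.toList F p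

theorem ins_insMu_famTot : Y.ins (Y.insMu Y.famTot) = Y.kap 1 + Y.insMu (Y.ins Y.famTot) := by
  have h : Y.ins (Y.insMu Y.famTot) = Y.ins (Y.kap 0) + Y.insMu (Y.ins Y.famTot) := by
    funext i X p f
    simp only [ins, insMu_famTot_cons, List.sum_map_add, Finset.sum_add_distrib, Pi.add_apply,
      aI_list, aI_sum]
    rfl
  rw [h, ins_kap, kapNil_zero]
  congr 1
  rw [show Y.ins 0 = 0 from Y.insHom.map_zero, zero_add]

theorem insMu_add (φ ψ : Y.Fam) : Y.insMu (φ + ψ) = Y.insMu φ + Y.insMu ψ := by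
  funext i X p f
  exact congrFun (aI_add (fun p => φ i X p f) fun p => ψ i X p f) p

theorem insMu_famOp_zero : Y.insMu (Y.famOp 0) = 0 := by
  funext i X p f
  have h : ∀ p' : A.Ch X (Y.Y i), p'.rdeg = p.rdeg + 1 → Y.famOp 0 i X p' f =
      Y.ofTot (p.rdeg + 3 + Y.σ i)
        (Pi.single i (f ⊗ₜ A.μ _ _ p' (p.rdeg + 3 + Y.σ i - Y.σ i))) := fun p' hp =>
    Y.ofTot_congr (by rw [hp]; ring) fun e => Pi.single i (f ⊗ₜ A.μ _ _ p' (e - Y.σ i))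
  let φ : A.Hom X (Y.Y i) (p.rdeg + 3 + Y.σ i - Y.σ i) →+ Y.yon.T X :=
    (Y.ofTot (p.rdeg + 3 + Y.σ i)).comp
      ((AddMonoidHom.single (fun j => Y.F j ⊗[R] A.Hom X (Y.Y j) _) i).comp
        (TensorProduct.mk R (Y.F i) _ f).toAddMonoidHom)
  have h₁ : Y.insMu (Y.famOp 0) i X p f = φ (sp3 p fun l m r => r.rdeg.negOnePow •
      A.μ _ _ (l.append (cons (A.μ _ _ m (m.rdeg + 2)) r)) (p.rdeg + 3 + Y.σ i - Y.σ i)) := by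
    refine Eq.trans ?_ (map_sp3 φ p _).symm
    change sp3 p (fun l m r => r.rdeg.negOnePow •
      Y.famOp 0 i X (l.append (cons (A.μ _ _ m (m.rdeg + 2)) r)) f) = _
    refine sp3_congr fun l m r hp => ?_
    rw [Units.smul_def, Units.smul_def, map_zsmul, h _ (by rw [rdeg_insert, hp])]
    rfl
  exact h₁.trans ((congrArg φ (sp3_mu p _)).trans (map_zero φ))

/-- The defect in the module equations for the Yoneda module. -/
def relDefect : Y.Fam := ∑ r ∈ Finset.range Y.N, Y.kap r + Y.insMu Y.famTot - Y.kap 0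

theorem relDefect_eq_zero (hY : Y.MaurerCartan) : Y.relDefect = 0 := by
  have h₁ : Y.ins Y.relDefect = ∑ r ∈ Finset.range Y.N, Y.kap (r + 1) +
      Y.insMu (Y.ins Y.famTot) := by
    change Y.insHom _ = _
    rw [relDefect, map_sub, map_add, map_sum]
    change ∑ r ∈ _, Y.ins (Y.kap r) + Y.ins (Y.insMu Y.famTot) - Y.ins (Y.kap 0) = _
    have h₂ : ∑ r ∈ Finset.range Y.N, Y.ins (Y.kapNil r) = 0 := by
      refine (map_sum Y.insHom _ _).symm.trans ?_
      rw [Y.sum_kapNil hY, map_zero]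
    have h₃ : Y.ins 0 = 0 := Y.insHom.map_zero
    simp only [ins_kap, Finset.sum_add_distrib, h₂, ins_insMu_famTot, kapNil_zero, h₃]
    abel
  have h₂ : Y.relDefect = Y.ins Y.relDefect := by
    rw [h₁, relDefect]
    have h₃ := (Finset.sum_range_succ Y.kap Y.N).symm.trans (Finset.sum_range_succ' Y.kap Y.N)
    have h₄ : Y.kap Y.N = 0 := by
      funext i X p f
      refine (sp_congr (g := fun _ => 0) fun S _ => ?_).trans (sp_zero p)
      rw [Y.famOp_eq_zero Y.N i (by omega)]
      exact (congrArg (S.right.rdeg.negOnePow • ·) (map_zero _)).trans (smul_zero _)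
    rw [h₄, add_zero] at h₃
    have h₅ : Y.famTot = Y.ins Y.famTot + Y.famOp 0 := by rw [← famTot_sub_ins]; abel
    have h₆ : Y.insMu Y.famTot = Y.insMu (Y.ins Y.famTot) := by
      conv_lhs => rw [h₅, insMu_add, insMu_famOp_zero, add_zero]
    rw [h₃, h₆]
    abel
  have h₃ : ∀ r, Y.relDefect = Y.ins^[r] Y.relDefect := fun r => by
    induction r with
    | zero => rfl
    | succ r ih => rw [Function.iterate_succ_apply', ← ih, ← h₂]
  funext i
  rw [h₃ Y.N]
  exact Y.ins_iterate_eq_zero _ _ i (by omega)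

theorem isRel_yon (hY : Y.MaurerCartan) : IsRel Y.yon := by
  funext W X p
  refine DirectSum.addHom_ext' fun k => Y.tot_ext fun i f a => ?_
  have h := congrFun (congrFun (congrFun (congrFun (Y.relDefect_eq_zero hY) i) W) (cons a p)) f
  have h₀ := congrFun (congrFun (congrFun (congrFun (Y.sum_kapNil hY) i) W) (cons a p)) f
  simp only [relDefect, Pi.sub_apply, Pi.add_apply, Finset.sum_apply, insMu_famTot_cons,
    kap_cons _ _ _ a p, Finset.sum_add_distrib] at h h₀
  rw [h₀, Pi.zero_apply, Pi.zero_apply, Pi.zero_apply, Pi.zero_apply, zero_add, add_sub_assoc,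
    add_sub_cancel_left, ← sp_sum] at h
  set x : Y.yon.T X := Y.ofTot k (Pi.single i (f ⊗ₜ[R] a)) with hx
  have h₁ : star (eps (bmu Y.yon)) (bmu Y.yon) W X p x = sp p fun S =>
      ∑ r ∈ Finset.range Y.N, S.right.rdeg.negOnePow •
        bmu Y.yon W S.mid S.right (Y.famOp r i S.mid (cons a S.left) f) := by
    rw [star, sp_apply]
    refine sp_congr fun S _ => ?_
    rw [← Finset.smul_sum, ← map_sum, ← famTot_apply, ← bmu_single]
    rfl
  have h₂ : IB (bmu Y.yon) W X p x = aI A (fun p => Y.famTot i W (cons a p) f) p := by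
    refine (congrFun (aI_comp (AddMonoidHom.eval x) fun p => bmu Y.yon W X p) p).symm.trans ?_
    congr 1
    funext p
    exact Y.bmu_single i p k f a
  change star (eps (bmu Y.yon)) (bmu Y.yon) W X p x + IB (bmu Y.yon) W X p x = 0
  rw [h₁, h₂]
  exact h

theorem op_unit (r : ℕ) (i : Fin Y.N) {W X : A.Ob} (q : A.Ch X (Y.Y i)) (r' : A.Ch W X)
    (h : 2 ≤ q.length + r'.length + r) (f : Y.F i) :
    Y.famOp r i W (q.append (cons (A.one X) r')) f = 0 := by
  induction r generalizing i with
  | zero =>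
    change Y.ofTot _ (Pi.single i (f ⊗ₜ A.μ _ _ _ _)) = 0
    rw [A.one_vanish _ _ _ q r' (by omega), TensorProduct.tmul_zero, Pi.single_zero, map_zero]
  | succ r ih =>
    rw [← ins_famOp]
    refine Finset.sum_eq_zero fun j _ => ?_
    rw [List.map_congr_left (g := fun _ => 0) fun y _ => ?_]
    · simp
    · exact ih j (cons y.2 q) (by simp only [length]; omega) y.1

theorem isUMod_yon (hY : Y.MaurerCartan) : IsUMod Y.yon where
  rel := Y.isRel_yon hY
  unit X := by
    refine DirectSum.addHom_ext' fun k => Y.tot_ext fun i f a => ?_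
    refine (Y.bmu_single i (cons (A.one X) (nil X)) k f a).trans ?_
    rw [famTot_apply, Finset.sum_eq_single 0]
    · refine (Y.ofTot_congr (k' := k) (by rw [rdeg_cons, rdeg_cons, rdeg_nil]; ring) fun e =>
        Pi.single i (f ⊗ₜ A.μ _ _ _ (e - Y.σ i))).trans ?_
      rw [A.one_right]
      rfl
    · intro r _ hr
      exact Y.op_unit r i (cons a (nil _)) (nil _) (by simp only [length]; omega) f
    · intro h
      exact absurd (Finset.mem_range.mpr (by have := i.2; omega)) h
  unit_vanish W X Z q r hqr := by
    refine DirectSum.addHom_ext' fun k => Y.tot_ext fun i f a => ?_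
    refine (Y.bmu_single i _ k f a).trans ?_
    rw [famTot_apply]
    exact Finset.sum_eq_zero fun r' _ =>
      Y.op_unit r' i (cons a q) r (by simp only [length]; omega) f

end TwData
end AInf

namespace AInf
open Chain

/-! ### Morphisms out of the Yoneda module of a twisted complex -/

variable {R : Type u} [Field R] {A : Category R} {B : Type u} [CommRing B] [Algebra R B]
variable {L N : ModData A.toCatData B}

namespace TwData

variable (Y : TwData A.toCatData B)

theorem ofTot_single_congr {X : A.Ob} {k k' : ℤ} (h : k = k') (i : Fin Y.N) (f : Y.F i)
    (a : A.Hom X (Y.Y i) (k - Y.σ i)) (a' : A.Hom X (Y.Y i) (k' - Y.σ i)) (ha : HEq a a') :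
    Y.ofTot k (Pi.single i (f ⊗ₜ a)) = Y.ofTot k' (Pi.single i (f ⊗ₜ a')) := by
  subst h
  obtain rfl := eq_of_heq ha
  rfl

/-- The element `f ⊗ a` of the Yoneda module. -/
def el (i : Fin Y.N) {X : A.Ob} {n : ℤ} (a : A.Hom X (Y.Y i) n) (f : Y.F i) : Y.yon.T X :=
  Y.ofTot (n + Y.σ i) (Pi.single i (f ⊗ₜ cast (by rw [add_sub_cancel_right]) a))

theorem ofTot_single {X : A.Ob} (k : ℤ) (i : Fin Y.N) (f : Y.F i)
    (a : A.Hom X (Y.Y i) (k - Y.σ i)) : Y.ofTot k (Pi.single i (f ⊗ₜ a)) = Y.el i a f :=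
  Y.ofTot_single_congr (by ring) i f _ _ (cast_heq _ _).symm

theorem exists_of_el (i : Fin Y.N) {X : A.Ob} {n : ℤ} (a : A.Hom X (Y.Y i) n) :
    ∃ (k : ℤ) (h : n = k - Y.σ i), ∀ f, Y.el i a f = Y.ofTot k (Pi.single i (f ⊗ₜ (h ▸ a))) := by
  refine ⟨n + Y.σ i, by ring, fun f => Y.ofTot_single_congr rfl i f _ _ ?_⟩
  exact (cast_heq _ _).trans (by simp)

theorem bmu_el (i : Fin Y.N) {W X : A.Ob} (p : A.Ch W X) {n : ℤ} (a : A.Hom X (Y.Y i) n)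
    (f : Y.F i) : bmu Y.yon W X p (Y.el i a f) = Y.famTot i W (cons a p) f := by
  obtain ⟨k, rfl, hk⟩ := Y.exists_of_el i a
  rw [hk]
  exact Y.bmu_single i p k f a

theorem famOp_zero (i : Fin Y.N) {X : A.Ob} (p : A.Ch X (Y.Y i)) (f : Y.F i) :
    Y.famOp 0 i X p f = Y.el i (A.μ _ _ p (p.rdeg + 2)) f := by
  refine (Y.ofTot_single _ i f _).trans ?_
  have h : ∀ d d', d = d' → Y.el i (A.μ _ _ p d) f = Y.el i (A.μ _ _ p d') f := by
    rintro d _ rfl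
    rfl
  exact h _ _ (by ring)

theorem sgn_el (i : Fin Y.N) {X : A.Ob} {n : ℤ} (a : A.Hom X (Y.Y i) n) (f : Y.F i) :
    sgn Y.yon X (Y.el i a f) = (n + Y.σ i).negOnePow • Y.el i a f := sgn_of X _ _

theorem yon_ext {W X : A.Ob} {φ ψ : Y.yon.T X →+ N.T W}
    (h : ∀ i n (a : A.Hom X (Y.Y i) n) f, φ (Y.el i a f) = ψ (Y.el i a f)) : φ = ψ := by
  refine DirectSum.addHom_ext' fun k => Y.tot_ext fun i f a => ?_
  change φ (Y.ofTot k _) = ψ (Y.ofTot k _)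
  rw [ofTot_single, h]

theorem el_zero (i : Fin Y.N) {X : A.Ob} {n : ℤ} (f : Y.F i) :
    Y.el i (0 : A.Hom X (Y.Y i) n) f = 0 := by
  obtain ⟨k, rfl, hk⟩ := Y.exists_of_el i (0 : A.Hom X (Y.Y i) n)
  rw [hk, TensorProduct.tmul_zero, Pi.single_zero, map_zero]

theorem el_sign (i : Fin Y.N) {X : A.Ob} {n m : ℤ} (a : A.Hom X (Y.Y i) n) (f : Y.F i) :
    Y.el i (m.negOnePow • a) f = m.negOnePow • Y.el i a f := by
  obtain ⟨k, rfl, hk⟩ := Y.exists_of_el i a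
  rw [← ofTot_single, ← ofTot_single, Units.smul_def, Units.smul_def, TensorProduct.tmul_smul,
    ← map_zsmul]
  congr 1
  exact Pi.single_smul _ _ _

/-- The map `f ↦ f ⊗ a`. -/
def elₗ (i : Fin Y.N) {X : A.Ob} {n : ℤ} (a : A.Hom X (Y.Y i) n) : Y.F i →ₗ[B] Y.yon.T X where
  toFun := Y.el i a
  map_add' f f' := by
    rw [el, TensorProduct.add_tmul, Pi.single_add, map_add]
    rfl
  map_smul' b f := by
    have h : (Pi.single i ((b • f) ⊗ₜ[R] cast (by rw [add_sub_cancel_right]) a) :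
        Y.Tot X (n + Y.σ i)) = b • Pi.single i (f ⊗ₜ[R] cast (by rw [add_sub_cancel_right]) a) :=
      (LinearMap.single B (fun j => Y.F j ⊗[R] A.Hom X (Y.Y j) (n + Y.σ i - Y.σ j)) i).map_smul b
        (f ⊗ₜ[R] cast (by rw [add_sub_cancel_right]) a)
    rw [el, h]
    exact of_smul (M := Y.yon) _ b _

/-- Additive maps which vanish on the components with index at least `m`. -/
def Vanishes (m : ℕ) {X : A.Ob} {G : Type*} [AddCommGroup G] (φ : Y.yon.T X →+ G) : Prop :=
  ∀ (i : Fin Y.N), m ≤ i → ∀ (n : ℤ) (a : A.Hom X (Y.Y i) n) (f : Y.F i), φ (Y.el i a f) = 0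

variable {Y}

theorem map_ins_eq_zero {X : A.Ob} {G : Type*} [AddCommGroup G] {φ : Y.yon.T X →+ G} {ψ : Y.Fam}
    (i : Fin Y.N) (p : A.Ch X (Y.Y i)) (f : Y.F i)
    (h : ∀ j, i < j → ∀ (q : A.Ch X (Y.Y j)) f, φ (ψ j X q f) = 0) : φ (Y.ins ψ i X p f) = 0 := by
  rw [ins, map_sum]
  refine Finset.sum_eq_zero fun j _ => ?_
  by_cases hij : i < j
  · rw [map_list_sum]
    refine List.sum_eq_zero fun x hx => ?_
    simp only [List.mem_map] at hx
    obtain ⟨_, ⟨y, _, rfl⟩, rfl⟩ := hx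
    exact h j hij _ _
  · rw [show Y.rep i j f = [] from if_pos (by rw [Y.δ_strict i j hij, LinearMap.zero_apply])]
    exact map_zero φ

theorem Vanishes.famOp {m : ℕ} {X : A.Ob} {G : Type*} [AddCommGroup G] {φ : Y.yon.T X →+ G}
    (h : Y.Vanishes m φ) (r : ℕ) (i : Fin Y.N) (hi : m ≤ i) (p : A.Ch X (Y.Y i))
    (f : Y.F i) : φ (Y.famOp r i X p f) = 0 := by
  induction r generalizing i with
  | zero => rw [famOp_zero, h i hi]
  | succ r ih =>
    rw [← ins_famOp]
    exact map_ins_eq_zero i p f fun j hj q f => ih j (by omega) q f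

theorem Vanishes.famTot {m : ℕ} {X : A.Ob} {G : Type*} [AddCommGroup G] {φ : Y.yon.T X →+ G}
    (h : Y.Vanishes m φ) (i : Fin Y.N) (hi : m ≤ i) (p : A.Ch X (Y.Y i))
    (f : Y.F i) : φ (Y.famTot i X p f) = 0 := by
  rw [famTot_apply, map_sum]
  exact Finset.sum_eq_zero fun r _ => h.famOp r i hi p f

/-- On a map which vanishes on all later components, only the first term of `famTot` counts. -/
theorem Vanishes.famTot_eq {i : Fin Y.N} {X : A.Ob} {G : Type*} [AddCommGroup G]
    {φ : Y.yon.T X →+ G} (h : Y.Vanishes (i + 1) φ) (p : A.Ch X (Y.Y i)) (f : Y.F i) :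
    φ (Y.famTot i X p f) = φ (Y.el i (A.μ _ _ p (p.rdeg + 2)) f) := by
  rw [famTot_apply, map_sum, Finset.sum_eq_single 0, famOp_zero]
  · intro r _ hr
    obtain ⟨r, rfl⟩ := Nat.exists_eq_succ_of_ne_zero hr
    rw [Nat.succ_eq_add_one, ← ins_famOp]
    exact map_ins_eq_zero i p f fun j hj q f => h.famOp r j (by omega) q f
  · intro h
    exact absurd (Finset.mem_range.mpr (by have := i.2; omega)) h

theorem blin_yon {u : BHom Y.yon N} (h : ∀ X W (p : A.Ch W X) (b : B) (i : Fin Y.N) (n : ℤ)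
    (a : A.Hom X (Y.Y i) n) (f : Y.F i), u W X p (Y.el i a (b • f)) = b • u W X p (Y.el i a f)) :
    IsBLin u := by
  intro W X p b x
  have := Y.yon_ext (φ := (u W X p).comp (DistribSMul.toAddMonoidHom (Y.yon.T X) b))
    (ψ := (DistribSMul.toAddMonoidHom (N.T W) b).comp (u W X p)) fun i n a f => by
      change u W X p (b • Y.elₗ i a f) = b • u W X p (Y.el i a f)
      rw [← map_smul]
      exact h X W p b i n a f
  exact DFunLike.congr_fun this x

theorem isDeg_yon {g : ℤ} {u : BHom Y.yon N} (h : ∀ X W (p : A.Ch W X) (i : Fin Y.N) (n : ℤ)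
    (a : A.Hom X (Y.Y i) n) (f : Y.F i) (e : ℤ), e ≠ n + Y.σ i + p.rdeg + g →
      u W X p (Y.el i a f) e = 0) : IsDeg g u := by
  intro W X p k x e he
  have := Y.tot_ext (φ := (DFinsupp.evalAddMonoidHom (β := fun e => N.M W e) e).comp
    ((u W X p).comp (Y.ofTot k))) (ψ := 0) fun i f a => by
      change u W X p (Y.ofTot k _) e = 0
      rw [ofTot_single]
      exact h X W p i _ a f e (by rwa [sub_add_cancel])
  exact DFunLike.congr_fun this x

theorem isMulti_yon {u : BHom Y.yon N} (h : ∀ {W X X' Z : A.Ob} (n : ℤ) (q : A.Ch X' Z)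
    (r : A.Ch W X) (i : Fin Y.N) (n' : ℤ) (a' : A.Hom Z (Y.Y i) n') (f : Y.F i),
      IsRLin R B fun a : A.Hom X X' n => u W Z (q.append (cons a r)) (Y.el i a' f)) :
    IsMulti u := fun _ _ => isMul_iff.mpr fun n q r =>
  ⟨fun a a' => Y.yon_ext fun i n' a₀ f => (h n q r i n' a₀ f).add a a',
    fun c a => Y.yon_ext fun i n' a₀ f => (h n q r i n' a₀ f).smul c a⟩

theorem isRed_yon {u : BHom Y.yon N} (h : ∀ {W X Z : A.Ob} (q : A.Ch X Z) (r : A.Ch W X)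
    (i : Fin Y.N) (n : ℤ) (a : A.Hom Z (Y.Y i) n) (f : Y.F i),
      u W Z (q.append (cons (A.one X) r)) (Y.el i a f) = 0) : IsRed u :=
  fun _ _ _ q r => Y.yon_ext fun i n a f => h q r i n a f

/-- The map `f ⊗ a ↦ V(c(f), a, a_{d-1}, …, a_1)`. -/
def hatT (i : Fin Y.N) (V : BHom L N) (hV : IsMulti V) (hl : IsBLin V)
    (c : Y.F i →ₗ[B] L.T (Y.Y i)) {W X : A.Ob} (p : A.Ch W X) (n : ℤ) :
    Y.F i ⊗[R] A.Hom X (Y.Y i) n →+ N.T W :=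
  TensorProduct.liftAddHom
    (AddMonoidHom.mk' (fun f => AddMonoidHom.mk'
        (fun a : A.Hom X (Y.Y i) n => V W _ ((nil _).append (cons a p)) (c f))
        (hV.at _ (nil _) p (c f)).add)
      (fun f f' => AddMonoidHom.ext fun a => by
        change V W _ (cons a p) (c (f + f')) = V W _ (cons a p) (c f) + V W _ (cons a p) (c f')
        rw [map_add, map_add]))
    (fun r f a => by
      change V W _ (cons a p) (c (r • f)) = V W _ (cons (r • a) p) (c f)
      rw [← algebraMap_smul B r f, map_smul, hl]
      exact ((hV.at _ (nil _) p (c f)).smul r a).symm)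

/-- The sequence of maps `(f ⊗ a_d, …, a_1) ↦ V(c(f), a_d, …, a_1)` on the component with index `i`
of a twisted complex, and zero on the others. -/
def hat (i : Fin Y.N) (V : BHom L N) (hV : IsMulti V) (hl : IsBLin V)
    (c : Y.F i →ₗ[B] L.T (Y.Y i)) : BHom Y.yon N := fun _ X p =>
  DirectSum.toAddMonoid fun k => (hatT i V hV hl c p (k - Y.σ i)).comp
    (Pi.evalAddMonoidHom (fun j => Y.F j ⊗[R] A.Hom X (Y.Y j) (k - Y.σ j)) i)

section hat

variable {i : Fin Y.N} {V : BHom L N} {hV : IsMulti V} {hl : IsBLin V}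
  {c : Y.F i →ₗ[B] L.T (Y.Y i)}

theorem hat_el {W X : A.Ob} (p : A.Ch W X) {n : ℤ} (a : A.Hom X (Y.Y i) n) (f : Y.F i) :
    hat i V hV hl c W X p (Y.el i a f) = V W _ (cons a p) (c f) := by
  obtain ⟨k, rfl, hk⟩ := Y.exists_of_el i a
  rw [hk]
  refine (DirectSum.toAddMonoid_of _ _ _).trans ((congrArg (hatT i V hV hl c p _)
    (Pi.single_eq_same i _)).trans ?_)
  rfl

theorem hat_el_ne {W X : A.Ob} (p : A.Ch W X) {j : Fin Y.N} (hj : j ≠ i) {n : ℤ}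
    (a : A.Hom X (Y.Y j) n) (f : Y.F j) : hat i V hV hl c W X p (Y.el j a f) = 0 := by
  obtain ⟨k, rfl, hk⟩ := Y.exists_of_el j a
  rw [hk]
  exact (DirectSum.toAddMonoid_of _ _ _).trans ((congrArg (hatT i V hV hl c p _)
    (Pi.single_eq_of_ne hj.symm _)).trans (map_zero _))

theorem vanishes_hat {W X : A.Ob} (p : A.Ch W X) : Y.Vanishes (i + 1) (hat i V hV hl c W X p) :=
  fun j hj n a f => hat_el_ne p (by rintro rfl; omega) a f

theorem isHom_hat {g d h : ℤ} (hd : IsDeg h V)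
    (hred : ∀ {W X Z : A.Ob} {n : ℤ} (a : A.Hom Z (Y.Y i) n) (q : A.Ch X Z) (r : A.Ch W X),
      V W _ (cons a (q.append (cons (A.one X) r))) = 0)
    (hc : ∀ f, ∃ m : L.M (Y.Y i) d, c f = L.of d m) (hg : d - 1 + h = Y.σ i + g) :
    IsHom g (hat i V hV hl c) where
  deg := isDeg_yon fun X W p j n a f e he => by
    by_cases hj : j = i
    · subst hj
      obtain ⟨m, hm⟩ := hc f
      rw [hat_el, hm]
      refine hd _ _ _ _ _ _ ?_
      rw [rdeg_cons]
      intro h'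
      exact he (by linarith)
    · rw [hat_el_ne p hj]
      rfl
  lin := blin_yon fun X W p b j n a f => by
    by_cases hj : j = i
    · subst hj
      rw [hat_el, hat_el, map_smul, hl]
    · rw [hat_el_ne p hj, hat_el_ne p hj, smul_zero]
  mul := isMulti_yon fun n q r j n' a' f => by
    by_cases hj : j = i
    · subst hj
      exact (hV.at n (cons a' q) r (c f)).congr fun a => hat_el _ a' f
    · exact IsRLin.zero.congr fun a => hat_el_ne _ hj a' f
  red := isRed_yon fun q r j n a f => by
    by_cases hj : j = i
    · subst hj
      rw [hat_el, hred]
      rfl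
    · exact hat_el_ne _ hj a f

theorem aI_cons {W X Z : A.Ob} {G : Type*} [AddCommGroup G] {φ : A.Ch W Z → G}
    (hφ : IsAdditive φ) {n : ℤ} (a : A.Hom X Z n) (p : A.Ch W X) :
    aI A φ (cons a p) = (sp p fun S => S.right.rdeg.negOnePow • φ
      (cons (A.μ _ _ (cons a S.left) ((cons a S.left).rdeg + 2)) S.right)) +
      aI A (fun p => φ (cons a p)) p := by
  rw [aI, sp3_cons, sp_cons]
  have h : φ ((nil Z).append
      (cons (A.μ _ _ (nil Z) ((nil Z : A.Ch Z Z).rdeg + 2)) (cons a p))) = 0 := by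
    rw [A.μ_nil]
    exact hφ.map_zero _ _ _
  rw [h, smul_zero, zero_add]
  rfl

/-- The differential of `hat V c`, in terms of that of `V` and of the operations on `c(f)`. For a
cocycle `V` and `c(f) = f ⊗ 1`, the right hand side consists of `V(f ⊗ a, …)`, up to sign, and of
a term which only depends on the first order part `V(f ⊗ 1)`. -/
theorem bL_hat {W X : A.Ob} (p : A.Ch W X) {n : ℤ} (a : A.Hom X (Y.Y i) n) (f : Y.F i) :
    bL (hat i V hV hl c) W X p (Y.el i a f) = (bL V + star (eps V) (bmu L)) W _ (cons a p) (c f) -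
      bmu N W _ (cons a p) (V _ _ (nil _) (c f)) := by
  have hadd : IsAdditive fun p => V W (Y.Y i) p (c f) := fun q b b' r =>
    (hV.at _ q r (c f)).add b b'
  have h₁ : star (bmu N) (hat i V hV hl c) W X p (Y.el i a f) =
      sp p fun S => bmu N _ _ S.right (V _ _ (cons a S.left) (c f)) := by
    rw [star, sp_apply]
    refine sp_congr fun S _ => ?_
    rw [AddMonoidHom.comp_apply, hat_el]
  have h₂ : star (bmu N) V W _ (cons a p) (c f) = bmu N W _ (cons a p) (V _ _ (nil _) (c f)) +
      sp p fun S => bmu N _ _ S.right (V _ _ (cons a S.left) (c f)) := by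
    rw [star, sp_apply, sp_cons]
    rfl
  have h₃ : star (eps (hat i V hV hl c)) (bmu Y.yon) W X p (Y.el i a f) =
      sp p fun S => S.right.rdeg.negOnePow • V W _
        (cons (A.μ _ _ (cons a S.left) ((cons a S.left).rdeg + 2)) S.right) (c f) := by
    rw [star, sp_apply]
    refine sp_congr fun S _ => ?_
    rw [AddMonoidHom.comp_apply, bmu_el]
    refine congrArg (fun z : N.T W => S.right.rdeg.negOnePow • z) ?_
    rw [(vanishes_hat S.right).famTot_eq, hat_el]
  have h₄ : IB (hat i V hV hl c) W X p (Y.el i a f) = aI A (fun p => V W _ (cons a p) (c f)) p := by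
    refine (congrFun (aI_comp (AddMonoidHom.eval (Y.el i a f))
      fun p => hat i V hV hl c W X p) p).symm.trans ?_
    congr 1
    funext p
    exact hat_el (hV := hV) (hl := hl) p a f
  have h₅ : IB V W _ (cons a p) (c f) = aI A (fun p => V W _ p (c f)) (cons a p) :=
    (congrFun (aI_comp (AddMonoidHom.eval (c f)) fun p => V W (Y.Y i) p) (cons a p)).symm
  rw [aI_cons hadd] at h₅
  have h₆ : bL V + star (eps V) (bmu L) = star (bmu N) V - IB V := by
    rw [bL]
    abel
  rw [h₆]
  change star (bmu N) _ W X p _ - star (eps _) (bmu Y.yon) W X p _ - IB _ W X p _ =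
    star (bmu N) V W _ (cons a p) (c f) - IB V W _ (cons a p) (c f) - _
  rw [h₁, h₂, h₃, h₄, h₅]
  abel

end hat

end TwData
end AInf

namespace AInf
open Chain

/-! ### Finiteness of the morphism spaces -/

variable {R : Type u} [Field R] {A : Category R} {B : Type u} [CommRing B] [Algebra R B]
variable {L M N : ModData A.toCatData B}

theorem bL_eq_zero {u : BHom M N} (h : bd u = 0) : bL u = 0 := by
  rw [← tau_tau (bL u)]
  change tau (bd u) = 0
  rw [h, tau_zero]

theorem bL_eps_bmu (h : IsRel N) : bL (eps (bmu N)) + star (eps (eps (bmu N))) (bmu N) = 0 := by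
  have h' := congrArg eps (show star (eps (bmu N)) (bmu N) = - IB (bmu N) from
    eq_neg_of_add_eq_zero_left h)
  rw [eps_star, eps_eps, eps_neg] at h'
  rw [bL, IB_eps, h', eps_eps]
  abel

theorem BB_le_ZB (hM : IsUMod M) (hN : IsUMod N) (g : ℤ) : BB M N g ≤ ZB M N g := by
  intro u hu
  obtain ⟨w, hw, rfl⟩ := mem_BB.mp hu
  refine mem_ZB.mpr ⟨?_, bd_bd hM.rel hN.rel fun X Y => (hw.mul X Y).add⟩
  have := hw.bd hM hN
  rwa [sub_add_cancel] at this

/-- The image of `π` is finitely generated if the image of `e` and the image under `π` of the kernel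
of `e` are. -/
theorem fg_range_of_fg {E Q P : Type*} [AddCommGroup E] [Module B E] [AddCommGroup Q]
    [Module B Q] [AddCommGroup P] [Module B P] (e : E →ₗ[B] Q) (π : E →ₗ[B] P)
    (h₁ : (LinearMap.range e).FG) (h₂ : ((LinearMap.ker e).map π).FG) :
    (LinearMap.range π).FG := by
  have h : (LinearMap.range (π.prod e)).FG := by
    refine Submodule.fg_of_fg_map_of_fg_inf_ker (LinearMap.snd B P Q) ?_ ?_
    · rwa [← LinearMap.range_comp, LinearMap.snd_prod]
    · have : LinearMap.range (π.prod e) ⊓ LinearMap.ker (LinearMap.snd B P Q) =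
          ((LinearMap.ker e).map π).map (LinearMap.inl B P Q) := by
        ext x
        constructor
        · rintro ⟨⟨u, rfl⟩, hx⟩
          exact ⟨π u, ⟨u, hx, rfl⟩, Prod.ext rfl hx.symm⟩
        · rintro ⟨_, ⟨u, hu, rfl⟩, rfl⟩
          exact ⟨⟨u, Prod.ext rfl hu⟩, rfl⟩
      rw [this]
      exact h₂.map _
  have h' := h.map (LinearMap.fst B P Q)
  rwa [← LinearMap.range_comp, LinearMap.fst_prod] at h'

namespace TwData

variable {Y : TwData A.toCatData B} {i : Fin Y.N}

theorem el_one_mul {X : A.Ob} {n d : ℤ} (hd : d = n) (a : A.Hom X (Y.Y i) n) (f : Y.F i) :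
    Y.el i (A.μ _ _ (cons (A.one (Y.Y i)) (cons a (nil X))) d) f = n.negOnePow • Y.el i a f := by
  subst hd
  conv_rhs => rw [← A.one_left _ _ _ a, el_sign, sign_smul_smul,
    Int.negOnePow_even _ ⟨_, rfl⟩, one_smul]

theorem star_bmu_el_one {u : BHom Y.yon N} (hv : ∀ W X p, Y.Vanishes (i + 1) (u W X p))
    {W X : A.Ob} (p : A.Ch W X) {n : ℤ} (a : A.Hom X (Y.Y i) n) (f : Y.F i) :
    star (eps u) (bmu Y.yon) W _ (cons a p) (Y.el i (A.one (Y.Y i)) f) =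
      (p.rdeg + n).negOnePow • u W X p (Y.el i a f) := by
  have h : ∀ {W X Z : A.Ob} (q : A.Ch X (Y.Y i)) (r : A.Ch W X),
      (eps u W X r).comp (bmu Y.yon X _ q) (Y.el i (A.one (Y.Y i)) f) =
      r.rdeg.negOnePow • u W X r
        (Y.el i (A.μ _ _ (cons (A.one _) q) ((cons (A.one _) q).rdeg + 2)) f) := by
    intro W X Z q r
    rw [AddMonoidHom.comp_apply, bmu_el]
    exact congrArg (fun z : N.T W => r.rdeg.negOnePow • z) ((hv W X r).famTot_eq _ _)
  have h₀ : ∀ {X : A.Ob} (q : A.Ch X (Y.Y i)) (d : ℤ), q.length ≠ 1 →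
      A.μ _ _ (cons (A.one _) q) d = 0 := fun q d hq =>
    A.one_vanish _ _ _ (nil _) q (by simpa using hq) d
  rw [star, sp_apply, sp_cons, sp_first]
  · rw [h (Z := W), h (Z := W), h₀ _ _ (by simp), el_zero, map_zero, smul_zero, zero_add,
      el_one_mul (by simp only [rdeg_cons, rdeg_nil]; ring), Units.smul_def n.negOnePow, map_zsmul,
      ← Units.smul_def, sign_smul_smul]
  · intro S hS
    rw [h (Z := W), h₀ _ _ (by simpa using hS), el_zero, map_zero, smul_zero]

theorem bd_el (w : BHom Y.yon N) {W X : A.Ob} (p : A.Ch W X) {n : ℤ} (a : A.Hom X (Y.Y i) n)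
    (f : Y.F i) : bd w W X p (Y.el i a f) =
      (p.rdeg + n + Y.σ i).negOnePow • bL w W X p (Y.el i a f) := by
  change p.rdeg.negOnePow • bL w W X p (sgn Y.yon X (Y.el i a f)) = _
  rw [sgn_el, Units.smul_def (n + Y.σ i).negOnePow, map_zsmul, ← Units.smul_def, sign_smul_smul,
    add_assoc]

theorem vanishes_bd {m : ℕ} {w : BHom Y.yon N} (hw : ∀ W X p, Y.Vanishes m (w W X p)) :
    ∀ W X p, Y.Vanishes m (bd w W X p) := by
  intro W X p j hj n a f
  have h₁ : star (bmu N) w W X p (Y.el j a f) = 0 := by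
    rw [star, sp_apply]
    refine (sp_congr fun S _ => ?_).trans (sp_zero p)
    rw [AddMonoidHom.comp_apply, hw _ _ _ j hj, map_zero]
  have h₂ : star (eps w) (bmu Y.yon) W X p (Y.el j a f) = 0 := by
    rw [star, sp_apply]
    refine (sp_congr fun S _ => ?_).trans (sp_zero p)
    rw [AddMonoidHom.comp_apply, bmu_el]
    exact (congrArg (fun z : N.T W => S.right.rdeg.negOnePow • z)
      ((hw _ _ _).famTot j hj _ _)).trans (smul_zero _)
  have h₃ : IB w W X p (Y.el j a f) = 0 := by
    refine (congrFun (aI_comp (AddMonoidHom.eval (Y.el j a f)) fun p => w W X p) p).symm.trans ?_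
    refine (congrArg (fun φ => aI A φ p) (funext fun p => hw W X p j hj n a f)).trans ?_
    exact congrFun (aI_comp (0 : N.T W →+ N.T W) fun _ => 0) p
  rw [bd_el]
  change _ • (star (bmu N) w W X p _ - star (eps w) (bmu Y.yon) W X p _ - IB w W X p _) = 0
  rw [h₁, h₂, h₃, sub_zero, sub_zero, smul_zero]

/-- A cocycle which vanishes on all components after the one with index `i`, and which sends the
first order part of that component to coboundaries, is cohomologous to one which vanishes on the
component with index `i` as well. This is the Yoneda lemma. -/
theorem exists_vanishes_sub_bd {g : ℤ} (hN : IsUMod N) {u : BHom Y.yon N}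
    (hu : u ∈ ZB Y.yon N g) (hv : ∀ W X p, Y.Vanishes (i + 1) (u W X p))
    (c : Y.F i →ₗ[B] N.T (Y.Y i))
    (hc : ∀ f, ∃ m : N.M (Y.Y i) (Y.σ i + g - 1), c f = N.of _ m)
    (huc : ∀ f, bmu N _ _ (nil (Y.Y i)) (c f) = u _ _ (nil _) (Y.el i (A.one (Y.Y i)) f)) :
    ∃ w : BHom Y.yon N, IsHom (g - 1) w ∧ ∀ W X p, Y.Vanishes i ((u - bd w) W X p) := by
  obtain ⟨hu, hbd⟩ := mem_ZB.mp hu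
  have hE : ∀ f, ∃ m : Y.yon.M (Y.Y i) (0 + Y.σ i), Y.elₗ i (A.one (Y.Y i)) f = Y.yon.of _ m :=
    fun f => ⟨_, rfl⟩
  -- `w₁(f ⊗ a, …) = u(f ⊗ 1, a, …)` is the usual homotopy in the Yoneda lemma, and
  -- `w₂(f ⊗ a, …) = ± μ(c(f), a, …)` removes the remaining first order part.
  let w₁ := hat i u hu.mul hu.lin (Y.elₗ i (A.one (Y.Y i)))
  let w₂ := hat i (eps (bmu N)) (isMulti_bmu N).eps (isBLin_bmu N).eps c
  have hw₁ : IsHom (g - 1) w₁ :=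
    isHom_hat hu.deg (fun a q r => by
      have := hu.red _ _ _ (cons a q) r
      rw [← cons_append, this]) hE (by ring)
  have hw₂ : IsHom (g - 1) w₂ :=
    isHom_hat (isDeg_bmu N).eps (fun a q r => by
      have := hN.unit_vanish _ _ _ (cons a q) r (by simp)
      rw [← cons_append]
      change _ • bmu N _ _ ((cons a q).append _) = 0
      rw [this, smul_zero]) hc (by ring)
  let s : B := (((Y.σ i).negOnePow : ℤ) : B)
  have hw : IsHom (g - 1) (s • (w₁ - w₂)) := (sub_eq_add_neg w₁ w₂ ▸ (hw₁.add (by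
    simpa using hw₂.smul (-1)))).smul s
  refine ⟨_, hw, fun W X p j hj n a f => ?_⟩
  have hsub : ((u - bd (s • (w₁ - w₂))) W X p) (Y.el j a f) =
      u W X p (Y.el j a f) - (Y.σ i).negOnePow •
        (bd w₁ W X p (Y.el j a f) - bd w₂ W X p (Y.el j a f)) := by
    rw [bd_smul, bd_sub, Units.smul_def, ← Int.cast_smul_eq_zsmul B]
    rfl
  rw [hsub]
  by_cases hji : j = i
  · subst hji
    have h₁ : bL u = 0 := bL_eq_zero hbd
    have h₂ := bL_eps_bmu hN.rel
    have h₃ : eps (bmu N) _ _ (nil (Y.Y j)) (c f) = bmu N _ _ (nil _) (c f) := by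
      simp [eps]
    rw [bd_el, bd_el, bL_hat, bL_hat, h₁, zero_add, h₂, h₃, huc, ← smul_sub]
    rw [show Y.elₗ j (A.one (Y.Y j)) f = Y.el j (A.one (Y.Y j)) f from rfl, star_bmu_el_one hv,
      Pi.zero_apply, Pi.zero_apply, Pi.zero_apply, AddMonoidHom.zero_apply, zero_sub]
    simp only [sub_neg_eq_add, sub_add_cancel, sign_smul_smul]
    rw [Int.negOnePow_even _ ⟨p.rdeg + n + Y.σ j, by ring⟩, one_smul, sub_self]
  · have hj' : (i : ℕ) + 1 ≤ j := by
      have : (j : ℕ) ≠ i := fun h => hji (Fin.ext h)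
      omega
    rw [hv W X p j hj', vanishes_bd (fun W X p => vanishes_hat p) W X p j hj',
      vanishes_bd (fun W X p => vanishes_hat p) W X p j hj', sub_zero, smul_zero, sub_zero]

variable (Y N) in
/-- The cocycles which vanish on the components with index at least `m`. -/
def ZV (g : ℤ) (m : ℕ) : Submodule B (ZB Y.yon N g) where
  carrier := {u | ∀ W X p, Y.Vanishes m (u.1 W X p)}
  zero_mem' W X p j hj n a f := rfl
  add_mem' {u v} hu hv W X p j hj n a f := by
    change u.1 W X p _ + v.1 W X p _ = 0
    rw [hu W X p j hj, hv W X p j hj, add_zero]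
  smul_mem' b u hu W X p j hj n a f := by
    change b • u.1 W X p _ = 0
    rw [hu W X p j hj, smul_zero]

/-- The map `f ↦ u(f ⊗ 1)` for an element `1` which is a strict unit. -/
def evalOne (g : ℤ) (i : Fin Y.N) :
    ZB Y.yon N g →ₗ[B] Y.F i →ₗ[B] N.M (Y.Y i) (Y.σ i + g) where
  toFun u :=
    { toFun := fun f => u.1 _ _ (nil _) (Y.elₗ i (A.one (Y.Y i)) f) (Y.σ i + g)
      map_add' := fun f f' => by
        rw [map_add, map_add]
        rfl
      map_smul' := fun b f => by
        rw [map_smul, u.2.1.lin]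
        rfl }
  map_add' u v := rfl
  map_smul' b u := rfl

theorem of_evalOne {g : ℤ} (u : ZB Y.yon N g) (f : Y.F i) :
    N.of _ (evalOne g i u f) = u.1 _ _ (nil _) (Y.el i (A.one (Y.Y i)) f) :=
  (eq_of_degree fun e he => u.2.1.deg _ _ (nil _) _ _ e (by
    rwa [rdeg_nil, zero_add, add_zero])).symm

theorem mu_evalOne {g : ℤ} (u : ZB Y.yon N g) (hu : u ∈ ZV N Y g (i + 1)) (f : Y.F i) :
    N.μ _ _ (nil _) _ (Y.σ i + g + 1) (evalOne g i u f) = 0 := by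
  have h := DFunLike.congr_fun (congrFun (congrFun (congrFun (bL_eq_zero u.2.2) _) _)
    (nil (Y.Y i))) (Y.el i (A.one (Y.Y i)) f)
  have h₁ : star (bmu N) u.1 _ _ (nil _) (Y.el i (A.one (Y.Y i)) f) =
      N.of _ (N.μ _ _ (nil _) _ (Y.σ i + g + 0 + 1) (evalOne g i u f)) := by
    refine Eq.trans ?_ (bmu_of _ _ (nil _) _ _)
    rw [of_evalOne]
    simp [star]
  have h₂ : star (eps u.1) (bmu Y.yon) _ _ (nil _) (Y.el i (A.one (Y.Y i)) f) = 0 := by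
    have : bmu Y.yon _ _ (nil _) (Y.el i (A.one (Y.Y i)) f) =
      Y.famTot i _ (cons (A.one (Y.Y i)) (nil _)) f := Y.bmu_el i (nil _) _ f
    have h₃ : A.μ _ _ (cons (A.one (Y.Y i)) (nil _))
        ((cons (A.one (Y.Y i)) (nil _) : A.Ch _ _).rdeg + 2) = 0 :=
      A.one_vanish _ _ _ (nil _) (nil _) (by simp) _
    simp only [star, sp, splits, List.map_cons, List.map_nil, List.sum_cons, List.sum_nil, add_zero,
      AddMonoidHom.comp_apply, this]
    have h₄ := (hu _ _ (nil (Y.Y i))).famTot_eq (cons (A.one (Y.Y i)) (nil _)) f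
    rw [h₃, el_zero, map_zero] at h₄
    exact (congrArg (fun z : N.T (Y.Y i) => (0 : ℤ).negOnePow • z) h₄).trans (smul_zero _)
  have h₃ : IB u.1 _ _ (nil _) (Y.el i (A.one (Y.Y i)) f) = 0 := by
    have : A.μ _ _ (nil (Y.Y i)) ((nil (Y.Y i) : A.Ch _ _).rdeg + 2) = 0 := A.μ_nil _ _
    have h : IB u.1 _ _ (nil (Y.Y i)) = 0 := by
      simp only [IB, aI, sp3, sp, splits, List.map_cons, List.map_nil, List.sum_cons, List.sum_nil,
        add_zero, this]
      rw [IsAdditive.map_zero (u.2.1.mul _ _).add, smul_zero]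
    rw [h]
    rfl
  change star (bmu N) u.1 _ _ (nil _) _ - star (eps u.1) (bmu Y.yon) _ _ (nil _) _ -
    IB u.1 _ _ (nil _) _ = 0 at h
  rw [h₁, h₂, h₃, sub_zero, sub_zero] at h
  have h₄ := DirectSum.of_injective _ (h.trans (map_zero _).symm)
  rwa [add_zero (Y.σ i + g)] at h₄

/-- The classes of cocycles which vanish on the components with index at least `m` are finitely
generated. The quotient of two successive steps embeds into the maps from `Y.F i` to the cohomology
of `N`, by `exists_vanishes_sub_bd`. -/
theorem fg_map_ZV [IsNoetherianRing B] (hY : Y.MaurerCartan) (hN : N.IsModule) (g : ℤ) (m : ℕ)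
    (hm : m ≤ Y.N) :
    ((ZV N Y g m).map (Submodule.mkQ ((BB Y.yon N g).submoduleOf (ZB Y.yon N g)))).FG := by
  induction m with
  | zero =>
    have : ZV N Y g 0 = ⊥ := by
      refine (Submodule.eq_bot_iff _).mpr fun u hu => Subtype.ext ?_
      funext W X p
      exact Y.yon_ext fun i n a f => hu W X p i (Nat.zero_le _) n a f
    rw [this, Submodule.map_bot]
    exact Submodule.fg_bot
  | succ m ih =>
    set q := Submodule.mkQ ((BB Y.yon N g).submoduleOf (ZB Y.yon N g))
    let i : Fin Y.N := ⟨m, hm⟩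
    have := Y.fin i
    have := Y.proj i
    have hfin := (hN.finite (Y.Y i)).1 (Y.σ i + g)
    let μ₁ := N.μ (Y.Y i) (Y.Y i) (nil _) (Y.σ i + g - 1) (Y.σ i + g)
    let μ₂ := N.μ (Y.Y i) (Y.Y i) (nil _) (Y.σ i + g) (Y.σ i + g + 1)
    let e₀ : ZV N Y g (m + 1) →ₗ[B] Y.F i →ₗ[B] LinearMap.ker μ₂ :=
      { toFun := fun u => (evalOne g i u.1).codRestrict _ fun f => mu_evalOne u.1 u.2 f
        map_add' := fun u v => rfl
        map_smul' := fun b u => rfl }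
    let e : ZV N Y g (m + 1) →ₗ[B] Y.F i →ₗ[B] Coh μ₁ μ₂ :=
      (LinearMap.compRight B (Submodule.mkQ _)) ∘ₗ e₀
    have h := fg_range_of_fg (B := B) (E := ZV N Y g (m + 1)) (P := HB Y.yon N g) e
      (q.domRestrict (ZV N Y g (m + 1))) (IsNoetherian.noetherian _) ?_
    · rwa [LinearMap.range_domRestrict] at h
    refine (congrArg Submodule.FG ?_).mp (ih (by omega))
    symm
    ext x
    constructor
    · rintro ⟨u, hu, rfl⟩
      have hr : ∀ f, evalOne g i u.1 f ∈ LinearMap.range μ₁ := fun f =>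
        (Submodule.Quotient.mk_eq_zero ((LinearMap.range μ₁).comap (LinearMap.ker μ₂).subtype)
          (x := e₀ u f)).mp (DFunLike.congr_fun (LinearMap.mem_ker.mp hu) f)
      obtain ⟨c, hc⟩ := Module.projective_lifting_property μ₁.rangeRestrict
        ((evalOne g i u.1).codRestrict _ hr) μ₁.surjective_rangeRestrict
      let cT : Y.F i →ₗ[B] N.T (Y.Y i) := (DirectSum.lof B ℤ (fun k => N.M (Y.Y i) k) _) ∘ₗ c
      have hcT : ∀ f, cT f = N.of _ (c f) := fun f => rfl
      obtain ⟨w, hw, hv⟩ := exists_vanishes_sub_bd (i := i) hN.isUMod u.1.2 u.2 cT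
        (fun f => ⟨c f, rfl⟩) fun f => by
          have h₁ : μ₁ (c f) = evalOne g i u.1 f :=
            congrArg Subtype.val (DFunLike.congr_fun hc f)
          rw [← of_evalOne, ← h₁, hcT, bmu_of]
          exact of_congr (by rw [rdeg_nil]; ring) fun d =>
            N.μ (Y.Y i) (Y.Y i) (nil _) (Y.σ i + g - 1) d (c f)
      have hw' : bd w ∈ BB Y.yon N g := mem_BB.mpr ⟨w, hw, rfl⟩
      have hw'' : bd w ∈ ZB Y.yon N g := BB_le_ZB (Y.isUMod_yon hY) hN.isUMod g hw'
      refine ⟨⟨u.1.1 - bd w, sub_mem u.1.2 hw''⟩, hv, cls_eq_iff.mpr ?_⟩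
      change u.1.1 - bd w - u.1.1 ∈ BB Y.yon N g
      rw [sub_sub_cancel_left]
      exact neg_mem hw'
    · rintro ⟨u, hu, rfl⟩
      have hu' : u ∈ ZV N Y g (m + 1) := fun W X p j hj => hu W X p j (by omega)
      refine ⟨⟨u, hu'⟩, ?_, rfl⟩
      refine LinearMap.mem_ker.mpr (LinearMap.ext fun f => ?_)
      refine (Submodule.Quotient.mk_eq_zero _).mpr ?_
      have h₁ : evalOne g i u f = 0 := by
        change u.1 _ _ (nil _) (Y.el i (A.one (Y.Y i)) f) _ = 0
        rw [hu _ _ _ i le_rfl]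
        rfl
      change evalOne g i u f ∈ LinearMap.range μ₁
      rw [h₁]
      exact zero_mem _

/-- The morphism spaces out of a twisted complex are finitely generated in every degree. -/
theorem finite_HB [IsNoetherianRing B] (hY : Y.MaurerCartan) (hN : N.IsModule) (g : ℤ) :
    Module.Finite B (HB Y.yon N g) := by
  have h := fg_map_ZV hY hN g Y.N le_rfl
  have h' : ZV N Y g Y.N = ⊤ :=
    eq_top_iff.mpr fun u _ W X p j hj => absurd j.2 (not_lt.mpr hj)
  rw [h', Submodule.map_top, Submodule.range_mkQ] at h
  exact ⟨h⟩

end TwData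

/-- The morphism spaces out of a perfect family are finitely generated in every degree. -/
theorem ModData.IsPerfect.finite_HB [IsNoetherianRing B] (hM : M.IsPerfect) (hN : N.IsModule)
    (g : ℤ) : Module.Finite B (HB M N g) := by
  obtain ⟨Y, hY, f, hf, f', hf', h⟩ := hM.summand
  have := TwData.finite_HB hY hN g
  let φ : ZB M Y.yon 0 := ⟨toB 0 f, toB_mem_ZB hf⟩
  let φ' : ZB Y.yon M 0 := ⟨toB 0 f', toB_mem_ZB hf'⟩
  refine Module.Finite.of_surjective ((hcomp M Y.yon N g).flip (cls 0 φ)) fun x => ?_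
  obtain ⟨u, rfl⟩ := Submodule.Quotient.mk_surjective _ x
  refine ⟨hcomp Y.yon M N g (cls g u) (cls 0 φ'), cls_eq_iff.mpr ?_⟩
  have h₁ := star_mem_BB u.2 (toB_cohomologous h)
  rw [toB_comp, toB_idHom, star_sub, star_bone, ← star_assoc] at h₁
  exact h₁

end AInf

namespace AInf
open Chain

/-! ### Comparison of fibres -/

open CategoryTheory

variable {R : Type u} [Field R] {A : Category R} {B : Type u} [CommRing B] [Algebra R B]
variable {L M N : ModData A.toCatData B}

theorem ModData.IsModule.hasDeg (hM : M.IsModule) : M.HasDeg := hM.deg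

theorem ModData.HasDeg.fibre (hM : M.HasDeg) (s : B →ₐ[R] R) : (M.fibre s).HasDeg := by
  intro X Y p k e he
  refine LinearMap.ext fun x => ?_
  change LinearMap.lTensor (AtPoint s) (M.μ X Y p k e) x = 0
  rw [hM X Y p k e he, LinearMap.lTensor_zero]
  rfl

theorem ModData.IsModule.eq_zero_of_smul_eq_zero [IsDomain B] (hM : M.IsModule) {t : B}
    (ht : t ≠ 0) (X : A.Ob) (k : ℤ) (x : M.M X k) (hx : t • x = 0) : x = 0 := by
  have := hM.projective X k
  have : Module.IsTorsionFree B (M.M X k) := Module.Flat.isTorsionFree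
  exact (smul_eq_zero.mp hx).resolve_left ht

/-- Restriction of endomorphism rings to a fibre. -/
def redEnd (s : B →ₐ[R] R) (M : ModData A.toCatData B) : HEnd M →+* HEnd (M.fibre s) where
  toFun := redH s M M 0
  map_one' := redH_bone M
  map_mul' x y := redH_hcomp 0 x y
  map_zero' := map_zero (redH s M M 0)
  map_add' := map_add (redH s M M 0)

theorem redEnd_algebraMap (s : B →ₐ[R] R) (M : ModData A.toCatData B) (a : R) :
    redEnd s M (algebraMap B (HEnd M) (algebraMap R B a)) =
      algebraMap R (HEnd (M.fibre s)) a := by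
  rw [Algebra.algebraMap_eq_smul_one (A := HEnd M),
    Algebra.algebraMap_eq_smul_one (A := HEnd (M.fibre s))]
  refine (redH_smul 0 (algebraMap R B a) (1 : HEnd M)).trans ?_
  rw [s.commutes]
  exact congrArg (fun x : HEnd (M.fibre s) => a • x) (redH_bone M)

theorem commute_of_iso {C : Type*} [CategoryTheory.Category C] {X Y : C} (e : X ≅ Y)
    (h : ∀ x y : End Y, x * y = y * x) (x y : End X) : x * y = y * x :=
  e.conj.injective (by rw [map_mul, map_mul, h])

theorem conj_zero {C : Type*} [CategoryTheory.Category C] [Preadditive C] {X Y : C} (e : X ≅ Y) :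
    e.conj (0 : End X) = 0 := by
  have h : e.inv ≫ (0 : X ⟶ X) ≫ e.hom = 0 := by simp
  exact h

theorem isNilpotent_of_iso {C : Type*} [CategoryTheory.Category C] [Preadditive C] [Linear R C]
    {X Y : C} (e : X ≅ Y) {x : End X} {a : R}
    (h : IsNilpotent (e.conj x - algebraMap R (End Y) a)) :
    IsNilpotent (x - algebraMap R (End X) a) := by
  obtain ⟨n, hn⟩ := h
  have h₀ : e.conj (0 : End X) = 0 := conj_zero e
  have h₁ : e.conj (x - algebraMap R (End X) a) = e.conj x - algebraMap R (End Y) a := by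
    rw [Algebra.algebraMap_eq_smul_one, Algebra.algebraMap_eq_smul_one]
    have h₂ : ∀ x : X ⟶ X, e.inv ≫ (x - a • 𝟙 X) ≫ e.hom = e.inv ≫ x ≫ e.hom - a • 𝟙 Y := by
      intro x
      simp
    exact h₂ x
  exact ⟨n, e.conj.injective (by rw [map_pow, h₁, hn, h₀])⟩

section CommLocal

variable {P : ModData A.toCatData R} {s : B →ₐ[R] R}

theorem CommLocal.commutator_mem (hP' : CommLocal P) (hP : P.HasDeg)
    (e : HMod.of (M.fibre s) ≅ HMod.of P) (hred : ∀ x : HEnd M, redEnd s M x = 0 →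
      x ∈ RingHom.ker s • (⊤ : Submodule B (HEnd M))) (x y : HEnd M) :
    x * y - y * x ∈ RingHom.ker s • (⊤ : Submodule B (HEnd M)) := by
  refine hred _ ?_
  rw [map_sub, map_mul, map_mul, commute_of_iso e (hP'.commute hP), sub_self]

theorem CommLocal.exists_pow_mem (hP' : CommLocal P) (hP : P.HasDeg)
    (e : HMod.of (M.fibre s) ≅ HMod.of P) (hred : ∀ x : HEnd M, redEnd s M x = 0 →
      x ∈ RingHom.ker s • (⊤ : Submodule B (HEnd M))) (x : HEnd M) :
    ∃ (a : B) (n : ℕ), (x - algebraMap B (HEnd M) a) ^ n ∈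
      RingHom.ker s • (⊤ : Submodule B (HEnd M)) := by
  obtain ⟨a, ha⟩ := hP'.exists_isNilpotent hP (e.conj (redEnd s M x))
  obtain ⟨n, hn⟩ := isNilpotent_of_iso e ha
  refine ⟨algebraMap R B a, n, hred _ ?_⟩
  rwa [map_pow, map_sub, redEnd_algebraMap]

theorem CommLocal.one_notMem (hP' : CommLocal P) (hP : P.HasDeg)
    (e : HMod.of (M.fibre s) ≅ HMod.of P) :
    𝟙 (HMod.of M) ∉ RingHom.ker s • (⊤ : Submodule B (HMod.of M ⟶ HMod.of M)) := by
  intro h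
  have h₁ : redEnd s M 1 = 0 := redH_eq_zero_of_mem h
  rw [map_one] at h₁
  have h₂ := congrArg e.conj h₁
  rw [map_one] at h₂
  exact hP'.one_ne_zero hP (h₂.trans (conj_zero e))

end CommLocal

set_option maxHeartbeats 1000000 in
/-- Perfect families which follow a deformation field, and which at one point are all
quasi-isomorphic to a module with commutative local endomorphism ring, are pairwise
quasi-isomorphic at every other point. -/
theorem quasiIso_fibre [IsAlgClosed R] [CharZero R] [IsDomain B] [Algebra.Smooth R B]
    (hB : ringKrullDim B = 1) (γ : DefField A.toCatData B) (s s' : B →ₐ[R] R)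
    {P : ModData A.toCatData R} (hP : P.HasDeg) (hP' : CommLocal P) {ι : Type*}
    (F : ι → ModData A.toCatData B) (hF : ∀ i, (F i).IsPerfect) (hγ : ∀ i, γ.IsFollowedBy (F i))
    (hs : ∀ i, QuasiIso ((F i).fibre s) P) (i j : ι) :
    QuasiIso ((F i).fibre s') ((F j).fibre s') := by
  have hnoeth : IsNoetherianRing B := Algebra.FiniteType.isNoetherianRing R B
  have hU := fun i => (hF i).isModule.isUMod
  have hdeg : ∀ i (s : B →ₐ[R] R), ((F i).fibre s).HasDeg := fun i s =>
    (hF i).isModule.hasDeg.fibre s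
  have hproj := fun i => (hF i).isModule.projective
  obtain ⟨t, b, ξ, ht, hξ⟩ := exists_isParam hB s
  have ht0 : t ≠ 0 := by
    rintro rfl
    exact hξ (by simp)
  have htf := fun i => (hF i).isModule.eq_zero_of_smul_eq_zero ht0
  have hmax : (RingHom.ker s).IsMaximal := RingHom.ker_isMaximal_of_surjective s fun r =>
    ⟨algebraMap R B r, s.commutes r⟩
  have hred : ∀ i j (x : HB (F i) (F j) 0), redH s (F i) (F j) 0 x = 0 →
      x ∈ RingHom.ker s • (⊤ : Submodule B (HB (F i) (F j) 0)) := fun i j x hx =>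
    mem_ker_smul_of_redH_eq_zero (hU i) (hU j) (hproj i) ht (htf j) hx
  -- The obstruction to extending a morphism from the fibre is torsion in degree `1`, and the
  -- connection on the degree `1` cohomology excludes such torsion.
  have hsurj : ∀ i j, Function.Surjective (redH s (F i) (F j) 0) := fun i j => by
    have := (hF i).finite_HB (hF j).isModule (0 + 1)
    obtain ⟨m, hm⟩ := (hγ i).exists_isConn ξ
    obtain ⟨n, hn⟩ := (hγ j).exists_isConn ξ
    obtain ⟨c, hc, hc'⟩ := ht.exists_kills_torsion (d := ξ.compDer (KaehlerDifferential.D R B))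
      hξ (D := HB.deriv hm hn (0 + 1)) fun f x => HB.deriv_smul hm hn _ f x
    exact redH_surjective (hU i) (hU j) (hproj i) ht (htf j) hc fun z hz => hc' t z ht0 hz
  have e : ∀ i, HMod.of ((F i).fibre s) ≅ HMod.of P := fun i =>
    ((quasiIso_iff_nonempty_iso (hdeg i s) hP).mp (hs i)).some
  obtain ⟨f₀, hf₀⟩ := hsurj i j ((e i).hom ≫ (e j).inv)
  obtain ⟨g₀, hg₀⟩ := hsurj j i ((e j).hom ≫ (e i).inv)
  have hfin : ∀ i j, Module.Finite B (HMod.of (F i) ⟶ HMod.of (F j)) := fun i j =>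
    (hF i).finite_HB (hF j).isModule 0
  have key := exists_inverse_at_point (R := R) (fun i => HMod.of (F i)) (hfin := hfin) hB ?_ s s'
    ?_ ?_ ?_ (i := i) (j := j) f₀ g₀ ?_
  · obtain ⟨f, g, hfg, hgf⟩ := key
    have h₁ := redH_eq_zero_of_mem (s := s') hfg
    have h₂ := redH_eq_zero_of_mem (s := s') hgf
    rw [map_sub, sub_eq_zero] at h₁ h₂
    exact (quasiIso_iff (hdeg i s') (hdeg j s')).mpr
      ⟨redH s' _ _ 0 f, redH s' _ _ 0 g,
        (redH_hcomp (s := s') 0 g f).symm.trans (h₁.trans (redH_bone _)),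
        (redH_hcomp (s := s') 0 f g).symm.trans (h₂.trans (redH_bone _))⟩
  · intro ξ
    choose n hn using fun i => (hγ i).exists_isConn ξ
    exact ⟨fun i j => HB.deriv (hn i) (hn j) 0, fun i j f x => HB.deriv_smul _ _ _ f x,
      fun i j k f g => (HB.deriv_hcomp (hn i) (hn j) (hn k) 0 g f).trans (add_comm _ _)⟩
  · exact fun i x y => hP'.commutator_mem hP (e i) (hred i i) y x
  · exact fun i x => hP'.exists_pow_mem hP (e i) (hred i i) x
  · exact fun i => hP'.one_notMem hP (e i)
  · refine hred i i _ ?_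
    have h₁ : redH s (F i) (F i) 0 (hcomp _ _ _ 0 g₀ f₀) = 𝟙 (HMod.of ((F i).fibre s)) := by
      rw [redH_hcomp, hf₀, hg₀]
      change ((e i).hom ≫ (e j).inv) ≫ ((e j).hom ≫ (e i).inv) = _
      simp
    exact (map_sub (redH s (F i) (F i) 0) _ _).trans (sub_eq_zero.mpr (h₁.trans (redH_bone _).symm))

end AInf

end

theorem proposition1p21 {R : Type u} [Field R] [IsAlgClosed R] [CharZero R]
    (A : AInf.Category R)
    (B : Type u) [CommRing B] [IsDomain B] [Algebra R B] [Algebra.Smooth R B]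
    (hB : ringKrullDim B = 1)
    (γ : AInf.DefField A.toCatData B) (s s' : B →ₐ[R] R)
    (M : AInf.ModData A.toCatData R) (hM : M.IsPerfect) (hM' : AInf.CommLocal M)
    (M₁ M₂ : AInf.ModData A.toCatData B)
    (h₁ : M₁.IsPerfect) (h₂ : M₂.IsPerfect)
    (hγ₁ : γ.IsFollowedBy M₁) (hγ₂ : γ.IsFollowedBy M₂)
    (hs₁ : AInf.QuasiIso (M₁.fibre s) M) (hs₂ : AInf.QuasiIso (M₂.fibre s) M) :
    AInf.QuasiIso (M₁.fibre s') (M₂.fibre s') :=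
  AInf.quasiIso_fibre hB γ s s' hM.isModule.hasDeg hM' (fun b => bif b then M₁ else M₂)
    (Bool.forall_bool.mpr ⟨h₂, h₁⟩) (Bool.forall_bool.mpr ⟨hγ₂, hγ₁⟩)
    (Bool.forall_bool.mpr ⟨hs₂, hs₁⟩) true false
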